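/- Let $\Bbbk$ be a field of characteristic $0$. All operads are symmetric operads in $\mathbb Z$-graded $\Bbbk$-vector spaces (cohomological degrees, Koszul signs), with operations of every arity $n\ge 0$. A filtered operad is an operad $P$ with a decreasing filtration $P=\mathrm F_0P\supseteq \mathrm F_1P\supseteq\cdots$ by graded subspaces such that $\mathrm F_sP\circ_i \mathrm F_tP\subseteq \mathrm F_{s+t}P$ for all partial compositions; it is complete if $P\to\lim_k P/\mathrm F_kP$ is an isomorphism. Morphisms preserve the filtrations, and an isomorphism has an inverse which preserves them too. A complete dg operad carries moreover a degree $1$ square-zero operadic derivation preserving the filtration. For a complete operad $P$ and a symbol $\xi$ of arity $0$ and given degree, placed in $\mathrm F_1$, $P\,\hat\vee\,\xi$ is the coproduct, in complete operads, of $P$ with the (trivial) operad spanned by $\xi$: the operad obtained from $P$ by freely adding $\xi$, completed with respect to the number of occurrences of $\xi$ (when $P$ has the trivial filtration $\mathrm F_1P=0$). Let $\mathrm{Gerst}$ be the operad generated by $\mu$ (arity $2$, degree $0$) and $\lambda$ (arity $2$, degree $1$), both invariant under the transposition, with the relations $$\mu\circ_1\mu=\mu\circ_2\mu,\qquad \lambda\circ_1\lambda+(\lambda\circ_1\lambda)^{(123)}+(\lambda\circ_1\lambda)^{(321)}=0,\qquad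 \lambda\circ_1\mu=\mu\circ_2\lambda+(\mu\circ_1\lambda)^{(23)},$$ and let $\mathrm{BV}$ be the operad generated by $\mu,\lambda$ as above and $\Delta$ (arity $1$, degree $1$), with these relations and $$\Delta\circ_1\Delta=0,\qquad \Delta\circ_1\mu=\mu\circ_1\Delta+\mu\circ_2\Delta+\lambda,\qquad \Delta\circ_1\lambda+\lambda\circ_1\Delta+\lambda\circ_2\Delta=0 .$$ Both have the trivial filtration and the zero differential. Let $\mathrm{MC}\,\mathrm{BV}=(\mathrm{BV}\,\hat\vee\,\alpha,\mathrm d)$, where $\alpha$ has arity $0$ and degree $0$ and lies in $\mathrm F_1$, and where the differential $\mathrm d$ vanishes on $\mathrm{BV}$ and satisfies $\mathrm d(\alpha)=-\tfrac12\lambda(\alpha,\alpha)$. The arity $1$, degree $1$ element $\lambda(\alpha,-)=\lambda\circ_1\alpha$ is a Maurer–Cartan element of $\mathrm{MC}\,\mathrm{BV}$, i.e. $\mathrm d(\lambda(\alpha,-))+\lambda(\alpha,-)\circ_1\lambda(\alpha,-)=0$. Let $\mathrm{Tw}\,\mathrm{BV}$ be the complete dg operad with the same underlying complete operad and the twisted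 differential $$\mathrm d^{\lambda}(\nu)=\mathrm d(\nu)+\lambda(\alpha,-)\circ_1\nu-(-1)^{|\nu|}\sum_{j}\nu\circ_j\lambda(\alpha,-).$$ Its cohomology operad $\mathrm H(\mathrm{Tw}\,\mathrm{BV})$ is filtered by letting $\mathrm F_k$ consist of the classes of the cocycles lying in $\mathrm F_k$. Let $\eta$ be a symbol of arity $0$ and degree $1$, placed in $\mathrm F_1$; equip $\mathrm{Gerst}\,\hat\vee\,\eta$ with the zero differential, and let $$\mathrm{Gerst}^+=\frac{\mathrm{Gerst}\,\hat\vee\,\eta}{(\lambda(\eta,-))}$$ be the complete operad obtained as the quotient by the closed operadic ideal generated by $\lambda(\eta,-)=\lambda\circ_1\eta$, with the quotient filtration. **Theorem.** There is a morphism of complete dg operads $\varphi:\mathrm{Gerst}\,\hat\vee\,\eta\to\mathrm{Tw}\,\mathrm{BV}$ with $\mu\mapsto\mu$, $\lambda\mapsto\lambda$, $\eta\mapsto\Delta(\alpha)=\Delta\circ_1\alpha$, and it is the only morphism of complete operads with these values. The filtered operads $\mathrm{Gerst}^+$ and $\mathrm H(\mathrm{Tw}\,\mathrm{BV})$ are complete,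 and $\varphi$ induces an isomorphism of complete operads $\psi:\mathrm{Gerst}^+\xrightarrow{\ \cong\ }\mathrm H(\mathrm{Tw}\,\mathrm{BV})$; that is, every $\varphi(x)$ is a cocycle, and $\psi$ sends the class of $x\in\mathrm{Gerst}\,\hat\vee\,\eta$ to the cohomology class of $\varphi(x)$. -/

import Mathlib

set_option linter.unusedVariables false

universe u

noncomputable section

namespace OperadTw

/-- Operads are described by partial compositions along arbitrary identifications of the inputs.
For an operation with inputs `Fin m`, an input `i` of it, and an operation with inputs `Fin n`,
the composite at `i` has inputs `(Fin m ∖ {i}) ⊔ Fin n`; an element of `Graft i n p` is a labelling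
of these inputs by `Fin p`. -/
abbrev Graft {m : ℕ} (i : Fin m) (n p : ℕ) : Type := {x : Fin m // x ≠ i} ⊕ Fin n ≃ Fin p

namespace Graft

/-- The new label of an input `a ≠ i` of the outer operation. -/
def outer {m n p : ℕ} {i : Fin m} (e : Graft i n p) (a : Fin m) (ha : a ≠ i) : Fin p :=
  e (Sum.inl ⟨a, ha⟩)

/-- The new label of an input of the inner operation. -/
def inner {m n p : ℕ} {i : Fin m} (e : Graft i n p) (b : Fin n) : Fin p :=
  e (Sum.inr b)

/-- The standard labelling, used for the usual partial composition `∘ᵢ`: the inputs of the inner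
operation are inserted, in order, at the place of the input `i`. -/
def std {m : ℕ} (i : Fin m) (n : ℕ) {p : ℕ} (h : m + n = p + 1) : Graft i n p where
  toFun := Sum.elim
    (fun a => if ha : a.1.1 < i.1 then ⟨a.1.1, by omega⟩ else
      ⟨a.1.1 + n - 1, by have := a.1.2; have := a.2; omega⟩)
    (fun b => ⟨i.1 + b.1, by have := b.2; omega⟩)
  invFun t :=
    if h1 : t.1 < i.1 then Sum.inl ⟨⟨t.1, by omega⟩, by intro hh; apply_fun Fin.val at hh; simp at hh; omega⟩
    else if h2 : t.1 < i.1 + n then Sum.inr ⟨t.1 - i.1, by omega⟩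
    else Sum.inl ⟨⟨t.1 + 1 - n, by have := t.2; omega⟩,
      by intro hh; apply_fun Fin.val at hh; simp at hh; omega⟩
  left_inv := by
    rintro (⟨a, ha⟩ | b)
    · have hne : a.1 ≠ i.1 := fun hh => ha (Fin.ext hh)
      by_cases h1 : a.1 < i.1
      · simp only [Sum.elim_inl, h1, dite_true]
      · have h3 : ¬ (a.1 + n - 1 < i.1) := by omega
        have h4 : ¬ (a.1 + n - 1 < i.1 + n) := by omega
        simp only [Sum.elim_inl, h1, dite_false, h3, h4]
        congr 2
        apply Fin.ext
        simp only
        omega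
    · have := b.2
      simp
  right_inv := by
    intro t
    by_cases h1 : t.1 < i.1
    · simp only [h1, dite_true, Sum.elim_inl]
    · by_cases h2 : t.1 < i.1 + n
      · simp only [h1, h2, dite_true, dite_false, Sum.elim_inr]
        apply Fin.ext
        simp only
        omega
      · have h3 : ¬ (t.1 + 1 - n < i.1) := by omega
        simp only [h1, h2, dite_false, Sum.elim_inl, h3]
        apply Fin.ext
        simp only
        omega

theorem std_unit_inner {n : ℕ} (h : 1 + n = n + 1) (b : Fin n) :
    inner (std (0 : Fin 1) n h) b = b := by
  apply Fin.ext; simp [inner, std]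

theorem std_one_inner {m : ℕ} (i : Fin m) (h : m + 1 = m + 1) (b : Fin 1) :
    inner (std i 1 h) b = i := by
  apply Fin.ext; simp [inner, std]

theorem std_one_outer {m : ℕ} (i : Fin m) (h : m + 1 = m + 1) (a : Fin m) (ha : a ≠ i) :
    outer (std i 1 h) a ha = a := by
  apply Fin.ext; simp [outer, std]

theorem outer_congr {m n p : ℕ} {i : Fin m} (e : Graft i n p) {a a' : Fin m} (h : a = a')
    (ha : a ≠ i) (ha' : a' ≠ i) : outer e a ha = outer e a' ha' := by
  subst h; rfl

/-- `(x ∘ᵢ y) ∘ₖ z` and `x ∘ᵢ (y ∘ⱼ z)` are the same labelled composite: the label `k` is that of the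
input `j` of `y`, and the two resulting labellings of all the inputs of `x`, `y`, `z` agree. -/
structure SeqCompat {m n q p s r : ℕ} {i : Fin m} {j : Fin n} {k : Fin p}
    (e₁ : Graft i n p) (e₂ : Graft k q r) (f₁ : Graft j q s) (f₂ : Graft i s r) : Prop where
  node : k = inner e₁ j
  outer_eq : ∀ a (ha : a ≠ i) (h : outer e₁ a ha ≠ k), outer e₂ (outer e₁ a ha) h = outer f₂ a ha
  middle_eq : ∀ b (hb : b ≠ j) (h : inner e₁ b ≠ k),
    outer e₂ (inner e₁ b) h = inner f₂ (outer f₁ b hb)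
  inner_eq : ∀ c, inner e₂ c = inner f₂ (inner f₁ c)

/-- `(x ∘ᵢ y) ∘ₖ z` and `(x ∘ᵢ' z) ∘ₖ' y` are the same labelled composite: `i ≠ i'` are two inputs
of `x`, labelled `k'` and `k` after the first composition, and the two resulting labellings of all
the inputs of `x`, `y`, `z` agree. -/
structure ParCompat {m n q p s r : ℕ} {i i' : Fin m} {k : Fin p} {k' : Fin s}
    (e₁ : Graft i n p) (e₂ : Graft k q r) (f₁ : Graft i' q s) (f₂ : Graft k' n r) : Prop where
  ne : i ≠ i'
  node : k = outer e₁ i' ne.symm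
  node' : k' = outer f₁ i ne
  outer_eq : ∀ a (ha : a ≠ i) (ha' : a ≠ i') (h : outer e₁ a ha ≠ k) (h' : outer f₁ a ha' ≠ k'),
    outer e₂ (outer e₁ a ha) h = outer f₂ (outer f₁ a ha') h'
  left_eq : ∀ b (h : inner e₁ b ≠ k), outer e₂ (inner e₁ b) h = inner f₂ b
  right_eq : ∀ c (h : inner f₁ c ≠ k'), inner e₂ c = outer f₂ (inner f₁ c) h

end Graft

open Graft

/-- The data of a graded operad over `𝕜`: for every arity `n` and every (cohomological) degree `d` a
`𝕜`-module of operations, a unit, and bilinear partial compositions of degree `0`. In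
`comp i e h x y` the operation `y` is plugged into the input `i` of `x` and the inputs of the
composite are labelled through `e`. (The degree of the composite is a variable `c` with `a + b = c`,
which avoids casts.) The action of the symmetric groups is recovered in `OpData.act`. -/
structure OpData (𝕜 : Type u) [Field 𝕜] where
  obj : ℕ → ℤ → Type u
  [instAdd : ∀ n d, AddCommGroup (obj n d)]
  [instMod : ∀ n d, Module 𝕜 (obj n d)]
  one : obj 1 0
  comp : ∀ {m n p : ℕ} (i : Fin m) (_ : Graft i n p) {a b c : ℤ} (_ : a + b = c),
    obj m a →ₗ[𝕜] obj n b →ₗ[𝕜] obj p c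

attribute [instance] OpData.instAdd OpData.instMod

/-- The axioms of a symmetric graded operad: unitality, and sequential and parallel associativity
with the Koszul sign. Since they are imposed for all labellings, equivariance is included. -/
structure OpData.IsOperad {𝕜 : Type u} [Field 𝕜] (P : OpData 𝕜) : Prop where
  one_comp : ∀ {n : ℕ} {d : ℤ} (x : P.obj n d),
    P.comp 0 (std 0 n (add_comm 1 n)) (zero_add d) P.one x = x
  comp_one : ∀ {m : ℕ} {d : ℤ} (i : Fin m) (x : P.obj m d),
    P.comp i (std i 1 rfl) (add_zero d) x P.one = x
  assoc_seq : ∀ {m n q p s r : ℕ} {i : Fin m} {j : Fin n} {k : Fin p}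
    (e₁ : Graft i n p) (e₂ : Graft k q r) (f₁ : Graft j q s) (f₂ : Graft i s r),
    SeqCompat e₁ e₂ f₁ f₂ → ∀ {a b c ab bc abc : ℤ} (h₁ : a + b = ab) (h₂ : ab + c = abc)
    (h₃ : b + c = bc) (h₄ : a + bc = abc) (x : P.obj m a) (y : P.obj n b) (z : P.obj q c),
    P.comp k e₂ h₂ (P.comp i e₁ h₁ x y) z = P.comp i f₂ h₄ x (P.comp j f₁ h₃ y z)
  assoc_par : ∀ {m n q p s r : ℕ} {i i' : Fin m} {k : Fin p} {k' : Fin s}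
    (e₁ : Graft i n p) (e₂ : Graft k q r) (f₁ : Graft i' q s) (f₂ : Graft k' n r),
    ParCompat e₁ e₂ f₁ f₂ → ∀ {a b c ab ac abc : ℤ} (h₁ : a + b = ab) (h₂ : ab + c = abc)
    (h₃ : a + c = ac) (h₄ : ac + b = abc) (x : P.obj m a) (y : P.obj n b) (z : P.obj q c),
    P.comp k e₂ h₂ (P.comp i e₁ h₁ x y) z =
      (-1 : 𝕜) ^ (b * c) • P.comp k' f₂ h₄ (P.comp i' f₁ h₃ x z) y

section Constructions

variable {𝕜 : Type u} [Field 𝕜]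

namespace OpData

/-- The usual partial composition `x ∘ᵢ y` (inputs are numbered from `0`). -/
def circ (P : OpData 𝕜) {m n p : ℕ} (i : Fin m) {a b c : ℤ} (x : P.obj m a) (y : P.obj n b)
    (hp : m + n = p + 1 := by rfl) (h : a + b = c := by rfl) : P.obj p c :=
  P.comp i (std i n hp) h x y

/-- The action of a permutation, by relabelling the inputs: the input `j` of `x` becomes the input
`σ j` of `act σ x`. -/
def act (P : OpData 𝕜) {n : ℕ} {d : ℤ} (σ : Equiv.Perm (Fin n)) (x : P.obj n d) : P.obj n d :=
  P.comp 0 ((std (0 : Fin 1) n (add_comm 1 n)).trans σ) (zero_add d) P.one x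

/-- Operadic ideals (with homogeneous components). -/
structure Ideal (P : OpData 𝕜) where
  carrier : ∀ n d, Submodule 𝕜 (P.obj n d)
  comp_left : ∀ {m n p : ℕ} (i : Fin m) (e : Graft i n p) {a b c : ℤ} (h : a + b = c)
    (x : P.obj m a) (y : P.obj n b), x ∈ carrier m a → P.comp i e h x y ∈ carrier p c
  comp_right : ∀ {m n p : ℕ} (i : Fin m) (e : Graft i n p) {a b c : ℤ} (h : a + b = c)
    (x : P.obj m a) (y : P.obj n b), y ∈ carrier n b → P.comp i e h x y ∈ carrier p c

/-- The quotient of an operad by an operadic ideal. -/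
def quot (P : OpData 𝕜) (I : P.Ideal) : OpData 𝕜 where
  obj n d := P.obj n d ⧸ I.carrier n d
  one := Submodule.Quotient.mk P.one
  comp {m n p} i e {a b c} h :=
    (I.carrier m a).liftQ
      { toFun := fun x => (I.carrier n b).liftQ ((I.carrier p c).mkQ ∘ₗ P.comp i e h x) (by
          intro y hy
          simpa using I.comp_right i e h x y hy)
        map_add' := by
          intro x x'; ext y; simp
        map_smul' := by
          intro r x; ext y; simp }
      (by
        intro x hx
        simp only [LinearMap.mem_ker]
        ext y
        simpa using I.comp_left i e h x y hx)

theorem quot_comp (P : OpData 𝕜) (I : P.Ideal) {m n p : ℕ} (i : Fin m) (e : Graft i n p)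
    {a b c : ℤ} (h : a + b = c) (x : P.obj m a) (y : P.obj n b) :
    (P.quot I).comp i e h (Submodule.Quotient.mk x) (Submodule.Quotient.mk y) =
      Submodule.Quotient.mk (P.comp i e h x y) := rfl

theorem IsOperad.quot {P : OpData 𝕜} (hP : P.IsOperad) (I : P.Ideal) : (P.quot I).IsOperad where
  one_comp x := by
    obtain ⟨x, rfl⟩ := Submodule.Quotient.mk_surjective _ x
    exact congrArg Submodule.Quotient.mk (hP.one_comp x)
  comp_one i x := by
    obtain ⟨x, rfl⟩ := Submodule.Quotient.mk_surjective _ x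
    exact congrArg Submodule.Quotient.mk (hP.comp_one i x)
  assoc_seq e₁ e₂ f₁ f₂ hc a b c ab bc abc h₁ h₂ h₃ h₄ x y z := by
    obtain ⟨x, rfl⟩ := Submodule.Quotient.mk_surjective _ x
    obtain ⟨y, rfl⟩ := Submodule.Quotient.mk_surjective _ y
    obtain ⟨z, rfl⟩ := Submodule.Quotient.mk_surjective _ z
    exact congrArg Submodule.Quotient.mk (hP.assoc_seq e₁ e₂ f₁ f₂ hc h₁ h₂ h₃ h₄ x y z)
  assoc_par e₁ e₂ f₁ f₂ hc a b c ab bc abc h₁ h₂ h₃ h₄ x y z := by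
    obtain ⟨x, rfl⟩ := Submodule.Quotient.mk_surjective _ x
    obtain ⟨y, rfl⟩ := Submodule.Quotient.mk_surjective _ y
    obtain ⟨z, rfl⟩ := Submodule.Quotient.mk_surjective _ z
    exact congrArg Submodule.Quotient.mk (hP.assoc_par e₁ e₂ f₁ f₂ hc h₁ h₂ h₃ h₄ x y z)

/-- The product of a sequence of operads. -/
def pi (P : ℕ → OpData 𝕜) : OpData 𝕜 where
  obj n d := ∀ k, (P k).obj n d
  one k := (P k).one
  comp {m n p} i e {a b c} h := LinearMap.mk₂ 𝕜 (fun (x : ∀ k, (P k).obj m a) (y : ∀ k, (P k).obj n b) => (fun k => (P k).comp i e h (x k) (y k) : ∀ k, (P k).obj p c))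
    (by intros; ext; simp) (by intros; ext; simp) (by intros; ext; simp) (by intros; ext; simp)

theorem IsOperad.pi {P : ℕ → OpData 𝕜} (hP : ∀ k, (P k).IsOperad) : (OpData.pi P).IsOperad where
  one_comp x := funext fun k => (hP k).one_comp ((x : ∀ k, (P k).obj _ _) k)
  comp_one i x := funext fun k => (hP k).comp_one i ((x : ∀ k, (P k).obj _ _) k)
  assoc_seq e₁ e₂ f₁ f₂ hc _ _ _ _ _ _ h₁ h₂ h₃ h₄ x y z := funext fun k =>
    (hP k).assoc_seq e₁ e₂ f₁ f₂ hc h₁ h₂ h₃ h₄ ((x : ∀ k, (P k).obj _ _) k) ((y : ∀ k, (P k).obj _ _) k) ((z : ∀ k, (P k).obj _ _) k)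
  assoc_par e₁ e₂ f₁ f₂ hc _ _ _ _ _ _ h₁ h₂ h₃ h₄ x y z := funext fun k =>
    (hP k).assoc_par e₁ e₂ f₁ f₂ hc h₁ h₂ h₃ h₄ ((x : ∀ k, (P k).obj _ _) k) ((y : ∀ k, (P k).obj _ _) k) ((z : ∀ k, (P k).obj _ _) k)

/-- Suboperads. -/
structure Sub (P : OpData 𝕜) where
  carrier : ∀ n d, Submodule 𝕜 (P.obj n d)
  one_mem : P.one ∈ carrier 1 0
  comp_mem : ∀ {m n p : ℕ} (i : Fin m) (e : Graft i n p) {a b c : ℤ} (h : a + b = c)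
    (x : P.obj m a) (y : P.obj n b), x ∈ carrier m a → y ∈ carrier n b →
      P.comp i e h x y ∈ carrier p c

/-- The operad structure on a suboperad. -/
def sub (P : OpData 𝕜) (S : P.Sub) : OpData 𝕜 where
  obj n d := S.carrier n d
  one := ⟨P.one, S.one_mem⟩
  comp {m n p} i e {a b c} h := LinearMap.mk₂ 𝕜
    (fun (x : S.carrier m a) (y : S.carrier n b) =>
      (⟨P.comp i e h x.1 y.1, S.comp_mem i e h x.1 y.1 x.2 y.2⟩ : S.carrier p c))
    (by intros; ext; simp) (by intros; ext; simp) (by intros; ext; simp) (by intros; ext; simp)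

theorem IsOperad.sub {P : OpData 𝕜} (hP : P.IsOperad) (S : P.Sub) : (P.sub S).IsOperad where
  one_comp x := Subtype.ext (hP.one_comp (x : S.carrier _ _).1)
  comp_one i x := Subtype.ext (hP.comp_one i (x : S.carrier _ _).1)
  assoc_seq e₁ e₂ f₁ f₂ hc _ _ _ _ _ _ h₁ h₂ h₃ h₄ x y z :=
    Subtype.ext (hP.assoc_seq e₁ e₂ f₁ f₂ hc h₁ h₂ h₃ h₄ (x : S.carrier _ _).1 (y : S.carrier _ _).1 (z : S.carrier _ _).1)
  assoc_par e₁ e₂ f₁ f₂ hc _ _ _ _ _ _ h₁ h₂ h₃ h₄ x y z :=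
    Subtype.ext (hP.assoc_par e₁ e₂ f₁ f₂ hc h₁ h₂ h₃ h₄ (x : S.carrier _ _).1 (y : S.carrier _ _).1 (z : S.carrier _ _).1)

end OpData

end Constructions

/-- A filtered graded operad: each module of operations carries a decreasing filtration
`P = F₀ ⊇ F₁ ⊇ F₂ ⊇ ⋯` with `F_s ∘ᵢ F_t ⊆ F_{s+t}`. -/
structure FilteredOperad (𝕜 : Type u) [Field 𝕜] extends OpData 𝕜 where
  isOperad : toOpData.IsOperad
  fil : ∀ (n : ℕ) (d : ℤ), ℕ → Submodule 𝕜 (obj n d)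
  fil_zero : ∀ n d, fil n d 0 = ⊤
  fil_anti : ∀ n d, Antitone (fil n d)
  comp_fil : ∀ {m n p : ℕ} (i : Fin m) (e : Graft i n p) {a b c : ℤ} (h : a + b = c) {s t : ℕ}
    (x : obj m a) (y : obj n b), x ∈ fil m a s → y ∈ fil n b t → comp i e h x y ∈ fil p c (s + t)

namespace FilteredOperad

variable {𝕜 : Type u} [Field 𝕜]

theorem mem_fil_zero (P : FilteredOperad 𝕜) {n : ℕ} {d : ℤ} (x : P.obj n d) : x ∈ P.fil n d 0 := by
  rw [P.fil_zero]; trivial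

theorem comp_fil_left (P : FilteredOperad 𝕜) {m n p : ℕ} (i : Fin m) (e : Graft i n p) {a b c : ℤ}
    (h : a + b = c) {s : ℕ} (x : P.obj m a) (y : P.obj n b) (hx : x ∈ P.fil m a s) :
    P.comp i e h x y ∈ P.fil p c s :=
  P.comp_fil i e h x y hx (P.mem_fil_zero y)

theorem comp_fil_right (P : FilteredOperad 𝕜) {m n p : ℕ} (i : Fin m) (e : Graft i n p) {a b c : ℤ}
    (h : a + b = c) {s : ℕ} (x : P.obj m a) (y : P.obj n b) (hy : y ∈ P.fil n b s) :
    P.comp i e h x y ∈ P.fil p c s := by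
  simpa using P.comp_fil i e h x y (P.mem_fil_zero x) hy

/-- The stage `F_k` of the filtration is an operadic ideal. -/
def filIdeal (P : FilteredOperad 𝕜) (k : ℕ) : P.toOpData.Ideal where
  carrier n d := P.fil n d k
  comp_left i e _ _ _ h x y hx := P.comp_fil_left i e h x y hx
  comp_right i e _ _ _ h x y hy := P.comp_fil_right i e h x y hy

/-- The projection `P / F_{k+1} → P / F_k`. -/
def proj (P : FilteredOperad 𝕜) (n : ℕ) (d : ℤ) (k : ℕ) :
    (P.obj n d ⧸ P.fil n d (k + 1)) →ₗ[𝕜] (P.obj n d ⧸ P.fil n d k) :=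
  Submodule.factor (P.fil_anti n d (Nat.le_succ k))

/-- The limit of the tower `P / F_k`, inside the product. -/
def limSub (P : FilteredOperad 𝕜) : (OpData.pi fun k => P.toOpData.quot (P.filIdeal k)).Sub where
  carrier n d :=
    { carrier := {x : ∀ k, P.obj n d ⧸ P.fil n d k | ∀ k, P.proj n d k (x (k + 1)) = x k}
      add_mem' := by
        intro x y hx hy k
        exact (map_add (P.proj n d k) _ _).trans (congrArg₂ _ (hx k) (hy k))
      zero_mem' := fun k => map_zero (P.proj n d k)
      smul_mem' := by
        intro r x hx k
        exact (map_smul (P.proj n d k) r _).trans (congrArg _ (hx k)) }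
  one_mem := fun k => rfl
  comp_mem := by
    intro m n p i e a b c h x y hx hy k
    have hx := hx k
    have hy := hy k
    change ∀ k, P.obj m a ⧸ P.fil m a k at x
    change ∀ k, P.obj n b ⧸ P.fil n b k at y
    change P.proj p c k ((P.toOpData.quot (P.filIdeal (k+1))).comp i e h (x (k+1)) (y (k+1))) =
      (P.toOpData.quot (P.filIdeal k)).comp i e h (x k) (y k)
    rw [← hx, ← hy]
    obtain ⟨x', hx'⟩ := Submodule.Quotient.mk_surjective _ (x (k+1))
    obtain ⟨y', hy'⟩ := Submodule.Quotient.mk_surjective _ (y (k+1))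
    rw [← hx', ← hy']
    rfl

/-- The operad `lim_k P / F_k`. -/
def limData (P : FilteredOperad 𝕜) : OpData 𝕜 := OpData.sub _ P.limSub

theorem limData_isOperad (P : FilteredOperad 𝕜) : P.limData.IsOperad :=
  OpData.IsOperad.sub (OpData.IsOperad.pi fun k => P.isOperad.quot (P.filIdeal k)) P.limSub

/-- The canonical map `P → lim_k P / F_k`. -/
def toLim (P : FilteredOperad 𝕜) (n : ℕ) (d : ℤ) : P.obj n d →ₗ[𝕜] P.limData.obj n d where
  toFun x := ⟨fun k => (P.fil n d k).mkQ x, fun _ => rfl⟩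
  map_add' _ _ := rfl
  map_smul' _ _ := rfl

/-- The structure map `lim_k P / F_k → P / F_k`. -/
def limEval (P : FilteredOperad 𝕜) (n : ℕ) (d : ℤ) (k : ℕ) :
    P.limData.obj n d →ₗ[𝕜] (P.obj n d ⧸ P.fil n d k) where
  toFun x := (x : P.limSub.carrier n d).1 k
  map_add' _ _ := rfl
  map_smul' _ _ := rfl

/-- The element of the limit given by a compatible family. -/
def mkLim (P : FilteredOperad 𝕜) {n : ℕ} {d : ℤ} (s : ∀ k, P.obj n d ⧸ P.fil n d k)
    (hs : ∀ k, P.proj n d k (s (k + 1)) = s k) : P.limData.obj n d :=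
  (⟨s, hs⟩ : P.limSub.carrier n d)

theorem lim_ext (P : FilteredOperad 𝕜) {n : ℕ} {d : ℤ} {x y : P.limData.obj n d}
    (h : ∀ k, P.limEval n d k x = P.limEval n d k y) : x = y :=
  Subtype.ext (funext h)

theorem limEval_proj (P : FilteredOperad 𝕜) {n : ℕ} {d : ℤ} (k : ℕ) (x : P.limData.obj n d) :
    P.proj n d k (P.limEval n d (k + 1) x) = P.limEval n d k x :=
  (x : P.limSub.carrier n d).2 k

theorem limEval_rep (P : FilteredOperad 𝕜) {n : ℕ} {d : ℤ} (x : P.limData.obj n d) (l k : ℕ)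
    (w : P.obj n d) (hw : P.limEval n d (k + l) x = Submodule.Quotient.mk w) :
    P.limEval n d k x = Submodule.Quotient.mk w := by
  induction l with
  | zero => exact hw
  | succ l ih =>
    apply ih
    have := P.limEval_proj (k + l) x
    rw [← this]
    have hw' : P.limEval n d (k + l + 1) x = Submodule.Quotient.mk w := hw
    rw [hw']
    rfl

/-- The completion `lim_k P / F_k`, filtered by the kernels of the structure maps onto `P / F_k`. -/
def completion (P : FilteredOperad 𝕜) : FilteredOperad 𝕜 where
  toOpData := P.limData
  isOperad := P.limData_isOperad
  fil n d k := LinearMap.ker (P.limEval n d k)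
  fil_zero n d := by
    rw [eq_top_iff]
    intro x _
    rw [LinearMap.mem_ker]
    obtain ⟨w, hw⟩ := Submodule.Quotient.mk_surjective _ (P.limEval n d 0 x)
    rw [← hw, Submodule.Quotient.mk_eq_zero]
    exact P.mem_fil_zero w
  fil_anti n d := by
    apply antitone_nat_of_succ_le
    intro k x hx
    rw [LinearMap.mem_ker] at hx ⊢
    rw [← P.limEval_proj, hx, map_zero]
  comp_fil := by
    intro m n p i e a b c h s t x y hx hy
    rw [LinearMap.mem_ker] at hx hy ⊢
    obtain ⟨v, hv⟩ := Submodule.Quotient.mk_surjective _ (P.limEval m a (s + t) x)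
    obtain ⟨w, hw⟩ := Submodule.Quotient.mk_surjective _ (P.limEval n b (s + t) y)
    have h1 := P.limEval_rep x t s v hv.symm
    have h2 := P.limEval_rep y s t w (by rw [add_comm t s]; exact hw.symm)
    rw [hx, eq_comm, Submodule.Quotient.mk_eq_zero] at h1
    rw [hy, eq_comm, Submodule.Quotient.mk_eq_zero] at h2
    have h3 : P.limEval p c (s + t) (P.limData.comp i e h x y) =
      (P.toOpData.quot (P.filIdeal (s + t))).comp i e h (P.limEval m a (s + t) x)
        (P.limEval n b (s + t) y) := rfl
    rw [h3, ← hv, ← hw]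
    exact (Submodule.Quotient.mk_eq_zero _).2 (P.comp_fil i e h v w h1 h2)

/-- A filtered operad is complete when `P → lim_k P / F_k` is an isomorphism in every arity and
degree. -/
def IsComplete (P : FilteredOperad 𝕜) : Prop := ∀ n d, Function.Bijective (P.toLim n d)

theorem isComplete_of (P : FilteredOperad 𝕜)
    (hsep : ∀ {n d} (x : P.obj n d), (∀ p, x ∈ P.fil n d p) → x = 0)
    (hcau : ∀ {n d} (s : ℕ → P.obj n d), (∀ p, s (p + 1) - s p ∈ P.fil n d p) →
      ∃ x, ∀ p, x - s p ∈ P.fil n d p) : P.IsComplete := by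
  intro n d
  constructor
  · rw [injective_iff_map_eq_zero]
    intro x hx
    apply hsep
    intro p
    have := congrArg (P.limEval n d p) hx
    exact (Submodule.Quotient.mk_eq_zero _).1 (this.trans (map_zero _))
  · intro x
    choose s hs using fun k => Submodule.Quotient.mk_surjective _ (P.limEval n d k x)
    obtain ⟨y, hy⟩ := hcau s (by
      intro p
      rw [← Submodule.Quotient.eq, hs p]
      have := P.limEval_rep x 1 p (s (p + 1)) (hs (p + 1)).symm
      exact this.symm)
    refine ⟨y, P.lim_ext fun k => ?_⟩
    rw [← hs k]
    exact (Submodule.Quotient.eq _).2 (hy k)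

theorem IsComplete.sep {P : FilteredOperad 𝕜} (hP : P.IsComplete) {n : ℕ} {d : ℤ} (x : P.obj n d)
    (hx : ∀ p, x ∈ P.fil n d p) : x = 0 := by
  apply (hP n d).1
  apply P.lim_ext
  intro k
  exact ((Submodule.Quotient.mk_eq_zero _).2 (hx k)).trans (map_zero (P.limEval n d k)).symm

theorem IsComplete.cauchy {P : FilteredOperad 𝕜} (hP : P.IsComplete) {n : ℕ} {d : ℤ}
    (s : ℕ → P.obj n d) (hs : ∀ p, s (p + 1) - s p ∈ P.fil n d p) :
    ∃ x, ∀ p, x - s p ∈ P.fil n d p := by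
  obtain ⟨x, hx⟩ := (hP n d).2 (P.mkLim
    (fun k => Submodule.Quotient.mk (s k)) fun k => (Submodule.Quotient.eq _).2 (hs k))
  exact ⟨x, fun p => (Submodule.Quotient.eq _).1 (congrArg (P.limEval n d p) hx)⟩

theorem completion_isComplete (P : FilteredOperad 𝕜) : P.completion.IsComplete := by
  apply isComplete_of
  · intro n d x hx
    exact P.lim_ext fun k => (hx k).trans (map_zero (P.limEval n d k)).symm
  · intro n d s hs
    have hs' : ∀ p, P.limEval n d p (s (p + 1)) = P.limEval n d p (s p) := fun p =>
      sub_eq_zero.1 ((map_sub (P.limEval n d p) _ _).symm.trans (hs p))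
    refine ⟨P.mkLim (fun k => P.limEval n d k (s k)) fun k => ?_, fun p => ?_⟩
    · exact (P.limEval_proj k (s (k + 1))).trans (hs' k)
    · exact sub_self (P.limEval n d p (s p))

/-- The quotient by an operadic ideal, with the quotient filtration. -/
def quot (P : FilteredOperad 𝕜) (I : P.toOpData.Ideal) : FilteredOperad 𝕜 where
  toOpData := P.toOpData.quot I
  isOperad := P.isOperad.quot I
  fil n d k := (P.fil n d k).map (I.carrier n d).mkQ
  fil_zero n d := by
    rw [P.fil_zero]
    exact (Submodule.map_top _).trans (Submodule.range_mkQ _)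
  fil_anti n d _ _ h := Submodule.map_mono (P.fil_anti n d h)
  comp_fil := by
    rintro m n p i e a b c h s t _ _ ⟨x, hx, rfl⟩ ⟨y, hy, rfl⟩
    exact ⟨_, P.comp_fil i e h x y hx hy, rfl⟩

/-- A suboperad, with the induced filtration. -/
def sub (P : FilteredOperad 𝕜) (S : P.toOpData.Sub) : FilteredOperad 𝕜 where
  toOpData := P.toOpData.sub S
  isOperad := P.isOperad.sub S
  fil n d k := (P.fil n d k).comap (S.carrier n d).subtype
  fil_zero n d := by
    rw [P.fil_zero]
    exact Submodule.comap_top _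
  fil_anti n d _ _ h := Submodule.comap_mono (P.fil_anti n d h)
  comp_fil := by
    rintro m n p i e a b c h s t x y hx hy
    exact P.comp_fil i e h (x : S.carrier m a).1 (y : S.carrier n b).1 hx hy

/-- Membership in the smallest operadic ideal that contains `r` and is closed for the topology given
by the filtration. -/
inductive ClosedIdealMem (P : FilteredOperad 𝕜) {n₀ : ℕ} {d₀ : ℤ} (r : P.obj n₀ d₀) :
    ∀ {n : ℕ} {d : ℤ}, P.obj n d → Prop
  | base : ClosedIdealMem P r r
  | zero {n : ℕ} {d : ℤ} : ClosedIdealMem P r (0 : P.obj n d)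
  | add {n : ℕ} {d : ℤ} (x y : P.obj n d) :
      ClosedIdealMem P r x → ClosedIdealMem P r y → ClosedIdealMem P r (x + y)
  | smul {n : ℕ} {d : ℤ} (c : 𝕜) (x : P.obj n d) :
      ClosedIdealMem P r x → ClosedIdealMem P r (c • x)
  | comp_left {m n p : ℕ} (i : Fin m) (e : Graft i n p) {a b c : ℤ} (h : a + b = c)
      (x : P.obj m a) (y : P.obj n b) :
      ClosedIdealMem P r x → ClosedIdealMem P r (P.comp i e h x y)
  | comp_right {m n p : ℕ} (i : Fin m) (e : Graft i n p) {a b c : ℤ} (h : a + b = c)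
      (x : P.obj m a) (y : P.obj n b) :
      ClosedIdealMem P r y → ClosedIdealMem P r (P.comp i e h x y)
  | limit {n : ℕ} {d : ℤ} (x : P.obj n d) (s : ℕ → P.obj n d) :
      (∀ k, ClosedIdealMem P r (s k)) → (∀ k, x - s k ∈ P.fil n d k) → ClosedIdealMem P r x

/-- The closed operadic ideal generated by `r`. The quotient of a complete operad by it is again
complete (`IsComplete.quot`); it is the quotient by `(r)` in the category of complete operads. -/
def closedIdeal (P : FilteredOperad 𝕜) {n₀ : ℕ} {d₀ : ℤ} (r : P.obj n₀ d₀) : P.toOpData.Ideal where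
  carrier n d :=
    { carrier := {x | P.ClosedIdealMem r x}
      add_mem' := fun hx hy => .add _ _ hx hy
      zero_mem' := .zero
      smul_mem' := fun c x hx => .smul c x hx }
  comp_left i e _ _ _ h x y hx := .comp_left i e h x y hx
  comp_right i e _ _ _ h x y hy := .comp_right i e h x y hy

theorem IsComplete.quot {P : FilteredOperad 𝕜} (hP : P.IsComplete) {n₀ : ℕ} {d₀ : ℤ}
    (r : P.obj n₀ d₀) : (P.quot (P.closedIdeal r)).IsComplete := by
  apply isComplete_of
  · intro _ _ x hx
    obtain ⟨x, rfl⟩ := Submodule.Quotient.mk_surjective _ x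
    choose f hf hfx using hx
    refine (Submodule.Quotient.mk_eq_zero _).2
      (.limit x (fun k => x - f k) (fun k => ?_) (fun k => ?_))
    · exact (Submodule.Quotient.eq _).1 (hfx k).symm
    · simpa using hf k
  · intro n d s hs
    choose a ha using fun k => Submodule.Quotient.mk_surjective _ (s k)
    choose f hf hfx using hs
    have hI : ∀ k, a (k + 1) - a k - f k ∈ (P.closedIdeal r).carrier n d := by
      intro k
      have h1 : (Submodule.Quotient.mk (a (k + 1) - a k) :
          P.obj n d ⧸ (P.closedIdeal r).carrier n d) = Submodule.Quotient.mk (f k) :=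
        ((congrArg₂ (fun u v : P.obj n d ⧸ (P.closedIdeal r).carrier n d => u - v)
          (ha (k + 1)) (ha k))).trans (hfx k).symm
      exact (Submodule.Quotient.eq _).1 h1
    obtain ⟨x, hx⟩ := hP.cauchy
      (fun k => a 0 + ∑ j ∈ Finset.range k, f j) (by
        intro k
        simpa [Finset.sum_range_succ] using hf k)
    refine ⟨Submodule.Quotient.mk x, fun k => ⟨_, hx k, ?_⟩⟩
    have h2 : a k - (a 0 + ∑ j ∈ Finset.range k, f j) ∈ (P.closedIdeal r).carrier n d := by
      induction k with
      | zero => simp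
      | succ k ih =>
        have := Submodule.add_mem _ ih (hI k)
        convert this using 1
        rw [Finset.sum_range_succ]; abel
    have h3 := (Submodule.Quotient.eq _).2 h2
    exact congrArg (fun v : P.obj n d ⧸ (P.closedIdeal r).carrier n d =>
      Submodule.Quotient.mk x - v) (h3.symm.trans (ha k))

/-- A differential on a filtered graded operad: a degree `1` map of square zero which is a derivation
for all the partial compositions and preserves the filtration. -/
structure Differential (P : FilteredOperad 𝕜) where
  d : ∀ {n : ℕ} {a b : ℤ} (_ : a + 1 = b), P.obj n a →ₗ[𝕜] P.obj n b
  d_d : ∀ {n : ℕ} {a b c : ℤ} (h : a + 1 = b) (h' : b + 1 = c) (x : P.obj n a), d h' (d h x) = 0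
  leibniz : ∀ {m n p : ℕ} (i : Fin m) (e : Graft i n p) {a b c a' b' c' : ℤ} (h : a + b = c)
    (ha : a + 1 = a') (hb : b + 1 = b') (hc : c + 1 = c') (h₁ : a' + b = c') (h₂ : a + b' = c')
    (x : P.obj m a) (y : P.obj n b),
    d hc (P.comp i e h x y) =
      P.comp i e h₁ (d ha x) y + (-1 : 𝕜) ^ a • P.comp i e h₂ x (d hb y)
  d_fil : ∀ {n : ℕ} {a b : ℤ} (h : a + 1 = b) (k : ℕ) (x : P.obj n a),
    x ∈ P.fil n a k → d h x ∈ P.fil n b k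

namespace Differential

variable {P : FilteredOperad 𝕜} (D : P.Differential)

theorem d_one {b : ℤ} (h : 0 + 1 = b) : D.d h P.one = 0 := by
  have h0 := P.isOperad.comp_one (0 : Fin 1) P.one
  have h1 := D.leibniz (0 : Fin 1) (Graft.std 0 1 rfl) (add_zero 0) h h h
    (by omega) (by omega) P.one P.one
  rw [h0] at h1
  subst h
  have h2 := P.isOperad.comp_one (0 : Fin 1) (D.d rfl P.one)
  have h3 := P.isOperad.one_comp (D.d rfl P.one)
  rw [h2, h3] at h1
  simpa using h1

/-- The zero differential. -/
def zero (P : FilteredOperad 𝕜) : P.Differential where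
  d _ := 0
  d_d _ _ _ := rfl
  leibniz := by intros; simp
  d_fil := by intros; simp

/-- The suboperad of cocycles. -/
def cycles : P.toOpData.Sub where
  carrier n a := LinearMap.ker (D.d (n := n) (rfl : a + 1 = a + 1))
  one_mem := D.d_one rfl
  comp_mem i e a b c h x y hx hy := by
    rw [LinearMap.mem_ker] at hx hy ⊢
    rw [D.leibniz i e h rfl rfl rfl (by omega) (by omega), hx, hy]
    simp

theorem mem_cycles {n : ℕ} {a b : ℤ} (h : a + 1 = b) (x : P.obj n a) :
    x ∈ D.cycles.carrier n a ↔ D.d h x = 0 := by subst h; rfl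

/-- The ideal of coboundaries inside the cocycles. -/
def boundaries : (P.toOpData.sub D.cycles).Ideal where
  carrier n b := (LinearMap.range (D.d (n := n) (sub_add_cancel b 1))).comap
    (D.cycles.carrier n b).subtype
  comp_left {m n p} i e {a b c} h x y := by
    rintro ⟨w, hw⟩
    refine ⟨P.comp i e (by omega) w (y : D.cycles.carrier n b).1, ?_⟩
    rw [D.leibniz i e _ (sub_add_cancel a 1) (rfl : b + 1 = b + 1) _ h (by omega), hw]
    have hy : D.d rfl (y : D.cycles.carrier n b).1 = 0 := (y : D.cycles.carrier n b).2
    rw [hy]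
    simp
    rfl
  comp_right {m n p} i e {a b c} h x y := by
    rintro ⟨w, hw⟩
    refine ⟨(-1 : 𝕜) ^ a • P.comp i e (by omega) (x : D.cycles.carrier m a).1 w, ?_⟩
    rw [map_smul, D.leibniz i e _ (rfl : a + 1 = a + 1) (sub_add_cancel b 1) _ (by omega) h, hw]
    have hx : D.d rfl (x : D.cycles.carrier m a).1 = 0 := (x : D.cycles.carrier m a).2
    rw [hx, map_zero, LinearMap.zero_apply, zero_add, smul_smul, ← mul_zpow]
    simp
    rfl

/-- The cohomology operad: cocycles modulo coboundaries, where the `k`-th stage of the filtration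
consists of the classes of the cocycles lying in `F_k`. -/
def homology : FilteredOperad 𝕜 := (P.sub D.cycles).quot D.boundaries

/-- The cohomology class of a cocycle. -/
def homologyClass {n : ℕ} {a : ℤ} (x : P.obj n a) (hx : x ∈ D.cycles.carrier n a) :
    D.homology.obj n a :=
  Submodule.Quotient.mk (p := D.boundaries.carrier n a) (⟨x, hx⟩ : D.cycles.carrier n a)

/-- The map induced by a differential on `P / F_k`. -/
def quotMap {n : ℕ} {a b : ℤ} (h : a + 1 = b) (k : ℕ) :
    (P.obj n a ⧸ P.fil n a k) →ₗ[𝕜] (P.obj n b ⧸ P.fil n b k) :=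
  Submodule.mapQ (P.fil n a k) (P.fil n b k) (D.d h) (fun z hz => D.d_fil h k z hz)

/-- The map induced by a differential on the limit. -/
def limMap {n : ℕ} {a b : ℤ} (h : a + 1 = b) : P.limData.obj n a →ₗ[𝕜] P.limData.obj n b where
  toFun x := P.mkLim (fun k => D.quotMap h k (P.limEval n a k x))
    (by
      intro k
      rw [← P.limEval_proj k x]
      obtain ⟨w, hw⟩ := Submodule.Quotient.mk_surjective _ (P.limEval n a (k + 1) x)
      rw [← hw]
      rfl)
  map_add' x y := by
    apply P.lim_ext
    intro k
    exact (congrArg (D.quotMap h k) (map_add (P.limEval n a k) x y)).trans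
      (map_add (D.quotMap h k) _ _)
  map_smul' r x := by
    apply P.lim_ext
    intro k
    exact (congrArg (D.quotMap h k) (map_smul (P.limEval n a k) r x)).trans
      (map_smul (D.quotMap h k) _ _)

theorem limEval_limMap {n : ℕ} {a b : ℤ} (h : a + 1 = b) (k : ℕ) (x : P.limData.obj n a)
    (w : P.obj n a) (hw : P.limEval n a k x = Submodule.Quotient.mk w) :
    P.limEval n b k (D.limMap h x) = Submodule.Quotient.mk (D.d h w) := by
  change D.quotMap h k (P.limEval n a k x) = _
  rw [hw]
  rfl

/-- The differential induced on the completion. -/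
def completion : P.completion.Differential where
  d h := D.limMap h
  d_d {n a b c} h h' x := by
    apply P.lim_ext
    intro k
    obtain ⟨w, hw⟩ := Submodule.Quotient.mk_surjective _ (P.limEval n a k x)
    refine (D.limEval_limMap h' k _ _ (D.limEval_limMap h k _ _ hw.symm)).trans ?_
    rw [D.d_d]
    exact (map_zero (P.limEval n c k)).symm
  leibniz {m n p} i e {a b c a' b' c'} h ha hb hc h₁ h₂ x y := by
    apply P.lim_ext
    intro k
    obtain ⟨v, hv⟩ := Submodule.Quotient.mk_surjective _ (P.limEval m a k x)
    obtain ⟨w, hw⟩ := Submodule.Quotient.mk_surjective _ (P.limEval n b k y)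
    have hc1 : ∀ {m n p : ℕ} (i : Fin m) (e : Graft i n p) {a b c : ℤ} (h : a + b = c)
        (x : P.limData.obj m a) (y : P.limData.obj n b) (v : P.obj m a) (w : P.obj n b)
        (_ : P.limEval m a k x = Submodule.Quotient.mk v)
        (_ : P.limEval n b k y = Submodule.Quotient.mk w),
        P.limEval p c k (P.limData.comp i e h x y) = Submodule.Quotient.mk (P.comp i e h v w) := by
      intro m n p i e a b c h x y v w hv hw
      change (P.toOpData.quot (P.filIdeal k)).comp i e h
        (P.limEval m a k x) (P.limEval n b k y) = _
      rw [hv, hw]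
      rfl
    refine (D.limEval_limMap hc k _ _ (hc1 i e h x y v w hv.symm hw.symm)).trans ?_
    rw [D.leibniz i e h ha hb hc h₁ h₂ v w]
    have e1 := hc1 i e h₁ (D.limMap ha x) y _ _ (D.limEval_limMap ha k x v hv.symm) hw.symm
    have e2 := hc1 i e h₂ x (D.limMap hb y) _ _ hv.symm (D.limEval_limMap hb k y w hw.symm)
    refine Eq.symm ((map_add (P.limEval p c' k) _ _).trans ?_)
    exact congrArg₂ (fun u v : P.obj p c' ⧸ P.fil p c' k => u + v) e1
      ((map_smul (P.limEval p c' k) _ _).trans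
        (congrArg (fun u : P.obj p c' ⧸ P.fil p c' k => (-1 : 𝕜) ^ a • u) e2))
  d_fil {n a b} h k x hx := by
    have hx' : P.limEval n a k x = Submodule.Quotient.mk 0 := hx
    have h1 := D.limEval_limMap h k x 0 hx'
    rw [(D.d h).map_zero] at h1
    exact h1

end Differential

section Twist

variable (P : FilteredOperad 𝕜)

/-- Left composition `x ↦ ν ∘₁ x` with an operation of arity one. -/
def lft {n : ℕ} {c a b : ℤ} (ν : P.obj 1 c) (h : c + a = b) : P.obj n a →ₗ[𝕜] P.obj n b :=
  P.comp 0 (std 0 n (add_comm 1 n)) h ν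

/-- The sum `∑ⱼ x ∘ⱼ ν` over all the inputs of `x`. -/
def ins {n : ℕ} {c a b : ℤ} (ν : P.obj 1 c) (h : a + c = b) : P.obj n a →ₗ[𝕜] P.obj n b :=
  ∑ j : Fin n, (P.comp j (std j 1 rfl) h).flip ν

theorem ins_apply {n : ℕ} {c a b : ℤ} (ν : P.obj 1 c) (h : a + c = b) (x : P.obj n a) :
    P.ins ν h x = ∑ j : Fin n, P.comp j (std j 1 rfl) h x ν := by
  simp [ins]

theorem lft_comp {m n p : ℕ} (i : Fin m) (e : Graft i n p) {a b c ab ca cab : ℤ}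
    (ν : P.obj 1 c) (x : P.obj m a) (y : P.obj n b) (h : a + b = ab) (h₁ : c + ab = cab)
    (h₂ : c + a = ca) (h₃ : ca + b = cab) :
    P.lft ν h₁ (P.comp i e h x y) = P.comp i e h₃ (P.lft ν h₂ x) y := by
  refine (P.isOperad.assoc_seq (std 0 m (add_comm 1 m)) e e (std 0 p (add_comm 1 p))
    ⟨?_, ?_, ?_, ?_⟩ h₂ h₃ h h₁ ν x y).symm
  · exact (std_unit_inner _ _).symm
  · intro u hu; exact absurd (Subsingleton.elim _ _) hu
  · intro u hu hu'
    exact (outer_congr e (std_unit_inner _ _) _ hu).trans (std_unit_inner _ _).symm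
  · intro u
    rw [std_unit_inner]

theorem comp_lft {m n p : ℕ} (i : Fin m) (e : Graft i n p) {a b c ac cb acb : ℤ}
    (ν : P.obj 1 c) (x : P.obj m a) (y : P.obj n b) (h : a + c = ac) (h₁ : ac + b = acb)
    (h₂ : c + b = cb) (h₃ : a + cb = acb) :
    P.comp i e h₁ (P.comp i (std i 1 rfl) h x ν) y = P.comp i e h₃ x (P.lft ν h₂ y) := by
  refine P.isOperad.assoc_seq (std i 1 rfl) e (std 0 n (add_comm 1 n)) e
    ⟨?_, ?_, ?_, ?_⟩ h h₁ h₂ h₃ x ν y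
  · exact (std_one_inner _ _ _).symm
  · intro u hu hu'
    exact outer_congr e (std_one_outer _ _ _ _) _ _
  · intro u hu; exact absurd (Subsingleton.elim _ _) hu
  · intro u
    rw [std_unit_inner]

theorem comp_inner {m n p : ℕ} (i : Fin m) (e : Graft i n p) {a b c ab bc abc : ℤ}
    (ν : P.obj 1 c) (x : P.obj m a) (y : P.obj n b) (j : Fin n) (h : a + b = ab)
    (h₁ : ab + c = abc) (h₂ : b + c = bc) (h₃ : a + bc = abc) :
    P.comp (inner e j) (std _ 1 rfl) h₁ (P.comp i e h x y) ν =
      P.comp i e h₃ x (P.comp j (std j 1 rfl) h₂ y ν) := by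
  refine P.isOperad.assoc_seq e (std _ 1 rfl) (std j 1 rfl) e
    ⟨rfl, ?_, ?_, ?_⟩ h h₁ h₂ h₃ x y ν
  · intro u hu hu'
    rw [std_one_outer]
  · intro u hu hu'
    rw [std_one_outer, std_one_outer]
  · intro u
    rw [std_one_inner, std_one_inner]

theorem comp_outer {m n p : ℕ} (i : Fin m) (e : Graft i n p) {a b c ab ac abc : ℤ}
    (ν : P.obj 1 c) (x : P.obj m a) (y : P.obj n b) (j : Fin m) (hj : j ≠ i) (h : a + b = ab)
    (h₁ : ab + c = abc) (h₂ : a + c = ac) (h₃ : ac + b = abc) :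
    P.comp (outer e j hj) (std _ 1 rfl) h₁ (P.comp i e h x y) ν =
      (-1 : 𝕜) ^ (b * c) • P.comp i e h₃ (P.comp j (std j 1 rfl) h₂ x ν) y := by
  refine P.isOperad.assoc_par e (std _ 1 rfl) (std j 1 rfl) e
    ⟨hj.symm, rfl, ?_, ?_, ?_, ?_⟩ h h₁ h₂ h₃ x y ν
  · rw [std_one_outer]
  · intro u hu hu' hv hv'
    rw [std_one_outer]
    exact outer_congr e (std_one_outer _ _ _ _).symm _ _
  · intro u hu
    rw [std_one_outer]
  · intro u hu
    rw [std_one_inner]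
    exact outer_congr e (std_one_inner _ _ _).symm _ _

theorem ins_comp {m n p : ℕ} (i : Fin m) (e : Graft i n p) {a b c ab ac bc cb abc : ℤ}
    (ν : P.obj 1 c) (x : P.obj m a) (y : P.obj n b) (h : a + b = ab)
    (h₁ : ab + c = abc) (h₂ : b + c = bc) (h₃ : a + bc = abc) (h₄ : a + c = ac)
    (h₅ : ac + b = abc) (h₆ : c + b = cb) (h₇ : a + cb = abc) :
    P.ins ν h₁ (P.comp i e h x y) =
      (-1 : 𝕜) ^ (b * c) • (P.comp i e h₅ (P.ins ν h₄ x) y - P.comp i e h₇ x (P.lft ν h₆ y)) +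
        P.comp i e h₃ x (P.ins ν h₂ y) := by
  have hA : P.ins ν h₁ (P.comp i e h x y) =
      (∑ u : {u : Fin m // u ≠ i}, (-1 : 𝕜) ^ (b * c) •
        P.comp i e h₅ (P.comp u.1 (std u.1 1 rfl) h₄ x ν) y) +
      ∑ j : Fin n, P.comp i e h₃ x (P.comp j (std j 1 rfl) h₂ y ν) := by
    rw [ins_apply, ← Equiv.sum_comp e, Fintype.sum_sum_type]
    congr 1
    · exact Finset.sum_congr rfl fun u _ => P.comp_outer i e ν x y u.1 u.2 h h₁ h₄ h₅
    · exact Finset.sum_congr rfl fun j _ => P.comp_inner i e ν x y j h h₁ h₂ h₃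
  have hB : P.comp i e h₅ (P.ins ν h₄ x) y =
      P.comp i e h₇ x (P.lft ν h₆ y) +
      ∑ u : {u : Fin m // u ≠ i}, P.comp i e h₅ (P.comp u.1 (std u.1 1 rfl) h₄ x ν) y := by
    rw [ins_apply, map_sum, LinearMap.sum_apply,
      ← Fintype.sum_subtype_add_sum_subtype (fun u : Fin m => u = i)]
    congr 1
    rw [← P.comp_lft i e ν x y h₄ h₅ h₆ h₇]
    convert Fintype.sum_eq_single
      (f := fun u : {u : Fin m // u = i} => P.comp i e h₅ (P.comp u.1 (std u.1 1 rfl) h₄ x ν) y)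
      ⟨i, rfl⟩ (fun u hu => absurd (Subtype.ext u.2) hu)
  rw [hA, hB, ← Finset.smul_sum, ins_apply, map_sum, add_sub_cancel_left]

theorem lft_lft {n : ℕ} {a b b' c : ℤ} (μ : P.obj 1 1) (h : 1 + a = b) (h' : 1 + b = b')
    (h₁ : 1 + 1 = c) (h₂ : c + a = b') (x : P.obj n a) :
    P.lft μ h' (P.lft μ h x) = P.lft (P.lft μ h₁ μ) h₂ x :=
  P.lft_comp 0 _ μ μ x h h' h₁ h₂

theorem lft_ins {n : ℕ} {a b b' : ℤ} (μ : P.obj 1 1) (h : a + 1 = b) (h' : 1 + b = b')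
    (h₁ : 1 + a = b) (h₂ : b + 1 = b') (x : P.obj n a) :
    P.lft μ h' (P.ins μ h x) = P.ins μ h₂ (P.lft μ h₁ x) := by
  rw [ins_apply, ins_apply, map_sum]
  exact Finset.sum_congr rfl fun j _ => P.lft_comp j _ μ x μ h h' h₁ h₂

theorem ins_ins [CharZero 𝕜] {n : ℕ} {a b b' c : ℤ} (μ : P.obj 1 1) (h : a + 1 = b)
    (h' : b + 1 = b') (h₁ : 1 + 1 = c) (h₂ : a + c = b') (x : P.obj n a) :
    P.ins μ h' (P.ins μ h x) = P.ins (P.lft μ h₁ μ) h₂ x := by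
  have h1 : P.ins μ h₁ μ = P.lft μ h₁ μ := by
    rw [ins_apply]
    exact Fintype.sum_unique _
  have h2 : P.ins μ h' (P.ins μ h x) = -P.ins μ h' (P.ins μ h x) +
      (2 : 𝕜) • P.ins (P.lft μ h₁ μ) h₂ x := by
    conv_lhs => rw [ins_apply P μ h x, map_sum]
    have h3 : ∀ j : Fin n, P.ins μ h' (P.comp j (std j 1 rfl) h x μ) =
        -P.comp j (std j 1 rfl) h' (P.ins μ h x) μ +
          (2 : 𝕜) • P.comp j (std j 1 rfl) h₂ x (P.lft μ h₁ μ) := by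
      intro j
      rw [P.ins_comp j _ μ x μ h h' h₁ h₂ h h' h₁ h₂, h1]
      simp
      module
    rw [Finset.sum_congr rfl fun j _ => h3 j, Finset.sum_add_distrib, Finset.sum_neg_distrib,
      ← Finset.smul_sum, ← ins_apply, ← ins_apply]
  have h4 : (2 : 𝕜) • P.ins μ h' (P.ins μ h x) = (2 : 𝕜) • P.ins (P.lft μ h₁ μ) h₂ x := by
    rw [two_smul]
    nth_rewrite 1 [h2]
    abel
  exact smul_right_injective _ (two_ne_zero' 𝕜) h4

variable {P}

/-- Maurer-Cartan elements: `d μ + μ ∘₁ μ = 0`, in arity `1` and degree `1`. -/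
structure Differential.IsMC (D : P.Differential) (μ : P.obj 1 1) : Prop where
  eq : D.d (b := 2) rfl μ + P.circ 0 μ μ = 0

/-- The operator `ad_μ(x) = μ ∘₁ x - (-1)^{|x|} ∑ⱼ x ∘ⱼ μ`. -/
def ad (μ : P.obj 1 1) {n : ℕ} {a b : ℤ} (h : a + 1 = b) : P.obj n a →ₗ[𝕜] P.obj n b :=
  P.lft μ ((add_comm 1 a).trans h) - (-1 : 𝕜) ^ a • P.ins μ h

theorem neg_one_zpow_succ (a : ℤ) : (-1 : 𝕜) ^ (a + 1) = -(-1 : 𝕜) ^ a := by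
  rw [zpow_add₀ (by simp), zpow_one]; ring

theorem neg_one_zpow_sq (a : ℤ) : (-1 : 𝕜) ^ a * (-1 : 𝕜) ^ a = 1 := by
  rw [← mul_zpow]; simp

theorem ad_leibniz (μ : P.obj 1 1) {m n p : ℕ} (i : Fin m) (e : Graft i n p)
    {a b c a' b' c' : ℤ} (h : a + b = c)
    (ha : a + 1 = a') (hb : b + 1 = b') (hc : c + 1 = c') (h₁ : a' + b = c') (h₂ : a + b' = c')
    (x : P.obj m a) (y : P.obj n b) :
    ad μ hc (P.comp i e h x y) =
      P.comp i e h₁ (ad μ ha x) y + (-1 : 𝕜) ^ a • P.comp i e h₂ x (ad μ hb y) := by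
  have e1 := P.lft_comp i e μ x y h ((add_comm 1 c).trans hc) ((add_comm 1 a).trans ha) h₁
  have e2 := P.ins_comp i e μ x y h hc hb h₂ ha h₁ ((add_comm 1 b).trans hb) h₂
  have e3 : (-1 : 𝕜) ^ c = (-1 : 𝕜) ^ a * (-1 : 𝕜) ^ b := by
    rw [← h, zpow_add₀ (by simp)]
  have e4 := neg_one_zpow_sq (𝕜 := 𝕜) b
  simp only [ad, LinearMap.sub_apply, LinearMap.smul_apply, map_sub, map_smul, e1, e2, e3, mul_one,
    smul_add, smul_sub, smul_smul, mul_assoc, e4]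
  module

/-- The twisted differential `d + ad_μ` for a Maurer-Cartan element `μ`. -/
def Differential.twist [CharZero 𝕜] (D : P.Differential) (μ : P.obj 1 1) (hμ : D.IsMC μ) :
    P.Differential where
  d h := D.d h + ad μ h
  d_d {n a b c} h h' x := by
    have hc : a + 2 = c := by omega
    have hmc : P.lft μ (rfl : (1 : ℤ) + 1 = 2) μ = - D.d (b := 2) rfl μ :=
      eq_neg_of_add_eq_zero_right hμ.eq
    have e1 := P.lft_lft μ ((add_comm 1 a).trans h) ((add_comm 1 b).trans h')
      (rfl : (1 : ℤ) + 1 = 2) ((add_comm 2 a).trans hc) x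
    have e2 := P.lft_ins μ h ((add_comm 1 b).trans h') ((add_comm 1 a).trans h) h' x
    have e3 := P.ins_ins μ h h' (rfl : (1 : ℤ) + 1 = 2) hc x
    have e4 : D.d h' (P.lft μ ((add_comm 1 a).trans h) x) =
        P.lft (D.d (b := 2) rfl μ) ((add_comm 2 a).trans hc) x -
          P.lft μ ((add_comm 1 b).trans h') (D.d h x) := by
      have := D.leibniz 0 (std 0 n (add_comm 1 n)) ((add_comm 1 a).trans h)
        (rfl : (1 : ℤ) + 1 = 2) h h' ((add_comm 2 a).trans hc) ((add_comm 1 b).trans h') μ x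
      simp only [lft, this]
      simp [sub_eq_add_neg]
    have e5 : D.d h' (P.ins μ h x) =
        P.ins μ h' (D.d h x) + (-1 : 𝕜) ^ a • P.ins (D.d (b := 2) rfl μ) hc x := by
      simp only [ins_apply, map_sum, Finset.smul_sum]
      rw [← Finset.sum_add_distrib]
      exact Finset.sum_congr rfl fun j _ => D.leibniz j (std j 1 rfl) h h
        (rfl : (1 : ℤ) + 1 = 2) h' h' hc x μ
    rw [hmc] at e1 e3
    have e6 := neg_one_zpow_sq (𝕜 := 𝕜) a
    have e7 : (-1 : 𝕜) ^ b = -(-1 : 𝕜) ^ a := by rw [← h, neg_one_zpow_succ]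
    have e8 : P.lft (-D.d (b := 2) rfl μ) ((add_comm 2 a).trans hc) x =
        -P.lft (D.d (b := 2) rfl μ) ((add_comm 2 a).trans hc) x := by simp [lft]
    have e9 : P.ins (-D.d (b := 2) rfl μ) hc x = -P.ins (D.d (b := 2) rfl μ) hc x := by
      simp [ins_apply]
    rw [e8] at e1
    rw [e9] at e3
    simp only [ad, LinearMap.add_apply, LinearMap.sub_apply, LinearMap.smul_apply, map_add, map_sub,
      map_smul, D.d_d, e1, e2, e3, e4, e5, e7, smul_add, smul_sub, smul_smul, mul_neg, e6]
    module
  leibniz := by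
    intro m n p i e a b c a' b' c' h ha hb hc h₁ h₂ x y
    simp only [LinearMap.add_apply, map_add, D.leibniz i e h ha hb hc h₁ h₂ x y,
      ad_leibniz μ i e h ha hb hc h₁ h₂ x y]
    module
  d_fil h k x hx := by
    refine Submodule.add_mem _ (D.d_fil h k x hx) (Submodule.sub_mem _ ?_ (Submodule.smul_mem _ _ ?_))
    · exact P.comp_fil_right _ _ _ _ _ hx
    · rw [ins_apply]
      exact Submodule.sum_mem _ fun j _ => P.comp_fil_left _ _ _ _ _ hx

end Twist

end FilteredOperad

/-- Formal composites of generators; `E n d` is the set of generators of arity `n` and degree `d`. -/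
inductive Tree (E : ℕ → ℤ → Type) : ℕ → ℤ → Type
  | gen {n : ℕ} {d : ℤ} (g : E n d) : Tree E n d
  | one : Tree E 1 0
  | comp {m n p : ℕ} (i : Fin m) (e : Graft i n p) {a b c : ℤ} (h : a + b = c)
      (x : Tree E m a) (y : Tree E n b) : Tree E p c

/-- Renaming of generators. -/
def Tree.map {E E' : ℕ → ℤ → Type} (f : ∀ {n : ℕ} {d : ℤ}, E n d → E' n d) :
    ∀ {n : ℕ} {d : ℤ}, Tree E n d → Tree E' n d
  | _, _, .gen g => .gen (f g)
  | _, _, .one => .one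
  | _, _, .comp i e h x y => .comp i e h (x.map f) (y.map f)

section Presentations

variable (𝕜 : Type u) [Field 𝕜]

/-- Linear combinations of formal composites (before the operad axioms are imposed). -/
def freeData (E : ℕ → ℤ → Type) : OpData 𝕜 where
  obj n d := Tree E n d →₀ 𝕜
  one := Finsupp.single .one 1
  comp i e _ _ _ h := Finsupp.linearCombination 𝕜
    fun x => Finsupp.lmapDomain 𝕜 𝕜 fun y => Tree.comp i e h x y

/-- A formal composite, as an element of `freeData`. -/
def freeTree {E : ℕ → ℤ → Type} {n : ℕ} {d : ℤ} (t : Tree E n d) : (freeData 𝕜 E).obj n d :=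
  Finsupp.single t 1

theorem freeData_hom_ext {E : ℕ → ℤ → Type} {n : ℕ} {d : ℤ} {M : Type u} [AddCommMonoid M]
    [Module 𝕜 M] {f g : (freeData 𝕜 E).obj n d →ₗ[𝕜] M}
    (h : ∀ t : Tree E n d, f (freeTree 𝕜 t) = g (freeTree 𝕜 t)) : f = g :=
  Finsupp.lhom_ext' fun t => LinearMap.ext_ring (h t)

theorem freeData_comp_tree {E : ℕ → ℤ → Type} {m n p : ℕ} (i : Fin m) (e : Graft i n p)
    {a b c : ℤ} (h : a + b = c) (x : Tree E m a) (y : Tree E n b) :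
    (freeData 𝕜 E).comp i e h (freeTree 𝕜 x) (freeTree 𝕜 y) = freeTree 𝕜 (.comp i e h x y) := by
  change (Finsupp.linearCombination 𝕜
    (fun x => Finsupp.lmapDomain 𝕜 𝕜 fun y => Tree.comp i e h x y) (Finsupp.single x 1))
      (Finsupp.single y 1) = _
  rw [Finsupp.linearCombination_single, one_smul]
  exact Finsupp.mapDomain_single

/-- A presentation of a filtered operad: homogeneous generators, each with a weight (the stage of
the filtration in which it is placed), and homogeneous relations. -/
structure Presentation where
  Gen : ℕ → ℤ → Type
  weight : ∀ {n : ℕ} {d : ℤ}, Gen n d → ℕ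
  rel : ∀ n d, Set ((freeData 𝕜 Gen).obj n d)

end Presentations

namespace Presentation

variable {𝕜 : Type u} [Field 𝕜] (R : Presentation 𝕜)

abbrev free : OpData 𝕜 := freeData 𝕜 R.Gen

/-- The smallest ideal containing the relations of the presentation and the operad axioms. -/
inductive Ker : ∀ {n : ℕ} {d : ℤ}, R.free.obj n d → Prop
  | rel {n : ℕ} {d : ℤ} (x : R.free.obj n d) : x ∈ R.rel n d → Ker x
  | zero {n : ℕ} {d : ℤ} : Ker (0 : R.free.obj n d)
  | add {n : ℕ} {d : ℤ} (x y : R.free.obj n d) : Ker x → Ker y → Ker (x + y)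
  | smul {n : ℕ} {d : ℤ} (c : 𝕜) (x : R.free.obj n d) : Ker x → Ker (c • x)
  | comp_left {m n p : ℕ} (i : Fin m) (e : Graft i n p) {a b c : ℤ} (h : a + b = c)
      (x : R.free.obj m a) (y : R.free.obj n b) : Ker x → Ker (R.free.comp i e h x y)
  | comp_right {m n p : ℕ} (i : Fin m) (e : Graft i n p) {a b c : ℤ} (h : a + b = c)
      (x : R.free.obj m a) (y : R.free.obj n b) : Ker y → Ker (R.free.comp i e h x y)
  | one_comp {n : ℕ} {d : ℤ} (x : R.free.obj n d) :
      Ker (R.free.comp 0 (std 0 n (add_comm 1 n)) (zero_add d) R.free.one x - x)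
  | comp_one {m : ℕ} {d : ℤ} (i : Fin m) (x : R.free.obj m d) :
      Ker (R.free.comp i (std i 1 rfl) (add_zero d) x R.free.one - x)
  | assoc_seq {m n q p s r : ℕ} {i : Fin m} {j : Fin n} {k : Fin p}
      (e₁ : Graft i n p) (e₂ : Graft k q r) (f₁ : Graft j q s) (f₂ : Graft i s r)
      (hc : SeqCompat e₁ e₂ f₁ f₂) {a b c ab bc abc : ℤ} (h₁ : a + b = ab) (h₂ : ab + c = abc)
      (h₃ : b + c = bc) (h₄ : a + bc = abc) (x : R.free.obj m a) (y : R.free.obj n b)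
      (z : R.free.obj q c) :
      Ker (R.free.comp k e₂ h₂ (R.free.comp i e₁ h₁ x y) z -
        R.free.comp i f₂ h₄ x (R.free.comp j f₁ h₃ y z))
  | assoc_par {m n q p s r : ℕ} {i i' : Fin m} {k : Fin p} {k' : Fin s}
      (e₁ : Graft i n p) (e₂ : Graft k q r) (f₁ : Graft i' q s) (f₂ : Graft k' n r)
      (hc : ParCompat e₁ e₂ f₁ f₂) {a b c ab ac abc : ℤ} (h₁ : a + b = ab) (h₂ : ab + c = abc)
      (h₃ : a + c = ac) (h₄ : ac + b = abc) (x : R.free.obj m a) (y : R.free.obj n b)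
      (z : R.free.obj q c) :
      Ker (R.free.comp k e₂ h₂ (R.free.comp i e₁ h₁ x y) z -
        (-1 : 𝕜) ^ (b * c) • R.free.comp k' f₂ h₄ (R.free.comp i' f₁ h₃ x z) y)

/-- The ideal `Ker`. -/
def ker : R.free.Ideal where
  carrier n d :=
    { carrier := {x | R.Ker x}
      add_mem' := fun hx hy => .add _ _ hx hy
      zero_mem' := .zero
      smul_mem' := fun c x hx => .smul c x hx }
  comp_left i e _ _ _ h x y hx := .comp_left i e h x y hx
  comp_right i e _ _ _ h x y hy := .comp_right i e h x y hy

/-- The operad with the given generators and relations. -/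
def data : OpData 𝕜 := R.free.quot R.ker

/-- The class of a combination of formal composites. -/
def cls {n : ℕ} {d : ℤ} (x : R.free.obj n d) : R.data.obj n d :=
  Submodule.Quotient.mk (p := R.ker.carrier n d) x

theorem cls_surj {n : ℕ} {d : ℤ} (x : R.data.obj n d) : ∃ y, R.cls y = x :=
  Submodule.Quotient.mk_surjective (R.ker.carrier n d) x

theorem cls_eq {n : ℕ} {d : ℤ} {x y : R.free.obj n d} (h : R.Ker (x - y)) : R.cls x = R.cls y :=
  (Submodule.Quotient.eq (R.ker.carrier n d)).2 h

theorem data_isOperad : R.data.IsOperad where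
  one_comp x := by
    obtain ⟨x, rfl⟩ := R.cls_surj x
    exact R.cls_eq (.one_comp x)
  comp_one i x := by
    obtain ⟨x, rfl⟩ := R.cls_surj x
    exact R.cls_eq (.comp_one i x)
  assoc_seq e₁ e₂ f₁ f₂ hc a b c ab bc abc h₁ h₂ h₃ h₄ x y z := by
    obtain ⟨x, rfl⟩ := R.cls_surj x
    obtain ⟨y, rfl⟩ := R.cls_surj y
    obtain ⟨z, rfl⟩ := R.cls_surj z
    exact R.cls_eq (.assoc_seq e₁ e₂ f₁ f₂ hc h₁ h₂ h₃ h₄ x y z)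
  assoc_par e₁ e₂ f₁ f₂ hc a b c ab ac abc h₁ h₂ h₃ h₄ x y z := by
    obtain ⟨x, rfl⟩ := R.cls_surj x
    obtain ⟨y, rfl⟩ := R.cls_surj y
    obtain ⟨z, rfl⟩ := R.cls_surj z
    exact R.cls_eq (.assoc_par e₁ e₂ f₁ f₂ hc h₁ h₂ h₃ h₄ x y z)

/-- The class of a generator. -/
def dataGen {n : ℕ} {d : ℤ} (g : R.Gen n d) : R.data.obj n d := R.cls (freeTree 𝕜 (.gen g))

/-- The smallest operadic filtration for which each generator lies in the stage given by its
weight. -/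
inductive FilMem : ∀ {n : ℕ} {d : ℤ}, ℕ → R.data.obj n d → Prop
  | top {n : ℕ} {d : ℤ} (x : R.data.obj n d) : FilMem 0 x
  | anti {n : ℕ} {d : ℤ} (k : ℕ) (x : R.data.obj n d) : FilMem (k + 1) x → FilMem k x
  | zero {n : ℕ} {d : ℤ} (k : ℕ) : FilMem k (0 : R.data.obj n d)
  | add {n : ℕ} {d : ℤ} (k : ℕ) (x y : R.data.obj n d) : FilMem k x → FilMem k y →
      FilMem k (x + y)
  | smul {n : ℕ} {d : ℤ} (k : ℕ) (c : 𝕜) (x : R.data.obj n d) : FilMem k x → FilMem k (c • x)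
  | gen {n : ℕ} {d : ℤ} (g : R.Gen n d) : FilMem (R.weight g) (R.dataGen g)
  | comp {m n p : ℕ} (i : Fin m) (e : Graft i n p) {a b c : ℤ} (h : a + b = c) (s t : ℕ)
      (x : R.data.obj m a) (y : R.data.obj n b) : FilMem s x → FilMem t y →
      FilMem (s + t) (R.data.comp i e h x y)

/-- The filtered operad with the given (weighted) generators and relations. -/
def operad : FilteredOperad 𝕜 where
  toOpData := R.data
  isOperad := R.data_isOperad
  fil n d k :=
    { carrier := {x | R.FilMem k x}
      add_mem' := fun hx hy => .add k _ _ hx hy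
      zero_mem' := .zero k
      smul_mem' := fun c x hx => .smul k c x hx }
  fil_zero n d := eq_top_iff.2 fun x _ => .top x
  fil_anti n d := antitone_nat_of_succ_le fun k x hx => .anti k x hx
  comp_fil i e _ _ _ h s t x y hx hy := .comp i e h s t x y hx hy

/-- A generator, as an operation of the filtered operad. -/
def gen {n : ℕ} {d : ℤ} (g : R.Gen n d) : R.operad.obj n d := R.dataGen g

section Derivation

variable (δ : ∀ {n : ℕ} {d : ℤ}, R.Gen n d → R.data.obj n (d + 1))

/-- The derivation determined by the images `δ g` of the generators, on formal composites. -/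
def derTree : ∀ {n : ℕ} {d : ℤ}, Tree R.Gen n d → R.data.obj n (d + 1)
  | _, _, .gen g => δ g
  | _, _, .one => 0
  | _, _, .comp i e (a := a) (b := b) (c := c) h x y =>
      R.data.comp i e (show a + 1 + b = c + 1 by omega) (derTree x) (R.cls (freeTree 𝕜 y)) +
        (-1 : 𝕜) ^ a • R.data.comp i e (show a + (b + 1) = c + 1 by omega)
          (R.cls (freeTree 𝕜 x)) (derTree y)

/-- The linear extension of `derTree`. -/
def derFree {n : ℕ} {d : ℤ} : R.free.obj n d →ₗ[𝕜] R.data.obj n (d + 1) :=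
  Finsupp.linearCombination 𝕜 fun t => R.derTree δ t

/-- The linear map `cls`. -/
def clsMap (n : ℕ) (d : ℤ) : R.free.obj n d →ₗ[𝕜] R.data.obj n d := (R.ker.carrier n d).mkQ

theorem cls_comp {m n p : ℕ} (i : Fin m) (e : Graft i n p) {a b c : ℤ} (h : a + b = c)
    (x : R.free.obj m a) (y : R.free.obj n b) :
    R.data.comp i e h (R.cls x) (R.cls y) = R.cls (R.free.comp i e h x y) := rfl

theorem derFree_tree {n : ℕ} {d : ℤ} (t : Tree R.Gen n d) :
    R.derFree δ (freeTree 𝕜 t) = R.derTree δ t :=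
  (Finsupp.linearCombination_single 𝕜 1 t).trans (one_smul _ _)

theorem derFree_comp {m n p : ℕ} (i : Fin m) (e : Graft i n p) {a b c : ℤ} (h : a + b = c)
    (h₁ : a + 1 + b = c + 1) (h₂ : a + (b + 1) = c + 1) (x : R.free.obj m a) (y : R.free.obj n b) :
    R.derFree δ (R.free.comp i e h x y) =
      R.data.comp i e h₁ (R.derFree δ x) (R.cls y) +
        (-1 : 𝕜) ^ a • R.data.comp i e h₂ (R.cls x) (R.derFree δ y) := by
  have key : (R.free.comp i e h).compr₂ (R.derFree δ) =
      (R.data.comp i e h₁).compl₁₂ (R.derFree δ) (R.clsMap n b) +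
        (-1 : 𝕜) ^ a • (R.data.comp i e h₂).compl₁₂ (R.clsMap m a) (R.derFree δ) := by
    refine freeData_hom_ext 𝕜 fun s => freeData_hom_ext 𝕜 fun t => ?_
    change R.derFree δ (R.free.comp i e h (freeTree 𝕜 s) (freeTree 𝕜 t)) =
      R.data.comp i e h₁ (R.derFree δ (freeTree 𝕜 s)) (R.cls (freeTree 𝕜 t)) +
        (-1 : 𝕜) ^ a • R.data.comp i e h₂ (R.cls (freeTree 𝕜 s)) (R.derFree δ (freeTree 𝕜 t))
    rw [freeData_comp_tree, derFree_tree, derFree_tree, derFree_tree, derTree]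
  exact LinearMap.congr_fun₂ key x y

theorem derFree_one : R.derFree δ R.free.one = 0 := by
  refine (R.derFree_tree δ .one).trans ?_
  rw [derTree]

theorem derFree_ker (hrel : ∀ {n : ℕ} {d : ℤ} (x : R.free.obj n d), x ∈ R.rel n d →
    R.derFree δ x = 0) {n : ℕ} {d : ℤ} (x : R.free.obj n d) (hx : R.Ker x) :
    R.derFree δ x = 0 := by
  have hcl : ∀ {n : ℕ} {d : ℤ} (x : R.free.obj n d), R.Ker x → R.cls x = 0 := fun x hx =>
    (Submodule.Quotient.mk_eq_zero _).2 hx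
  induction hx with
  | rel x h => exact hrel x h
  | zero => exact map_zero _
  | add x y _ _ hx hy => rw [map_add, hx, hy, add_zero]
  | smul c x _ hx => rw [map_smul, hx, smul_zero]
  | comp_left i e h x y hx' hx =>
    rw [R.derFree_comp δ i e h (by omega) (by omega), hx, hcl x hx']
    simp
  | comp_right i e h x y hx' hx =>
    rw [R.derFree_comp δ i e h (by omega) (by omega), hx, hcl y hx']
    simp
  | @one_comp n d x =>
    rw [map_sub, R.derFree_comp δ 0 _ _ (by omega) (zero_add (d + 1)), derFree_one]
    have := R.data_isOperad.one_comp (R.derFree δ x)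
    have h1 : R.data.one = R.cls R.free.one := rfl
    rw [h1] at this
    rw [this]
    simp
  | @comp_one m d i x =>
    rw [map_sub, R.derFree_comp δ i _ _ (add_zero (d + 1)) (by omega), derFree_one]
    have := R.data_isOperad.comp_one i (R.derFree δ x)
    have h1 : R.data.one = R.cls R.free.one := rfl
    rw [h1] at this
    rw [this]
    simp
  | @assoc_seq m n q p s r i j k e₁ e₂ f₁ f₂ hc a b c ab bc abc h₁ h₂ h₃ h₄ x y z =>
    rw [map_sub, R.derFree_comp δ k e₂ h₂ (by omega) (by omega),
      R.derFree_comp δ i e₁ h₁ (by omega) (by omega),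
      R.derFree_comp δ i f₂ h₄ (by omega) (by omega),
      R.derFree_comp δ j f₁ h₃ (by omega) (by omega), ← cls_comp, ← cls_comp]
    simp only [map_add, map_smul, LinearMap.add_apply, LinearMap.smul_apply]
    rw [R.data_isOperad.assoc_seq e₁ e₂ f₁ f₂ hc (ab := ab + 1) (bc := bc) (by omega) (by omega) h₃
        (by omega) (R.derFree δ x) (R.cls y) (R.cls z),
      R.data_isOperad.assoc_seq e₁ e₂ f₁ f₂ hc (ab := ab + 1) (bc := bc + 1) (by omega) (by omega)
        (by omega) (by omega) (R.cls x) (R.derFree δ y) (R.cls z),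
      R.data_isOperad.assoc_seq e₁ e₂ f₁ f₂ hc (bc := bc + 1) h₁ (by omega) (by omega) (by omega)
        (R.cls x) (R.cls y) (R.derFree δ z),
      show (-1 : 𝕜) ^ ab = (-1 : 𝕜) ^ a * (-1 : 𝕜) ^ b by rw [← h₁, zpow_add₀ (by simp)]]
    module
  | @assoc_par m n q p s r i i' k k' e₁ e₂ f₁ f₂ hc a b c ab ac abc h₁ h₂ h₃ h₄ x y z =>
    rw [map_sub, map_smul, R.derFree_comp δ k e₂ h₂ (by omega) (by omega),
      R.derFree_comp δ i e₁ h₁ (by omega) (by omega),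
      R.derFree_comp δ k' f₂ h₄ (by omega) (by omega),
      R.derFree_comp δ i' f₁ h₃ (by omega) (by omega), ← cls_comp, ← cls_comp]
    simp only [map_add, map_smul, LinearMap.add_apply, LinearMap.smul_apply]
    rw [R.data_isOperad.assoc_par e₁ e₂ f₁ f₂ hc (ab := ab + 1) (ac := ac + 1) (by omega) (by omega) (by omega) (by omega)
        (R.derFree δ x) (R.cls y) (R.cls z),
      R.data_isOperad.assoc_par e₁ e₂ f₁ f₂ hc (ab := ab + 1) (by omega) (by omega) h₃ (by omega)
        (R.cls x) (R.derFree δ y) (R.cls z),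
      R.data_isOperad.assoc_par e₁ e₂ f₁ f₂ hc (ac := ac + 1) h₁ (by omega) (by omega) (by omega)
        (R.cls x) (R.cls y) (R.derFree δ z),
      show (-1 : 𝕜) ^ ab = (-1 : 𝕜) ^ a * (-1 : 𝕜) ^ b by rw [← h₁, zpow_add₀ (by simp)],
      show (-1 : 𝕜) ^ ac = (-1 : 𝕜) ^ a * (-1 : 𝕜) ^ c by rw [← h₃, zpow_add₀ (by simp)],
      show (-1 : 𝕜) ^ ((b + 1) * c) = (-1 : 𝕜) ^ (b * c) * (-1 : 𝕜) ^ c by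
        rw [← zpow_add₀ (by simp)]; congr 1; ring,
      show (-1 : 𝕜) ^ (b * (c + 1)) = (-1 : 𝕜) ^ (b * c) * (-1 : 𝕜) ^ b by
        rw [← zpow_add₀ (by simp)]; congr 1; ring]
    have e4 := FilteredOperad.neg_one_zpow_sq (𝕜 := 𝕜) b
    simp only [smul_add, smul_smul, mul_assoc]
    rw [show (-1 : 𝕜) ^ a * ((-1 : 𝕜) ^ b * ((-1 : 𝕜) ^ (b * c) * (-1 : 𝕜) ^ b)) =
      (-1 : 𝕜) ^ (b * c) * (-1 : 𝕜) ^ a by linear_combination ((-1 : 𝕜) ^ (b * c) * (-1 : 𝕜) ^ a) * e4]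
    module

variable (hrel : ∀ {n : ℕ} {d : ℤ} (x : R.free.obj n d), x ∈ R.rel n d → R.derFree δ x = 0)

/-- The derivation of the presented operad with prescribed values on the generators, provided that
it is compatible with the relations. -/
def der (n : ℕ) (d : ℤ) : R.data.obj n d →ₗ[𝕜] R.data.obj n (d + 1) :=
  (R.ker.carrier n d).liftQ (R.derFree δ) fun x hx => R.derFree_ker δ hrel x hx

theorem der_cls {n : ℕ} {d : ℤ} (x : R.free.obj n d) :
    R.der δ hrel n d (R.cls x) = R.derFree δ x := rfl

theorem der_comp {m n p : ℕ} (i : Fin m) (e : Graft i n p) {a b c : ℤ} (h : a + b = c)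
    (h₁ : a + 1 + b = c + 1) (h₂ : a + (b + 1) = c + 1) (x : R.data.obj m a) (y : R.data.obj n b) :
    R.der δ hrel p c (R.data.comp i e h x y) =
      R.data.comp i e h₁ (R.der δ hrel m a x) y +
        (-1 : 𝕜) ^ a • R.data.comp i e h₂ x (R.der δ hrel n b y) := by
  obtain ⟨x, rfl⟩ := R.cls_surj x
  obtain ⟨y, rfl⟩ := R.cls_surj y
  exact R.derFree_comp δ i e h h₁ h₂ x y

theorem der_der (hdd : ∀ {n : ℕ} {d : ℤ} (g : R.Gen n d), R.der δ hrel n (d + 1) (δ g) = 0)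
    {n : ℕ} {d : ℤ} (x : R.data.obj n d) : R.der δ hrel n (d + 1) (R.der δ hrel n d x) = 0 := by
  have key : ∀ {n : ℕ} {d : ℤ} (t : Tree R.Gen n d),
      R.der δ hrel n (d + 1) (R.derTree δ t) = 0 := by
    intro n d t
    induction t with
    | gen g => rw [derTree]; exact hdd g
    | one => rw [derTree]; exact map_zero _
    | @comp m n p i e a b c h x y hx hy =>
      have ex : R.der δ hrel m a (R.cls (freeTree 𝕜 x)) = R.derTree δ x := by
        rw [der_cls, derFree_tree]
      have ey : R.der δ hrel n b (R.cls (freeTree 𝕜 y)) = R.derTree δ y := by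
        rw [der_cls, derFree_tree]
      rw [derTree, map_add, map_smul, R.der_comp δ hrel i e _ (by omega) (by omega),
        R.der_comp δ hrel i e _ (by omega) (by omega), hx, hy, ex, ey,
        FilteredOperad.neg_one_zpow_succ]
      simp
  obtain ⟨x, rfl⟩ := R.cls_surj x
  rw [der_cls]
  have : (R.der δ hrel n (d + 1)) ∘ₗ (R.derFree δ (n := n) (d := d)) = 0 := by
    refine freeData_hom_ext 𝕜 fun t => ?_
    rw [LinearMap.comp_apply, derFree_tree, key, LinearMap.zero_apply]
  exact LinearMap.congr_fun this x

theorem der_fil (hfil : ∀ {n : ℕ} {d : ℤ} (g : R.Gen n d), R.FilMem (R.weight g) (δ g))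
    {n : ℕ} {d : ℤ} (k : ℕ) (x : R.data.obj n d) (hx : R.FilMem k x) :
    R.FilMem k (R.der δ hrel n d x) := by
  induction hx with
  | top x => exact .top _
  | anti k x _ h => exact .anti _ _ h
  | zero k => rw [map_zero]; exact .zero k
  | add k x y _ _ hx hy => rw [map_add]; exact .add _ _ _ hx hy
  | smul k c x _ hx => rw [map_smul]; exact .smul _ _ _ hx
  | gen g =>
    have : R.der δ hrel _ _ (R.dataGen g) = δ g := by
      refine (R.derFree_tree δ (.gen g)).trans ?_
      rw [derTree]
    rw [this]; exact hfil g
  | @comp m n p i e a b c h s t x y hx' hy' hx hy =>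
    rw [R.der_comp δ hrel i e h (by omega) (by omega)]
    exact .add _ _ _ (.comp _ _ _ _ _ _ _ hx hy') (.smul _ _ _ (.comp _ _ _ _ _ _ _ hx' hy))

/-- The differential of the presented operad with prescribed values on the generators. -/
def differential (hdd : ∀ {n : ℕ} {d : ℤ} (g : R.Gen n d), R.der δ hrel n (d + 1) (δ g) = 0)
    (hfil : ∀ {n : ℕ} {d : ℤ} (g : R.Gen n d), R.FilMem (R.weight g) (δ g)) :
    R.operad.Differential where
  d {n a b} h := h ▸ R.der δ hrel n a
  d_d {n a b c} h h' x := by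
    subst h; subst h'
    exact R.der_der δ hrel hdd x
  leibniz i e a b c a' b' c' h ha hb hc h₁ h₂ x y := by
    subst ha; subst hb; subst hc
    exact R.der_comp δ hrel i e h h₁ h₂ x y
  d_fil h k x hx := by
    subst h
    exact R.der_fil δ hrel hfil k x hx

end Derivation

end Presentation

section Jacobi

variable {𝕜 : Type u} [Field 𝕜] (P : FilteredOperad 𝕜)

theorem FilteredOperad.act_comp {m n p : ℕ} (σ : Equiv.Perm (Fin p)) (i : Fin m) (e : Graft i n p)
    {a b c : ℤ} (h : a + b = c) (x : P.obj m a) (y : P.obj n b) :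
    P.act σ (P.comp i e h x y) = P.comp i (e.trans σ) h x y := by
  have := P.isOperad.assoc_seq (std 0 m (add_comm 1 m)) (e.trans σ) e
    ((std (0 : Fin 1) p (add_comm 1 p)).trans σ) ⟨?_, ?_, ?_, ?_⟩ (zero_add a) h h (zero_add c)
    P.one x y
  · rw [P.isOperad.one_comp] at this
    exact this.symm
  · exact (std_unit_inner _ _).symm
  · intro u hu; exact absurd (Subsingleton.elim _ _) hu
  · intro u hu hu'
    have h1 := outer_congr e (std_unit_inner (add_comm 1 m) u) hu' hu
    have h2 := std_unit_inner (add_comm 1 p) (outer e u hu)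
    exact (congrArg σ h1).trans (congrArg σ h2).symm
  · intro u
    have h2 := std_unit_inner (add_comm 1 p) (inner e u)
    exact (congrArg σ h2).symm

theorem circ_one_eq (lam : P.obj 2 1) (α : P.obj 0 0) (hs : P.act (Equiv.swap 0 1) lam = lam) :
    P.circ (c := 1) (p := 1) 1 lam α = P.circ (c := 1) (p := 1) 0 lam α := by
  conv_lhs => rw [← hs]
  have := P.isOperad.assoc_seq ((std (0 : Fin 1) 2 (add_comm 1 2)).trans (Equiv.swap 0 1))
    (std (1 : Fin 2) 0 (p := 1) rfl) (std (0 : Fin 2) 0 (p := 1) rfl) (std (0 : Fin 1) 1 rfl)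
    ⟨by decide, by decide, by decide, by decide⟩ (zero_add 1) (add_zero 1) (add_zero 1)
    (zero_add 1) P.one lam α
  refine this.trans (P.isOperad.one_comp _)

theorem jacobi_alpha (lam : P.obj 2 1) (α : P.obj 0 0)
    (hs : P.act (Equiv.swap 0 1) lam = lam)
    (hj : P.circ 0 lam lam + P.act (finRotate 3) (P.circ 0 lam lam) +
      P.act (finRotate 3 ^ 2) (P.circ (c := 2) (p := 3) 0 lam lam) = 0) :
    P.circ (c := 2) (p := 1) 0 lam (P.circ (c := 1) (p := 0) 0
        (P.circ (c := 1) (p := 1) 0 lam α) α) +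
      (2 : 𝕜) • P.circ (c := 2) (p := 1) 0 (P.circ (c := 1) (p := 1) 0 lam α)
        (P.circ (c := 1) (p := 1) 0 lam α) = 0 := by
  have hs' := circ_one_eq P lam α hs
  have hsum := congrArg (fun z => P.circ (c := 2) (p := 1) 0 (P.circ (c := 2) (p := 2) 0 z α) α) hj
  have e0 : P.circ (c := 2) (p := 1) 0 (P.circ (c := 2) (p := 2) 0
      (P.circ (c := 2) (p := 3) 0 lam lam) α) α = P.circ (c := 2) (p := 1) 0 lam
        (P.circ (c := 1) (p := 0) 0 (P.circ (c := 1) (p := 1) 0 lam α) α) := by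
    have h1 := P.isOperad.assoc_seq (std (0 : Fin 2) 2 (p := 3) rfl) (std (0 : Fin 3) 0 (p := 2) rfl)
      (std (0 : Fin 2) 0 (p := 1) rfl) (std (0 : Fin 2) 1 (p := 2) rfl)
      ⟨by decide, by decide, by decide, by decide⟩ (ab := 2) (abc := 2) rfl rfl (bc := 1) rfl rfl
      lam lam α
    have h2 := P.isOperad.assoc_seq (std (0 : Fin 2) 1 (p := 2) rfl) (std (0 : Fin 2) 0 (p := 1) rfl)
      (std (0 : Fin 1) 0 (p := 0) rfl) (std (0 : Fin 2) 0 (p := 1) rfl)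
      ⟨by decide, by decide, by decide, by decide⟩ (ab := 2) (abc := 2) rfl rfl (bc := 1) rfl rfl
      lam (P.circ (c := 1) (p := 1) 0 lam α) α
    exact (congrArg (fun z => P.circ (c := 2) (p := 1) 0 z α) h1).trans h2
  have e1 : P.circ (c := 2) (p := 1) 0 (P.circ (c := 2) (p := 2) 0
      (P.act (finRotate 3) (P.circ (c := 2) (p := 3) 0 lam lam)) α) α =
      P.circ (c := 2) (p := 1) 0 (P.circ (c := 1) (p := 1) 0 lam α)
        (P.circ (c := 1) (p := 1) 0 lam α) := by
    have h0 := P.act_comp (finRotate 3) 0 (std (0 : Fin 2) 2 (p := 3) rfl) (c := 2) rfl lam lam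
    have h1 := P.isOperad.assoc_par ((std (0 : Fin 2) 2 (p := 3) rfl).trans (finRotate 3))
      (std (0 : Fin 3) 0 (p := 2) rfl)
      (std (1 : Fin 2) 0 (p := 1) rfl) (std (0 : Fin 1) 2 (p := 2) rfl)
      ⟨by decide, by decide, by decide, by decide, by decide, by decide⟩
      (ab := 2) (abc := 2) rfl rfl (ac := 1) rfl rfl lam lam α
    have h2 := P.isOperad.assoc_seq (std (0 : Fin 1) 2 (p := 2) rfl) (std (0 : Fin 2) 0 (p := 1) rfl)
      (std (0 : Fin 2) 0 (p := 1) rfl) (std (0 : Fin 1) 1 (p := 1) rfl)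
      ⟨by decide, by decide, by decide, by decide⟩ (ab := 2) (abc := 2) rfl rfl (bc := 1) rfl rfl
      (P.circ (c := 1) (p := 1) 0 lam α) lam α
    change P.circ (c := 2) (p := 1) 0 (P.circ (c := 2) (p := 2) 0 (P.act (finRotate 3)
      (P.comp 0 (std (0 : Fin 2) 2 (p := 3) rfl) (c := 2) rfl lam lam)) α) α = _
    rw [h0]
    refine (congrArg (fun z => P.circ (c := 2) (p := 1) 0 z α) h1).trans ?_
    rw [mul_zero, zpow_zero, one_smul]
    refine Eq.trans ?_ h2
    exact congrArg (fun z => P.circ (c := 2) (p := 1) 0 (P.circ (c := 2) (p := 2) 0 z lam) α) hs'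
  have e2 : P.circ (c := 2) (p := 1) 0 (P.circ (c := 2) (p := 2) 0
      (P.act (finRotate 3 ^ 2) (P.circ (c := 2) (p := 3) 0 lam lam)) α) α =
      P.circ (c := 2) (p := 1) 0 (P.circ (c := 1) (p := 1) 0 lam α)
        (P.circ (c := 1) (p := 1) 0 lam α) := by
    have h0 := P.act_comp (finRotate 3 ^ 2) 0 (std (0 : Fin 2) 2 (p := 3) rfl) (c := 2) rfl lam lam
    have h1 := P.isOperad.assoc_seq ((std (0 : Fin 2) 2 (p := 3) rfl).trans (finRotate 3 ^ 2))
      (std (0 : Fin 3) 0 (p := 2) rfl)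
      (std (1 : Fin 2) 0 (p := 1) rfl) ((std (0 : Fin 2) 1 (p := 2) rfl).trans (Equiv.swap 0 1))
      ⟨by decide, by decide, by decide, by decide⟩ (ab := 2) (abc := 2) rfl rfl (bc := 1) rfl rfl
      lam lam α
    have h2 := P.isOperad.assoc_par ((std (0 : Fin 2) 1 (p := 2) rfl).trans (Equiv.swap 0 1))
      (std (0 : Fin 2) 0 (p := 1) rfl)
      (std (1 : Fin 2) 0 (p := 1) rfl) (std (0 : Fin 1) 1 (p := 1) rfl)
      ⟨by decide, by decide, by decide, by decide, by decide, by decide⟩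
      (ab := 2) (abc := 2) rfl rfl (ac := 1) rfl rfl lam (P.circ (c := 1) (p := 1) 1 lam α) α
    change P.circ (c := 2) (p := 1) 0 (P.circ (c := 2) (p := 2) 0 (P.act (finRotate 3 ^ 2)
      (P.comp 0 (std (0 : Fin 2) 2 (p := 3) rfl) (c := 2) rfl lam lam)) α) α = _
    rw [h0]
    refine (congrArg (fun z => P.circ (c := 2) (p := 1) 0 z α) h1).trans (h2.trans ?_)
    rw [mul_zero, zpow_zero, one_smul]
    exact congrArg₂ (fun z w => P.circ (c := 2) (p := 1) 0 z w) hs' hs'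
  have hlin : ∀ x y z : P.obj 3 2, P.circ (c := 2) (p := 1) 0 (P.circ (c := 2) (p := 2) 0
      (x + y + z) α) α = P.circ (c := 2) (p := 1) 0 (P.circ (c := 2) (p := 2) 0 x α) α +
      P.circ (c := 2) (p := 1) 0 (P.circ (c := 2) (p := 2) 0 y α) α +
      P.circ (c := 2) (p := 1) 0 (P.circ (c := 2) (p := 2) 0 z α) α := by
    intro x y z
    simp [OpData.circ]
  have hz : P.circ (c := 2) (p := 1) 0 (P.circ (c := 2) (p := 2) 0 (0 : P.obj 3 2) α) α = 0 := by
    simp [OpData.circ]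
  have h3 := (hlin _ _ _).symm.trans (hsum.trans hz)
  rw [e0, e1, e2, add_assoc] at h3
  rw [two_smul]
  exact h3

end Jacobi

/-- Morphisms of filtered operads: they preserve units, all the partial compositions (hence the
symmetric group actions) and the filtrations. Morphisms of complete operads are morphisms between
the underlying filtered operads. -/
structure FilteredOperad.Hom {𝕜 : Type u} [Field 𝕜] (P Q : FilteredOperad 𝕜) where
  map : ∀ {n : ℕ} {d : ℤ}, P.obj n d →ₗ[𝕜] Q.obj n d
  map_one : map P.one = Q.one
  map_comp : ∀ {m n p : ℕ} (i : Fin m) (e : Graft i n p) {a b c : ℤ} (h : a + b = c)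
    (x : P.obj m a) (y : P.obj n b), map (P.comp i e h x y) = Q.comp i e h (map x) (map y)
  map_fil : ∀ {n : ℕ} {d : ℤ} (k : ℕ) (x : P.obj n d), x ∈ P.fil n d k → map x ∈ Q.fil n d k

/-- Isomorphisms of filtered operads: the inverse is a morphism too, so the filtrations correspond
to each other. -/
structure FilteredOperad.Iso {𝕜 : Type u} [Field 𝕜] (P Q : FilteredOperad 𝕜) where
  hom : P.Hom Q
  inv : Q.Hom P
  inv_hom : ∀ {n : ℕ} {d : ℤ} (x : P.obj n d), inv.map (hom.map x) = x
  hom_inv : ∀ {n : ℕ} {d : ℤ} (y : Q.obj n d), hom.map (inv.map y) = y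

/-- Complete differential graded operads. -/
structure CompleteDGOperad (𝕜 : Type u) [Field 𝕜] extends FilteredOperad 𝕜 where
  complete : toFilteredOperad.IsComplete
  diff : toFilteredOperad.Differential

/-- Morphisms of complete dg operads. -/
structure CompleteDGOperad.Hom {𝕜 : Type u} [Field 𝕜] (P Q : CompleteDGOperad 𝕜) extends
    P.toFilteredOperad.Hom Q.toFilteredOperad where
  map_d : ∀ {n : ℕ} {a b : ℤ} (h : a + 1 = b) (x : P.obj n a),
    map (P.diff.d h x) = Q.diff.d h (map x)

section Adjoin

variable {𝕜 : Type u} [Field 𝕜]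

/-- The generators `E` together with one more, of arity `0` and degree `δ`. -/
inductive AdjoinGen (E : ℕ → ℤ → Type) (δ : ℤ) : ℕ → ℤ → Type
  | old {n : ℕ} {d : ℤ} (g : E n d) : AdjoinGen E δ n d
  | new : AdjoinGen E δ 0 δ

/-- The map induced by a renaming of generators. -/
def freeMap {E E' : ℕ → ℤ → Type} (f : ∀ {n : ℕ} {d : ℤ}, E n d → E' n d) {n : ℕ} {d : ℤ} :
    (freeData 𝕜 E).obj n d →ₗ[𝕜] (freeData 𝕜 E').obj n d :=
  Finsupp.lmapDomain 𝕜 𝕜 (Tree.map f)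

theorem freeMap_tree {E E' : ℕ → ℤ → Type} (f : ∀ {n : ℕ} {d : ℤ}, E n d → E' n d) {n : ℕ} {d : ℤ}
    (t : Tree E n d) : freeMap (𝕜 := 𝕜) f (freeTree 𝕜 t) = freeTree 𝕜 (t.map f) :=
  Finsupp.mapDomain_single

namespace Presentation

/-- The presentation obtained by adding one free generator of arity `0` and degree `δ`, placed in
`F₁`. The completion of the operad it presents is the complete coproduct `P ∨̂ η` of the presented
operad `P` with the (trivial) operad spanned by one element `η` of arity `0`, degree `δ`, in `F₁`. -/
def adjoin (R : Presentation 𝕜) (δ : ℤ) : Presentation 𝕜 where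
  Gen := AdjoinGen R.Gen δ
  weight g := match g with
    | .old g => R.weight g
    | .new => 1
  rel n d := freeMap AdjoinGen.old '' R.rel n d

/-- The complete operad given by a presentation. -/
def complete (R : Presentation 𝕜) : FilteredOperad 𝕜 := R.operad.completion

/-- A generator, as an operation of the complete operad. -/
def cgen (R : Presentation 𝕜) {n : ℕ} {d : ℤ} (g : R.Gen n d) : R.complete.obj n d :=
  R.operad.toLim n d (R.gen g)

/-- The values on generators of the derivation that vanishes on the old generators and sends the new
one to `w`. -/
def adjoinDer (R : Presentation 𝕜) (s : ℤ) (w : (R.adjoin s).data.obj 0 (s + 1)) :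
    ∀ {n : ℕ} {d : ℤ}, (R.adjoin s).Gen n d → (R.adjoin s).data.obj n (d + 1)
  | _, _, .old _ => 0
  | _, _, .new => w

theorem adjoinDer_rel (R : Presentation 𝕜) (s : ℤ) (w : (R.adjoin s).data.obj 0 (s + 1)) {n : ℕ}
    {d : ℤ} (x : (R.adjoin s).free.obj n d) (hx : x ∈ (R.adjoin s).rel n d) :
    (R.adjoin s).derFree (R.adjoinDer s w) x = 0 := by
  obtain ⟨r, _, rfl⟩ := hx
  have key : ∀ {n : ℕ} {d : ℤ} (t : Tree R.Gen n d),
      (R.adjoin s).derTree (R.adjoinDer s w) (t.map AdjoinGen.old) = 0 := by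
    intro n d t
    induction t with
    | gen g => rfl
    | one => rfl
    | @comp m n p i e a b c h x y hx hy =>
      change (R.adjoin s).data.comp i e _ ((R.adjoin s).derTree (R.adjoinDer s w)
          (x.map AdjoinGen.old)) _ + (-1 : 𝕜) ^ a • (R.adjoin s).data.comp i e _ _
          ((R.adjoin s).derTree (R.adjoinDer s w) (y.map AdjoinGen.old)) = 0
      rw [hx, hy]
      simp
  have key2 : ∀ t : Tree R.Gen n d,
      (R.adjoin s).derFree (R.adjoinDer s w) (freeMap AdjoinGen.old (freeTree 𝕜 t)) = 0 := by
    intro t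
    rw [freeMap_tree]
    exact ((R.adjoin s).derFree_tree _ _).trans (key t)
  let f : (freeData 𝕜 R.Gen).obj n d →ₗ[𝕜] (R.adjoin s).data.obj n (d + 1) :=
    LinearMap.comp ((R.adjoin s).derFree (R.adjoinDer s w)) (freeMap AdjoinGen.old)
  have : f = 0 := freeData_hom_ext 𝕜 key2
  exact LinearMap.congr_fun this r

/-- The canonical map from the old generators and their composites to the enlarged operad. -/
def adjoinMap (R : Presentation 𝕜) (s : ℤ) (n : ℕ) (d : ℤ) :
    R.free.obj n d →ₗ[𝕜] (R.adjoin s).data.obj n d :=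
  LinearMap.comp ((R.adjoin s).clsMap n d) (freeMap AdjoinGen.old)

theorem adjoinMap_rel (R : Presentation 𝕜) (s : ℤ) {n : ℕ} {d : ℤ} (x : R.free.obj n d)
    (hx : x ∈ R.rel n d) : R.adjoinMap s n d x = 0 :=
  (Submodule.Quotient.mk_eq_zero _).2 (.rel _ ⟨x, hx, rfl⟩)

theorem adjoinMap_gen (R : Presentation 𝕜) (s : ℤ) {n : ℕ} {d : ℤ} (g : R.Gen n d) :
    R.adjoinMap s n d (freeTree 𝕜 (.gen g)) = (R.adjoin s).dataGen (.old g) :=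
  congrArg (R.adjoin s).cls (freeMap_tree _ _)

theorem adjoinMap_one (R : Presentation 𝕜) (s : ℤ) :
    R.adjoinMap s 1 0 R.free.one = (R.adjoin s).data.one :=
  congrArg (R.adjoin s).cls (freeMap_tree (𝕜 := 𝕜) AdjoinGen.old (.one : Tree R.Gen 1 0))

theorem adjoinMap_comp (R : Presentation 𝕜) (s : ℤ) {m n p : ℕ} (i : Fin m) (e : Graft i n p)
    {a b c : ℤ} (h : a + b = c) (x : R.free.obj m a) (y : R.free.obj n b) :
    R.adjoinMap s p c (R.free.comp i e h x y) =
      (R.adjoin s).data.comp i e h (R.adjoinMap s m a x) (R.adjoinMap s n b y) := by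
  have key : (R.free.comp i e h).compr₂ (R.adjoinMap s p c) =
      ((R.adjoin s).data.comp i e h).compl₁₂ (R.adjoinMap s m a) (R.adjoinMap s n b) := by
    refine freeData_hom_ext 𝕜 fun t => freeData_hom_ext 𝕜 fun q => ?_
    change (R.adjoin s).cls (freeMap AdjoinGen.old
        (R.free.comp i e h (freeTree 𝕜 t) (freeTree 𝕜 q))) =
      (R.adjoin s).cls ((R.adjoin s).free.comp i e h (freeMap AdjoinGen.old (freeTree 𝕜 t))
        (freeMap AdjoinGen.old (freeTree 𝕜 q)))
    rw [freeData_comp_tree, freeMap_tree, freeMap_tree, freeMap_tree]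
    refine congrArg (R.adjoin s).cls (Eq.symm ?_)
    exact freeData_comp_tree 𝕜 i e h _ _
  exact LinearMap.congr_fun₂ key x y

theorem adjoinMap_act (R : Presentation 𝕜) (s : ℤ) {n : ℕ} {d : ℤ} (σ : Equiv.Perm (Fin n))
    (x : R.free.obj n d) :
    R.adjoinMap s n d (R.free.act σ x) = (R.adjoin s).data.act σ (R.adjoinMap s n d x) := by
  rw [OpData.act, adjoinMap_comp, adjoinMap_one]
  rfl

end Presentation

end Adjoin

section Concrete

variable {𝕜 : Type u} [Field 𝕜]

/-- The relations of Gerstenhaber algebras, for a product `μ` of degree `0` and a bracket `lam` of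
degree `1`: both are symmetric, `μ` is associative, `lam` satisfies the (shifted) Jacobi relation
and the Leibniz relation `lam ∘₁ μ = μ ∘₂ lam + (μ ∘₁ lam)^{(23)}`. -/
inductive GerstRel (P : OpData 𝕜) (μ : P.obj 2 0) (lam : P.obj 2 1) :
    ∀ (n : ℕ) (d : ℤ), P.obj n d → Prop
  | mu_symm : GerstRel P μ lam 2 0 (P.act (Equiv.swap 0 1) μ - μ)
  | lam_symm : GerstRel P μ lam 2 1 (P.act (Equiv.swap 0 1) lam - lam)
  | mu_assoc : GerstRel P μ lam 3 0 (P.circ 0 μ μ - P.circ 1 μ μ)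
  | jacobi : GerstRel P μ lam 3 2 (P.circ 0 lam lam + P.act (finRotate 3) (P.circ 0 lam lam) +
      P.act (finRotate 3 ^ 2) (P.circ 0 lam lam))
  | leibniz : GerstRel P μ lam 3 1
      (P.circ 0 lam μ - (P.circ 1 μ lam + P.act (Equiv.swap 1 2) (P.circ 0 μ lam)))

/-- The relations of Batalin-Vilkovisky algebras: those of Gerstenhaber algebras, `Δ² = 0`,
`Δ ∘ μ = μ ∘₁ Δ + μ ∘₂ Δ + lam` and `Δ ∘ lam + lam ∘₁ Δ + lam ∘₂ Δ = 0`. -/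
inductive BVRel (P : OpData 𝕜) (μ : P.obj 2 0) (lam : P.obj 2 1) (Δ : P.obj 1 1) :
    ∀ (n : ℕ) (d : ℤ), P.obj n d → Prop
  | gerst {n : ℕ} {d : ℤ} (x : P.obj n d) : GerstRel P μ lam n d x → BVRel P μ lam Δ n d x
  | delta_sq : BVRel P μ lam Δ 1 2 (P.circ 0 Δ Δ)
  | delta_mu : BVRel P μ lam Δ 2 1 (P.circ 0 Δ μ - (P.circ 0 μ Δ + P.circ 1 μ Δ + lam))
  | delta_lam : BVRel P μ lam Δ 2 2 (P.circ 0 Δ lam + P.circ 0 lam Δ + P.circ 1 lam Δ)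

/-- The generators of the operad `Gerst`. -/
inductive GerstGen : ℕ → ℤ → Type
  | mu : GerstGen 2 0
  | lam : GerstGen 2 1

/-- The generators of the operad `BV`. -/
inductive BVGen : ℕ → ℤ → Type
  | mu : BVGen 2 0
  | lam : BVGen 2 1
  | delta : BVGen 1 1

variable (𝕜)

/-- The operad `Gerst`, with the trivial filtration `F₀ = Gerst`, `F₁ = 0` (all the generators have
weight zero). -/
def gerst : Presentation 𝕜 where
  Gen := GerstGen
  weight _ := 0
  rel n d := {x | GerstRel (freeData 𝕜 GerstGen) (freeTree 𝕜 (.gen .mu)) (freeTree 𝕜 (.gen .lam)) n d x}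

/-- The operad `BV`, with the trivial filtration `F₀ = BV`, `F₁ = 0`. -/
def bv : Presentation 𝕜 where
  Gen := BVGen
  weight _ := 0
  rel n d := {x | BVRel (freeData 𝕜 BVGen) (freeTree 𝕜 (.gen .mu)) (freeTree 𝕜 (.gen .lam))
    (freeTree 𝕜 (.gen .delta)) n d x}

/-- The complete operad `Gerst ∨̂ η`, with `η` of arity `0` and degree `1` in `F₁`, and with zero
differential. -/
def gerstEta : CompleteDGOperad 𝕜 where
  toFilteredOperad := ((gerst 𝕜).adjoin 1).complete
  complete := FilteredOperad.completion_isComplete _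
  diff := .zero _

namespace gerstEta
def mu : (gerstEta 𝕜).obj 2 0 := ((gerst 𝕜).adjoin 1).cgen (.old .mu)
def lam : (gerstEta 𝕜).obj 2 1 := ((gerst 𝕜).adjoin 1).cgen (.old .lam)
def eta : (gerstEta 𝕜).obj 0 1 := ((gerst 𝕜).adjoin 1).cgen .new
/-- The element `λ(η, -)`. -/
def lamEta : (gerstEta 𝕜).obj 1 2 := (gerstEta 𝕜).circ 0 (lam 𝕜) (eta 𝕜)
end gerstEta

/-- The complete operad `Gerst⁺ = (Gerst ∨̂ η) / (λ(η, -))`. -/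
def gerstPlus : FilteredOperad 𝕜 :=
  (gerstEta 𝕜).quot ((gerstEta 𝕜).closedIdeal (gerstEta.lamEta 𝕜))

/-- The projection `Gerst ∨̂ η → Gerst⁺`. -/
def gerstPlus.proj {n : ℕ} {d : ℤ} (x : (gerstEta 𝕜).obj n d) : (gerstPlus 𝕜).obj n d :=
  Submodule.Quotient.mk (p := ((gerstEta 𝕜).closedIdeal (gerstEta.lamEta 𝕜)).carrier n d) x

theorem gerstPlus_isComplete : (gerstPlus 𝕜).IsComplete := (gerstEta 𝕜).complete.quot _

/-- The operad `BV ∨ α` (before completion), with `α` of arity `0` and degree `0` in `F₁`. -/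
def bvAlpha : Presentation 𝕜 := (bv 𝕜).adjoin 0

namespace bvAlpha
def mu : (bvAlpha 𝕜).data.obj 2 0 := (bvAlpha 𝕜).dataGen (.old .mu)
def lam : (bvAlpha 𝕜).data.obj 2 1 := (bvAlpha 𝕜).dataGen (.old .lam)
def delta : (bvAlpha 𝕜).data.obj 1 1 := (bvAlpha 𝕜).dataGen (.old .delta)
def alpha : (bvAlpha 𝕜).data.obj 0 0 := (bvAlpha 𝕜).dataGen .new

/-- The element `λ(α, -)`. -/
def lamAlpha : (bvAlpha 𝕜).data.obj 1 1 := (bvAlpha 𝕜).data.circ 0 (lam 𝕜) (alpha 𝕜)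
/-- The element `λ(α, α)`. -/
def lamAlphaAlpha : (bvAlpha 𝕜).data.obj 0 1 := (bvAlpha 𝕜).data.circ 0 (lamAlpha 𝕜) (alpha 𝕜)

theorem lam_symm : (bvAlpha 𝕜).data.act (Equiv.swap 0 1) (lam 𝕜) = lam 𝕜 := by
  have h : ∀ l : (bv 𝕜).free.obj 2 1, (bv 𝕜).adjoinMap 0 2 1
      ((bv 𝕜).free.act (Equiv.swap 0 1) l - l) =
      ((bv 𝕜).adjoin 0).data.act (Equiv.swap 0 1) ((bv 𝕜).adjoinMap 0 2 1 l) -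
        (bv 𝕜).adjoinMap 0 2 1 l := by
    intro l
    rw [map_sub, Presentation.adjoinMap_act]
  have h1 := (h (freeTree 𝕜 (.gen BVGen.lam))).symm.trans
    ((bv 𝕜).adjoinMap_rel 0 _ (BVRel.gerst _ GerstRel.lam_symm))
  have h2 : (bv 𝕜).adjoinMap 0 2 1 (freeTree 𝕜 (.gen BVGen.lam)) = lam 𝕜 :=
    (bv 𝕜).adjoinMap_gen 0 BVGen.lam
  rw [h2] at h1
  exact sub_eq_zero.1 h1

theorem jacobi : (bvAlpha 𝕜).data.circ 0 (lam 𝕜) (lam 𝕜) +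
    (bvAlpha 𝕜).data.act (finRotate 3) ((bvAlpha 𝕜).data.circ 0 (lam 𝕜) (lam 𝕜)) +
      (bvAlpha 𝕜).data.act (finRotate 3 ^ 2)
        ((bvAlpha 𝕜).data.circ (c := 2) (p := 3) 0 (lam 𝕜) (lam 𝕜)) = 0 := by
  have h : ∀ l : (bv 𝕜).free.obj 2 1, (bv 𝕜).adjoinMap 0 3 2
      ((bv 𝕜).free.circ 0 l l + (bv 𝕜).free.act (finRotate 3) ((bv 𝕜).free.circ 0 l l) +
        (bv 𝕜).free.act (finRotate 3 ^ 2) ((bv 𝕜).free.circ 0 l l)) =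
      (bvAlpha 𝕜).data.circ 0 ((bv 𝕜).adjoinMap 0 2 1 l) ((bv 𝕜).adjoinMap 0 2 1 l) +
      (bvAlpha 𝕜).data.act (finRotate 3) ((bvAlpha 𝕜).data.circ 0 ((bv 𝕜).adjoinMap 0 2 1 l)
        ((bv 𝕜).adjoinMap 0 2 1 l)) +
      (bvAlpha 𝕜).data.act (finRotate 3 ^ 2) ((bvAlpha 𝕜).data.circ 0
        ((bv 𝕜).adjoinMap 0 2 1 l) ((bv 𝕜).adjoinMap 0 2 1 l)) := by
    intro l
    rw [map_add, map_add, Presentation.adjoinMap_act, Presentation.adjoinMap_act, OpData.circ,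
      Presentation.adjoinMap_comp]
    rfl
  have h1 := (h (freeTree 𝕜 (.gen BVGen.lam))).symm.trans
    ((bv 𝕜).adjoinMap_rel 0 _ (BVRel.gerst _ GerstRel.jacobi))
  have h2 : (bv 𝕜).adjoinMap 0 2 1 (freeTree 𝕜 (.gen BVGen.lam)) = lam 𝕜 :=
    (bv 𝕜).adjoinMap_gen 0 BVGen.lam
  rw [h2] at h1
  exact h1

/-- The value `d(α) = - ½ λ(α, α)`. -/
def dAlpha : (bvAlpha 𝕜).data.obj 0 (0 + 1) := -((2 : 𝕜)⁻¹ • lamAlphaAlpha 𝕜)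

/-- The differential on generators: `d(μ) = d(λ) = d(Δ) = 0` and `d(α) = - ½ λ(α, α)`. -/
abbrev dGen : ∀ {n : ℕ} {d : ℤ}, (bvAlpha 𝕜).Gen n d → (bvAlpha 𝕜).data.obj n (d + 1) :=
  (bv 𝕜).adjoinDer 0 (dAlpha 𝕜)

theorem dGen_rel {n : ℕ} {d : ℤ} (x : (bvAlpha 𝕜).free.obj n d) (hx : x ∈ (bvAlpha 𝕜).rel n d) :
    (bvAlpha 𝕜).derFree (dGen 𝕜) x = 0 :=
  (bv 𝕜).adjoinDer_rel 0 (dAlpha 𝕜) x hx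

/-- The derivation of `BV ∨ α` with the values `dGen` on the generators. -/
abbrev der (n : ℕ) (d : ℤ) : (bvAlpha 𝕜).data.obj n d →ₗ[𝕜] (bvAlpha 𝕜).data.obj n (d + 1) :=
  (bvAlpha 𝕜).der (dGen 𝕜) (dGen_rel 𝕜) n d

theorem der_gen {n : ℕ} {d : ℤ} (g : (bvAlpha 𝕜).Gen n d) :
    der 𝕜 n d ((bvAlpha 𝕜).dataGen g) = dGen 𝕜 g :=
  (bvAlpha 𝕜).derFree_tree (dGen 𝕜) (.gen g)

theorem jacobi_alpha : (bvAlpha 𝕜).data.circ (c := 2) (p := 1) 0 (lam 𝕜) (lamAlphaAlpha 𝕜) +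
    (2 : 𝕜) • (bvAlpha 𝕜).data.circ (c := 2) (p := 1) 0 (lamAlpha 𝕜) (lamAlpha 𝕜) = 0 :=
  OperadTw.jacobi_alpha (bvAlpha 𝕜).operad (lam 𝕜) (alpha 𝕜) (lam_symm 𝕜) (jacobi 𝕜)

theorem dGen_fil {n : ℕ} {d : ℤ} (g : (bvAlpha 𝕜).Gen n d) :
    (bvAlpha 𝕜).FilMem ((bvAlpha 𝕜).weight g) (dGen 𝕜 g) := by
  cases g with
  | old g => exact .zero _
  | new =>
    have h0 : (bvAlpha 𝕜).FilMem 1 (alpha 𝕜) :=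
      Presentation.FilMem.gen (R := bvAlpha 𝕜) AdjoinGen.new
    have h1 : (bvAlpha 𝕜).FilMem 1 (lamAlphaAlpha 𝕜) :=
      .comp _ _ _ 1 0 _ _ (.comp _ _ _ 0 1 _ _ (.top _) h0) (.top _)
    have h2 := (Presentation.FilMem.smul 1 (-1 : 𝕜) _ (.smul 1 (2 : 𝕜)⁻¹ _ h1))
    rw [neg_one_smul] at h2
    exact h2

variable [CharZero 𝕜]

theorem der_lamAlpha : der 𝕜 1 1 (lamAlpha 𝕜) =
    -(bvAlpha 𝕜).data.circ (c := 1 + 1) (p := 1) 0 (lamAlpha 𝕜) (lamAlpha 𝕜) := by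
  have h1 := (bvAlpha 𝕜).der_comp (dGen 𝕜) (dGen_rel 𝕜) 0 (std (0 : Fin 2) 0 (p := 1) rfl)
    (c := 1) rfl rfl rfl (lam 𝕜) (alpha 𝕜)
  have h2 : der 𝕜 2 1 (lam 𝕜) = 0 := der_gen 𝕜 _
  have h3 : der 𝕜 0 0 (alpha 𝕜) = dAlpha 𝕜 := der_gen 𝕜 _
  rw [h2, h3] at h1
  have h4 : der 𝕜 1 1 (lamAlpha 𝕜) = (2 : 𝕜)⁻¹ •
      (bvAlpha 𝕜).data.circ (c := 1 + 1) (p := 1) 0 (lam 𝕜) (lamAlphaAlpha 𝕜) := by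
    refine h1.trans ?_
    simp only [dAlpha, map_zero, LinearMap.zero_apply, zero_add, zpow_one, map_neg, map_smul,
      smul_neg, neg_smul, one_smul, neg_neg]
    rfl
  have h5 : (bvAlpha 𝕜).data.circ (c := 1 + 1) (p := 1) 0 (lam 𝕜) (lamAlphaAlpha 𝕜) =
      -((2 : 𝕜) • (bvAlpha 𝕜).data.circ (c := 1 + 1) (p := 1) 0 (lamAlpha 𝕜) (lamAlpha 𝕜)) :=
    eq_neg_of_add_eq_zero_left (jacobi_alpha 𝕜)
  rw [h4, h5, smul_neg, smul_smul, inv_mul_cancel₀ two_ne_zero, one_smul]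

theorem lamAlpha_lamAlphaAlpha :
    (bvAlpha 𝕜).data.circ (c := 2) (p := 0) 0 (lamAlpha 𝕜) (lamAlphaAlpha 𝕜) = 0 := by
  have hP := (bvAlpha 𝕜).data_isOperad
  have hA := hP.assoc_par (std (0 : Fin 2) 0 (p := 1) rfl) (std (0 : Fin 1) 0 (p := 0) rfl)
      (std (1 : Fin 2) 0 (p := 1) rfl) (std (0 : Fin 1) 0 (p := 0) rfl)
      ⟨by decide, by decide, by decide, by decide, by decide, by decide⟩
      (ab := 2) (abc := 2) rfl rfl (ac := 1) rfl rfl (lam 𝕜) (lamAlphaAlpha 𝕜) (alpha 𝕜)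
  have hB := hP.assoc_seq (std (0 : Fin 1) 1 (p := 1) rfl) (std (0 : Fin 1) 0 (p := 0) rfl)
      (std (0 : Fin 1) 0 (p := 0) rfl) (std (0 : Fin 1) 0 (p := 0) rfl)
      ⟨by decide, by decide, by decide, by decide⟩
      (ab := 2) (abc := 2) rfl rfl (bc := 1) rfl rfl (lamAlpha 𝕜) (lamAlpha 𝕜) (alpha 𝕜)
  have hs : (bvAlpha 𝕜).data.comp 1 (std (1 : Fin 2) 0 (p := 1) rfl) (c := 1) rfl (lam 𝕜)
      (alpha 𝕜) = lamAlpha 𝕜 :=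
    circ_one_eq (bvAlpha 𝕜).operad (lam 𝕜) (alpha 𝕜) (lam_symm 𝕜)
  rw [hs, mul_zero, zpow_zero, one_smul] at hA
  have h := congrArg (fun z => (bvAlpha 𝕜).data.comp 0 (std (0 : Fin 1) 0 (p := 0) rfl)
    (show (2 : ℤ) + 0 = 2 from rfl) z (alpha 𝕜)) (jacobi_alpha 𝕜)
  simp only [OpData.circ, map_add, map_smul, LinearMap.add_apply, LinearMap.smul_apply, map_zero,
    LinearMap.zero_apply] at h
  rw [hA, hB] at h
  have h3 : (3 : 𝕜) • (bvAlpha 𝕜).data.circ (c := 2) (p := 0) 0 (lamAlpha 𝕜)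
      (lamAlphaAlpha 𝕜) = 0 := by
    refine Eq.trans ?_ h
    rw [show (3 : 𝕜) = 1 + 2 by norm_num, add_smul, one_smul]
    rfl
  exact (smul_eq_zero.1 h3).resolve_left three_ne_zero

theorem der_dAlpha : der 𝕜 0 1 (dAlpha 𝕜) = 0 := by
  have h1 := (bvAlpha 𝕜).der_comp (dGen 𝕜) (dGen_rel 𝕜) 0 (std (0 : Fin 1) 0 (p := 0) rfl)
    (c := 1) rfl rfl rfl (lamAlpha 𝕜) (alpha 𝕜)
  have h2 : der 𝕜 0 0 (alpha 𝕜) = dAlpha 𝕜 := der_gen 𝕜 _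
  rw [h2, der_lamAlpha] at h1
  have hB := (bvAlpha 𝕜).data_isOperad.assoc_seq (std (0 : Fin 1) 1 (p := 1) rfl)
      (std (0 : Fin 1) 0 (p := 0) rfl)
      (std (0 : Fin 1) 0 (p := 0) rfl) (std (0 : Fin 1) 0 (p := 0) rfl)
      ⟨by decide, by decide, by decide, by decide⟩
      (ab := 1 + 1) (abc := 1 + 1) rfl rfl (bc := 1) rfl rfl (lamAlpha 𝕜) (lamAlpha 𝕜) (alpha 𝕜)
  have h0 : (bvAlpha 𝕜).data.comp 0 (std (0 : Fin 1) 0 (p := 0) rfl) (c := 1 + 1) rfl (lamAlpha 𝕜)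
      (lamAlphaAlpha 𝕜) = 0 := lamAlpha_lamAlphaAlpha 𝕜
  have h3 : der 𝕜 0 1 (lamAlphaAlpha 𝕜) = 0 := by
    refine h1.trans ?_
    have hB' : (bvAlpha 𝕜).data.comp 0 (std (0 : Fin 1) 0 (p := 0) rfl)
      (show (1 + 1 : ℤ) + 0 = 1 + 1 from rfl)
      ((bvAlpha 𝕜).data.circ (c := 1 + 1) (p := 1) 0 (lamAlpha 𝕜) (lamAlpha 𝕜)) (alpha 𝕜) = 0 :=
      hB.trans h0
    have h0' : (bvAlpha 𝕜).data.comp 0 (std (0 : Fin 1) 0 (p := 0) rfl) (c := 1 + 1) rfl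
      (lamAlpha 𝕜) (dAlpha 𝕜) = 0 := by
      rw [dAlpha, map_neg, map_smul, h0, smul_zero, neg_zero]
    rw [map_neg, LinearMap.neg_apply]
    exact (congrArg₂ (fun z w => -z + (-1 : 𝕜) ^ (1 : ℤ) • w) hB' h0').trans (by simp)
  rw [dAlpha, map_neg, map_smul, h3, smul_zero, neg_zero]

theorem der_dGen {n : ℕ} {d : ℤ} (g : (bvAlpha 𝕜).Gen n d) : der 𝕜 n (d + 1) (dGen 𝕜 g) = 0 := by
  cases g with
  | old g => exact map_zero _
  | new => exact der_dAlpha 𝕜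

/-- The differential of `BV ∨ α` with the values `dGen` on the generators. -/
def differential : (bvAlpha 𝕜).operad.Differential :=
  (bvAlpha 𝕜).differential (dGen 𝕜) (dGen_rel 𝕜) (der_dGen 𝕜) (dGen_fil 𝕜)

end bvAlpha

variable [CharZero 𝕜]

/-- The complete dg operad `MC BV = (BV ∨̂ α, d)`, where `d` vanishes on `BV` and
`d(α) = - ½ λ(α, α)`. -/
def mcBV : CompleteDGOperad 𝕜 where
  toFilteredOperad := (bvAlpha 𝕜).complete
  complete := FilteredOperad.completion_isComplete _
  diff := (bvAlpha.differential 𝕜).completion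

namespace mcBV
def mu : (mcBV 𝕜).obj 2 0 := (bvAlpha 𝕜).cgen (.old .mu)
def lam : (mcBV 𝕜).obj 2 1 := (bvAlpha 𝕜).cgen (.old .lam)
def delta : (mcBV 𝕜).obj 1 1 := (bvAlpha 𝕜).cgen (.old .delta)
def alpha : (mcBV 𝕜).obj 0 0 := (bvAlpha 𝕜).cgen .new
/-- The Maurer-Cartan element `λ(α, -)`. -/
def lamAlpha : (mcBV 𝕜).obj 1 1 := (mcBV 𝕜).circ 0 (lam 𝕜) (alpha 𝕜)

theorem lamAlpha_isMC : (mcBV 𝕜).diff.IsMC (lamAlpha 𝕜) where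
  eq := by
    have h := congrArg ((bvAlpha 𝕜).operad.toLim 1 (1 + 1))
      (add_eq_zero_iff_eq_neg.2 (bvAlpha.der_lamAlpha 𝕜))
    exact h

end mcBV

/-- The complete dg operad `Tw BV`: the operad `MC BV` with the differential twisted by its
Maurer-Cartan element `λ(α, -)`. -/
def twBV : CompleteDGOperad 𝕜 where
  toFilteredOperad := (mcBV 𝕜).toFilteredOperad
  complete := (mcBV 𝕜).complete
  diff := (mcBV 𝕜).diff.twist (mcBV.lamAlpha 𝕜) (mcBV.lamAlpha_isMC 𝕜)

namespace twBV
def mu : (twBV 𝕜).obj 2 0 := mcBV.mu 𝕜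
def lam : (twBV 𝕜).obj 2 1 := mcBV.lam 𝕜
def delta : (twBV 𝕜).obj 1 1 := mcBV.delta 𝕜
def alpha : (twBV 𝕜).obj 0 0 := mcBV.alpha 𝕜

/-- The element `Δ(α)`. -/
def deltaAlpha : (twBV 𝕜).obj 0 1 := (twBV 𝕜).circ 0 (delta 𝕜) (alpha 𝕜)
end twBV

end Concrete

end OperadTw

end

open OperadTw

set_option linter.unusedVariables false
set_option linter.unusedSimpArgs false

noncomputable section

namespace OperadTw

/-! ### Signs -/

section Signs

variable (K : Type u) [Field K]

/-- The sign `(-1)^i`. -/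
def sg (i : ℤ) : K := (-1 : K) ^ i

theorem sg_add (i j : ℤ) : sg K (i + j) = sg K i * sg K j := zpow_add₀ (by simp) _ _

@[simp] theorem sg_zero : sg K 0 = 1 := zpow_zero _

@[simp] theorem sg_one : sg K 1 = -1 := zpow_one _

theorem sg_neg (i : ℤ) : sg K (-i) = sg K i := by
  rw [sg, sg, zpow_neg, ← inv_zpow, inv_neg, inv_one]

theorem sg_sub (i j : ℤ) : sg K (i - j) = sg K i * sg K j := by
  rw [sub_eq_add_neg, sg_add, sg_neg]

theorem sg_sq (i : ℤ) : sg K i * sg K i = 1 := FilteredOperad.neg_one_zpow_sq i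

theorem sg_parity (i : ℤ) : (sg K i = 1 ∧ ∀ j, sg K (i * j) = 1 ∧ sg K (j * i) = 1) ∨
    (sg K i = -1 ∧ ∀ j, sg K (i * j) = sg K j ∧ sg K (j * i) = sg K j) := by
  rcases Int.even_or_odd i with h | h
  · exact .inl ⟨h.neg_one_zpow, fun j =>
      ⟨(h.mul_right j).neg_one_zpow, (h.mul_left j).neg_one_zpow⟩⟩
  · refine .inr ⟨h.neg_one_zpow, fun j => ?_⟩
    rw [mul_comm j i, and_self]
    rcases Int.even_or_odd j with h' | h'
    · rw [sg, sg, (h'.mul_left i).neg_one_zpow, h'.neg_one_zpow]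
    · rw [sg, sg, (h.mul h').neg_one_zpow, h'.neg_one_zpow]

end Signs

/-! ### Gerstenhaber algebras -/

/-- Unital Gerstenhaber algebras with a product of degree `0` and a bracket of degree `1`, on a
module with a family of homogeneous submodules. -/
structure GAlg (K : Type u) [Field K] (A : Type u) [AddCommGroup A] [Module K A] where
  gr : ℤ → Submodule K A
  one : A
  mul : A →ₗ[K] A →ₗ[K] A
  brk : A →ₗ[K] A →ₗ[K] A
  one_mem : one ∈ gr 0
  mul_mem : ∀ {i j : ℤ} {a b : A}, a ∈ gr i → b ∈ gr j → mul a b ∈ gr (i + j)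
  brk_mem : ∀ {i j : ℤ} {a b : A}, a ∈ gr i → b ∈ gr j → brk a b ∈ gr (i + j + 1)
  one_mul : ∀ a, mul one a = a
  one_brk : ∀ a, brk one a = 0
  mul_comm : ∀ {i j : ℤ} {a b : A}, a ∈ gr i → b ∈ gr j → mul a b = sg K (i * j) • mul b a
  brk_comm : ∀ {i j : ℤ} {a b : A}, a ∈ gr i → b ∈ gr j → brk a b = sg K (i * j) • brk b a
  assoc : ∀ {i j k : ℤ} {a b c : A}, a ∈ gr i → b ∈ gr j → c ∈ gr k →
    mul (mul a b) c = mul a (mul b c)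
  leibniz : ∀ {i j k : ℤ} {a b c : A}, a ∈ gr i → b ∈ gr j → c ∈ gr k →
    brk (mul a b) c = sg K i • mul a (brk b c) + sg K (j * k) • mul (brk a c) b
  jacobi : ∀ {i j k : ℤ} {a b c : A}, a ∈ gr i → b ∈ gr j → c ∈ gr k →
    brk (brk a b) c + sg K (i * (j + k)) • brk (brk b c) a +
      sg K (k * (i + j)) • brk (brk c a) b = 0

/-! ### The free algebra -/

/-- The generators `x i`, `y i = Δ (x i)`, `α` and `β = Δ α`. -/
inductive Letter : Type
  | x : ℕ → Letter
  | y : ℕ → Letter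
  | al : Letter
  | be : Letter

/-- The degree of a generator. -/
def Letter.deg : Letter → ℤ
  | .x _ => 0
  | .y _ => 1
  | .al => 0
  | .be => 1

/-- Formal Gerstenhaber monomials. -/
inductive GTerm : Type
  | one : GTerm
  | lt : Letter → GTerm
  | mul : GTerm → GTerm → GTerm
  | brk : GTerm → GTerm → GTerm

/-- The weight of a monomial for given weights of the generators and of the bracket. -/
def GTerm.wt {Γ : Type} [AddCommMonoid Γ] (g : Letter → Γ) (b : Γ) : GTerm → Γ
  | .one => 0
  | .lt l => g l
  | .mul s t => s.wt g b + t.wt g b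
  | .brk s t => s.wt g b + t.wt g b + b

/-- The degree of a monomial. -/
def GTerm.deg (t : GTerm) : ℤ := t.wt Letter.deg 1

theorem GTerm.deg_mul (s t : GTerm) : (GTerm.mul s t).deg = s.deg + t.deg := rfl

theorem GTerm.deg_brk (s t : GTerm) : (GTerm.brk s t).deg = s.deg + t.deg + 1 := rfl

section Free

variable (K : Type u) [Field K]

open Finsupp in
/-- The relations of unital Gerstenhaber algebras, multiplied from the left by monomials. -/
inductive GRel : (GTerm →₀ K) → Prop
  | one_mul (a : GTerm) : GRel (single (.mul .one a) 1 - single a 1)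
  | one_brk (a : GTerm) : GRel (single (.brk .one a) 1)
  | mul_comm (a b : GTerm) : GRel (single (.mul a b) 1 - single (.mul b a) (sg K (a.deg * b.deg)))
  | brk_comm (a b : GTerm) : GRel (single (.brk a b) 1 - single (.brk b a) (sg K (a.deg * b.deg)))
  | assoc (a b c : GTerm) : GRel (single (.mul (.mul a b) c) 1 - single (.mul a (.mul b c)) 1)
  | leibniz (a b c : GTerm) : GRel (single (.brk (.mul a b) c) 1 -
      single (.mul a (.brk b c)) (sg K a.deg) -
        single (.mul (.brk a c) b) (sg K (b.deg * c.deg)))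
  | jacobi (a b c : GTerm) : GRel (single (.brk (.brk a b) c) 1 +
      single (.brk (.brk b c) a) (sg K (a.deg * (b.deg + c.deg))) +
        single (.brk (.brk c a) b) (sg K (c.deg * (a.deg + b.deg))))
  | mulL (t : GTerm) (r : GTerm →₀ K) : GRel r → GRel (lmapDomain K K (GTerm.mul t) r)
  | brkL (t : GTerm) (r : GTerm →₀ K) : GRel r → GRel (lmapDomain K K (GTerm.brk t) r)

/-- Finite combinations of monomials of one weight. -/
def wtSupp {Γ : Type} [AddCommMonoid Γ] (g : Letter → Γ) (b : Γ) (c : Γ) :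
    Submodule K (GTerm →₀ K) :=
  Finsupp.supported K K {t | t.wt g b = c}

variable {K}

theorem single_mem_wtSupp {Γ : Type} [AddCommMonoid Γ] (g : Letter → Γ) (b : Γ) {c : Γ}
    {t : GTerm} (h : t.wt g b = c) (r : K) : Finsupp.single t r ∈ wtSupp K g b c :=
  Finsupp.single_mem_supported K r h

theorem GRel.homog {Γ : Type} [AddCommMonoid Γ] (g : Letter → Γ) (b : Γ) {r : GTerm →₀ K}
    (h : GRel K r) : ∃ c, r ∈ wtSupp K g b c := by
  have key : ∀ (op : GTerm → GTerm) (w : Γ → Γ) (_ : ∀ t, (op t).wt g b = w (t.wt g b)) (c : Γ)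
      (r : GTerm →₀ K), r ∈ wtSupp K g b c →
        Finsupp.lmapDomain K K op r ∈ wtSupp K g b (w c) := by
    intro op w hw c r hr
    have h1 : Finsupp.lmapDomain K K op r ∈ (wtSupp K g b c).map (Finsupp.lmapDomain K K op) :=
      Submodule.mem_map_of_mem hr
    rw [wtSupp, Finsupp.lmapDomain_supported] at h1
    refine Finsupp.supported_mono ?_ h1
    rintro _ ⟨t, ht, rfl⟩
    exact (hw t).trans (congrArg w ht)
  induction h with
  | one_mul a =>
    exact ⟨_, sub_mem (single_mem_wtSupp g b rfl _) (single_mem_wtSupp g b (zero_add _).symm _)⟩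
  | one_brk a => exact ⟨_, single_mem_wtSupp g b rfl _⟩
  | mul_comm a c =>
    exact ⟨_, sub_mem (single_mem_wtSupp g b rfl _) (single_mem_wtSupp g b (add_comm _ _) _)⟩
  | brk_comm a c =>
    refine ⟨_, sub_mem (single_mem_wtSupp g b rfl _) (single_mem_wtSupp g b ?_ _)⟩
    simp only [GTerm.wt]
    abel
  | assoc a c d =>
    refine ⟨_, sub_mem (single_mem_wtSupp g b rfl _) (single_mem_wtSupp g b ?_ _)⟩
    simp only [GTerm.wt]
    abel
  | leibniz a c d =>
    refine ⟨_, sub_mem (sub_mem (single_mem_wtSupp g b rfl _) (single_mem_wtSupp g b ?_ _))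
      (single_mem_wtSupp g b ?_ _)⟩ <;>
    · simp only [GTerm.wt]
      abel
  | jacobi a c d =>
    refine ⟨_, add_mem (add_mem (single_mem_wtSupp g b rfl _) (single_mem_wtSupp g b ?_ _))
      (single_mem_wtSupp g b ?_ _)⟩ <;>
    · simp only [GTerm.wt]
      abel
  | mulL t r _ ih =>
    obtain ⟨c, hc⟩ := ih
    exact ⟨_, key (GTerm.mul t) (fun c => t.wt g b + c) (fun _ => rfl) c r hc⟩
  | brkL t r _ ih =>
    obtain ⟨c, hc⟩ := ih
    exact ⟨_, key (GTerm.brk t) (fun c => t.wt g b + c + b) (fun _ => rfl) c r hc⟩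

variable (K)

/-- The submodule of relations. -/
def gRelSub : Submodule K (GTerm →₀ K) := Submodule.span K {r | GRel K r}

/-- The free unital Gerstenhaber algebra on the letters. -/
def FreeG : Type u := (GTerm →₀ K) ⧸ gRelSub K

instance : AddCommGroup (FreeG K) := inferInstanceAs (AddCommGroup ((GTerm →₀ K) ⧸ gRelSub K))

instance : Module K (FreeG K) := inferInstanceAs (Module K ((GTerm →₀ K) ⧸ gRelSub K))

namespace FreeG

/-- The projection from formal combinations of monomials. -/
def proj : (GTerm →₀ K) →ₗ[K] FreeG K := (gRelSub K).mkQ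

/-- The class of a monomial. -/
def cls (t : GTerm) : FreeG K := proj K (Finsupp.single t 1)

variable {K}

theorem proj_single (t : GTerm) (c : K) : proj K (Finsupp.single t c) = c • cls K t := by
  rw [cls, ← map_smul, Finsupp.smul_single, smul_eq_mul, mul_one]

theorem proj_surj (v : FreeG K) : ∃ r, proj K r = v := Submodule.mkQ_surjective _ v

theorem proj_eq_zero {r : GTerm →₀ K} (h : GRel K r) : proj K r = 0 :=
  (Submodule.Quotient.mk_eq_zero _).2 (Submodule.subset_span h)

theorem span_cls : Submodule.span K (Set.range (cls K)) = ⊤ := by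
  rw [eq_top_iff]
  intro v _
  obtain ⟨r, rfl⟩ := proj_surj v
  induction r using Finsupp.induction_linear with
  | zero => rw [map_zero]; exact zero_mem _
  | add r s hr hs => rw [map_add]; exact add_mem (hr trivial) (hs trivial)
  | single t c =>
    rw [proj_single]
    exact Submodule.smul_mem _ _ (Submodule.subset_span ⟨t, rfl⟩)

theorem hom_ext {M : Type*} [AddCommGroup M] [Module K M] {f g : FreeG K →ₗ[K] M}
    (h : ∀ t, f (cls K t) = g (cls K t)) : f = g :=
  LinearMap.ext_on span_cls (by rintro _ ⟨t, rfl⟩; exact h t)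

/-- The linear map with given values on the monomials. -/
def lift {M : Type*} [AddCommGroup M] [Module K M] (F : GTerm → M)
    (hF : ∀ r, GRel K r → Finsupp.linearCombination K F r = 0) : FreeG K →ₗ[K] M :=
  (gRelSub K).liftQ (Finsupp.linearCombination K F) (Submodule.span_le.2 hF)

theorem lift_proj {M : Type*} [AddCommGroup M] [Module K M] (F : GTerm → M)
    (hF : ∀ r, GRel K r → Finsupp.linearCombination K F r = 0) (r : GTerm →₀ K) :
    lift F hF (proj K r) = Finsupp.linearCombination K F r := rfl

@[simp] theorem lift_cls {M : Type*} [AddCommGroup M] [Module K M] (F : GTerm → M)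
    (hF : ∀ r, GRel K r → Finsupp.linearCombination K F r = 0) (t : GTerm) :
    lift F hF (cls K t) = F t := by
  rw [cls, lift_proj, Finsupp.linearCombination_single, one_smul]

/-- Left composition with a monomial for a binary operation on monomials. -/
def binR (op : GTerm → GTerm → GTerm)
    (hL : ∀ t r, GRel K r → GRel K (Finsupp.lmapDomain K K (op t) r)) (s : GTerm) :
    FreeG K →ₗ[K] FreeG K :=
  (gRelSub K).liftQ (proj K ∘ₗ Finsupp.lmapDomain K K (op s))
    (Submodule.span_le.2 fun r hr => proj_eq_zero (hL s r hr))

theorem binR_cls (op : GTerm → GTerm → GTerm)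
    (hL : ∀ t r, GRel K r → GRel K (Finsupp.lmapDomain K K (op t) r)) (s t : GTerm) :
    binR op hL s (cls K t) = cls K (op s t) := by
  change proj K (Finsupp.lmapDomain K K (op s) (Finsupp.single t 1)) = _
  rw [Finsupp.lmapDomain_apply, Finsupp.mapDomain_single, cls]

/-- Extension of a binary operation on monomials to the free algebra. -/
def bin (op : GTerm → GTerm → GTerm)
    (hL : ∀ t r, GRel K r → GRel K (Finsupp.lmapDomain K K (op t) r))
    (hC : ∀ a b, cls K (op a b) = sg K (a.deg * b.deg) • cls K (op b a)) :
    FreeG K →ₗ[K] FreeG K →ₗ[K] FreeG K :=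
  lift (binR op hL) (by
  intro r hr
  refine hom_ext fun t => ?_
  obtain ⟨d, hd⟩ := GRel.homog Letter.deg 1 hr
  have h1 : ∀ r : GTerm →₀ K, (Finsupp.linearCombination K (binR op hL) r) (cls K t) =
      Finsupp.linearCombination K (fun s => cls K (op s t)) r := by
    intro r
    induction r using Finsupp.induction_linear with
    | zero => simp
    | add r s hr hs => rw [map_add, map_add, LinearMap.add_apply, hr, hs]
    | single s c =>
      rw [Finsupp.linearCombination_single, Finsupp.linearCombination_single, LinearMap.smul_apply,
        binR_cls]
  have h2 : ∀ r ∈ wtSupp K Letter.deg 1 d,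
      Finsupp.linearCombination K (fun s => cls K (op s t)) r =
      sg K (d * t.deg) • proj K (Finsupp.lmapDomain K K (op t) r) := by
    intro r hr
    rw [wtSupp, Finsupp.supported_eq_span_single] at hr
    induction hr using Submodule.span_induction with
    | mem r hr =>
      obtain ⟨s, hs, rfl⟩ := hr
      have hs' : s.deg = d := hs
      rw [Finsupp.linearCombination_single, one_smul, Finsupp.lmapDomain_apply,
        Finsupp.mapDomain_single, hC, hs', cls]
    | zero => simp
    | add r s _ _ hr hs => simp only [map_add, smul_add, hr, hs]
    | smul c r _ hr => simp only [map_smul, hr, smul_comm c]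
  rw [h1, h2 r hd, proj_eq_zero (hL t r hr), smul_zero, LinearMap.zero_apply])

theorem bin_cls (op : GTerm → GTerm → GTerm)
    (hL : ∀ t r, GRel K r → GRel K (Finsupp.lmapDomain K K (op t) r))
    (hC : ∀ a b, cls K (op a b) = sg K (a.deg * b.deg) • cls K (op b a)) (s t : GTerm) :
    bin op hL hC (cls K s) (cls K t) = cls K (op s t) := by
  rw [bin, lift_cls, binR_cls]

theorem cls_mul_comm (a b : GTerm) :
    cls K (.mul a b) = sg K (a.deg * b.deg) • cls K (.mul b a) := by
  have := proj_eq_zero (GRel.mul_comm (K := K) a b)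
  rwa [map_sub, proj_single, proj_single, one_smul, sub_eq_zero] at this

theorem cls_brk_comm (a b : GTerm) :
    cls K (.brk a b) = sg K (a.deg * b.deg) • cls K (.brk b a) := by
  have := proj_eq_zero (GRel.brk_comm (K := K) a b)
  rwa [map_sub, proj_single, proj_single, one_smul, sub_eq_zero] at this

/-- The elements of a given weight. -/
def wtSub {Γ : Type} [AddCommMonoid Γ] (g : Letter → Γ) (b : Γ) (c : Γ) : Submodule K (FreeG K) :=
  Submodule.span K {v | ∃ t : GTerm, t.wt g b = c ∧ cls K t = v}

theorem cls_mem_wtSub {Γ : Type} [AddCommMonoid Γ] (g : Letter → Γ) (b : Γ) (t : GTerm) :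
    cls K t ∈ wtSub (K := K) g b (t.wt g b) := Submodule.subset_span ⟨t, rfl, rfl⟩

/-- To prove a linear condition on elements of given weight, it suffices to consider monomials. -/
theorem wtSub_le {Γ : Type} [AddCommMonoid Γ] {g : Letter → Γ} {b : Γ} {c : Γ}
    {N : Submodule K (FreeG K)} (h : ∀ t : GTerm, t.wt g b = c → cls K t ∈ N) :
    wtSub g b c ≤ N :=
  Submodule.span_le.2 (by rintro _ ⟨t, ht, rfl⟩; exact h t ht)

theorem bin_mem {Γ : Type} [AddCommMonoid Γ] {g : Letter → Γ} {b : Γ} (op : GTerm → GTerm → GTerm)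
    (B : FreeG K →ₗ[K] FreeG K →ₗ[K] FreeG K)
    (hB : ∀ s t, B (cls K s) (cls K t) = cls K (op s t)) {c d e : Γ}
    (h : ∀ s t : GTerm, s.wt g b = c → t.wt g b = d → (op s t).wt g b = e)
    {v w : FreeG K} (hv : v ∈ wtSub g b c) (hw : w ∈ wtSub g b d) :
    B v w ∈ wtSub (K := K) g b e := by
  have h1 : ∀ s : GTerm, s.wt g b = c → wtSub g b d ≤ (wtSub g b e).comap (B (cls K s)) := by
    intro s hs
    refine wtSub_le fun t ht => ?_
    rw [Submodule.mem_comap, hB]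
    exact Submodule.subset_span ⟨_, h s t hs ht, rfl⟩
  have h2 : wtSub g b c ≤ (wtSub g b e).comap (B.flip w) :=
    wtSub_le fun s hs => h1 s hs hw
  exact h2 hv

theorem triple_ind {Γ : Type} [AddCommMonoid Γ] {g : Letter → Γ} {b : Γ} {i j k : Γ}
    {M : Type*} [AddCommGroup M] [Module K M] (T : FreeG K → FreeG K → FreeG K → M)
    (a₁ : ∀ u u' v w, T (u + u') v w = T u v w + T u' v w)
    (s₁ : ∀ (c : K) u v w, T (c • u) v w = c • T u v w)
    (a₂ : ∀ u v v' w, T u (v + v') w = T u v w + T u v' w)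
    (s₂ : ∀ (c : K) u v w, T u (c • v) w = c • T u v w)
    (a₃ : ∀ u v w w', T u v (w + w') = T u v w + T u v w')
    (s₃ : ∀ (c : K) u v w, T u v (c • w) = c • T u v w)
    (h : ∀ s t w : GTerm, s.wt g b = i → t.wt g b = j → w.wt g b = k →
      T (cls K s) (cls K t) (cls K w) = 0)
    {u v w : FreeG K} (hu : u ∈ wtSub g b i) (hv : v ∈ wtSub g b j) (hw : w ∈ wtSub g b k) :
    T u v w = 0 := by
  let L₃ (u v) : FreeG K →ₗ[K] M := ⟨⟨fun w => T u v w, a₃ u v⟩, fun c => s₃ c u v⟩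
  let L₂ (u w) : FreeG K →ₗ[K] M := ⟨⟨fun v => T u v w, fun v v' => a₂ u v v' w⟩,
    fun c v => s₂ c u v w⟩
  let L₁ (v w) : FreeG K →ₗ[K] M := ⟨⟨fun u => T u v w, fun u u' => a₁ u u' v w⟩,
    fun c u => s₁ c u v w⟩
  have h1 : ∀ s t, s.wt g b = i → t.wt g b = j →
      wtSub g b k ≤ LinearMap.ker (L₃ (cls K s) (cls K t)) :=
    fun s t hs ht => wtSub_le fun w hw => h s t w hs ht hw
  have h2 : ∀ s, s.wt g b = i → wtSub g b j ≤ LinearMap.ker (L₂ (cls K s) w) :=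
    fun s hs => wtSub_le fun t ht => h1 s t hs ht hw
  have h3 : wtSub g b i ≤ LinearMap.ker (L₁ v w) := wtSub_le fun s hs => h2 s hs hv
  exact h3 hu

variable (K) in
/-- The product of the free algebra. -/
def mul : FreeG K →ₗ[K] FreeG K →ₗ[K] FreeG K := bin .mul GRel.mulL cls_mul_comm

variable (K) in
/-- The bracket of the free algebra. -/
def brk : FreeG K →ₗ[K] FreeG K →ₗ[K] FreeG K := bin .brk GRel.brkL cls_brk_comm

theorem mul_cls (s t : GTerm) : mul K (cls K s) (cls K t) = cls K (.mul s t) := bin_cls _ _ _ s t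

theorem brk_cls (s t : GTerm) : brk K (cls K s) (cls K t) = cls K (.brk s t) := bin_cls _ _ _ s t

theorem mul_mem_wt {Γ : Type} [AddCommMonoid Γ] {g : Letter → Γ} {b c d : Γ}
    {v w : FreeG K} (hv : v ∈ wtSub g b c) (hw : w ∈ wtSub g b d) :
    mul K v w ∈ wtSub (K := K) g b (c + d) :=
  bin_mem .mul (mul K) mul_cls (fun s t hs ht => by rw [← hs, ← ht]; rfl) hv hw

theorem brk_mem_wt {Γ : Type} [AddCommMonoid Γ] {g : Letter → Γ} {b c d : Γ}
    {v w : FreeG K} (hv : v ∈ wtSub g b c) (hw : w ∈ wtSub g b d) :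
    brk K v w ∈ wtSub (K := K) g b (c + d + b) :=
  bin_mem .brk (brk K) brk_cls (fun s t hs ht => by rw [← hs, ← ht]; rfl) hv hw

end FreeG

open FreeG in
/-- The free algebra is a unital Gerstenhaber algebra. -/
def freeGAlg : GAlg K (FreeG K) where
  gr d := wtSub Letter.deg 1 d
  one := cls K .one
  mul := FreeG.mul K
  brk := FreeG.brk K
  one_mem := cls_mem_wtSub _ _ .one
  mul_mem := mul_mem_wt
  brk_mem := brk_mem_wt
  one_mul a := by
    have : FreeG.mul K (cls K .one) = LinearMap.id := hom_ext fun t => by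
      have h := proj_eq_zero (GRel.one_mul (K := K) t)
      rw [map_sub, sub_eq_zero] at h
      rw [mul_cls, LinearMap.id_apply, cls, h, cls]
    rw [this, LinearMap.id_apply]
  one_brk a := by
    have : FreeG.brk K (cls K .one) = 0 := hom_ext fun t => by
      rw [brk_cls, cls, proj_eq_zero (GRel.one_brk (K := K) t), LinearMap.zero_apply]
    rw [this, LinearMap.zero_apply]
  mul_comm {i j a b} ha hb := by
    have h : wtSub Letter.deg 1 i ≤ LinearMap.ker ((FreeG.mul K).flip b -
        sg K (i * j) • FreeG.mul K b) := wtSub_le fun s hs => by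
      have h' : wtSub Letter.deg 1 j ≤ LinearMap.ker (FreeG.mul K (cls K s) -
          sg K (i * j) • (FreeG.mul K).flip (cls K s)) := wtSub_le fun t ht => by
        rw [LinearMap.mem_ker, LinearMap.sub_apply, LinearMap.smul_apply, LinearMap.flip_apply,
          mul_cls, mul_cls, cls_mul_comm, sub_eq_zero, ← hs, ← ht]
        rfl
      exact h' hb
    exact sub_eq_zero.1 (h ha)
  brk_comm {i j a b} ha hb := by
    have h : wtSub Letter.deg 1 i ≤ LinearMap.ker ((FreeG.brk K).flip b -
        sg K (i * j) • FreeG.brk K b) := wtSub_le fun s hs => by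
      have h' : wtSub Letter.deg 1 j ≤ LinearMap.ker (FreeG.brk K (cls K s) -
          sg K (i * j) • (FreeG.brk K).flip (cls K s)) := wtSub_le fun t ht => by
        rw [LinearMap.mem_ker, LinearMap.sub_apply, LinearMap.smul_apply, LinearMap.flip_apply,
          brk_cls, brk_cls, cls_brk_comm, sub_eq_zero, ← hs, ← ht]
        rfl
      exact h' hb
    exact sub_eq_zero.1 (h ha)
  assoc {i j k a b c} ha hb hc := by
    refine sub_eq_zero.1 (triple_ind (fun a b c => FreeG.mul K (FreeG.mul K a b) c -
      FreeG.mul K a (FreeG.mul K b c)) ?_ ?_ ?_ ?_ ?_ ?_ ?_ ha hb hc) <;> intros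
    iterate 6
      simp only [map_add, LinearMap.add_apply, map_smul, LinearMap.smul_apply]
      module
    rename_i s t w _ _ _
    have h := proj_eq_zero (GRel.assoc (K := K) s t w)
    simp only [mul_cls]
    simpa only [map_sub, cls] using h
  leibniz {i j k a b c} ha hb hc := by
    refine sub_eq_zero.1 (triple_ind (fun a b c => FreeG.brk K (FreeG.mul K a b) c -
      (sg K i • FreeG.mul K a (FreeG.brk K b c) + sg K (j * k) •
        FreeG.mul K (FreeG.brk K a c) b)) ?_ ?_ ?_ ?_ ?_ ?_ ?_ ha hb hc) <;> intros
    iterate 6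
      simp only [map_add, LinearMap.add_apply, map_smul, LinearMap.smul_apply]
      module
    rename_i s t w hs ht hw
    have h := proj_eq_zero (GRel.leibniz (K := K) s t w)
    simp only [map_sub, proj_single, one_smul] at h
    simp only [mul_cls, brk_cls]
    rw [← hs, ← ht, ← hw, ← h]
    simp only [GTerm.deg]
    module
  jacobi {i j k a b c} ha hb hc := by
    refine triple_ind (fun a b c => FreeG.brk K (FreeG.brk K a b) c +
      sg K (i * (j + k)) • FreeG.brk K (FreeG.brk K b c) a +
        sg K (k * (i + j)) • FreeG.brk K (FreeG.brk K c a) b) ?_ ?_ ?_ ?_ ?_ ?_ ?_ ha hb hc <;>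
          intros
    iterate 6
      simp only [map_add, LinearMap.add_apply, map_smul, LinearMap.smul_apply]
      module
    rename_i s t w hs ht hw
    have h := proj_eq_zero (GRel.jacobi (K := K) s t w)
    simp only [map_add, proj_single, one_smul] at h
    rw [← hs, ← ht, ← hw]
    simpa only [brk_cls, GTerm.deg] using h

end Free

end OperadTw

namespace OperadTw

/-! ### Homomorphisms out of the free algebra -/

section Ev

variable {K : Type u} [Field K]

open FreeG

theorem GRel.context {M : Type*} [AddCommGroup M] [Module K M] {F : GTerm → M}
    (one_mul : ∀ a, F (.mul .one a) = F a) (one_brk : ∀ a, F (.brk .one a) = 0)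
    (mul_comm : ∀ a b : GTerm, F (.mul a b) = sg K (a.deg * b.deg) • F (.mul b a))
    (brk_comm : ∀ a b : GTerm, F (.brk a b) = sg K (a.deg * b.deg) • F (.brk b a))
    (assoc : ∀ a b c, F (.mul (.mul a b) c) = F (.mul a (.mul b c)))
    (leibniz : ∀ a b c : GTerm, F (.brk (.mul a b) c) = sg K a.deg • F (.mul a (.brk b c)) +
      sg K (b.deg * c.deg) • F (.mul (.brk a c) b))
    (jacobi : ∀ a b c : GTerm, F (.brk (.brk a b) c) +
      sg K (a.deg * (b.deg + c.deg)) • F (.brk (.brk b c) a) +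
        sg K (c.deg * (a.deg + b.deg)) • F (.brk (.brk c a) b) = 0)
    (mulL : ∀ t, ∃ L : M × FreeG K →ₗ[K] M, ∀ s, F (.mul t s) = L (F s, cls K s))
    (brkL : ∀ t, ∃ L : M × FreeG K →ₗ[K] M, ∀ s, F (.brk t s) = L (F s, cls K s))
    (r : GTerm →₀ K) (hr : GRel K r) : Finsupp.linearCombination K F r = 0 := by
  have key : ∀ (op : GTerm → GTerm) (L : M × FreeG K →ₗ[K] M),
      (∀ s, F (op s) = L (F s, cls K s)) → ∀ r, Finsupp.linearCombination K F
        (Finsupp.lmapDomain K K op r) = L (Finsupp.linearCombination K F r, proj K r) := by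
    intro op L hL r
    induction r using Finsupp.induction_linear with
    | zero => simp only [map_zero, Prod.mk_zero_zero]
    | add r s hr hs => simp only [map_add, ← Prod.mk_add_mk, hr, hs]
    | single t c =>
      rw [Finsupp.lmapDomain_apply, Finsupp.mapDomain_single, Finsupp.linearCombination_single,
        Finsupp.linearCombination_single, proj_single, hL, ← Prod.smul_mk, map_smul]
  induction hr with
  | one_mul a => simp only [map_sub, Finsupp.linearCombination_single, one_smul, one_mul, sub_self]
  | one_brk a => simp only [Finsupp.linearCombination_single, one_smul, one_brk]
  | mul_comm a b =>
    simp only [map_sub, Finsupp.linearCombination_single, one_smul]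
    rw [mul_comm a b, sub_self]
  | brk_comm a b =>
    simp only [map_sub, Finsupp.linearCombination_single, one_smul]
    rw [brk_comm a b, sub_self]
  | assoc a b c => simp only [map_sub, Finsupp.linearCombination_single, one_smul, assoc, sub_self]
  | leibniz a b c =>
    simp only [map_sub, Finsupp.linearCombination_single, one_smul]
    rw [leibniz a b c]
    abel
  | jacobi a b c =>
    simp only [map_add, Finsupp.linearCombination_single, one_smul]
    rw [jacobi a b c]
  | mulL t r hr ih =>
    obtain ⟨L, hL⟩ := mulL t
    rw [key _ L hL, ih, proj_eq_zero hr, Prod.mk_zero_zero, map_zero]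
  | brkL t r hr ih =>
    obtain ⟨L, hL⟩ := brkL t
    rw [key _ L hL, ih, proj_eq_zero hr, Prod.mk_zero_zero, map_zero]

variable {A : Type u} [AddCommGroup A] [Module K A] (G : GAlg K A)

/-- The value of a monomial in an algebra. -/
def GAlg.evT (g : Letter → A) : GTerm → A
  | .one => G.one
  | .lt l => g l
  | .mul s t => G.mul (GAlg.evT g s) (GAlg.evT g t)
  | .brk s t => G.brk (GAlg.evT g s) (GAlg.evT g t)

theorem GAlg.evT_mem {g : Letter → A} (hg : ∀ l, g l ∈ G.gr l.deg) (t : GTerm) :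
    G.evT g t ∈ G.gr t.deg := by
  induction t with
  | one => exact G.one_mem
  | lt l => exact hg l
  | mul s t hs ht => exact G.mul_mem hs ht
  | brk s t hs ht => exact G.brk_mem hs ht

/-- The homomorphism from the free algebra with given values on the generators. -/
def GAlg.ev (g : Letter → A) (hg : ∀ l, g l ∈ G.gr l.deg) : FreeG K →ₗ[K] A :=
  FreeG.lift (G.evT g) (GRel.context (fun a => G.one_mul _) (fun a => G.one_brk _)
    (fun a b => G.mul_comm (G.evT_mem hg a) (G.evT_mem hg b))
    (fun a b => G.brk_comm (G.evT_mem hg a) (G.evT_mem hg b))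
    (fun a b c => G.assoc (G.evT_mem hg a) (G.evT_mem hg b) (G.evT_mem hg c))
    (fun a b c => G.leibniz (G.evT_mem hg a) (G.evT_mem hg b) (G.evT_mem hg c))
    (fun a b c => G.jacobi (G.evT_mem hg a) (G.evT_mem hg b) (G.evT_mem hg c))
    (fun t => ⟨G.mul (G.evT g t) ∘ₗ LinearMap.fst K _ _, fun s => rfl⟩)
    (fun t => ⟨G.brk (G.evT g t) ∘ₗ LinearMap.fst K _ _, fun s => rfl⟩))

/-- Homomorphisms from the free algebra to an algebra. -/
structure GAlg.IsHom (f : FreeG K →ₗ[K] A) : Prop where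
  one : f (cls K .one) = G.one
  mul : ∀ a b, f (FreeG.mul K a b) = G.mul (f a) (f b)
  brk : ∀ a b, f (FreeG.brk K a b) = G.brk (f a) (f b)

theorem FreeG.hom_ext₂ {M : Type*} [AddCommGroup M] [Module K M]
    {f g : FreeG K →ₗ[K] FreeG K →ₗ[K] M}
    (h : ∀ s t, f (cls K s) (cls K t) = g (cls K s) (cls K t)) : f = g :=
  FreeG.hom_ext fun s => FreeG.hom_ext fun t => h s t

variable {G}

theorem GAlg.ev_cls {g : Letter → A} (hg : ∀ l, g l ∈ G.gr l.deg) (t : GTerm) :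
    G.ev g hg (cls K t) = G.evT g t := FreeG.lift_cls _ _ _

theorem GAlg.ev_lt {g : Letter → A} (hg : ∀ l, g l ∈ G.gr l.deg) (l : Letter) :
    G.ev g hg (cls K (.lt l)) = g l := FreeG.lift_cls _ _ _

theorem GAlg.ev_isHom {g : Letter → A} (hg : ∀ l, g l ∈ G.gr l.deg) : G.IsHom (G.ev g hg) where
  one := ev_cls hg _
  mul a b := by
    have : (FreeG.mul K).compr₂ (G.ev g hg) = G.mul.compl₁₂ (G.ev g hg) (G.ev g hg) :=
      FreeG.hom_ext₂ fun s t => by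
        simp only [LinearMap.compr₂_apply, LinearMap.compl₁₂_apply, mul_cls, ev_cls, evT]
    exact LinearMap.congr_fun₂ this a b
  brk a b := by
    have : (FreeG.brk K).compr₂ (G.ev g hg) = G.brk.compl₁₂ (G.ev g hg) (G.ev g hg) :=
      FreeG.hom_ext₂ fun s t => by
        simp only [LinearMap.compr₂_apply, LinearMap.compl₁₂_apply, brk_cls, ev_cls, evT]
    exact LinearMap.congr_fun₂ this a b

end Ev

namespace FreeG

variable {K : Type u} [Field K]

variable (K) in
/-- The homogeneous elements of degree `d` of the free algebra. -/
abbrev gr (d : ℤ) : Submodule K (FreeG K) := wtSub Letter.deg 1 d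

variable (K) in
/-- A generator of the free algebra. -/
abbrev ltr (l : Letter) : FreeG K := cls K (.lt l)

theorem ltr_mem (l : Letter) : ltr K l ∈ gr K l.deg := cls_mem_wtSub _ _ (.lt l)

variable (K) in
/-- The unit of the free algebra. -/
abbrev unit : FreeG K := cls K .one

theorem unit_mul (a : FreeG K) : mul K (unit K) a = a := (freeGAlg K).one_mul a

theorem unit_brk (a : FreeG K) : brk K (unit K) a = 0 := (freeGAlg K).one_brk a

theorem unit_mem : unit K ∈ gr K 0 := (freeGAlg K).one_mem

section
variable {i j k : ℤ} {a b c : FreeG K}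

theorem mul_mem (ha : a ∈ gr K i) (hb : b ∈ gr K j) : mul K a b ∈ gr K (i + j) :=
  mul_mem_wt ha hb

theorem brk_mem (ha : a ∈ gr K i) (hb : b ∈ gr K j) : brk K a b ∈ gr K (i + j + 1) :=
  brk_mem_wt ha hb

theorem mul_comm (ha : a ∈ gr K i) (hb : b ∈ gr K j) : mul K a b = sg K (i * j) • mul K b a :=
  (freeGAlg K).mul_comm ha hb

theorem brk_comm (ha : a ∈ gr K i) (hb : b ∈ gr K j) : brk K a b = sg K (i * j) • brk K b a :=
  (freeGAlg K).brk_comm ha hb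

theorem assoc (ha : a ∈ gr K i) (hb : b ∈ gr K j) (hc : c ∈ gr K k) :
    mul K (mul K a b) c = mul K a (mul K b c) :=
  (freeGAlg K).assoc ha hb hc

theorem leibniz (ha : a ∈ gr K i) (hb : b ∈ gr K j) (hc : c ∈ gr K k) :
    brk K (mul K a b) c = sg K i • mul K a (brk K b c) + sg K (j * k) • mul K (brk K a c) b :=
  (freeGAlg K).leibniz ha hb hc

theorem jacobi (ha : a ∈ gr K i) (hb : b ∈ gr K j) (hc : c ∈ gr K k) :
    brk K (brk K a b) c + sg K (i * (j + k)) • brk K (brk K b c) a +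
      sg K (k * (i + j)) • brk K (brk K c a) b = 0 :=
  (freeGAlg K).jacobi ha hb hc

end

/-- Bilinear operations, depending on the degree of the first argument, which may occur as the
deviation of an operator of degree `s` from a derivation. -/
structure Cochain (s : ℤ) (cm cl : ℤ → FreeG K →ₗ[K] FreeG K →ₗ[K] FreeG K) : Prop where
  one_m : ∀ a, cm 0 (unit K) a = 0
  one_l : ∀ a, cl 0 (unit K) a = 0
  mem_m : ∀ {i j : ℤ} {a b : FreeG K}, a ∈ gr K i → b ∈ gr K j → cm i a b ∈ gr K (i + j + s)
  mem_l : ∀ {i j : ℤ} {a b : FreeG K}, a ∈ gr K i → b ∈ gr K j → cl i a b ∈ gr K (i + j + 1 + s)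
  comm_m : ∀ {i j : ℤ} {a b : FreeG K}, a ∈ gr K i → b ∈ gr K j →
    cm i a b = sg K (i * j) • cm j b a
  comm_l : ∀ {i j : ℤ} {a b : FreeG K}, a ∈ gr K i → b ∈ gr K j →
    cl i a b = sg K (i * j) • cl j b a
  assoc : ∀ {i j k : ℤ} {a b c : FreeG K}, a ∈ gr K i → b ∈ gr K j → c ∈ gr K k →
    mul K (cm i a b) c + cm (i + j) (mul K a b) c =
      sg K (s * i) • mul K a (cm j b c) + cm i a (mul K b c)
  leibniz : ∀ {i j k : ℤ} {a b c : FreeG K}, a ∈ gr K i → b ∈ gr K j → c ∈ gr K k →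
    sg K s • brk K (cm i a b) c + cl (i + j) (mul K a b) c =
      sg K i • (sg K (s * i) • mul K a (cl j b c) + cm i a (brk K b c)) +
        sg K (j * k) • (mul K (cl i a c) b + cm (i + k + 1) (brk K a c) b)
  jacobi : ∀ {i j k : ℤ} {a b c : FreeG K}, a ∈ gr K i → b ∈ gr K j → c ∈ gr K k →
    (sg K s • brk K (cl i a b) c + cl (i + j + 1) (brk K a b) c) +
      sg K (i * (j + k)) • (sg K s • brk K (cl j b c) a + cl (j + k + 1) (brk K b c) a) +
      sg K (k * (i + j)) • (sg K s • brk K (cl k c a) b + cl (k + i + 1) (brk K c a) b) = 0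

/-- Operators of degree `s` which are derivations up to given bilinear operations. -/
structure IsOp (s : ℤ) (cm cl : ℤ → FreeG K →ₗ[K] FreeG K →ₗ[K] FreeG K)
    (δ : FreeG K →ₗ[K] FreeG K) : Prop where
  one : δ (unit K) = 0
  mul : ∀ {i : ℤ} {a : FreeG K} (b : FreeG K), a ∈ gr K i →
    δ (mul K a b) = mul K (δ a) b + sg K (s * i) • mul K a (δ b) + cm i a b
  brk : ∀ {i : ℤ} {a : FreeG K} (b : FreeG K), a ∈ gr K i →
    δ (brk K a b) = sg K s • (brk K (δ a) b + sg K (s * i) • brk K a (δ b)) + cl i a b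

/-- The values of an operator on monomials. -/
def opT (s : ℤ) (cm cl : ℤ → FreeG K →ₗ[K] FreeG K →ₗ[K] FreeG K) (g : Letter → FreeG K) :
    GTerm → FreeG K
  | .one => 0
  | .lt l => g l
  | .mul a b => mul K (opT s cm cl g a) (cls K b) +
      sg K (s * a.deg) • mul K (cls K a) (opT s cm cl g b) + cm a.deg (cls K a) (cls K b)
  | .brk a b => sg K s • (brk K (opT s cm cl g a) (cls K b) +
      sg K (s * a.deg) • brk K (cls K a) (opT s cm cl g b)) + cl a.deg (cls K a) (cls K b)

theorem mem_gr {i j : ℤ} {a : FreeG K} (ha : a ∈ gr K i) (h : i = j) : a ∈ gr K j := h ▸ ha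

set_option maxHeartbeats 2000000 in
theorem exists_isOp {s : ℤ} {cm cl : ℤ → FreeG K →ₗ[K] FreeG K →ₗ[K] FreeG K}
    (hc : Cochain s cm cl) (g : Letter → FreeG K) (hg : ∀ l, g l ∈ gr K (l.deg + s)) :
    ∃ δ, IsOp s cm cl δ ∧ ∀ l, δ (ltr K l) = g l := by
  have hcl : ∀ t : GTerm, cls K t ∈ gr K t.deg := fun t => cls_mem_wtSub _ _ t
  have hF : ∀ t : GTerm, opT s cm cl g t ∈ gr K (t.deg + s) := by
    intro t
    induction t with
    | one => exact zero_mem _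
    | lt l => exact hg l
    | mul a b ha hb =>
      refine add_mem (add_mem ?_ (Submodule.smul_mem _ _ ?_)) ?_
      · exact mem_gr (mul_mem ha (hcl b)) (by rw [GTerm.deg_mul]; ring)
      · exact mem_gr (mul_mem (hcl a) hb) (by rw [GTerm.deg_mul]; ring)
      · exact hc.mem_m (hcl a) (hcl b)
    | brk a b ha hb =>
      refine add_mem (Submodule.smul_mem _ _ (add_mem ?_ (Submodule.smul_mem _ _ ?_))) ?_
      · exact mem_gr (brk_mem ha (hcl b)) (by rw [GTerm.deg_brk]; ring)
      · exact mem_gr (brk_mem (hcl a) hb) (by rw [GTerm.deg_brk]; ring)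
      · exact hc.mem_l (hcl a) (hcl b)
  set F := opT s cm cl g with hFdef
  have hFm : ∀ a b : GTerm, F (.mul a b) = mul K (F a) (cls K b) +
      sg K (s * a.deg) • mul K (cls K a) (F b) + cm a.deg (cls K a) (cls K b) := fun _ _ => rfl
  have hFb : ∀ a b : GTerm, F (.brk a b) = sg K s • (brk K (F a) (cls K b) +
      sg K (s * a.deg) • brk K (cls K a) (F b)) + cl a.deg (cls K a) (cls K b) := fun _ _ => rfl
  have hrel : ∀ r, GRel K r → Finsupp.linearCombination K F r = 0 := by
    refine GRel.context ?_ ?_ ?_ ?_ ?_ ?_ ?_ ?_ ?_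
    · intro a
      have e : GTerm.one.deg = 0 := rfl
      have e' : F .one = 0 := rfl
      rw [hFm, e', e, hc.one_m, map_zero, LinearMap.zero_apply, unit_mul]
      simp
    · intro a
      have e : GTerm.one.deg = 0 := rfl
      have e' : F .one = 0 := rfl
      rw [hFb, e', e, hc.one_l, map_zero, LinearMap.zero_apply, unit_brk]
      simp
    · intro a b
      rw [hFm, hFm, hc.comm_m (hcl a) (hcl b), mul_comm (hF a) (hcl b), mul_comm (hcl a) (hF b)]
      rcases sg_parity K a.deg with ⟨h1, h2⟩ | ⟨h1, h2⟩ <;>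
      rcases sg_parity K b.deg with ⟨h3, h4⟩ | ⟨h3, h4⟩ <;>
      rcases sg_parity K s with ⟨h5, h6⟩ | ⟨h5, h6⟩ <;>
      simp only [mul_add, add_mul, sg_add, h1, h2, h3, h4, h5, h6] <;> module
    · intro a b
      rw [hFb, hFb, hc.comm_l (hcl a) (hcl b), brk_comm (hF a) (hcl b), brk_comm (hcl a) (hF b)]
      rcases sg_parity K a.deg with ⟨h1, h2⟩ | ⟨h1, h2⟩ <;>
      rcases sg_parity K b.deg with ⟨h3, h4⟩ | ⟨h3, h4⟩ <;>
      rcases sg_parity K s with ⟨h5, h6⟩ | ⟨h5, h6⟩ <;>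
      simp only [mul_add, add_mul, sg_add, h1, h2, h3, h4, h5, h6] <;> module
    · intro a b c
      have h0 := hc.assoc (hcl a) (hcl b) (hcl c)
      simp only [hFm, map_add, map_smul, LinearMap.add_apply, LinearMap.smul_apply, GTerm.deg_mul,
        ← mul_cls]
      rw [assoc (hF a) (hcl b) (hcl c), assoc (hcl a) (hF b) (hcl c), assoc (hcl a) (hcl b) (hF c)]
      rw [← sub_eq_zero] at h0 ⊢
      rw [← h0, mul_add, sg_add]
      module
    · intro a b c
      have h0 := hc.leibniz (hcl a) (hcl b) (hcl c)
      simp only [hFm, hFb, map_add, map_smul, LinearMap.add_apply, LinearMap.smul_apply,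
        GTerm.deg_mul, GTerm.deg_brk, ← mul_cls, ← brk_cls]
      rw [leibniz (hF a) (hcl b) (hcl c), leibniz (hcl a) (hF b) (hcl c),
        leibniz (hcl a) (hcl b) (hF c)]
      rw [← sub_eq_zero] at h0 ⊢
      rw [← h0]
      rcases sg_parity K a.deg with ⟨h1, h2⟩ | ⟨h1, h2⟩ <;>
      rcases sg_parity K b.deg with ⟨h3, h4⟩ | ⟨h3, h4⟩ <;>
      rcases sg_parity K c.deg with ⟨h7, h8⟩ | ⟨h7, h8⟩ <;>
      rcases sg_parity K s with ⟨h5, h6⟩ | ⟨h5, h6⟩ <;>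
      simp only [mul_add, add_mul, sg_add, sg_one, mul_one, h1, h2, h3, h4, h5, h6, h7, h8] <;>
      module
    · intro a b c
      have h0 := hc.jacobi (hcl a) (hcl b) (hcl c)
      have j1 := jacobi (hF a) (hcl b) (hcl c)
      have j2 := jacobi (hcl a) (hF b) (hcl c)
      have j3 := jacobi (hcl a) (hcl b) (hF c)
      simp only [hFb, map_add, map_smul, LinearMap.add_apply, LinearMap.smul_apply,
        GTerm.deg_mul, GTerm.deg_brk, ← mul_cls, ← brk_cls]
      have h0' := congrArg₂ (· + ·) h0 (congrArg₂ (· + ·) j1 (congrArg₂ (· + ·)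
        (congrArg (sg K (s * a.deg) • ·) j2)
          (congrArg (sg K (s * (a.deg + b.deg)) • ·) j3)))
      simp only [smul_zero, add_zero] at h0'
      rw [← h0']
      rcases sg_parity K a.deg with ⟨h1, h2⟩ | ⟨h1, h2⟩ <;>
      rcases sg_parity K b.deg with ⟨h3, h4⟩ | ⟨h3, h4⟩ <;>
      rcases sg_parity K c.deg with ⟨h7, h8⟩ | ⟨h7, h8⟩ <;>
      rcases sg_parity K s with ⟨h5, h6⟩ | ⟨h5, h6⟩ <;>
      simp only [mul_add, add_mul, sg_add, sg_one, mul_one, h1, h2, h3, h4, h5, h6, h7, h8] <;>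
      module
    · intro t
      refine ⟨LinearMap.coprod (sg K (s * t.deg) • mul K (cls K t))
        (mul K (F t) + cm t.deg (cls K t)), fun a => ?_⟩
      rw [hFm, LinearMap.coprod_apply, LinearMap.smul_apply, LinearMap.add_apply]
      abel
    · intro t
      refine ⟨LinearMap.coprod (sg K s • sg K (s * t.deg) • brk K (cls K t))
        (sg K s • brk K (F t) + cl t.deg (cls K t)), fun a => ?_⟩
      rw [hFb, LinearMap.coprod_apply, LinearMap.smul_apply, LinearMap.add_apply,
        LinearMap.smul_apply, LinearMap.smul_apply]
      module
  refine ⟨FreeG.lift F hrel, ⟨lift_cls _ _ _, ?_, ?_⟩, fun l => lift_cls _ _ _⟩ <;>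
    set δ := FreeG.lift F hrel <;> have hδ : ∀ t, δ (cls K t) = F t := lift_cls _ _ <;>
    intro i a b ha
  · have h1 : ∀ t : GTerm, t.deg = i → δ ∘ₗ mul K (cls K t) = mul K (δ (cls K t)) +
        sg K (s * i) • (mul K (cls K t) ∘ₗ δ) + cm i (cls K t) := fun t ht =>
      hom_ext fun u => by
        simp only [LinearMap.comp_apply, LinearMap.add_apply, LinearMap.smul_apply, mul_cls, hδ,
          hFm, ht]
    have h : gr K i ≤ LinearMap.ker (δ ∘ₗ (mul K).flip b - ((mul K).flip b ∘ₗ δ +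
        sg K (s * i) • (mul K).flip (δ b) + (cm i).flip b)) := wtSub_le fun t ht => by
      rw [LinearMap.mem_ker, LinearMap.sub_apply, sub_eq_zero]
      exact LinearMap.congr_fun (h1 t ht) b
    exact sub_eq_zero.1 (h ha)
  · have h1 : ∀ t : GTerm, t.deg = i → δ ∘ₗ brk K (cls K t) = sg K s • (brk K (δ (cls K t)) +
        sg K (s * i) • (brk K (cls K t) ∘ₗ δ)) + cl i (cls K t) := fun t ht =>
      hom_ext fun u => by
        simp only [LinearMap.comp_apply, LinearMap.add_apply, LinearMap.smul_apply, brk_cls, hδ,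
          hFb, ht]
    have h : gr K i ≤ LinearMap.ker (δ ∘ₗ (brk K).flip b - (sg K s • ((brk K).flip b ∘ₗ δ +
        sg K (s * i) • (brk K).flip (δ b)) + (cl i).flip b)) := wtSub_le fun t ht => by
      rw [LinearMap.mem_ker, LinearMap.sub_apply, sub_eq_zero]
      exact LinearMap.congr_fun (h1 t ht) b
    exact sub_eq_zero.1 (h ha)

end FreeG

end OperadTw

namespace OperadTw

namespace FreeG

variable {K : Type u} [Field K]

/-! ### Derivations, the operator `Δ`, and products of derivations -/

/-- Derivations of degree `s`. -/
abbrev IsDer (s : ℤ) (δ : FreeG K →ₗ[K] FreeG K) : Prop := IsOp s (fun _ => 0) (fun _ => 0) δ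

/-- Maps of degree `s`. -/
def Shift (s : ℤ) (δ : FreeG K →ₗ[K] FreeG K) : Prop :=
  ∀ {i : ℤ} {a : FreeG K}, a ∈ gr K i → δ a ∈ gr K (i + s)

/-- The deviation from a derivation of the product of two derivations of degrees `0` and `q`. -/
def rhoC (q : ℤ) (δ₁ δ₂ : FreeG K →ₗ[K] FreeG K) (i : ℤ) :
    FreeG K →ₗ[K] FreeG K →ₗ[K] FreeG K :=
  (mul K).compl₁₂ δ₂ δ₁ + sg K (q * i) • (mul K).compl₁₂ δ₁ δ₂

theorem rhoC_apply (q : ℤ) (δ₁ δ₂ : FreeG K →ₗ[K] FreeG K) (i : ℤ) (a b : FreeG K) :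
    rhoC q δ₁ δ₂ i a b = mul K (δ₂ a) (δ₁ b) + sg K (q * i) • mul K (δ₁ a) (δ₂ b) := rfl

/-- Operators obtained from the coefficient `μ ∘ (δ₁ ⊗ δ₂)` of the bracket. -/
abbrev IsRho (q : ℤ) (δ₁ δ₂ ρ : FreeG K →ₗ[K] FreeG K) : Prop :=
  IsOp (q - 1) (fun _ => 0) (rhoC q δ₁ δ₂) ρ

theorem IsOp.mem_wt {s : ℤ} {cm cl : ℤ → FreeG K →ₗ[K] FreeG K →ₗ[K] FreeG K}
    {δ : FreeG K →ₗ[K] FreeG K} (h : IsOp s cm cl δ) {Γ : Type} [AddCommMonoid Γ]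
    {g : Letter → Γ} {b e : Γ} (hl : ∀ l, δ (ltr K l) ∈ wtSub g b (g l + e))
    (hm : ∀ {i : ℤ} {c d : Γ} {u v : FreeG K}, u ∈ wtSub g b c → v ∈ wtSub g b d →
      cm i u v ∈ wtSub g b (c + d + e))
    (hb : ∀ {i : ℤ} {c d : Γ} {u v : FreeG K}, u ∈ wtSub g b c → v ∈ wtSub g b d →
      cl i u v ∈ wtSub g b (c + d + b + e))
    {c : Γ} {v : FreeG K} (hv : v ∈ wtSub g b c) : δ v ∈ wtSub g b (c + e) := by
  have key : ∀ t : GTerm, δ (cls K t) ∈ wtSub g b (t.wt g b + e) := by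
    intro t
    induction t with
    | one => rw [h.one]; exact zero_mem _
    | lt l => exact hl l
    | mul s t hs ht =>
      rw [← mul_cls, h.mul _ (cls_mem_wtSub _ _ s)]
      refine add_mem (add_mem ?_ (Submodule.smul_mem _ _ ?_))
        (hm (cls_mem_wtSub _ _ s) (cls_mem_wtSub _ _ t))
      · convert mul_mem_wt hs (cls_mem_wtSub g b t) using 1
        simp only [GTerm.wt]; abel_nf
      · convert mul_mem_wt (cls_mem_wtSub g b s) ht using 1
        simp only [GTerm.wt]; abel_nf
    | brk s t hs ht =>
      rw [← brk_cls, h.brk _ (cls_mem_wtSub _ _ s)]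
      refine add_mem (Submodule.smul_mem _ _ (add_mem ?_ (Submodule.smul_mem _ _ ?_)))
        (hb (cls_mem_wtSub _ _ s) (cls_mem_wtSub _ _ t))
      · convert brk_mem_wt hs (cls_mem_wtSub g b t) using 1
        simp only [GTerm.wt]; abel_nf
      · convert brk_mem_wt (cls_mem_wtSub g b s) ht using 1
        simp only [GTerm.wt]; abel_nf
  have h' : wtSub g b c ≤ (wtSub g b (c + e)).comap δ := wtSub_le fun t ht => by
    rw [← ht]; exact key t
  exact h' hv

theorem IsOp.mem_wt_der {s : ℤ} {δ : FreeG K →ₗ[K] FreeG K} (h : IsDer s δ)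
    {Γ : Type} [AddCommMonoid Γ] {g : Letter → Γ} {b e : Γ}
    (hl : ∀ l, δ (ltr K l) ∈ wtSub g b (g l + e)) {c : Γ} {v : FreeG K} (hv : v ∈ wtSub g b c) :
    δ v ∈ wtSub g b (c + e) :=
  h.mem_wt hl (fun _ _ => zero_mem _) (fun _ _ => zero_mem _) hv

theorem IsOp.mem_wt_rho {q : ℤ} {δ₁ δ₂ ρ : FreeG K →ₗ[K] FreeG K} (h : IsRho q δ₁ δ₂ ρ)
    {Γ : Type} [AddCommMonoid Γ] {g : Letter → Γ} {b e₁ e₂ e : Γ} (he : e₁ + e₂ = b + e)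
    (h₁ : ∀ {c : Γ} {v : FreeG K}, v ∈ wtSub g b c → δ₁ v ∈ wtSub g b (c + e₁))
    (h₂ : ∀ {c : Γ} {v : FreeG K}, v ∈ wtSub g b c → δ₂ v ∈ wtSub g b (c + e₂))
    (hl : ∀ l, ρ (ltr K l) = 0) {c : Γ} {v : FreeG K} (hv : v ∈ wtSub g b c) :
    ρ v ∈ wtSub g b (c + e) := by
  refine h.mem_wt (fun l => by rw [hl]; exact zero_mem _) (fun _ _ => zero_mem _) ?_ hv
  intro i c d u v hu hv
  rw [rhoC_apply]
  refine add_mem ?_ (Submodule.smul_mem _ _ ?_)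
  · convert mul_mem_wt (h₂ hu) (h₁ hv) using 1
    rw [add_assoc, ← he]; abel_nf
  · convert mul_mem_wt (h₁ hu) (h₂ hv) using 1
    rw [add_assoc, ← he]; abel_nf

theorem IsOp.shift_der {s : ℤ} {δ : FreeG K →ₗ[K] FreeG K} (h : IsDer s δ)
    (hl : ∀ l, δ (ltr K l) ∈ gr K (l.deg + s)) : Shift s δ := fun ha => h.mem_wt_der hl ha

theorem exists_isDer {s : ℤ} (g : Letter → FreeG K) (hg : ∀ l, g l ∈ gr K (l.deg + s)) :
    ∃ δ, IsDer s δ ∧ Shift s δ ∧ ∀ l, δ (ltr K l) = g l := by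
  obtain ⟨δ, h, hl⟩ := exists_isOp (s := s) (cm := fun _ => (0 : FreeG K →ₗ[K] _))
    (cl := fun _ => (0 : FreeG K →ₗ[K] _))
    ⟨fun _ => rfl, fun _ => rfl, fun _ _ => zero_mem _, fun _ _ => zero_mem _,
      fun _ _ => by simp, fun _ _ => by simp, fun _ _ _ => by simp, fun _ _ _ => by simp,
      fun _ _ _ => by simp⟩ g hg
  exact ⟨δ, h, h.shift_der fun l => by rw [hl]; exact hg l, hl⟩

section Rho

variable {q : ℤ} {δ₁ δ₂ : FreeG K →ₗ[K] FreeG K}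

set_option maxHeartbeats 2000000 in
theorem exists_isRho (h₁ : IsDer 0 δ₁) (s₁ : Shift 0 δ₁) (h₂ : IsDer q δ₂) (s₂ : Shift q δ₂) :
    ∃ ρ, IsRho q δ₁ δ₂ ρ ∧ Shift (q - 1) ρ ∧ ∀ l, ρ (ltr K l) = 0 := by
  have s₁' : ∀ {i : ℤ} {a : FreeG K}, a ∈ gr K i → δ₁ a ∈ gr K i := fun ha =>
    mem_gr (s₁ ha) (add_zero _)
  have hc : Cochain (q - 1) (fun _ => (0 : FreeG K →ₗ[K] _)) (rhoC q δ₁ δ₂) := by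
    refine ⟨fun _ => rfl, fun a => ?_, fun _ _ => zero_mem _, fun {i j a b} ha hb => ?_,
      fun _ _ => by simp, fun {i j a b} ha hb => ?_, fun _ _ _ => by simp,
      fun {i j k a b c} ha hb hc => ?_, fun {i j k a b c} ha hb hc => ?_⟩
    · simp only [rhoC_apply, h₁.one, h₂.one, map_zero, LinearMap.zero_apply, smul_zero, add_zero]
    · rw [rhoC_apply]
      exact add_mem (mem_gr (mul_mem (s₂ ha) (s₁' hb)) (by ring))
        (Submodule.smul_mem _ _ (mem_gr (mul_mem (s₁' ha) (s₂ hb)) (by ring)))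
    · rw [rhoC_apply, rhoC_apply, mul_comm (s₂ ha) (s₁' hb), mul_comm (s₁' ha) (s₂ hb)]
      rcases sg_parity K i with ⟨h1, h2⟩ | ⟨h1, h2⟩ <;>
      rcases sg_parity K j with ⟨h3, h4⟩ | ⟨h3, h4⟩ <;>
      rcases sg_parity K q with ⟨h5, h6⟩ | ⟨h5, h6⟩ <;>
      simp only [mul_add, add_mul, sg_add, h1, h2, h3, h4, h5, h6] <;> module
    · simp only [rhoC_apply, h₁.mul _ ha, h₂.mul _ ha, map_add, map_smul, LinearMap.add_apply,
        LinearMap.smul_apply, LinearMap.zero_apply, map_zero, smul_zero, add_zero, zero_add]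
      rw [assoc (s₂ ha) hb (s₁' hc), assoc ha (s₂ hb) (s₁' hc), assoc ha (s₁' hb) (s₂ hc),
        assoc (s₁' ha) hb (s₂ hc), assoc (s₂ ha) (s₁' hc) hb, assoc (s₁' ha) (s₂ hc) hb,
        mul_comm hb (s₁' hc), mul_comm hb (s₂ hc)]
      rcases sg_parity K i with ⟨h1, h2⟩ | ⟨h1, h2⟩ <;>
      rcases sg_parity K j with ⟨h3, h4⟩ | ⟨h3, h4⟩ <;>
      rcases sg_parity K k with ⟨h7, h8⟩ | ⟨h7, h8⟩ <;>
      rcases sg_parity K q with ⟨h5, h6⟩ | ⟨h5, h6⟩ <;>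
      simp only [mul_add, add_mul, sub_mul, mul_sub, sg_sub, sg_add, sg_one, sg_zero, zero_mul,
        mul_zero, one_mul, mul_one, h1, h2, h3, h4, h5, h6, h7, h8, map_smul, smul_add] <;> module
    · have E : ∀ {i j k : ℤ} {a b c : FreeG K}, a ∈ gr K i → b ∈ gr K j → c ∈ gr K k →
          sg K (q - 1) • brk K (rhoC q δ₁ δ₂ i a b) c + rhoC q δ₁ δ₂ (i + j + 1) (brk K a b) c =
          sg K (q - 1) • ((sg K ((i + q) + (i + q) * (j + k + 1)) •
            mul K (brk K (δ₁ b) c) (δ₂ a) + sg K (j * k) • mul K (brk K (δ₂ a) c) (δ₁ b)) +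
            sg K (q * i) • (sg K (i + i * (j + q + k + 1)) • mul K (brk K (δ₂ b) c) (δ₁ a) +
              sg K ((j + q) * k) • mul K (brk K (δ₁ a) c) (δ₂ b))) +
          (sg K q • (mul K (brk K (δ₂ a) b) (δ₁ c) +
            sg K (q * i + i * (j + q)) • mul K (brk K (δ₂ b) a) (δ₁ c)) +
          sg K (q * (i + j + 1)) • (mul K (brk K (δ₁ a) b) (δ₂ c) +
            sg K (i * j) • mul K (brk K (δ₁ b) a) (δ₂ c))) := by
        intro i j k a b c ha hb hc
        simp only [rhoC_apply, h₁.brk _ ha, h₂.brk _ ha, map_add, map_smul, LinearMap.add_apply,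
          LinearMap.smul_apply, LinearMap.zero_apply, map_zero, smul_zero, add_zero, zero_add]
        rw [leibniz (s₂ ha) (s₁' hb) hc, leibniz (s₁' ha) (s₂ hb) hc,
          mul_comm (s₂ ha) (brk_mem (s₁' hb) hc), mul_comm (s₁' ha) (brk_mem (s₂ hb) hc),
          brk_comm ha (s₂ hb), brk_comm ha (s₁' hb)]
        simp only [sg_add, sg_zero, zero_mul, map_smul, LinearMap.smul_apply]
        module
      rw [E ha hb hc, E hb hc ha, E hc ha hb]
      rcases sg_parity K i with ⟨h1, h2⟩ | ⟨h1, h2⟩ <;>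
      rcases sg_parity K j with ⟨h3, h4⟩ | ⟨h3, h4⟩ <;>
      rcases sg_parity K k with ⟨h7, h8⟩ | ⟨h7, h8⟩ <;>
      rcases sg_parity K q with ⟨h5, h6⟩ | ⟨h5, h6⟩ <;>
      simp only [mul_add, add_mul, sub_mul, mul_sub, sg_sub, sg_add, sg_one, sg_zero, zero_mul,
        mul_zero, one_mul, mul_one, h1, h2, h3, h4, h5, h6, h7, h8, map_smul, smul_add] <;> module
  obtain ⟨ρ, h, hl⟩ := exists_isOp hc (fun _ => 0) fun _ => zero_mem _
  exact ⟨ρ, h, fun ha => h.mem_wt_rho (b := 1) (e₁ := 0) (e₂ := q) (by ring) s₁ s₂ hl ha, hl⟩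

end Rho

section
variable {i j k : ℤ} {a b c : FreeG K}

theorem leibniz' (ha : a ∈ gr K i) (hb : b ∈ gr K j) (hc : c ∈ gr K k) :
    brk K a (mul K b c) = mul K (brk K a b) c + sg K ((i + 1) * j) • mul K b (brk K a c) := by
  rw [brk_comm ha (mul_mem hb hc), leibniz hb hc ha, brk_comm hc ha, brk_comm hb ha]
  rcases sg_parity K i with ⟨h1, h2⟩ | ⟨h1, h2⟩ <;>
  rcases sg_parity K j with ⟨h3, h4⟩ | ⟨h3, h4⟩ <;>
  rcases sg_parity K k with ⟨h7, h8⟩ | ⟨h7, h8⟩ <;>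
  simp only [mul_add, add_mul, sg_add, one_mul, h1, h2, h3, h4, h7, h8, map_smul,
    LinearMap.smul_apply] <;> module

theorem jacobi' (ha : a ∈ gr K i) (hb : b ∈ gr K j) (hc : c ∈ gr K k) :
    brk K a (brk K b c) = sg K (i + 1) •
      (brk K (brk K a b) c + sg K ((i + 1) * j) • brk K b (brk K a c)) := by
  have h := jacobi ha hb hc
  rw [brk_comm (brk_mem hb hc) ha, brk_comm hc ha, map_smul, LinearMap.smul_apply,
    brk_comm (brk_mem ha hc) hb] at h
  rw [← sub_eq_zero]
  rw [← smul_zero (sg K i), ← h]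
  rcases sg_parity K i with ⟨h1, h2⟩ | ⟨h1, h2⟩ <;>
  rcases sg_parity K j with ⟨h3, h4⟩ | ⟨h3, h4⟩ <;>
  rcases sg_parity K k with ⟨h7, h8⟩ | ⟨h7, h8⟩ <;>
  simp only [mul_add, add_mul, sg_add, sg_one, one_mul, mul_one, h1, h2, h3, h4, h7, h8] <;> module

end

/-- To prove that two linear maps agree it suffices to consider homogeneous elements. -/
theorem hom_ext_gr {M : Type*} [AddCommGroup M] [Module K M] {f g : FreeG K →ₗ[K] M}
    (h : ∀ d, ∀ v ∈ gr K d, f v = g v) : f = g :=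
  hom_ext fun t => h _ _ (cls_mem_wtSub _ _ t)

theorem eq_on_gr {M : Type*} [AddCommGroup M] [Module K M] {f g : FreeG K →ₗ[K] M}
    (h : ∀ d, ∀ v ∈ gr K d, f v = g v) (v : FreeG K) : f v = g v :=
  LinearMap.congr_fun (hom_ext_gr h) v

theorem brk_isDer {i : ℤ} {a : FreeG K} (ha : a ∈ gr K i) : IsDer (i + 1) (brk K a) := by
  refine ⟨?_, fun {j b} c hb => ?_, fun {j b} c hb => ?_⟩
  · rw [brk_comm ha unit_mem, unit_brk, smul_zero]
  · refine eq_on_gr (f := brk K a ∘ₗ mul K b) (g := mul K (brk K a b) +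
      sg K ((i + 1) * j) • mul K b ∘ₗ brk K a + (0 : FreeG K →ₗ[K] _) b) (fun k c hc => ?_) c
    simp only [LinearMap.comp_apply, LinearMap.add_apply, LinearMap.smul_apply, leibniz' ha hb hc,
      LinearMap.zero_apply, add_zero]
  · refine eq_on_gr (f := brk K a ∘ₗ brk K b) (g := sg K (i + 1) • (brk K (brk K a b) +
      sg K ((i + 1) * j) • brk K b ∘ₗ brk K a) + (0 : FreeG K →ₗ[K] _) b) (fun k c hc => ?_) c
    simp only [LinearMap.comp_apply, LinearMap.add_apply, LinearMap.smul_apply, jacobi' ha hb hc,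
      LinearMap.zero_apply, add_zero]

/-! ### Uniqueness -/

/-- All generators occurring in a monomial satisfy `p`. -/
def _root_.OperadTw.GTerm.All (p : Letter → Prop) : GTerm → Prop
  | .one => True
  | .lt l => p l
  | .mul s t => s.All p ∧ t.All p
  | .brk s t => s.All p ∧ t.All p

theorem IsOp.congr_cls {s : ℤ} {cm cl cm' cl' : ℤ → FreeG K →ₗ[K] FreeG K →ₗ[K] FreeG K}
    {δ δ' : FreeG K →ₗ[K] FreeG K} (h : IsOp s cm cl δ) (h' : IsOp s cm' cl' δ')
    (p : Letter → Prop) (hl : ∀ l, p l → δ (ltr K l) = δ' (ltr K l))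
    (hm : ∀ t u : GTerm, t.All p → u.All p →
      cm t.deg (cls K t) (cls K u) = cm' t.deg (cls K t) (cls K u))
    (hb : ∀ t u : GTerm, t.All p → u.All p →
      cl t.deg (cls K t) (cls K u) = cl' t.deg (cls K t) (cls K u))
    {t : GTerm} (ht : t.All p) : δ (cls K t) = δ' (cls K t) := by
  induction t with
  | one => rw [h.one, h'.one]
  | lt l => exact hl l ht
  | mul a b ha hb =>
    rw [← mul_cls, h.mul _ (cls_mem_wtSub _ _ a), h'.mul _ (cls_mem_wtSub _ _ a), ha ht.1, hb ht.2]
    exact congrArg _ (hm a b ht.1 ht.2)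
  | brk a b ha hb' =>
    rw [← brk_cls, h.brk _ (cls_mem_wtSub _ _ a), h'.brk _ (cls_mem_wtSub _ _ a), ha ht.1,
      hb' ht.2]
    exact congrArg _ (hb a b ht.1 ht.2)

theorem IsOp.ext {s : ℤ} {cm cl : ℤ → FreeG K →ₗ[K] FreeG K →ₗ[K] FreeG K}
    {δ δ' : FreeG K →ₗ[K] FreeG K} (h : IsOp s cm cl δ) (h' : IsOp s cm cl δ')
    (hl : ∀ l, δ (ltr K l) = δ' (ltr K l)) : δ = δ' :=
  hom_ext fun t => h.congr_cls h' (fun _ => True) (fun l _ => hl l) (fun _ _ _ _ => rfl)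
    (fun _ _ _ _ => rfl) (by induction t <;> simp_all [GTerm.All])

theorem IsOp.congr_der {s : ℤ} {δ δ' : FreeG K →ₗ[K] FreeG K} (h : IsDer s δ) (h' : IsDer s δ')
    (p : Letter → Prop) (hl : ∀ l, p l → δ (ltr K l) = δ' (ltr K l))
    {t : GTerm} (ht : t.All p) : δ (cls K t) = δ' (cls K t) :=
  h.congr_cls h' p hl (fun _ _ _ _ => rfl) (fun _ _ _ _ => rfl) ht

theorem IsOp.add {s : ℤ} {cm cl cm' cl' : ℤ → FreeG K →ₗ[K] FreeG K →ₗ[K] FreeG K}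
    {δ δ' : FreeG K →ₗ[K] FreeG K} (h : IsOp s cm cl δ) (h' : IsOp s cm' cl' δ') :
    IsOp s (fun i => cm i + cm' i) (fun i => cl i + cl' i) (δ + δ') := by
  refine ⟨by rw [LinearMap.add_apply, h.one, h'.one, add_zero], fun b ha => ?_, fun b ha => ?_⟩ <;>
    simp only [LinearMap.add_apply, h.mul _ ha, h'.mul _ ha, h.brk _ ha,
      h'.brk _ ha, map_add] <;> module

theorem IsOp.smul {s : ℤ} {cm cl : ℤ → FreeG K →ₗ[K] FreeG K →ₗ[K] FreeG K}
    {δ : FreeG K →ₗ[K] FreeG K} (h : IsOp s cm cl δ) (r : K) :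
    IsOp s (fun i => r • cm i) (fun i => r • cl i) (r • δ) := by
  refine ⟨by rw [LinearMap.smul_apply, h.one, smul_zero], fun b ha => ?_, fun b ha => ?_⟩ <;>
    simp only [LinearMap.smul_apply, h.mul _ ha, h.brk _ ha, map_smul] <;> module

/-! ### Commutators -/

set_option maxHeartbeats 1000000 in
theorem IsOp.comm {s t : ℤ} {cm cl cm' cl' : ℤ → FreeG K →ₗ[K] FreeG K →ₗ[K] FreeG K}
    {D δ : FreeG K →ₗ[K] FreeG K} (hD : IsDer t D) (sD : Shift t D) (h : IsOp s cm cl δ)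
    (sδ : Shift s δ)
    (hm : ∀ {i : ℤ} {a : FreeG K} (b : FreeG K), a ∈ gr K i → D (cm i a b) - sg K (s * t) •
      (cm (i + t) (D a) b + sg K (t * i) • cm i a (D b)) = cm' i a b)
    (hl : ∀ {i : ℤ} {a : FreeG K} (b : FreeG K), a ∈ gr K i → D (cl i a b) -
      (sg K (s * t) * sg K t) • (cl (i + t) (D a) b + sg K (t * i) • cl i a (D b)) = cl' i a b) :
    IsOp (s + t) cm' cl' (D ∘ₗ δ - sg K (s * t) • δ ∘ₗ D) := by
  refine ⟨?_, fun {i a} b ha => ?_, fun {i a} b ha => ?_⟩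
  · simp only [LinearMap.sub_apply, LinearMap.comp_apply, LinearMap.smul_apply, h.one, hD.one,
      map_zero, smul_zero, sub_zero]
  · rw [← hm b ha]
    simp only [LinearMap.sub_apply, LinearMap.comp_apply, LinearMap.smul_apply, h.mul _ ha,
      hD.mul _ ha, map_add, map_smul, hD.mul _ (sδ ha), h.mul _ (sD ha), map_sub, map_zero,
      LinearMap.zero_apply]
    rcases sg_parity K i with ⟨h1, h2⟩ | ⟨h1, h2⟩ <;>
    rcases sg_parity K s with ⟨h3, h4⟩ | ⟨h3, h4⟩ <;>
    rcases sg_parity K t with ⟨h5, h6⟩ | ⟨h5, h6⟩ <;>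
    simp only [mul_add, add_mul, sg_add, h1, h2, h3, h4, h5, h6] <;> module
  · rw [← hl b ha]
    simp only [LinearMap.sub_apply, LinearMap.comp_apply, LinearMap.smul_apply, h.brk _ ha,
      hD.brk _ ha, map_add, map_smul, hD.brk _ (sδ ha), h.brk _ (sD ha), map_sub, map_zero,
      LinearMap.zero_apply]
    rcases sg_parity K i with ⟨h1, h2⟩ | ⟨h1, h2⟩ <;>
    rcases sg_parity K s with ⟨h3, h4⟩ | ⟨h3, h4⟩ <;>
    rcases sg_parity K t with ⟨h5, h6⟩ | ⟨h5, h6⟩ <;>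
    simp only [mul_add, add_mul, sg_add, h1, h2, h3, h4, h5, h6] <;> module

theorem IsOp.comm_der {s t : ℤ} {D δ : FreeG K →ₗ[K] FreeG K} (hD : IsDer t D) (sD : Shift t D)
    (h : IsDer s δ) (sδ : Shift s δ) : IsDer (s + t) (D ∘ₗ δ - sg K (s * t) • δ ∘ₗ D) :=
  IsOp.comm hD sD h sδ (fun b ha => by simp) (fun b ha => by simp)

theorem IsOp.comm_rho {q t : ℤ} {D δ₁ δ₂ ρ : FreeG K →ₗ[K] FreeG K} (hD : IsDer t D)
    (sD : Shift t D) (s₁ : Shift 0 δ₁) (s₂ : Shift q δ₂) (hρ : IsRho q δ₁ δ₂ ρ)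
    (sρ : Shift (q - 1) ρ) (hcomm : ∀ v, D (δ₁ v) = δ₁ (D v)) :
    IsRho (q + t) δ₁ (D ∘ₗ δ₂ - sg K (q * t) • δ₂ ∘ₗ D)
      (D ∘ₗ ρ - sg K ((q - 1) * t) • ρ ∘ₗ D) := by
  have h := IsOp.comm (cm' := fun _ => 0) (cl' := rhoC (q + t) δ₁
    (D ∘ₗ δ₂ - sg K (q * t) • δ₂ ∘ₗ D)) hD sD hρ sρ (fun b ha => by simp) ?_
  · rwa [show q - 1 + t = q + t - 1 by ring] at h
  · intro i a b ha
    simp only [rhoC_apply, map_add, map_smul, hD.mul _ (s₂ ha), hD.mul _ (s₁ ha), hcomm,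
      LinearMap.zero_apply, add_zero, LinearMap.sub_apply, LinearMap.comp_apply,
      LinearMap.smul_apply, map_sub]
    rcases sg_parity K i with ⟨h1, h2⟩ | ⟨h1, h2⟩ <;>
    rcases sg_parity K q with ⟨h3, h4⟩ | ⟨h3, h4⟩ <;>
    rcases sg_parity K t with ⟨h5, h6⟩ | ⟨h5, h6⟩ <;>
    simp only [mul_add, add_mul, sub_mul, mul_sub, sg_add, sg_sub, one_mul, mul_one, h1, h2, h3,
      h4, h5, h6] <;> module

/-! ### The operator `Δ` -/

theorem exists_isOp_brk (g : Letter → FreeG K) (hg : ∀ l, g l ∈ gr K (l.deg + 1)) :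
    ∃ δ, IsOp 1 (fun _ => brk K) (fun _ => 0) δ ∧ ∀ l, δ (ltr K l) = g l := by
  refine exists_isOp ⟨unit_brk, fun _ => rfl, brk_mem, fun _ _ => zero_mem _, brk_comm,
    fun _ _ => by simp, fun {i j k a b c} ha hb hc => ?_, fun {i j k a b c} ha hb hc => ?_,
    fun _ _ _ => by simp⟩ g hg
  · rw [leibniz ha hb hc, leibniz' ha hb hc, mul_comm (brk_mem ha hc) hb]
    rcases sg_parity K i with ⟨h1, h2⟩ | ⟨h1, h2⟩ <;>
    rcases sg_parity K j with ⟨h3, h4⟩ | ⟨h3, h4⟩ <;>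
    rcases sg_parity K k with ⟨h7, h8⟩ | ⟨h7, h8⟩ <;>
    simp only [mul_add, add_mul, sg_add, one_mul, mul_one, h1, h2, h3, h4, h7, h8] <;> module
  · rw [jacobi' ha hb hc, brk_comm (brk_mem ha hc) hb]
    simp only [LinearMap.zero_apply, map_zero]
    rcases sg_parity K i with ⟨h1, h2⟩ | ⟨h1, h2⟩ <;>
    rcases sg_parity K j with ⟨h3, h4⟩ | ⟨h3, h4⟩ <;>
    rcases sg_parity K k with ⟨h7, h8⟩ | ⟨h7, h8⟩ <;>
    simp only [mul_add, add_mul, sg_add, sg_one, one_mul, mul_one, h1, h2, h3, h4, h7, h8] <;>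
    module

theorem IsOp.comm_brk {t : ℤ} {D δ : FreeG K →ₗ[K] FreeG K} (hD : IsDer t D) (sD : Shift t D)
    (h : IsOp 1 (fun _ => FreeG.brk K) (fun _ => 0) δ) (sδ : Shift 1 δ) :
    IsDer (1 + t) (D ∘ₗ δ - sg K (1 * t) • δ ∘ₗ D) := by
  refine IsOp.comm hD sD h sδ (fun b ha => ?_) (fun b ha => by simp)
  rw [hD.brk _ ha]
  simp only [LinearMap.zero_apply, one_mul]
  module

end FreeG

end OperadTw

namespace OperadTw

namespace FreeG

variable {K : Type u} [Field K]

/-! ### Derivations given by their values -/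

variable (K) in
abbrev vx (i : ℕ) : FreeG K := ltr K (.x i)

variable (K) in
abbrev vy (i : ℕ) : FreeG K := ltr K (.y i)

variable (K) in
abbrev va : FreeG K := ltr K .al

variable (K) in
abbrev vb : FreeG K := ltr K .be

theorem vx_mem (i : ℕ) : vx K i ∈ gr K 0 := ltr_mem (.x i)

theorem vy_mem (i : ℕ) : vy K i ∈ gr K 1 := ltr_mem (.y i)

theorem va_mem : va K ∈ gr K 0 := ltr_mem .al

theorem vb_mem : vb K ∈ gr K 1 := ltr_mem .be

theorem brk_unit (a : FreeG K) : brk K a (unit K) = 0 := by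
  have : (brk K).flip (unit K) = 0 := hom_ext_gr fun d v hv => by
    rw [LinearMap.flip_apply, brk_comm hv unit_mem, unit_brk, smul_zero, LinearMap.zero_apply]
  exact LinearMap.congr_fun this a

theorem mul_unit (a : FreeG K) : mul K a (unit K) = a := by
  have : (mul K).flip (unit K) = LinearMap.id := hom_ext_gr fun d v hv => by
    rw [LinearMap.flip_apply, mul_comm hv unit_mem, unit_mul, mul_zero, sg_zero, one_smul,
      LinearMap.id_apply]
  exact LinearMap.congr_fun this a

theorem brk_comm_x (i : ℕ) (a : FreeG K) : brk K a (vx K i) = brk K (vx K i) a := by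
  have : (brk K).flip (vx K i) = brk K (vx K i) := hom_ext_gr fun d v hv => by
    rw [LinearMap.flip_apply, brk_comm hv (vx_mem i), mul_zero, sg_zero, one_smul]
  exact LinearMap.congr_fun this a

/-- `δ` is the derivation of degree `s` with the given values on the generators. -/
structure DerV (s : ℤ) (X Y : ℕ → FreeG K) (A B : FreeG K) (δ : FreeG K →ₗ[K] FreeG K) : Prop where
  der : IsDer s δ
  shift : Shift s δ
  x : ∀ i, δ (vx K i) = X i
  y : ∀ i, δ (vy K i) = Y i
  a : δ (va K) = A
  b : δ (vb K) = B

theorem exists_derV {s : ℤ} {X Y : ℕ → FreeG K} {A B : FreeG K} (hX : ∀ i, X i ∈ gr K s)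
    (hY : ∀ i, Y i ∈ gr K (1 + s)) (hA : A ∈ gr K s) (hB : B ∈ gr K (1 + s)) :
    ∃ δ, DerV s X Y A B δ := by
  obtain ⟨δ, h, hs, hl⟩ := exists_isDer (s := s) (fun l => match l with
    | .x i => X i
    | .y i => Y i
    | .al => A
    | .be => B) (by
      rintro (i | i | _ | _)
      · exact mem_gr (hX i) (zero_add _).symm
      · exact hY i
      · exact mem_gr hA (zero_add _).symm
      · exact hB)
  exact ⟨δ, h, hs, fun i => hl _, fun i => hl _, hl _, hl _⟩

namespace DerV

variable {s t : ℤ} {X Y X' Y' : ℕ → FreeG K} {A B A' B' : FreeG K}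
  {δ δ' D : FreeG K →ₗ[K] FreeG K}

theorem brk_x (h : DerV s X Y A B δ) (i : ℕ) (v : FreeG K) :
    δ (brk K (vx K i) v) = sg K s • (brk K (X i) v + brk K (vx K i) (δ v)) := by
  rw [h.der.brk _ (vx_mem i), h.x]; simp

theorem brk_a (h : DerV s X Y A B δ) (v : FreeG K) :
    δ (brk K (va K) v) = sg K s • (brk K A v + brk K (va K) (δ v)) := by
  rw [h.der.brk _ va_mem, h.a]; simp

theorem brk_y (h : DerV s X Y A B δ) (i : ℕ) (v : FreeG K) :
    δ (brk K (vy K i) v) = sg K s • (brk K (Y i) v + sg K s • brk K (vy K i) (δ v)) := by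
  rw [h.der.brk _ (vy_mem i), h.y]; simp

theorem brk_b (h : DerV s X Y A B δ) (v : FreeG K) :
    δ (brk K (vb K) v) = sg K s • (brk K B v + sg K s • brk K (vb K) (δ v)) := by
  rw [h.der.brk _ vb_mem, h.b]; simp

theorem mul_x (h : DerV s X Y A B δ) (i : ℕ) (v : FreeG K) :
    δ (FreeG.mul K (vx K i) v) = FreeG.mul K (X i) v + FreeG.mul K (vx K i) (δ v) := by
  rw [h.der.mul _ (vx_mem i), h.x]; simp

theorem mul_a (h : DerV s X Y A B δ) (v : FreeG K) :
    δ (FreeG.mul K (va K) v) = FreeG.mul K A v + FreeG.mul K (va K) (δ v) := by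
  rw [h.der.mul _ va_mem, h.a]; simp

theorem mul_b (h : DerV s X Y A B δ) (v : FreeG K) :
    δ (FreeG.mul K (vb K) v) = FreeG.mul K B v + sg K s • FreeG.mul K (vb K) (δ v) := by
  rw [h.der.mul _ vb_mem, h.b]; simp

theorem one (h : DerV s X Y A B δ) : δ (unit K) = 0 := h.der.one

theorem comm (hD : DerV t X' Y' A' B' D) (h : DerV s X Y A B δ) :
    DerV (s + t) (fun i => D (X i) - sg K (s * t) • δ (X' i))
      (fun i => D (Y i) - sg K (s * t) • δ (Y' i)) (D A - sg K (s * t) • δ A')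
      (D B - sg K (s * t) • δ B') (D ∘ₗ δ - sg K (s * t) • δ ∘ₗ D) where
  der := hD.der.comm_der hD.shift h.der h.shift
  shift ha := sub_mem (mem_gr (hD.shift (h.shift ha)) (by ring))
    (Submodule.smul_mem _ _ (mem_gr (h.shift (hD.shift ha)) (by ring)))
  x i := by simp [h.x, hD.x]
  y i := by simp [h.y, hD.y]
  a := by simp [h.a, hD.a]
  b := by simp [h.b, hD.b]

theorem add (h : DerV s X Y A B δ) (h' : DerV s X' Y' A' B' δ') :
    DerV s (fun i => X i + X' i) (fun i => Y i + Y' i) (A + A') (B + B') (δ + δ') where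
  der := by simpa using h.der.add h'.der
  shift ha := add_mem (h.shift ha) (h'.shift ha)
  x i := by simp [h.x, h'.x]
  y i := by simp [h.y, h'.y]
  a := by simp [h.a, h'.a]
  b := by simp [h.b, h'.b]

theorem smul (h : DerV s X Y A B δ) (r : K) :
    DerV s (fun i => r • X i) (fun i => r • Y i) (r • A) (r • B) (r • δ) where
  der := by simpa using h.der.smul r
  shift ha := Submodule.smul_mem _ _ (h.shift ha)
  x i := by simp [h.x]
  y i := by simp [h.y]
  a := by simp [h.a]
  b := by simp [h.b]

theorem ext (h : DerV s X Y A B δ) (h' : DerV s X' Y' A' B' δ') (hx : ∀ i, X i = X' i)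
    (hy : ∀ i, Y i = Y' i) (ha : A = A') (hb : B = B') : δ = δ' :=
  h.der.ext h'.der (by
    rintro (i | i | _ | _)
    · rw [h.x, h'.x, hx]
    · rw [h.y, h'.y, hy]
    · rw [h.a, h'.a, ha]
    · rw [h.b, h'.b, hb])

theorem zero : DerV s (fun _ => (0 : FreeG K)) (fun _ => 0) 0 0 0 where
  der := ⟨rfl, fun b ha => by simp, fun b ha => by simp⟩
  shift ha := zero_mem _
  x i := rfl
  y i := rfl
  a := rfl
  b := rfl

theorem sum {ι : Type*} (I : Finset ι) {X Y : ι → ℕ → FreeG K} {A B : ι → FreeG K}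
    {δ : ι → FreeG K →ₗ[K] FreeG K} (h : ∀ k, DerV s (X k) (Y k) (A k) (B k) (δ k)) :
    DerV s (fun i => ∑ k ∈ I, X k i) (fun i => ∑ k ∈ I, Y k i) (∑ k ∈ I, A k) (∑ k ∈ I, B k)
      (∑ k ∈ I, δ k) := by
  classical
  induction I using Finset.induction_on with
  | empty => simpa using zero
  | insert k I hk ih => simpa [Finset.sum_insert hk] using (h k).add ih

end DerV

/-- An operator `ρ` given by the product of the derivations `δ₁`, `δ₂`, vanishing on the
generators. -/
structure RhoV (q : ℤ) (δ₁ δ₂ ρ : FreeG K →ₗ[K] FreeG K) : Prop where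
  rho : IsRho q δ₁ δ₂ ρ
  shift : Shift (q - 1) ρ
  lt : ∀ l, ρ (ltr K l) = 0

theorem exists_rhoV {q : ℤ} {X Y X' Y' : ℕ → FreeG K} {A B A' B' : FreeG K}
    {δ₁ δ₂ : FreeG K →ₗ[K] FreeG K} (h₁ : DerV 0 X Y A B δ₁) (h₂ : DerV q X' Y' A' B' δ₂) :
    ∃ ρ, RhoV q δ₁ δ₂ ρ := by
  obtain ⟨ρ, h, hs, hl⟩ := exists_isRho h₁.der h₁.shift h₂.der h₂.shift
  exact ⟨ρ, h, hs, hl⟩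

namespace RhoV

variable {q t : ℤ} {δ₁ δ₂ ρ D δ δ₂' ρ' : FreeG K →ₗ[K] FreeG K}
  {X Y X' Y' : ℕ → FreeG K} {A B A' B' : FreeG K}

theorem brk_lt (h : RhoV q δ₁ δ₂ ρ) (l m : Letter) : ρ (brk K (ltr K l) (ltr K m)) =
    mul K (δ₂ (ltr K l)) (δ₁ (ltr K m)) +
      sg K (q * l.deg) • mul K (δ₁ (ltr K l)) (δ₂ (ltr K m)) := by
  rw [h.rho.brk _ (ltr_mem l), h.lt, h.lt, rhoC_apply]
  simp

/-- The commutator with a derivation is determined by its values on the generators. -/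
theorem comm (hD : DerV t X' Y' A' B' D) (h₁ : DerV 0 X Y A B δ₁) (s₂ : Shift q δ₂)
    (h : RhoV q δ₁ δ₂ ρ) (hcomm : ∀ v, D (δ₁ v) = δ₁ (D v))
    (h' : RhoV (q + t) δ₁ (D ∘ₗ δ₂ - sg K (q * t) • δ₂ ∘ₗ D) ρ') :
    DerV (q + t - 1) (fun i => - sg K ((q - 1) * t) • ρ (X' i))
      (fun i => - sg K ((q - 1) * t) • ρ (Y' i)) (- sg K ((q - 1) * t) • ρ A')
      (- sg K ((q - 1) * t) • ρ B') (D ∘ₗ ρ - sg K ((q - 1) * t) • ρ ∘ₗ D - ρ') where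
  der := by
    have h1 := (hD.der.comm_rho hD.shift h₁.shift s₂ h.rho h.shift hcomm).add (h'.rho.smul (-1))
    convert h1 using 1
    · simp
    · funext i
      module
    · module
  shift ha := sub_mem (sub_mem (mem_gr (hD.shift (h.shift ha)) (by ring))
    (Submodule.smul_mem _ _ (mem_gr (h.shift (hD.shift ha)) (by ring)))) (h'.shift ha)
  x i := by simp [h.lt, h'.lt, hD.x]
  y i := by simp [h.lt, h'.lt, hD.y]
  a := by simp [h.lt, h'.lt, hD.a]
  b := by simp [h.lt, h'.lt, hD.b]

theorem congr_cls (h : RhoV q δ₁ δ₂ ρ) (h' : RhoV q δ₁ δ₂' ρ') (d : IsDer q δ₂) (d' : IsDer q δ₂')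
    (p : Letter → Prop) (hl : ∀ l, p l → δ₂ (ltr K l) = δ₂' (ltr K l))
    {t : GTerm} (ht : t.All p) : ρ (cls K t) = ρ' (cls K t) :=
  h.rho.congr_cls h'.rho p (fun l _ => by rw [h.lt, h'.lt]) (fun _ _ _ _ => rfl)
    (fun u v hu hv => by rw [rhoC_apply, rhoC_apply, d.congr_der d' p hl hu, d.congr_der d' p hl hv])
    ht

theorem add (h : RhoV q δ₁ δ₂ ρ) (h' : RhoV q δ₁ δ₂' ρ') : RhoV q δ₁ (δ₂ + δ₂') (ρ + ρ') where
  rho := by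
    convert h.rho.add h'.rho using 1
    · simp
    · funext i
      refine LinearMap.ext₂ fun a b => ?_
      simp only [rhoC_apply, LinearMap.add_apply, map_add, smul_add]
      abel
  shift ha := add_mem (h.shift ha) (h'.shift ha)
  lt l := by simp [h.lt, h'.lt]

theorem zero : RhoV q δ₁ (0 : FreeG K →ₗ[K] FreeG K) 0 where
  rho := ⟨rfl, fun b ha => by simp, fun b ha => by simp [rhoC_apply]⟩
  shift ha := zero_mem _
  lt l := rfl

theorem sum {ι : Type*} (I : Finset ι) {δ₂ ρ : ι → FreeG K →ₗ[K] FreeG K}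
    (h : ∀ k, RhoV q δ₁ (δ₂ k) (ρ k)) : RhoV q δ₁ (∑ k ∈ I, δ₂ k) (∑ k ∈ I, ρ k) := by
  classical
  induction I using Finset.induction_on with
  | empty => simpa using zero
  | insert k I hk ih => simpa [Finset.sum_insert hk] using (h k).add ih

end RhoV

/-! ### Labels -/

/-- The labels occurring in a generator. -/
def lab : Letter → ℕ → ℤ
  | .x i => Pi.single i 1
  | .y i => Pi.single i 1
  | .al => 0
  | .be => 0

/-- The indicator function of a set of labels. -/
def ind (S : Finset ℕ) : ℕ → ℤ := fun i => if i ∈ S then 1 else 0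

variable (K) in
/-- The elements in which each of the labels in `S`, and no other one, occurs exactly once. -/
abbrev lin (S : Finset ℕ) : Submodule K (FreeG K) := wtSub lab 0 (ind S)

theorem lab_nonneg (l : Letter) (j : ℕ) : 0 ≤ lab l j := by
  cases l <;> simp only [lab, Pi.single_apply, Pi.zero_apply, le_refl] <;> split_ifs <;> simp

theorem wt_nonneg (t : GTerm) (j : ℕ) : 0 ≤ t.wt lab 0 j := by
  induction t with
  | one => exact le_rfl
  | lt l => exact lab_nonneg l j
  | mul s t hs ht => exact add_nonneg hs ht
  | brk s t hs ht => exact add_nonneg (add_nonneg hs ht) le_rfl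

theorem all_of_wt {t : GTerm} {j : ℕ} (h : t.wt lab 0 j = 0) : t.All (fun l => lab l j = 0) := by
  induction t with
  | one => trivial
  | lt l => exact h
  | mul s t hs ht =>
    have := wt_nonneg s j
    have := wt_nonneg t j
    have h' : s.wt lab 0 j + t.wt lab 0 j = 0 := h
    exact ⟨hs (by omega), ht (by omega)⟩
  | brk s t hs ht =>
    have := wt_nonneg s j
    have := wt_nonneg t j
    have h' : s.wt lab 0 j + t.wt lab 0 j + 0 = 0 := h
    exact ⟨hs (by omega), ht (by omega)⟩

theorem eq_on_wt {Γ : Type} [AddCommMonoid Γ] {g : Letter → Γ} {b c : Γ} {M : Type*}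
    [AddCommGroup M] [Module K M] {f f' : FreeG K →ₗ[K] M}
    (h : ∀ t : GTerm, t.wt g b = c → f (cls K t) = f' (cls K t)) {v : FreeG K}
    (hv : v ∈ wtSub g b c) : f v = f' v := by
  have : wtSub g b c ≤ LinearMap.eqLocus f f' := wtSub_le h
  exact this hv

theorem GTerm_all_forall {ι : Type*} {p : ι → Letter → Prop} {t : GTerm} (h : ∀ i, t.All (p i)) :
    t.All (fun l => ∀ i, p i l) := by
  induction t with
  | one => trivial
  | lt l => exact h
  | mul s t hs ht => exact ⟨hs fun i => (h i).1, ht fun i => (h i).2⟩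
  | brk s t hs ht => exact ⟨hs fun i => (h i).1, ht fun i => (h i).2⟩

/-- The generators with labels in `S`. -/
def labIn (S : Finset ℕ) (l : Letter) : Prop := ∀ j : {j // j ∉ S}, lab l j = 0

theorem all_of_lin {S : Finset ℕ} {t : GTerm} (h : t.wt lab 0 = ind S) : t.All (labIn S) :=
  GTerm_all_forall fun j => all_of_wt (by rw [h, ind, if_neg j.2])

theorem labIn_x {S : Finset ℕ} {i : ℕ} (h : labIn S (.x i)) : i ∈ S := by
  by_contra hi
  simpa [lab] using h ⟨i, hi⟩

theorem labIn_y {S : Finset ℕ} {i : ℕ} (h : labIn S (.y i)) : i ∈ S := by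
  by_contra hi
  simpa [lab] using h ⟨i, hi⟩

theorem DerV.eq_on_lin {s : ℤ} {X Y X' Y' : ℕ → FreeG K} {A B A' B' : FreeG K}
    {δ δ' : FreeG K →ₗ[K] FreeG K} (h : DerV s X Y A B δ) (h' : DerV s X' Y' A' B' δ')
    {S : Finset ℕ} (hx : ∀ i ∈ S, X i = X' i) (hy : ∀ i ∈ S, Y i = Y' i) (ha : A = A') (hb : B = B') {v : FreeG K}
    (hv : v ∈ lin K S) : δ v = δ' v :=
  eq_on_wt (fun t ht => h.der.congr_der h'.der (labIn S) (by
    rintro (i | i | _ | _) hl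
    · rw [h.x, h'.x, hx i (labIn_x hl)]
    · rw [h.y, h'.y, hy i (labIn_y hl)]
    · rw [h.a, h'.a, ha]
    · rw [h.b, h'.b, hb]) (all_of_lin ht)) hv

theorem RhoV.eq_on_lin {q : ℤ} {X Y X' Y' : ℕ → FreeG K} {A B A' B' : FreeG K}
    {δ₁ δ δ' ρ ρ' : FreeG K →ₗ[K] FreeG K} (hρ : RhoV q δ₁ δ ρ) (hρ' : RhoV q δ₁ δ' ρ')
    (h : DerV q X Y A B δ) (h' : DerV q X' Y' A' B' δ')
    {S : Finset ℕ} (hx : ∀ i ∈ S, X i = X' i) (hy : ∀ i ∈ S, Y i = Y' i) (ha : A = A') (hb : B = B') {v : FreeG K}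
    (hv : v ∈ lin K S) : ρ v = ρ' v :=
  eq_on_wt (fun t ht => hρ.congr_cls hρ' h.der h'.der (labIn S) (by
    rintro (i | i | _ | _) hl
    · rw [h.x, h'.x, hx i (labIn_x hl)]
    · rw [h.y, h'.y, hy i (labIn_y hl)]
    · rw [h.a, h'.a, ha]
    · rw [h.b, h'.b, hb]) (all_of_lin ht)) hv

/-- The product of two derivations which only act on one label vanishes on elements in which this
label occurs only once. -/
theorem RhoV.eq_zero_of_label {q : ℤ} {X Y X' Y' : ℕ → FreeG K}
    {δ₁ δ₂ ρ : FreeG K →ₗ[K] FreeG K} (hρ : RhoV q δ₁ δ₂ ρ)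
    (h₁ : DerV 0 X Y 0 0 δ₁) (h₂ : DerV q X' Y' 0 0 δ₂) {n : ℕ}
    (hx : ∀ i, i ≠ n → X i = 0 ∧ X' i = 0 ∧ Y i = 0 ∧ Y' i = 0) {S : Finset ℕ} {v : FreeG K}
    (hv : v ∈ lin K S) : ρ v = 0 := by
  have h0 : ∀ t : GTerm, t.wt lab 0 n = 0 → δ₁ (cls K t) = 0 ∧ δ₂ (cls K t) = 0 := by
    intro t ht
    have hp : ∀ i : ℕ, (Pi.single i (1 : ℤ) : ℕ → ℤ) n = 0 → i ≠ n := by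
      rintro i hi rfl
      simp at hi
    refine ⟨h₁.der.congr_der DerV.zero.der _ ?_ (all_of_wt ht),
      h₂.der.congr_der DerV.zero.der _ ?_ (all_of_wt ht)⟩ <;>
    rintro (i | i | _ | _) hl
    · rw [h₁.x, (hx i (hp i hl)).1]; rfl
    · rw [h₁.y, (hx i (hp i hl)).2.2.1]; rfl
    · rw [h₁.a]; rfl
    · rw [h₁.b]; rfl
    · rw [h₂.x, (hx i (hp i hl)).2.1]; rfl
    · rw [h₂.y, (hx i (hp i hl)).2.2.2]; rfl
    · rw [h₂.a]; rfl
    · rw [h₂.b]; rfl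
  have key : ∀ t : GTerm, t.wt lab 0 n ≤ 1 → ρ (cls K t) = 0 := by
    intro t ht
    induction t with
    | one => exact hρ.rho.one
    | lt l => exact hρ.lt l
    | mul a b ha hb =>
      have h1 := wt_nonneg a n
      have h2 := wt_nonneg b n
      have h' : a.wt lab 0 n + b.wt lab 0 n ≤ 1 := ht
      rw [← mul_cls, hρ.rho.mul _ (cls_mem_wtSub _ _ a), ha (by omega), hb (by omega)]
      simp
    | brk a b ha hb =>
      have h1 := wt_nonneg a n
      have h2 := wt_nonneg b n
      have h' : a.wt lab 0 n + b.wt lab 0 n + 0 ≤ 1 := ht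
      rw [← brk_cls, hρ.rho.brk _ (cls_mem_wtSub _ _ a), ha (by omega), hb (by omega), rhoC_apply]
      rcases eq_or_ne (a.wt lab 0 n) 0 with h3 | h3
      · simp [h0 a h3]
      · simp [h0 b (by omega)]
  refine eq_on_wt (f' := 0) (fun t ht => key t ?_) hv
  rw [ht, ind]
  split_ifs <;> simp

/-- The Euler derivation of a weight. -/
theorem DerV.euler {δ : FreeG K →ₗ[K] FreeG K} {X Y : ℕ → FreeG K} {A B : FreeG K}
    (h : DerV 0 X Y A B δ) {g : Letter → ℤ}
    (hx : ∀ i, X i = (g (.x i) : K) • vx K i) (hy : ∀ i, Y i = (g (.y i) : K) • vy K i)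
    (ha : A = (g .al : K) • va K) (hb : B = (g .be : K) • vb K) {c : ℤ} {v : FreeG K}
    (hv : v ∈ wtSub g 0 c) : δ v = (c : K) • v := by
  have key : ∀ t : GTerm, δ (cls K t) = ((t.wt g 0 : ℤ) : K) • cls K t := by
    intro t
    induction t with
    | one => rw [h.one]; simp [GTerm.wt]
    | lt l =>
      rcases l with i | i | _ | _
      · rw [h.x, hx]; rfl
      · rw [h.y, hy]; rfl
      · rw [h.a, ha]; rfl
      · rw [h.b, hb]; rfl
    | mul s t hs ht =>
      rw [← mul_cls, h.der.mul _ (cls_mem_wtSub _ _ s), hs, ht]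
      simp only [GTerm.wt, map_smul, LinearMap.smul_apply, LinearMap.zero_apply, zero_mul, sg_zero]
      push_cast
      module
    | brk s t hs ht =>
      rw [← brk_cls, h.der.brk _ (cls_mem_wtSub _ _ s), hs, ht]
      simp only [GTerm.wt, map_smul, LinearMap.smul_apply, LinearMap.zero_apply, zero_mul, sg_zero]
      push_cast
      module
  exact eq_on_wt (f' := (c : K) • LinearMap.id) (fun t ht => by rw [key, ht]; rfl) hv

theorem wtSub_map {Γ Γ' : Type} [AddCommMonoid Γ] [AddCommMonoid Γ'] (f : Γ →+ Γ') {g : Letter → Γ}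
    {b c : Γ} {v : FreeG K} (hv : v ∈ wtSub g b c) :
    v ∈ wtSub (K := K) (fun l => f (g l)) (f b) (f c) := by
  have key : ∀ t : GTerm, t.wt (fun l => f (g l)) (f b) = f (t.wt g b) := by
    intro t
    induction t with
    | one => exact (map_zero f).symm
    | lt l => rfl
    | mul s t hs ht => simp only [GTerm.wt, hs, ht, map_add]
    | brk s t hs ht => simp only [GTerm.wt, hs, ht, map_add]
  have : wtSub g b c ≤ wtSub (K := K) (fun l => f (g l)) (f b) (f c) := wtSub_le fun t ht => by
    rw [← ht, ← key]
    exact cls_mem_wtSub _ _ t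
  exact this hv

end FreeG

end OperadTw

namespace OperadTw

namespace FreeG

variable {K : Type u} [Field K]

/-! ### The differential of the free algebra -/

variable (K) in
theorem sg_neg_one : sg K (-1) = -1 := by rw [sg_neg, sg_one]

/-- The derivation `x ↦ 0`, `y ↦ -[β, x]`, `α ↦ ½ [α, α]`, `β ↦ 0`. -/
abbrev IsDiff (D : FreeG K →ₗ[K] FreeG K) : Prop :=
  DerV 1 (fun _ => 0) (fun i => - brk K (vb K) (vx K i)) ((2⁻¹ : K) • brk K (va K) (va K)) 0 D

theorem brk_mem' {i j k : ℤ} {a b : FreeG K} (ha : a ∈ gr K i) (hb : b ∈ gr K j)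
    (h : i + j + 1 = k) : brk K a b ∈ gr K k := mem_gr (brk_mem ha hb) h

theorem exists_isDiff : ∃ D : FreeG K →ₗ[K] FreeG K, IsDiff D :=
  exists_derV (fun _ => zero_mem _) (fun i => neg_mem (brk_mem' vb_mem (vx_mem i) (by norm_num)))
    (Submodule.smul_mem _ _ (brk_mem' va_mem va_mem (by norm_num))) (zero_mem _)

/-- The family with one nonzero member. -/
def pt (n : ℕ) (v : FreeG K) : ℕ → FreeG K := fun i => if i = n then v else 0

theorem pt_self (n : ℕ) (v : FreeG K) : pt n v n = v := if_pos rfl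

theorem pt_ne {n i : ℕ} (h : i ≠ n) (v : FreeG K) : pt n v i = 0 := if_neg h

theorem pt_mem {n i : ℕ} {v : FreeG K} {N : Submodule K (FreeG K)} (h : v ∈ N) : pt n v i ∈ N := by
  rw [pt]; split_ifs
  · exact h
  · exact zero_mem _

/-- The derivation `x_n ↦ 1`. -/
abbrev IsDel (n : ℕ) (δ : FreeG K →ₗ[K] FreeG K) : Prop :=
  DerV 0 (pt n (unit K)) (fun _ => 0) 0 0 δ

theorem exists_isDel (n : ℕ) : ∃ δ : FreeG K →ₗ[K] FreeG K, IsDel n δ :=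
  exists_derV (fun _ => pt_mem unit_mem) (fun i => zero_mem _) (zero_mem _) (zero_mem _)

theorem DerV.comm_eq {s t : ℤ} {X Y X' Y' : ℕ → FreeG K} {A B A' B' : FreeG K}
    {δ D : FreeG K →ₗ[K] FreeG K} (hD : DerV t X' Y' A' B' D) (h : DerV s X Y A B δ)
    (hx : ∀ i, D (X i) = sg K (s * t) • δ (X' i)) (hy : ∀ i, D (Y i) = sg K (s * t) • δ (Y' i))
    (ha : D A = sg K (s * t) • δ A') (hb : D B = sg K (s * t) • δ B') (v : FreeG K) :
    D (δ v) = sg K (s * t) • δ (D v) := by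
  have h0 := (hD.comm h).ext DerV.zero (fun i => sub_eq_zero.2 (hx i))
    (fun i => sub_eq_zero.2 (hy i)) (sub_eq_zero.2 ha) (sub_eq_zero.2 hb)
  exact sub_eq_zero.1 (LinearMap.congr_fun h0 v)

theorem diff_del {n : ℕ} {D δ : FreeG K →ₗ[K] FreeG K} (hD : IsDiff D) (h : IsDel n δ)
    (v : FreeG K) : D (δ v) = δ (D v) := by
  have := hD.comm_eq h (fun i => by rw [pt]; split_ifs <;> simp [hD.one])
    (fun i => by
      rw [map_neg, h.brk_b, h.x, pt]
      split_ifs <;> simp [brk_unit])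
    (by simp [h.brk_a, h.a]) (by simp) v
  simpa using this

theorem RhoV.comm_apply {q t : ℤ} {δ₁ δ₂ ρ D ρ' : FreeG K →ₗ[K] FreeG K}
    {X Y X' Y' X₂ Y₂ : ℕ → FreeG K} {A B A' B' A₂ B₂ : FreeG K}
    (h : RhoV q δ₁ δ₂ ρ) (hD : DerV t X' Y' A' B' D) (h₁ : DerV 0 X Y A B δ₁)
    (h₂ : DerV q X₂ Y₂ A₂ B₂ δ₂) (hcomm : ∀ v, D (δ₁ v) = δ₁ (D v))
    (h' : RhoV (q + t) δ₁ (D ∘ₗ δ₂ - sg K (q * t) • δ₂ ∘ₗ D) ρ')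
    (hx : ∀ i, ρ (X' i) = 0) (hy : ∀ i, ρ (Y' i) = 0) (ha : ρ A' = 0) (hb : ρ B' = 0)
    (v : FreeG K) : D (ρ v) = sg K ((q - 1) * t) • ρ (D v) + ρ' v := by
  have h0 := (RhoV.comm hD h₁ h₂.shift h hcomm h').ext DerV.zero (fun i => by simp [hx])
    (fun i => by simp [hy]) (by simp [ha]) (by simp [hb])
  have := LinearMap.congr_fun h0 v
  simp only [LinearMap.sub_apply, LinearMap.comp_apply, LinearMap.smul_apply,
    LinearMap.zero_apply] at this
  rw [← sub_eq_zero, ← this]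
  abel

theorem DerV.lin_mem {s : ℤ} {X Y : ℕ → FreeG K} {A B : FreeG K} {δ : FreeG K →ₗ[K] FreeG K}
    (h : DerV s X Y A B δ) {e : ℕ → ℤ} (hx : ∀ i, X i ∈ wtSub lab 0 (Pi.single i 1 + e))
    (hy : ∀ i, Y i ∈ wtSub lab 0 (Pi.single i 1 + e)) (ha : A ∈ wtSub lab 0 e)
    (hb : B ∈ wtSub lab 0 e) {c : ℕ → ℤ} {v : FreeG K} (hv : v ∈ wtSub lab 0 c) :
    δ v ∈ wtSub lab 0 (c + e) := by
  refine h.der.mem_wt_der ?_ hv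
  rintro (i | i | _ | _)
  · rw [h.x]; exact hx i
  · rw [h.y]; exact hy i
  · rw [h.a]; simpa [lab] using ha
  · rw [h.b]; simpa [lab] using hb

theorem vx_lab (i : ℕ) : vx K i ∈ wtSub lab 0 (Pi.single i 1) := cls_mem_wtSub lab 0 (.lt (.x i))

theorem vy_lab (i : ℕ) : vy K i ∈ wtSub lab 0 (Pi.single i 1) := cls_mem_wtSub lab 0 (.lt (.y i))

theorem va_lab : va K ∈ wtSub lab 0 0 := cls_mem_wtSub lab 0 (.lt .al)

theorem unit_wt {Γ : Type} [AddCommMonoid Γ] (g : Letter → Γ) (b : Γ) :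
    unit K ∈ wtSub g b 0 := cls_mem_wtSub g b .one

theorem del_lab {n : ℕ} {δ : FreeG K →ₗ[K] FreeG K} (h : IsDel n δ) {c : ℕ → ℤ} {v : FreeG K}
    (hv : v ∈ wtSub lab 0 c) : δ v ∈ wtSub lab 0 (c + -Pi.single n 1) := by
  refine h.lin_mem (fun i => ?_) (fun i => zero_mem _) (zero_mem _) (zero_mem _) hv
  rcases eq_or_ne i n with rfl | hi
  · rw [pt_self, add_neg_cancel]; exact unit_wt _ _
  · rw [pt_ne hi]; exact zero_mem _

theorem ind_erase {S : Finset ℕ} {n : ℕ} (hn : n ∈ S) :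
    ind (S.erase n) = ind S + -Pi.single n 1 := by
  funext i
  rcases eq_or_ne i n with rfl | hi
  · simp [ind, hn]
  · simp [ind, hi]

theorem ind_insert {S : Finset ℕ} {n : ℕ} (hn : n ∉ S) :
    ind (insert n S) = ind S + Pi.single n 1 := by
  funext i
  rcases eq_or_ne i n with rfl | hi
  · simp [ind, hn]
  · simp [ind, hi]

theorem lin_label {S : Finset ℕ} {j : ℕ} {v : FreeG K} (hv : v ∈ lin K S) {δ : FreeG K →ₗ[K] FreeG K}
    {s : ℤ} {v₁ v₂ : FreeG K} (h : DerV s (pt j v₁) (pt j v₂) 0 0 δ) (hj : j ∉ S) : δ v = 0 :=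
  h.eq_on_lin DerV.zero (fun i hi => pt_ne (by rintro rfl; exact hj hi) _)
    (fun i hi => pt_ne (by rintro rfl; exact hj hi) _) rfl rfl hv

theorem pt_zero (n : ℕ) : pt n (0 : FreeG K) = fun _ => 0 := by
  funext i; simp [pt]

section Steps

variable {D δ₁ : FreeG K →ₗ[K] FreeG K} (hD : IsDiff D) {n : ℕ} (h₁ : IsDel n δ₁)
  {S : Finset ℕ} {c : FreeG K} (hc : c ∈ lin K S) (hDc : D c = 0)

include hD h₁ hc hDc

set_option maxHeartbeats 1000000 in
theorem alpha_part [CharZero K] {A ρ : FreeG K →ₗ[K] FreeG K} (hn : n ∈ S)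
    (hA : DerV 1 (fun _ => 0) (fun _ => 0) (brk K (vx K n) (va K)) 0 A) (hρ : RhoV 1 δ₁ A ρ) :
    ρ c ∈ LinearMap.range D := by
  obtain ⟨k, hk⟩ := Infinite.exists_notMem_finset S
  have hnk : n ≠ k := by rintro rfl; exact hk hn
  obtain ⟨B, hB⟩ := exists_derV (K := K) (s := 0) (X := fun _ => 0) (Y := fun _ => 0) (A := vx K k)
    (B := 0) (fun _ => zero_mem _) (fun _ => zero_mem _) (vx_mem k) (zero_mem _)
  obtain ⟨ρB, hρB⟩ := exists_rhoV h₁ hB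
  obtain ⟨δk, hδk⟩ := exists_derV (K := K) (s := 1) (X := pt k (brk K (vx K k) (va K)))
    (Y := pt k 0) (A := 0) (B := 0) (fun _ => pt_mem (brk_mem' (vx_mem k) va_mem (by norm_num)))
    (fun _ => pt_mem (zero_mem _)) (zero_mem _) (zero_mem _)
  obtain ⟨σ, hσ⟩ := exists_derV (K := K) (s := 1) (X := pt k (brk K (vx K n) (va K)))
    (Y := pt k 0) (A := 0) (B := 0) (fun _ => pt_mem (brk_mem' (vx_mem n) va_mem (by norm_num)))
    (fun _ => pt_mem (zero_mem _)) (zero_mem _) (zero_mem _)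
  obtain ⟨dk, hdk⟩ := exists_isDel (K := K) k
  obtain ⟨P, hP⟩ := exists_rhoV hdk hA
  have hw : ρB c ∈ lin K (insert k (S.erase n)) := by
    have := hρB.rho.mem_wt_rho (g := lab) (b := 0) (e₁ := -Pi.single n 1) (e₂ := Pi.single k 1)
      (by rw [zero_add]) (fun hv => del_lab h₁ hv) (fun hv => hB.lin_mem (fun _ => zero_mem _)
        (fun _ => zero_mem _) (vx_lab k) (zero_mem _) hv) hρB.lt hc
    rwa [lin, ind_insert (by simp [hk]), ind_erase hn, add_assoc]
  obtain ⟨ρ₃, hρ₃⟩ := exists_rhoV h₁ (hD.comm hB)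
  obtain ⟨ρ₄, hρ₄⟩ := exists_rhoV h₁ (hδk.comm hB)
  obtain ⟨ρ₅, hρ₅⟩ := exists_rhoV h₁ (hσ.comm hB)
  have cδ : ∀ v, δk (δ₁ v) = δ₁ (δk v) := fun v => by
    have := hδk.comm_eq h₁ (fun i => ?_) (fun i => ?_) (by simp) (by simp) v
    · simpa using this
    · rw [pt, pt]
      split_ifs <;> simp [hδk.one, h₁.brk_x, h₁.a, pt, hnk.symm]
    · simp [pt_zero]
  have cσ : ∀ v, σ (δ₁ v) = δ₁ (σ v) := fun v => by
    have := hσ.comm_eq h₁ (fun i => ?_) (fun i => ?_) (by simp) (by simp) v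
    · simpa using this
    · rw [pt, pt]
      split_ifs <;> simp [hσ.one, h₁.brk_x, h₁.a, pt, hnk.symm, unit_brk]
    · simp [pt_zero]
  have ck : ∀ v, δk (dk v) = dk (δk v) := fun v => by
    have := hδk.comm_eq hdk (fun i => ?_) (fun i => ?_) (by simp) (by simp) v
    · simpa using this
    · rw [pt, pt]
      split_ifs <;> simp [hδk.one, hdk.brk_x, hdk.a, pt, unit_brk]
    · simp [pt_zero]
  have e₁ : D (ρB c) = ρ₃ c := by
    rw [hρB.comm_apply hD h₁ hB (diff_del hD h₁) hρ₃ (by simp) (fun i => by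
      simp [hρB.brk_lt, hB.x, hB.b, h₁.b]) (by simp [hρB.brk_lt, hB.a, h₁.a]) (by simp), hDc]
    simp
  have e₂ : δk (ρB c) = ρ₄ c := by
    rw [hρB.comm_apply hδk h₁ hB cδ hρ₄ (fun i => by
      rw [pt]; split_ifs <;> simp [hρB.brk_lt, hB.x, hB.a, h₁.a, h₁.x, pt, hnk.symm])
      (by simp [pt_zero]) (by simp) (by simp), lin_label hc hδk hk]
    simp
  have e₃ : ρ₃ c + ρ₄ c = 0 := by
    refine (hρ₃.add hρ₄).eq_on_lin RhoV.zero ((hD.comm hB).add (hδk.comm hB)) DerV.zero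
      (fun i hi => ?_) (fun i hi => ?_) ?_ ?_ hc
    · have : i ≠ k := by rintro rfl; exact hk hi
      simp [pt_ne this]
    · simp [pt_zero, hB.brk_b, hB.x]
    · simp only [hD.x, hδk.x, pt_self, map_smul, hB.brk_a, hB.a, map_zero]
      rw [brk_comm_x]
      simp only [zero_mul, sg_zero, zero_sub, one_smul, smul_zero, sub_zero]
      rw [← two_smul K, smul_smul, inv_mul_cancel₀ two_ne_zero, one_smul, neg_add_cancel]
    · simp
  have e₄ : σ (ρB c) = ρ c := by
    have h := hρB.comm hσ h₁ hB.shift cσ hρ₅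
    have h' := h.eq_on_lin DerV.zero (fun i hi => ?_) (fun i hi => ?_) (by simp) (by simp) hc
    · have h5 : ρ₅ c = ρ c := by
        refine hρ₅.eq_on_lin hρ (hσ.comm hB) hA (fun i hi => ?_) (fun i hi => ?_) ?_ ?_ hc
        · have : i ≠ k := by rintro rfl; exact hk hi
          simp [pt_ne this]
        · simp [pt_zero]
        · simp [hσ.x, pt_self]
        · simp
      simp only [LinearMap.sub_apply, LinearMap.comp_apply, LinearMap.smul_apply,
        LinearMap.zero_apply, lin_label hc hσ hk, map_zero, smul_zero, sub_zero, sub_eq_zero] at h'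
      rw [h', h5]
    · have : i ≠ k := by rintro rfl; exact hk hi
      simp [pt_ne this]
    · simp [pt_zero]
  have e₅ : ∀ v, D (P v) = P (D v) := fun v => by
    obtain ⟨ρ₆, hρ₆⟩ := exists_rhoV hdk (hD.comm hA)
    have h0 : D ∘ₗ A - sg K (1 * 1) • A ∘ₗ D = 0 := by
      refine (hD.comm hA).ext DerV.zero ?_ ?_ ?_ ?_
      · simp
      · simp [hA.brk_b, hA.x]
      · have hj := jacobi (vx_mem (K := K) n) va_mem va_mem
        have h2 : brk K (brk K (va K) (va K)) (vx K n) = brk K (vx K n) (brk K (va K) (va K)) :=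
          brk_comm_x n _
        rw [h2, brk_comm_x] at hj
        have h3 : brk K (va K) (brk K (vx K n) (va K)) = brk K (brk K (vx K n) (va K)) (va K) := by
          rw [brk_comm va_mem (brk_mem (vx_mem n) va_mem)]; simp
        simp only [hD.brk_x, hD.a, map_smul, hA.brk_a, hA.a, h3, map_zero, LinearMap.zero_apply]
        simp only [mul_add, add_mul, mul_zero, zero_mul, sg_zero, sg_one, sg_add, mul_one,
          add_zero, one_smul] at hj ⊢
        refine Eq.trans ?_ ((congrArg ((-2⁻¹ : K) • ·) hj).trans (smul_zero _))
        module
      · simp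
    rw [h0] at hρ₆
    have := hP.comm_apply (ρ' := 0) hD hdk hA (diff_del hD hdk) (by rw [h0]; exact RhoV.zero)
      (by simp) (fun i => by simp [hP.brk_lt, hA.x, hA.b, hdk.b]) (by simp [hP.brk_lt, hdk.a])
      (by simp) v
    simpa using this
  have e₆ : P (δk (ρB c)) = σ (ρB c) := by
    obtain ⟨ρ₇, hρ₇⟩ := exists_rhoV hdk (hδk.comm hA)
    have h := hP.comm hδk hdk hA.shift ck hρ₇
    have h0 : ρ₇ (ρB c) = 0 := by
      refine hρ₇.eq_zero_of_label hdk (?_ : DerV (1 + 1) (pt k (A (brk K (vx K k) (va K))))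
        (fun _ => 0) 0 0 _) (n := k) ?_ hw
      · have := hδk.comm hA
        convert this using 1
        · funext i; rw [pt, pt]; split_ifs <;> simp
        · funext i; simp [pt_zero]
        · simp [hδk.brk_x, pt_ne hnk, hδk.a]
        · simp
      · intro i hi; simp [pt_ne hi]
    have hs := LinearMap.congr_fun ((h.add (hσ.smul 1)).ext DerV.zero (fun i => ?_) (fun i => ?_)
      (by simp) (by simp)) (ρB c)
    · have h9 : δk (P (ρB c)) = 0 := by
        have hPw : P (ρB c) ∈ lin K S := by
          have := hP.rho.mem_wt_rho (g := lab) (b := 0) (e₁ := -Pi.single k 1)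
            (e₂ := Pi.single n 1) (by rw [zero_add]) (fun hv => del_lab hdk hv)
            (fun hv => hA.lin_mem (fun _ => zero_mem _) (fun _ => zero_mem _)
              (by simpa using brk_mem_wt (vx_lab n) va_lab) (zero_mem _) hv) hP.lt hw
          rw [ind_insert (by simp [hk]), ind_erase hn] at this
          convert this using 1
          rw [lin]
          congr 1
          abel
        exact lin_label hPw hδk hk
      simp only [LinearMap.add_apply, LinearMap.sub_apply, LinearMap.comp_apply,
        LinearMap.smul_apply, LinearMap.zero_apply, h9, h0] at hs
      simp only [sub_self, zero_mul, sg_zero, one_smul, sub_zero, zero_sub] at hs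
      rw [neg_add_eq_zero] at hs
      exact hs
    · rw [pt, pt]
      split_ifs <;> simp [hP.brk_lt, hA.x, hA.a, hdk.a, hdk.x, pt, unit_mul, Letter.deg]
    · simp [pt_zero]
  refine ⟨- P (ρB c), ?_⟩
  rw [map_neg, e₅, e₁, eq_neg_of_add_eq_zero_left e₃, ← e₂, map_neg, e₆, e₄, neg_neg]

end Steps

end FreeG

end OperadTw

namespace OperadTw

namespace FreeG

variable {K : Type u} [Field K]

/-! ### Cycles in the free algebra -/

/-- The number of letters `y i` and `α`. -/
def gxw : Letter → ℕ
  | .x _ => 0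
  | .y _ => 1
  | .al => 1
  | .be => 0

variable (K) in
/-- The subalgebra generated by the `x i` and `β`. -/
abbrev GX : Submodule K (FreeG K) := wtSub gxw 0 0

theorem vx_gx (i : ℕ) : vx K i ∈ wtSub gxw 0 0 := cls_mem_wtSub gxw 0 (.lt (.x i))

theorem vy_gx (i : ℕ) : vy K i ∈ wtSub gxw 0 1 := cls_mem_wtSub gxw 0 (.lt (.y i))

theorem vb_gx : vb K ∈ wtSub gxw 0 0 := cls_mem_wtSub gxw 0 (.lt .be)

/-- Multiplying the values of a derivation by an element of degree `0`. -/
theorem recon_isDer {u : FreeG K} (hu : u ∈ gr K 0) {δ₁ ρ : FreeG K →ₗ[K] FreeG K}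
    (h₁ : IsDer 0 δ₁) (s₁ : Shift 0 δ₁) (hρ : RhoV 1 δ₁ (brk K u) ρ) :
    IsDer 0 (mul K u ∘ₗ δ₁ + ρ) := by
  refine ⟨?_, fun {i a} b ha => ?_, fun {i a} b ha => ?_⟩
  · simp [h₁.one, hρ.rho.one]
  · refine eq_on_gr (f := (mul K u ∘ₗ δ₁ + ρ) ∘ₗ mul K a)
      (g := mul K ((mul K u ∘ₗ δ₁ + ρ) a) + sg K (0 * i) •
        mul K a ∘ₗ (mul K u ∘ₗ δ₁ + ρ) + (0 : FreeG K →ₗ[K] _) a) (fun j b hb => ?_) b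
    simp only [LinearMap.comp_apply, LinearMap.add_apply, LinearMap.smul_apply, h₁.mul _ ha,
      hρ.rho.mul _ ha, map_add, map_smul, LinearMap.zero_apply]
    rw [← assoc hu (s₁ ha) hb, ← assoc ha hu (s₁ hb), mul_comm ha hu, ← assoc hu ha (s₁ hb)]
    simp only [mul_zero, zero_mul, sub_self, sg_zero, map_zero, map_smul, LinearMap.smul_apply]
    module
  · refine eq_on_gr (f := (mul K u ∘ₗ δ₁ + ρ) ∘ₗ brk K a)
      (g := sg K 0 • (brk K ((mul K u ∘ₗ δ₁ + ρ) a) + sg K (0 * i) •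
        brk K a ∘ₗ (mul K u ∘ₗ δ₁ + ρ)) + (0 : FreeG K →ₗ[K] _) a) (fun j b hb => ?_) b
    simp only [LinearMap.comp_apply, LinearMap.add_apply, LinearMap.smul_apply, h₁.brk _ ha,
      hρ.rho.brk _ ha, map_add, map_smul, LinearMap.zero_apply, rhoC_apply]
    have ha' := mem_gr (s₁ ha) (add_zero i)
    have hb' := mem_gr (s₁ hb) (add_zero j)
    rw [leibniz hu ha' hb, leibniz' ha hu hb', brk_comm ha hu, mul_comm ha' (brk_mem hu hb)]
    rcases sg_parity K i with ⟨h1, h2⟩ | ⟨h1, h2⟩ <;>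
    rcases sg_parity K j with ⟨h3, h4⟩ | ⟨h3, h4⟩ <;>
    simp only [mul_zero, zero_mul, mul_one, one_mul, zero_add, add_mul, mul_add, sub_self, sg_add,
      sg_zero, sg_one, map_zero, h1, h2, h3, h4, one_smul] <;>
    module

section Steps

variable {D δ₁ : FreeG K →ₗ[K] FreeG K} (hD : IsDiff D) {n : ℕ} (h₁ : IsDel n δ₁)
  {S : Finset ℕ} {c : FreeG K} (hc : c ∈ lin K S) (hDc : D c = 0)

include hD h₁ hc hDc

set_option maxHeartbeats 1000000 in
theorem label_part {F ρ : FreeG K →ₗ[K] FreeG K} (hn : n ∈ S) {i : ℕ} (hi : i ∈ S.erase n)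
    (hF : DerV 1 (pt i (brk K (vx K n) (vx K i)))
      (pt i (brk K (vx K n) (vy K i) + brk K (vy K n) (vx K i))) 0 0 F) (hρ : RhoV 1 δ₁ F ρ)
    (ih : ∀ T : Finset ℕ, T.card < S.card → ∀ v ∈ lin K T, D v = 0 → v ∈ GX K ⊔ LinearMap.range D) :
    ρ c ∈ GX K ⊔ LinearMap.range D := by
  obtain ⟨j, hj⟩ := Infinite.exists_notMem_finset S
  have hiS : i ∈ S := Finset.mem_of_mem_erase hi
  have hin : i ≠ n := Finset.ne_of_mem_erase hi
  have hnj : n ≠ j := by rintro rfl; exact hj hn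
  have hij : i ≠ j := by rintro rfl; exact hj hiS
  obtain ⟨B, hB⟩ := exists_derV (K := K) (s := 0) (X := pt i (vx K j)) (Y := pt i (vy K j)) (A := 0)
    (B := 0) (fun _ => pt_mem (vx_mem j)) (fun _ => pt_mem (mem_gr (vy_mem j) (by norm_num)))
    (zero_mem _) (zero_mem _)
  obtain ⟨ρB, hρB⟩ := exists_rhoV h₁ hB
  have hbx := brk_mem' (K := K) (vx_mem n) (vx_mem i) (k := 1) (by norm_num)
  have hby := brk_mem' (K := K) (vx_mem n) (vy_mem i) (k := 1 + 1) (by norm_num)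
  have hby' := brk_mem' (K := K) (vy_mem n) (vx_mem i) (k := 1 + 1) (by norm_num)
  obtain ⟨δj, hδj⟩ := exists_derV (K := K) (s := 1) (X := pt j (brk K (vx K n) (vx K i)))
    (Y := pt j (brk K (vx K n) (vy K i) + brk K (vy K n) (vx K i))) (A := 0) (B := 0)
    (fun _ => pt_mem hbx) (fun _ => pt_mem (add_mem hby hby')) (zero_mem _) (zero_mem _)
  have hw : ρB c ∈ lin K (insert j ((S.erase n).erase i)) := by
    have := hρB.rho.mem_wt_rho (g := lab) (b := 0) (e₁ := -Pi.single n 1)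
      (e₂ := -Pi.single i 1 + Pi.single j 1)
      (by rw [zero_add]) (fun hv => del_lab h₁ hv) (fun hv => hB.lin_mem (fun k => ?_)
        (fun k => ?_) (zero_mem _) (zero_mem _) hv) hρB.lt hc
    · rw [lin, ind_insert (by simp [hj]), ind_erase hi, ind_erase hn]
      convert this using 2
      abel
    · rcases eq_or_ne k i with rfl | hk
      · rw [pt_self, ← add_assoc, add_neg_cancel, zero_add]; exact vx_lab j
      · rw [pt_ne hk]; exact zero_mem _
    · rcases eq_or_ne k i with rfl | hk
      · rw [pt_self, ← add_assoc, add_neg_cancel, zero_add]; exact vy_lab j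
      · rw [pt_ne hk]; exact zero_mem _
  have hDw : D (ρB c) = 0 := by
    have h0 : D ∘ₗ B - sg K (0 * 1) • B ∘ₗ D = 0 := by
      refine (hD.comm hB).ext DerV.zero (fun k => ?_) (fun k => ?_) ?_ ?_
      · rw [pt]; split_ifs <;> simp [hD.x]
      · rw [map_neg, hB.brk_b, hB.x, pt, pt]; split_ifs <;> simp [hD.y]
      · simp [hB.brk_a, hB.a]
      · simp
    rw [hρB.comm_apply (ρ' := 0) hD h₁ hB (diff_del hD h₁) (by rw [h0]; exact RhoV.zero) (by simp)
      (fun i => by simp [hρB.brk_lt, hB.b, h₁.b]) (by simp [hρB.brk_lt, h₁.a]) (by simp), hDc]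
    simp
  have cδ : ∀ v, δj (δ₁ v) = δ₁ (δj v) := fun v => by
    have := hδj.comm_eq h₁ (fun k => ?_) (fun k => ?_) (by simp) (by simp) v
    · simpa using this
    · rw [pt, pt]
      split_ifs <;> simp [hδj.one, h₁.brk_x, h₁.x, pt, hin, unit_brk]
    · rw [pt]
      split_ifs <;> simp [h₁.brk_x, h₁.brk_y, h₁.x, h₁.y, pt, hin, unit_brk]
  obtain ⟨ρ₄, hρ₄⟩ := exists_rhoV h₁ (hδj.comm hB)
  have e₁ : δj (ρB c) = ρ c := by
    have h := (hρB.comm hδj h₁ hB.shift cδ hρ₄).eq_on_lin DerV.zero (fun k hk => ?_)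
      (fun k hk => ?_) (by simp) (by simp) hc
    · have h5 : ρ₄ c = ρ c := by
        refine hρ₄.eq_on_lin hρ (hδj.comm hB) hF (fun k hk => ?_) (fun k hk => ?_) ?_ ?_ hc
        · have : k ≠ j := by rintro rfl; exact hj hk
          rw [pt_ne this, pt, pt]; split_ifs <;> simp [hδj.x, pt_self]
        · have : k ≠ j := by rintro rfl; exact hj hk
          rw [pt_ne this, pt, pt]; split_ifs <;> simp [hδj.y, pt_self]
        · simp
        · simp
      simp only [LinearMap.sub_apply, LinearMap.comp_apply, LinearMap.smul_apply,
        LinearMap.zero_apply, lin_label hc hδj hj, map_zero, smul_zero, sub_zero, sub_eq_zero] at h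
      rw [h, h5]
    · have : k ≠ j := by rintro rfl; exact hj hk
      simp [pt_ne this]
    · have : k ≠ j := by rintro rfl; exact hj hk
      simp [pt_ne this]
  have e₂ : ∀ v, D (δj v) = sg K (1 * 1) • δj (D v) := fun v => by
    refine hD.comm_eq hδj (fun k => ?_) (fun k => ?_) ?_ ?_ v
    · rw [pt]; split_ifs <;> simp [hD.brk_x, hD.x]
    · rw [map_neg, hδj.brk_b, hδj.x, pt, pt]
      split_ifs
      · have hjac := jacobi' (vb_mem (K := K)) (vx_mem n) (vx_mem i)
        rw [hjac]
        simp only [map_add, hD.brk_x, hD.brk_y, hD.x, hD.y, map_zero, map_neg, LinearMap.zero_apply,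
          LinearMap.neg_apply, mul_add, add_mul, mul_zero, zero_mul, mul_one, sg_zero, sg_one,
          sg_add]
        module
      · simp
    · simp [hδj.brk_a, hδj.a]
    · simp
  have hcard : (insert j ((S.erase n).erase i)).card < S.card := by
    rw [Finset.card_insert_of_notMem (by simp [hj]), Finset.card_erase_of_mem hi,
      Finset.card_erase_of_mem hn]
    have : 0 < (S.erase n).card := Finset.card_pos.2 ⟨i, hi⟩
    rw [Finset.card_erase_of_mem hn] at this
    omega
  obtain ⟨g, hg, _, ⟨e, rfl⟩, hge⟩ := Submodule.mem_sup.1 (ih _ hcard _ hw hDw)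
  rw [← e₁, ← hge, map_add]
  refine Submodule.add_mem_sup ?_ ?_
  · have h0 : brk K (vx K n) (vx K i) ∈ wtSub gxw 0 (0 + 0) := by
      have := brk_mem_wt (vx_gx (K := K) n) (vx_gx i)
      rwa [add_zero] at this
    have h1 : brk K (vx K n) (vy K i) + brk K (vy K n) (vx K i) ∈ wtSub gxw 0 (1 + 0) := by
      have h2 := brk_mem_wt (vx_gx (K := K) n) (vy_gx i)
      have h3 := brk_mem_wt (vy_gx (K := K) n) (vx_gx i)
      rw [add_zero, zero_add] at h2
      rw [add_zero] at h3
      exact add_mem h2 h3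
    have := hδj.der.mem_wt_der (g := gxw) (b := 0) (e := 0) ?_ hg
    · rwa [add_zero] at this
    · rintro (k | k | _ | _)
      · rw [hδj.x]; exact pt_mem h0
      · rw [hδj.y]; exact pt_mem h1
      · rw [hδj.a]; exact zero_mem _
      · rw [hδj.b]; exact zero_mem _
  · refine ⟨- δj e, ?_⟩
    rw [map_neg, e₂, mul_one, sg_one, neg_smul, one_smul, neg_neg]

set_option maxHeartbeats 1000000 in
/-- Reduction of a cycle to cycles with fewer labels. -/
theorem cycle_step [CharZero K] (hn : n ∈ S) {N : Submodule K (FreeG K)}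
    (hN : LinearMap.range D ≤ N)
    (h : ∀ i ∈ S.erase n, ∀ F ρ : FreeG K →ₗ[K] FreeG K,
      DerV 1 (pt i (brk K (vx K n) (vx K i)))
        (pt i (brk K (vx K n) (vy K i) + brk K (vy K n) (vx K i))) 0 0 F →
      RhoV 1 δ₁ F ρ → ρ c ∈ N) :
    c - mul K (vx K n) (δ₁ c) ∈ N := by
  have hbx : ∀ i, brk K (vx K n) (vx K i) ∈ gr K 1 := fun i =>
    brk_mem' (vx_mem n) (vx_mem i) (by norm_num)
  have hby : ∀ i, brk K (vx K n) (vy K i) ∈ gr K (1 + 1) := fun i =>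
    brk_mem' (vx_mem n) (vy_mem i) (by norm_num)
  have hby' : ∀ i, brk K (vy K n) (vx K i) ∈ gr K (1 + 1) := fun i =>
    brk_mem' (vy_mem n) (vx_mem i) (by norm_num)
  obtain ⟨E, hE⟩ := exists_derV (K := K) (s := 0) (X := fun _ => 0) (Y := fun _ => 0) (A := 0)
    (B := vy K n) (fun _ => zero_mem _) (fun _ => zero_mem _) (zero_mem _)
    (mem_gr (vy_mem n) (by norm_num))
  obtain ⟨ρE, hρE⟩ := exists_rhoV h₁ hE
  obtain ⟨ρ₃, hρ₃⟩ := exists_rhoV h₁ (hD.comm hE)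
  have hK := hρE.comm hD h₁ hE.shift (diff_del hD h₁) hρ₃
  have had : DerV 1 (fun i => brk K (vx K n) (vx K i)) (fun i => brk K (vx K n) (vy K i))
      (brk K (vx K n) (va K)) (brk K (vx K n) (vb K)) (brk K (vx K n)) :=
    ⟨by simpa using brk_isDer (vx_mem (K := K) n), fun ha => mem_gr (brk_mem (vx_mem n) ha)
      (by ring), fun _ => rfl, fun _ => rfl, rfl, rfl⟩
  obtain ⟨ρa, hρa⟩ := exists_rhoV h₁ had
  have hM : DerV 0 (pt n (vx K n)) (fun _ => 0) 0 0 (mul K (vx K n) ∘ₗ δ₁ + ρa) := by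
    refine ⟨recon_isDer (vx_mem n) h₁.der h₁.shift hρa, fun {i a} ha => ?_, fun i => ?_,
      fun i => ?_, ?_, ?_⟩
    · refine add_mem (mem_gr (mul_mem (vx_mem n) (h₁.shift ha)) (by ring)) (hρa.shift ha)
    · simp only [LinearMap.add_apply, LinearMap.comp_apply, h₁.x, hρa.lt, pt]
      split_ifs <;> simp [mul_unit]
    · simp [h₁.y, hρa.lt]
    · simp [h₁.a, hρa.lt]
    · simp [h₁.b, hρa.lt]
  have heul : (mul K (vx K n) (δ₁ c) + ρa c) - (D (ρE c) - ρ₃ c) = c := by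
    have hK' : DerV 0 (fun _ => 0) (pt n (vy K n)) 0 0
        ((-1 : K) • (D ∘ₗ ρE - sg K ((0 - 1) * 1) • ρE ∘ₗ D - ρ₃)) := by
      convert hK.smul (-1) using 1
      · simp
      · simp
      · funext i
        rw [map_neg, hρE.brk_lt, hE.b, h₁.x, h₁.b, pt, pt]
        split_ifs with hi
        · simp [mul_unit, sg_neg_one, hi]
        · simp
      · simp [hρE.brk_lt, h₁.a]
      · simp
    have hc' : c ∈ wtSub (fun l => lab l n) 0 (1 : ℤ) := by
      have := wtSub_map (Pi.evalAddMonoidHom (fun _ : ℕ => ℤ) n) hc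
      simpa only [Pi.evalAddMonoidHom_apply, ind, if_pos hn, Pi.zero_apply] using this
    have h0 := (hM.add hK').euler (g := fun l => lab l n) (fun i => ?_) (fun i => ?_) ?_ ?_
      hc'
    · simp only [LinearMap.add_apply, LinearMap.sub_apply, LinearMap.comp_apply,
        LinearMap.smul_apply, hDc, map_zero, smul_zero, sub_zero] at h0
      rw [Int.cast_one, one_smul] at h0
      refine Eq.trans ?_ h0
      module
    · simp only [lab, pt, Pi.single_apply]
      split_ifs with h1 h2 h2
      · simp [h1]
      · exact absurd h1.symm h2
      · exact absurd h2.symm h1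
      · simp
    · simp only [lab, pt, Pi.single_apply]
      split_ifs with h1 h2 h2
      · simp [h1]
      · exact absurd h1.symm h2
      · exact absurd h2.symm h1
      · simp
    · simp [lab]
    · simp [lab]
  obtain ⟨A, hA⟩ := exists_derV (K := K) (s := 1) (X := fun _ => 0) (Y := fun _ => 0)
    (A := brk K (vx K n) (va K)) (B := 0) (fun _ => zero_mem _) (fun _ => zero_mem _)
    (brk_mem' (vx_mem n) va_mem (by norm_num)) (zero_mem _)
  obtain ⟨ρA, hρA⟩ := exists_rhoV h₁ hA
  have hF : ∀ i : ℕ, ∃ F ρ : FreeG K →ₗ[K] FreeG K, DerV 1 (pt i (brk K (vx K n) (vx K i)))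
        (pt i (brk K (vx K n) (vy K i) + brk K (vy K n) (vx K i))) 0 0 F ∧
      RhoV 1 δ₁ F ρ := by
    intro i
    obtain ⟨F, hF⟩ := exists_derV (K := K) (s := 1) (X := pt i (brk K (vx K n) (vx K i)))
      (Y := pt i (brk K (vx K n) (vy K i) + brk K (vy K n) (vx K i))) (A := 0) (B := 0)
      (fun _ => pt_mem (hbx i)) (fun _ => pt_mem (add_mem (hby i) (hby' i))) (zero_mem _)
      (zero_mem _)
    obtain ⟨ρ, hρ⟩ := exists_rhoV h₁ hF
    exact ⟨F, ρ, hF, hρ⟩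
  choose F ρF hF hρF using hF
  have hn0 : ρF n c = 0 := (hρF n).eq_zero_of_label h₁ (hF n)
    (fun i hi => ⟨pt_ne hi _, pt_ne hi _, rfl, pt_ne hi _⟩) hc
  have hρ₃' : RhoV 1 δ₁ (D ∘ₗ E - sg K (0 * 1) • E ∘ₗ D) ρ₃ := by simpa using hρ₃
  have hE' := hD.comm hE
  rw [zero_add] at hE'
  have hsum : ρa c + ρ₃ c = (∑ i ∈ S, ρF i c) + ρA c := by
    have := (hρa.add hρ₃').eq_on_lin ((RhoV.sum S hρF).add hρA) (had.add hE')
      ((DerV.sum S hF).add hA) (fun i hi => ?_) (fun i hi => ?_) ?_ ?_ hc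
    · simpa [LinearMap.sum_apply] using this
    · simp [pt, hi]
    · simp only [hE.brk_b, hE.x, pt, Finset.sum_ite_eq, hi, if_true, map_neg, map_zero]
      simp
    · simp [hE.brk_a, hE.a]
    · simp only [hD.y, map_zero, smul_zero, sub_zero, Finset.sum_const_zero, add_zero]
      rw [brk_comm_x, add_neg_cancel]
  rw [← Finset.add_sum_erase S _ hn, hn0, zero_add] at hsum
  have : c - mul K (vx K n) (δ₁ c) = (∑ i ∈ S.erase n, ρF i c) + ρA c - D (ρE c) := by
    rw [← hsum]
    nth_rw 1 [← heul]
    abel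
  rw [this]
  exact sub_mem (add_mem (sum_mem fun i hi => h i hi _ _ (hF i) (hρF i))
    (hN (alpha_part hD h₁ hc hDc hn hA hρA))) (hN ⟨_, rfl⟩)

end Steps

end FreeG

end OperadTw

namespace OperadTw

namespace FreeG

variable {K : Type u} [Field K]

/-! ### Weight components -/

/-- The operator which multiplies the elements of weight `c` by `χ c`. -/
def scale {Γ : Type} [AddCommMonoid Γ] (g : Letter → Γ) (b : Γ) (χ : Γ → K) :
    FreeG K →ₗ[K] FreeG K :=
  lift (fun t => χ (t.wt g b) • cls K t) (by
    intro r hr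
    obtain ⟨c, hc⟩ := GRel.homog g b hr
    have h : ∀ r ∈ wtSupp K g b c,
        Finsupp.linearCombination K (fun t : GTerm => χ (t.wt g b) • cls K t) r = χ c • proj K r := by
      intro r hr
      rw [wtSupp, Finsupp.supported_eq_span_single] at hr
      induction hr using Submodule.span_induction with
      | mem r hr =>
        obtain ⟨s, hs, rfl⟩ := hr
        have hs' : s.wt g b = c := hs
        rw [Finsupp.linearCombination_single, one_smul, hs', cls]
      | zero => simp
      | add r s _ _ hr hs => simp only [map_add, smul_add, hr, hs]
      | smul c r _ hr => simp only [map_smul, hr, smul_comm c]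
    rw [h r hc, proj_eq_zero hr, smul_zero])

section Scale

variable {Γ : Type} [AddCommMonoid Γ] {g : Letter → Γ} {b : Γ} {χ : Γ → K}

theorem scale_cls (t : GTerm) : scale g b χ (cls K t) = χ (t.wt g b) • cls K t := lift_cls _ _ _

theorem scale_wt {c : Γ} {v : FreeG K} (hv : v ∈ wtSub g b c) : scale g b χ v = χ c • v :=
  eq_on_wt (f' := χ c • LinearMap.id) (fun t ht => by rw [scale_cls, ht]; rfl) hv

theorem scale_mem {Γ' : Type} [AddCommMonoid Γ'] {g' : Letter → Γ'} {b' c' : Γ'} {v : FreeG K}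
    (hv : v ∈ wtSub g' b' c') : scale g b χ v ∈ wtSub g' b' c' := by
  have : wtSub g' b' c' ≤ (wtSub g' b' c').comap (scale g b χ) := wtSub_le fun t ht => by
    rw [Submodule.mem_comap, scale_cls, ← ht]
    exact Submodule.smul_mem _ _ (cls_mem_wtSub _ _ t)
  exact this hv

theorem mem_of_scale [DecidableEq Γ] {N : Submodule K (FreeG K)} {v : FreeG K}
    (h : ∀ c, scale g b (Pi.single c 1) v ∈ N) : v ∈ N := by
  have key : ∀ v : FreeG K, ∃ I : Finset Γ, ∀ J, I ⊆ J →
      ∑ c ∈ J, scale g b (Pi.single c 1) v = v := by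
    intro v
    have hv : v ∈ Submodule.span K (Set.range (cls K)) := by rw [span_cls]; trivial
    induction hv using Submodule.span_induction with
    | mem v hv =>
      obtain ⟨t, rfl⟩ := hv
      refine ⟨{t.wt g b}, fun J hJ => ?_⟩
      rw [Finset.sum_eq_single_of_mem (t.wt g b) (hJ (Finset.mem_singleton_self _))]
      · rw [scale_cls, Pi.single_eq_same, one_smul]
      · intro c _ hc
        rw [scale_cls, Pi.single_eq_of_ne (Ne.symm hc), zero_smul]
    | zero => exact ⟨∅, fun J _ => by simp⟩
    | add v w _ _ hv hw =>
      obtain ⟨I, hI⟩ := hv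
      obtain ⟨I', hI'⟩ := hw
      refine ⟨I ∪ I', fun J hJ => ?_⟩
      simp only [map_add, Finset.sum_add_distrib]
      rw [hI J (Finset.union_subset_left hJ), hI' J (Finset.union_subset_right hJ)]
    | smul r v _ hv =>
      obtain ⟨I, hI⟩ := hv
      refine ⟨I, fun J hJ => ?_⟩
      simp only [map_smul, ← Finset.smul_sum]
      rw [hI J hJ]
  obtain ⟨I, hI⟩ := key v
  rw [← hI I subset_rfl]
  exact sum_mem fun c _ => h c

theorem scale_single_mem [DecidableEq Γ] {Γ' : Type} [AddCommMonoid Γ'] {g' : Letter → Γ'} {b' c' : Γ'}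
    {v : FreeG K} (hv : v ∈ wtSub g' b' c') (c : Γ) :
    scale g b (Pi.single c 1) v ∈ wtSub (fun l => (g l, g' l)) (b, b') (c, c') := by
  have hp : ∀ t : GTerm, t.wt (fun l => (g l, g' l)) (b, b') = (t.wt g b, t.wt g' b') := by
    intro t
    induction t with
    | one => rfl
    | lt l => rfl
    | mul s t hs ht => simp only [GTerm.wt, hs, ht, Prod.mk_add_mk]
    | brk s t hs ht => simp only [GTerm.wt, hs, ht, Prod.mk_add_mk]
  have : wtSub g' b' c' ≤ (wtSub (fun l => (g l, g' l)) (b, b') (c, c')).comap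
      (scale g b (Pi.single c (1 : K))) := wtSub_le fun t ht => by
    rw [Submodule.mem_comap, scale_cls, Pi.single_apply]
    split_ifs with h
    · rw [one_smul, ← ht, ← h, ← hp]
      exact cls_mem_wtSub _ _ t
    · rw [zero_smul]; exact zero_mem _
  exact this hv

theorem scale_single_mem_self [DecidableEq Γ] (v : FreeG K) (c : Γ) :
    scale g b (Pi.single c 1) v ∈ wtSub g b c := by
  have : Submodule.span K (Set.range (cls K)) ≤
      (wtSub g b c).comap (scale g b (Pi.single c (1 : K))) := by
    rw [Submodule.span_le]
    rintro _ ⟨t, rfl⟩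
    rw [SetLike.mem_coe, Submodule.mem_comap, scale_cls, Pi.single_apply]
    split_ifs with h
    · rw [one_smul, ← h]
      exact cls_mem_wtSub _ _ t
    · rw [zero_smul]; exact zero_mem _
  rw [span_cls] at this
  exact this trivial

theorem wtSub_prod {Γ' : Type} [AddCommMonoid Γ'] {g' : Letter → Γ'} {b' c' : Γ'} {c : Γ}
    {v : FreeG K} (hv : v ∈ wtSub g b c) (hv' : v ∈ wtSub g' b' c') :
    v ∈ wtSub (fun l => (g l, g' l)) (b, b') (c, c') := by
  classical
  have := scale_single_mem (g := g) (b := b) hv' c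
  rwa [scale_wt hv, Pi.single_eq_same, one_smul] at this

end Scale

theorem scale_comm {Γ : Type} [AddCommGroup Γ] {g : Letter → Γ} {b e : Γ} {χ χ' : Γ → K}
    (hχ : ∀ c, χ' (c + e) = χ c) {D : FreeG K →ₗ[K] FreeG K}
    (hD : ∀ {c : Γ} {v : FreeG K}, v ∈ wtSub g b c → D v ∈ wtSub g b (c + e)) (v : FreeG K) :
    D (scale g b χ v) = scale g b χ' (D v) := by
  have : D ∘ₗ scale g b χ = scale g b χ' ∘ₗ D := hom_ext fun t => by
    rw [LinearMap.comp_apply, LinearMap.comp_apply, scale_wt (cls_mem_wtSub g b t),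
      scale_wt (hD (cls_mem_wtSub g b t)), map_smul, hχ]
  exact LinearMap.congr_fun this v

/-! ### Cycles without labels -/

theorem diff_diff [CharZero K] {D : FreeG K →ₗ[K] FreeG K} (hD : IsDiff D) (v : FreeG K) :
    D (D v) = 0 := by
  have h3 : brk K (brk K (va K) (va K)) (va K) = 0 := by
    have hj := jacobi (va_mem (K := K)) va_mem va_mem
    simp only [zero_mul, sg_zero, one_smul] at hj
    have h4 : (3 : K) • brk K (brk K (va K) (va K)) (va K) = 0 := by
      rw [← hj]; module
    exact (smul_eq_zero.1 h4).resolve_left three_ne_zero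
  have h3' : brk K (va K) (brk K (va K) (va K)) = 0 := by
    rw [brk_comm va_mem (brk_mem va_mem va_mem), h3, smul_zero]
  have := hD.comm_eq hD (by simp) (fun i => by simp [hD.brk_b, hD.x])
    (by simp [hD.brk_a, hD.a, h3, h3']) (by simp) v
  rw [mul_one, sg_one, neg_one_smul, eq_neg_iff_add_eq_zero, ← two_smul K] at this
  exact (smul_eq_zero.1 this).resolve_left two_ne_zero

/-- The number of letters `β` and `y i`. -/
def bw : Letter → ℤ
  | .x _ => 0
  | .y _ => 1
  | .al => 0
  | .be => 1

/-- The number of letters `α`, minus the number of letters `y i`. -/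
def aw : Letter → ℤ
  | .x _ => 0
  | .y _ => -1
  | .al => 1
  | .be => 0

/-- The weight which detects all generators other than `α`. -/
def pw : Letter → (ℕ → ℤ) × ℤ := fun l => (lab l, bw l)

variable (K) in
/-- The elements which only involve `α`. -/
abbrev pure : Submodule K (FreeG K) := wtSub pw 0 0

theorem pw_wt (t : GTerm) : t.wt pw 0 = (t.wt lab 0, t.wt bw 0) := by
  induction t with
  | one => rfl
  | lt l => rfl
  | mul s t hs ht => simp only [GTerm.wt, hs, ht, Prod.mk_add_mk]
  | brk s t hs ht => simp only [GTerm.wt, hs, ht, Prod.mk_add_mk, add_zero]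

theorem bw_nonneg (t : GTerm) : 0 ≤ t.wt bw 0 := by
  induction t with
  | one => exact le_rfl
  | lt l => cases l <;> simp [GTerm.wt, bw]
  | mul s t hs ht => exact add_nonneg hs ht
  | brk s t hs ht => exact add_nonneg (add_nonneg hs ht) le_rfl

theorem all_of_pure {t : GTerm} (h : t.wt pw 0 = 0) : t.All (fun l => l = .al) := by
  rw [pw_wt, Prod.mk_eq_zero] at h
  obtain ⟨h1, h2⟩ := h
  induction t with
  | one => trivial
  | lt l =>
    cases l with
    | x i => simpa [GTerm.wt, lab] using h1
    | y i => simpa [GTerm.wt, lab] using h1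
    | al => rfl
    | be => simpa [GTerm.wt, bw] using h2
  | mul s t hs ht =>
    have h3 := bw_nonneg s
    have h4 := bw_nonneg t
    have h5 : s.wt bw 0 + t.wt bw 0 = 0 := h2
    have h6 : ∀ j, s.wt lab 0 j + t.wt lab 0 j = 0 := congrFun h1
    refine ⟨hs (funext fun j => ?_) (by omega), ht (funext fun j => ?_) (by omega)⟩ <;>
    · have := wt_nonneg s j
      have := wt_nonneg t j
      have := h6 j
      simp only [Pi.zero_apply]
      omega
  | brk s t hs ht =>
    have h3 := bw_nonneg s
    have h4 := bw_nonneg t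
    have h5 : s.wt bw 0 + t.wt bw 0 + 0 = 0 := h2
    have h6 : ∀ j, s.wt lab 0 j + t.wt lab 0 j + 0 = 0 := congrFun h1
    refine ⟨hs (funext fun j => ?_) (by omega), ht (funext fun j => ?_) (by omega)⟩ <;>
    · have := wt_nonneg s j
      have := wt_nonneg t j
      have := h6 j
      simp only [Pi.zero_apply]
      omega

theorem aw_nonneg {t : GTerm} (h : t.All (fun l => l = .al)) : 0 ≤ t.wt aw 0 ∧
    (t.wt aw 0 = 0 → cls K t ∈ Submodule.span K {unit K}) := by
  induction t with
  | one => exact ⟨le_rfl, fun _ => Submodule.subset_span rfl⟩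
  | lt l =>
    obtain rfl : l = .al := h
    exact ⟨by simp [GTerm.wt, aw], fun h => by simp [GTerm.wt, aw] at h⟩
  | mul s t hs ht =>
    have h1 := hs h.1
    have h2 := ht h.2
    refine ⟨add_nonneg h1.1 h2.1, fun h3 => ?_⟩
    have h3 : s.wt aw 0 + t.wt aw 0 = 0 := h3
    obtain ⟨a, ha⟩ := Submodule.mem_span_singleton.1 (h1.2 (by omega))
    rw [← mul_cls, ← ha, map_smul, LinearMap.smul_apply, unit_mul]
    exact Submodule.smul_mem _ _ (h2.2 (by omega))
  | brk s t hs ht =>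
    have h1 := hs h.1
    have h2 := ht h.2
    refine ⟨add_nonneg (add_nonneg h1.1 h2.1) le_rfl, fun h3 => ?_⟩
    have h3 : s.wt aw 0 + t.wt aw 0 + 0 = 0 := h3
    obtain ⟨a, ha⟩ := Submodule.mem_span_singleton.1 (h1.2 (by omega))
    rw [← brk_cls, ← ha, map_smul, LinearMap.smul_apply, unit_brk, smul_zero]
    exact zero_mem _

theorem DerV.eq_on_pure {s : ℤ} {X Y X' Y' : ℕ → FreeG K} {A B A' B' : FreeG K}
    {δ δ' : FreeG K →ₗ[K] FreeG K} (h : DerV s X Y A B δ) (h' : DerV s X' Y' A' B' δ')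
    (ha : A = A') {v : FreeG K} (hv : v ∈ pure K) : δ v = δ' v :=
  eq_on_wt (fun t ht => h.der.congr_der h'.der _ (by rintro _ rfl; rw [h.a, h'.a, ha])
    (all_of_pure ht)) hv

theorem RhoV.eq_on_pure {q : ℤ} {X Y X' Y' : ℕ → FreeG K} {A B A' B' : FreeG K}
    {δ₁ δ δ' ρ ρ' : FreeG K →ₗ[K] FreeG K} (hρ : RhoV q δ₁ δ ρ) (hρ' : RhoV q δ₁ δ' ρ')
    (h : DerV q X Y A B δ) (h' : DerV q X' Y' A' B' δ') (ha : A = A') {v : FreeG K}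
    (hv : v ∈ pure K) : ρ v = ρ' v :=
  eq_on_wt (fun t ht => hρ.congr_cls hρ' h.der h'.der _ (by rintro _ rfl; rw [h.a, h'.a, ha])
    (all_of_pure ht)) hv

theorem pure_le {c : ℤ} (hc : c ≤ 0) {v : FreeG K} (hv : v ∈ pure K) (hv' : v ∈ wtSub aw 0 c) :
    (c < 0 → v = 0) ∧ v ∈ Submodule.span K {unit K} := by
  have hp : ∀ t : GTerm, t.wt (fun l => (pw l, aw l)) (0, 0) = (t.wt pw 0, t.wt aw 0) := by
    intro t
    induction t with
    | one => rfl
    | lt l => rfl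
    | mul s t hs ht => simp only [GTerm.wt, hs, ht, Prod.mk_add_mk]
    | brk s t hs ht => simp only [GTerm.wt, hs, ht, Prod.mk_add_mk]
  have h := wtSub_prod hv hv'
  constructor
  · intro hc'
    refine eq_on_wt (f := LinearMap.id) (f' := 0) (fun t ht => ?_) h
    rw [hp, Prod.mk.injEq] at ht
    have := (aw_nonneg (K := K) (all_of_pure ht.1)).1
    omega
  · refine (wtSub_le fun t ht => ?_ : _ ≤ Submodule.span K {unit K}) h
    rw [hp, Prod.mk.injEq] at ht
    have := aw_nonneg (K := K) (all_of_pure ht.1)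
    exact this.2 (by omega)

theorem DerV.mem_wt {s : ℤ} {X Y : ℕ → FreeG K} {A B : FreeG K} {δ : FreeG K →ₗ[K] FreeG K}
    (h : DerV s X Y A B δ) {Γ : Type} [AddCommMonoid Γ] {g : Letter → Γ} {b e : Γ}
    (hx : ∀ i, X i ∈ wtSub g b (g (.x i) + e)) (hy : ∀ i, Y i ∈ wtSub g b (g (.y i) + e))
    (ha : A ∈ wtSub g b (g .al + e)) (hb : B ∈ wtSub g b (g .be + e)) {c : Γ} {v : FreeG K}
    (hv : v ∈ wtSub g b c) : δ v ∈ wtSub g b (c + e) := by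
  refine h.der.mem_wt_der ?_ hv
  rintro (i | i | _ | _)
  · rw [h.x]; exact hx i
  · rw [h.y]; exact hy i
  · rw [h.a]; exact ha
  · rw [h.b]; exact hb

theorem brk_ltr_wt {Γ : Type} [AddCommMonoid Γ] {g : Letter → Γ} {b c : Γ} (l m : Letter)
    (h : g l + g m + b = c) : brk K (ltr K l) (ltr K m) ∈ wtSub g b c := by
  rw [← h]
  exact brk_mem_wt (cls_mem_wtSub g b (.lt l)) (cls_mem_wtSub g b (.lt m))

theorem ltr_wt {Γ : Type} [AddCommMonoid Γ] {g : Letter → Γ} {b c : Γ} (l : Letter)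
    (h : g l = c) : ltr K l ∈ wtSub g b c := by
  rw [← h]
  exact cls_mem_wtSub g b (.lt l)

theorem diff_aw {D : FreeG K →ₗ[K] FreeG K} (hD : IsDiff D) {c : ℤ} {v : FreeG K}
    (hv : v ∈ wtSub aw 0 c) : D v ∈ wtSub aw 0 (c + 1) :=
  hD.mem_wt (fun i => zero_mem _) (fun i => neg_mem (brk_ltr_wt _ _ (by simp [aw])))
    (Submodule.smul_mem _ _ (brk_ltr_wt _ _ (by simp [aw]))) (zero_mem _) hv

theorem diff_bw {D : FreeG K →ₗ[K] FreeG K} (hD : IsDiff D) {c : ℤ} {v : FreeG K}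
    (hv : v ∈ wtSub bw 0 c) : D v ∈ wtSub bw 0 (c + 0) :=
  hD.mem_wt (fun i => zero_mem _) (fun i => neg_mem (brk_ltr_wt _ _ (by simp [bw])))
    (Submodule.smul_mem _ _ (brk_ltr_wt _ _ (by simp [bw]))) (zero_mem _) hv

section Alpha

variable [CharZero K] {D : FreeG K →ₗ[K] FreeG K} (hD : IsDiff D)

include hD

set_option maxHeartbeats 1000000 in
theorem pure_boundary {w : ℤ} (hw : 0 < w) {z : FreeG K} (hz : z ∈ pure K) (hz' : z ∈ wtSub aw 0 w)
    (hDz : D z = 0) : z ∈ LinearMap.range D := by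
  obtain ⟨δ, hδ⟩ := exists_derV (K := K) (s := 0) (X := fun _ => 0) (Y := fun _ => 0) (A := unit K)
    (B := 0) (fun _ => zero_mem _) (fun _ => zero_mem _) unit_mem (zero_mem _)
  obtain ⟨E, hE⟩ := exists_derV (K := K) (s := 0) (X := fun _ => 0) (Y := fun _ => 0) (A := va K)
    (B := 0) (fun _ => zero_mem _) (fun _ => zero_mem _) va_mem (zero_mem _)
  obtain ⟨N, hN⟩ := exists_derV (K := K) (s := 0) (X := fun _ => 0) (Y := fun i => - vy K i)
    (A := va K) (B := 0) (fun _ => zero_mem _)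
    (fun i => neg_mem (mem_gr (vy_mem i) (by norm_num))) va_mem (zero_mem _)
  obtain ⟨ρ, hρ⟩ := exists_rhoV hδ hE
  obtain ⟨ρ₃, hρ₃⟩ := exists_rhoV hδ (hD.comm hE)
  have hcomm : ∀ v, D (δ v) = δ (D v) := fun v => by
    have := hD.comm_eq hδ (by simp) (fun i => by simp [hδ.brk_b, hδ.x])
      (by simp [hD.one, hδ.brk_a, hδ.a, unit_brk, brk_unit]) (by simp) v
    simpa using this
  have hK := hρ.comm hD hδ hE.shift hcomm hρ₃
  have had : DerV 1 (fun i => brk K (va K) (vx K i)) (fun i => brk K (va K) (vy K i))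
      (brk K (va K) (va K)) (brk K (va K) (vb K)) (brk K (va K)) :=
    ⟨by simpa using brk_isDer (va_mem (K := K)), fun ha => mem_gr (brk_mem va_mem ha)
      (by ring), fun _ => rfl, fun _ => rfl, rfl, rfl⟩
  obtain ⟨ρa, hρa⟩ := exists_rhoV hδ had
  have hM : DerV 0 (fun _ => 0) (fun _ => 0) (va K) 0 (mul K (va K) ∘ₗ δ + ρa) := by
    refine ⟨recon_isDer va_mem hδ.der hδ.shift hρa, fun {i a} ha => ?_, fun i => ?_,
      fun i => ?_, ?_, ?_⟩
    · refine add_mem (mem_gr (mul_mem va_mem (hδ.shift ha)) (by ring)) (hρa.shift ha)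
    · simp [hδ.x, hρa.lt]
    · simp [hδ.y, hρa.lt]
    · simp [hδ.a, hρa.lt, mul_unit]
    · simp [hδ.b, hρa.lt]
  have hρ₃' : RhoV 1 δ (D ∘ₗ E - sg K (0 * 1) • E ∘ₗ D) ρ₃ := by simpa using hρ₃
  have hE' := hD.comm hE
  rw [zero_add] at hE'
  rw [zero_add, sub_self] at hK
  have key : ∀ v ∈ pure K, v ∈ wtSub aw 0 w → D v = 0 →
      (w : K) • v + mul K (va K) (δ v) = (2 : K) • D (ρ v) := by
    intro v hv hv' hDv
    have e0 : N v = (w : K) • v := hN.euler (by simp [aw]) (by simp [aw]) (by simp [aw])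
      (by simp [aw]) hv'
    have e1 := hM.eq_on_pure hN rfl hv
    have e2 := hK.eq_on_pure hN (by
      rw [map_smul, hρ.brk_lt, hE.a, hδ.a, zero_sub, mul_one, sg_neg_one, mul_unit, unit_mul,
        zero_mul, sg_zero, one_smul, ← two_smul K, inv_smul_smul₀ two_ne_zero, neg_neg,
        one_smul]) hv
    have e3 := (hρa.add (hρ₃'.add hρ₃')).eq_on_pure RhoV.zero (had.add (hE'.add hE')) DerV.zero (by
      simp only [hD.a, map_smul, hE.brk_a, hE.a, zero_mul, sg_zero]
      have : (2⁻¹ : K) • (2 : K) • brk K (va K) (va K) = brk K (va K) (va K) := by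
        rw [smul_smul, inv_mul_cancel₀ two_ne_zero, one_smul]
      nth_rw 1 [← this]
      module) hv
    rw [e0] at e1 e2
    simp only [LinearMap.add_apply, LinearMap.sub_apply, LinearMap.comp_apply,
      LinearMap.smul_apply, hDv, map_zero, smul_zero, sub_zero, LinearMap.zero_apply] at e1 e2 e3
    rw [← sub_eq_zero, ← neg_eq_zero, ← e3]
    have e4 : ρ₃ v = D (ρ v) - (w : K) • v := by rw [← e2]; abel
    have e5 : ρa v = (w : K) • v - mul K (va K) (δ v) := by rw [← e1]; abel
    rw [e4, e5]
    module
  have hLpure : ∀ {e : ℤ} {v}, v ∈ wtSub aw 0 e → mul K (va K) v ∈ wtSub aw 0 (1 + e) := fun hv =>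
    mul_mem_wt (ltr_wt .al rfl) hv
  have hpa : pw .al = 0 := Prod.ext rfl rfl
  have hLp : ∀ {v}, v ∈ pure K → mul K (va K) v ∈ pure K := fun hv => by
    have := mul_mem_wt (ltr_wt (K := K) (g := pw) (b := 0) (c := 0) .al hpa) hv
    rwa [add_zero] at this
  have hδp : ∀ {v}, v ∈ pure K → δ v ∈ pure K := fun hv => by
    have := hδ.mem_wt (e := 0) (fun i => zero_mem _) (fun i => zero_mem _)
      (by rw [hpa, add_zero]; exact unit_wt _ _) (zero_mem _) hv
    rwa [add_zero] at this
  have hδa : ∀ {e : ℤ} {v}, v ∈ wtSub aw 0 e → δ v ∈ wtSub aw 0 (e + -1) := fun hv =>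
    hδ.mem_wt (fun i => zero_mem _) (fun i => zero_mem _)
      (by rw [show aw .al + -1 = 0 by simp [aw]]; exact unit_wt _ _) (zero_mem _) hv
  have hX : ∀ (m : ℕ) u, mul K (va K) (δ (((mul K (va K)) ^ m) u)) =
      (m : K) • ((mul K (va K)) ^ m) u + ((mul K (va K)) ^ (m + 1)) (δ u) := by
    intro m
    induction m with
    | zero => intro u; simp
    | succ m ih =>
      intro u
      rw [pow_succ', Module.End.mul_apply, hδ.mul_a, unit_mul, map_add, ih, map_add, map_smul,
        pow_succ' _ (m + 1), Module.End.mul_apply]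
      push_cast
      module
  set Z : ℕ → FreeG K := fun m => ((mul K (va K)) ^ m) ((δ ^ m) z) with hZ
  have hZs : ∀ m, mul K (va K) (δ (Z m)) = (m : K) • Z m + Z (m + 1) := by
    intro m
    rw [hZ]
    simp only
    rw [hX, pow_succ' δ, Module.End.mul_apply]
  have hZm : ∀ m, Z m ∈ pure K ∧ Z m ∈ wtSub aw 0 w ∧ D (Z m) = 0 := by
    intro m
    induction m with
    | zero => exact ⟨hz, hz', hDz⟩
    | succ m ih =>
      have e : Z (m + 1) = mul K (va K) (δ (Z m)) - (m : K) • Z m := by rw [hZs]; abel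
      refine ⟨?_, ?_, ?_⟩
      · rw [e]; exact sub_mem (hLp (hδp ih.1)) (Submodule.smul_mem _ _ ih.1)
      · have := hLpure (hδa ih.2.1)
        rw [show 1 + (w + -1) = w by ring] at this
        rw [e]; exact sub_mem this (Submodule.smul_mem _ _ ih.2.1)
      · have h5 := congrArg D (key _ ih.1 ih.2.1 ih.2.2)
        rw [map_add, map_smul, map_smul, diff_diff hD, ih.2.2, smul_zero, smul_zero, zero_add] at h5
        rw [e, map_sub, map_smul, h5, ih.2.2, smul_zero, sub_zero]
  have hδm : ∀ m : ℕ, (δ ^ m) z ∈ pure K ∧ (δ ^ m) z ∈ wtSub aw 0 (w - m) := by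
    intro m
    induction m with
    | zero => simpa using ⟨hz, hz'⟩
    | succ m ih =>
      rw [pow_succ', Module.End.mul_apply]
      refine ⟨hδp ih.1, ?_⟩
      have := hδa ih.2
      rwa [show w - m + -1 = w - ((m + 1 : ℕ) : ℤ) by push_cast; ring] at this
  have hend : Z (w.toNat + 1) = 0 := by
    have h6 := (pure_le (c := w - ((w.toNat + 1 : ℕ) : ℤ)) (by omega) (hδm _).1 (hδm _).2).1
      (by omega)
    rw [hZ]
    simp only
    rw [h6, map_zero]
  have hdesc : ∀ k m, m + k = w.toNat + 1 → Z m ∈ LinearMap.range D := by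
    intro k
    induction k with
    | zero => intro m hm; obtain rfl : m = w.toNat + 1 := hm; rw [hend]; exact zero_mem _
    | succ k ih =>
      intro m hm
      have h7 := ih (m + 1) (by omega)
      have h8 := key _ (hZm m).1 (hZm m).2.1 (hZm m).2.2
      rw [hZs] at h8
      have h9 : ((w : K) + m) • Z m = D ((2 : K) • ρ (Z m)) - Z (m + 1) := by
        rw [map_smul, ← h8]; module
      have h10 : (w : K) + m ≠ 0 := by
        have : ((w + m : ℤ) : K) ≠ 0 := Int.cast_ne_zero.2 (by omega)
        simpa using this
      rw [← inv_smul_smul₀ h10 (Z m), h9]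
      exact Submodule.smul_mem _ _ (sub_mem ⟨_, rfl⟩ h7)
  exact hdesc _ 0 (zero_add _)

theorem pure_cycle {z : FreeG K} (hz : z ∈ pure K) (hDz : D z = 0) :
    z ∈ Submodule.span K {unit K} ⊔ LinearMap.range D := by
  refine mem_of_scale (g := aw) (b := 0) fun c => ?_
  have h1 : scale aw 0 (Pi.single c (1 : K)) z ∈ wtSub aw 0 c :=
    scale_single_mem_self z c
  have h2 : scale aw 0 (Pi.single c (1 : K)) z ∈ pure K := scale_mem hz
  have h3 : D (scale aw 0 (Pi.single c (1 : K)) z) = 0 := by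
    rw [scale_comm (χ' := fun d => (Pi.single c (1 : K) : ℤ → K) (d - 1)) (e := 1)
      (fun d => by rw [add_sub_cancel_right]) (diff_aw hD), hDz,
      map_zero]
  rcases lt_or_ge 0 c with hc | hc
  · exact Submodule.mem_sup_right (pure_boundary hD hc h2 h1 h3)
  · exact Submodule.mem_sup_left (pure_le hc h2 h1).2

theorem beta_step {z : FreeG K} (hz : z ∈ lin K ∅) (hDz : D z = 0) {b : ℤ}
    (hb : z ∈ wtSub bw 0 b) : ∃ z', z' ∈ lin K ∅ ∧ D z' = 0 ∧ z' ∈ wtSub bw 0 (b - 1) ∧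
      (b : K) • z - mul K (vb K) z' ∈ LinearMap.range D := by
  obtain ⟨B, hB⟩ := exists_derV (K := K) (s := -1) (X := fun _ => 0) (Y := fun _ => 0) (A := 0)
    (B := vx K 0) (fun _ => zero_mem _) (fun _ => zero_mem _) (zero_mem _)
    (mem_gr (vx_mem 0) (by norm_num))
  obtain ⟨σ, hσ⟩ := exists_derV (K := K) (s := 1) (X := pt 0 (vb K)) (Y := pt 0 0) (A := 0)
    (B := 0) (fun _ => pt_mem vb_mem) (fun _ => pt_mem (zero_mem _)) (zero_mem _) (zero_mem _)
  obtain ⟨N, hN⟩ := exists_derV (K := K) (s := 0) (X := fun _ => 0) (Y := fun i => vy K i) (A := 0)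
    (B := vb K) (fun _ => zero_mem _) (fun i => mem_gr (vy_mem i) (by norm_num)) (zero_mem _)
    (mem_gr vb_mem (by norm_num))
  obtain ⟨δ, hδ⟩ := exists_isDel (K := K) 0
  have hu : B z ∈ lin K {0} := by
    have := hB.lin_mem (fun i => zero_mem _) (fun i => zero_mem _) (zero_mem _) (vx_lab 0) hz
    rwa [← ind_insert (Finset.notMem_empty 0)] at this
  have hDu : D (B z) = 0 := by
    have := (hD.comm hB).eq_on_lin DerV.zero (by simp) (by simp) (by simp [hB.brk_a, hB.a])
      (by simp [hD.x]) hz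
    simpa [hDz] using this
  have hz' : δ (B z) ∈ lin K ∅ := by
    have := del_lab hδ hu
    rwa [← ind_erase (Finset.mem_singleton_self 0), Finset.erase_singleton] at this
  have h1 := cycle_step hD hδ hu hDu (Finset.mem_singleton_self 0) le_rfl
    (by simp)
  refine ⟨δ (B z), hz', by rw [diff_del hD hδ, hDu, map_zero], ?_, ?_⟩
  · have h2 := hB.mem_wt (e := -1) (fun i => zero_mem _) (fun i => zero_mem _) (zero_mem _)
      (ltr_wt _ (by simp [bw])) hb
    have h3 := hδ.mem_wt (e := 0) (fun i => pt_mem (by simpa [bw] using unit_wt _ _))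
      (fun i => zero_mem _) (zero_mem _) (zero_mem _) h2
    rwa [add_zero, ← sub_eq_add_neg] at h3
  · have hbb : brk K (vb K) (vb K) = 0 := by
      have := brk_comm (vb_mem (K := K)) vb_mem
      rw [mul_one, sg_one, neg_one_smul, eq_neg_iff_add_eq_zero, ← two_smul K] at this
      exact (smul_eq_zero.1 this).resolve_left two_ne_zero
    have h4 : ∀ v, D (σ v) = sg K (1 * 1) • σ (D v) := fun v => by
      refine hD.comm_eq hσ (fun i => ?_) (fun i => ?_) ?_ ?_ v
      · rw [pt]; split_ifs <;> simp [hD.b]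
      · simp only [pt_zero, map_zero, map_neg, hσ.brk_b, hσ.x, pt]
        split_ifs <;> simp [hbb]
      · simp [hσ.brk_a, hσ.a]
      · simp
    have h5 : σ (B z) = (b : K) • z := by
      have := (hσ.comm hB).eq_on_lin (hN.smul 1) (by simp) (by simp) (by simp)
        (by simp [hσ.x, pt_self]) hz
      rw [← hN.euler (by simp [bw]) (by simp [bw]) (by simp [bw]) (by simp [bw]) hb]
      simpa [lin_label hz hσ (Finset.notMem_empty 0)] using this
    have h6 : σ (mul K (vx K 0) (δ (B z))) = mul K (vb K) (δ (B z)) := by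
      rw [hσ.mul_x, pt_self, lin_label hz' hσ (Finset.notMem_empty 0), map_zero, add_zero]
    rw [← h5, ← h6, ← map_sub]
    obtain ⟨e, he⟩ := h1
    refine ⟨- σ e, ?_⟩
    rw [← he, map_neg, h4]
    simp

theorem cycle_empty {z : FreeG K} (hz : z ∈ lin K ∅) (hDz : D z = 0) :
    z ∈ GX K ⊔ LinearMap.range D := by
  refine mem_of_scale (g := bw) (b := 0) fun c => ?_
  have hb : scale bw 0 (Pi.single c (1 : K)) z ∈ wtSub bw 0 c :=
    scale_single_mem_self z c
  have h2 : scale bw 0 (Pi.single c (1 : K)) z ∈ lin K ∅ := scale_mem hz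
  have h3 : D (scale bw 0 (Pi.single c (1 : K)) z) = 0 := by
    rw [scale_comm (χ' := Pi.single c 1) (e := 0) (by simp) (diff_bw hD), hDz, map_zero]
  generalize scale bw 0 (Pi.single c (1 : K)) z = z at hb h2 h3
  have hind : ind ∅ = 0 := by funext i; simp [ind]
  have hβD : ∀ e, mul K (vb K) (D e) ∈ LinearMap.range D := fun e =>
    ⟨- mul K (vb K) e, by rw [map_neg, hD.mul_b]; simp⟩
  have hunit : Submodule.span K {unit K} ≤ GX K := by
    rw [Submodule.span_singleton_le_iff_mem]; exact unit_wt _ _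
  by_cases hc0 : c = 0
  · subst hc0
    have hp : z ∈ pure K := by
      have := wtSub_prod h2 hb
      rw [hind] at this
      exact this
    exact sup_le_sup_right hunit _ (pure_cycle hD hp h3)
  · have hc0' : (c : K) ≠ 0 := Int.cast_ne_zero.2 hc0
    obtain ⟨z', hz', hDz', hb', hzz'⟩ := beta_step hD h2 h3 hb
    have hfin : mul K (vb K) z' ∈ GX K ⊔ LinearMap.range D := by
      by_cases hc1 : c = 1
      · subst hc1
        rw [sub_self] at hb'
        have hp : z' ∈ pure K := by
          have := wtSub_prod hz' hb'
          rw [hind] at this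
          exact this
        obtain ⟨u, hu, _, ⟨e, rfl⟩, rfl⟩ := Submodule.mem_sup.1 (pure_cycle hD hp hDz')
        rw [map_add]
        refine Submodule.add_mem_sup ?_ (hβD e)
        have := mul_mem_wt (vb_gx (K := K)) (hunit hu)
        rwa [add_zero] at this
      · have hc1' : ((c - 1 : ℤ) : K) ≠ 0 := Int.cast_ne_zero.2 (by omega)
        obtain ⟨z'', -, -, -, e, he⟩ := beta_step hD hz' hDz' hb'
        have hbb : mul K (vb K) (vb K) = 0 := by
          have := mul_comm (vb_mem (K := K)) vb_mem
          rw [mul_one, sg_one, neg_one_smul, eq_neg_iff_add_eq_zero, ← two_smul K] at this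
          exact (smul_eq_zero.1 this).resolve_left two_ne_zero
        have hbb' : ∀ v, mul K (vb K) (mul K (vb K) v) = 0 :=
          eq_on_gr (f := mul K (vb K) ∘ₗ mul K (vb K)) (g := 0) fun d v hv => by
            rw [LinearMap.comp_apply, ← assoc vb_mem vb_mem hv, hbb, map_zero]
        have h4 : mul K (vb K) (D e) = ((c - 1 : ℤ) : K) • mul K (vb K) z' := by
          rw [he, map_sub, map_smul, hbb', sub_zero]
        rw [← inv_smul_smul₀ hc1' (mul K (vb K) z'), ← h4]
        exact Submodule.smul_mem _ _ (Submodule.mem_sup_right (hβD e))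
    rw [← inv_smul_smul₀ hc0' z]
    refine Submodule.smul_mem _ _ ?_
    have := add_mem (Submodule.mem_sup_right hzz') hfin
    rwa [sub_add_cancel] at this

/-- Cycles which are linear in each of their labels are homologous to elements of the subalgebra
generated by the `x i` and `β`. -/
theorem cycle_mem (S : Finset ℕ) {v : FreeG K} (hv : v ∈ lin K S) (hDv : D v = 0) :
    v ∈ GX K ⊔ LinearMap.range D := by
  have key : ∀ k : ℕ, ∀ S : Finset ℕ, S.card = k → ∀ v ∈ lin K S, D v = 0 →
      v ∈ GX K ⊔ LinearMap.range D := by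
    intro k
    induction k using Nat.strong_induction_on with
    | _ k ih =>
      intro S hS v hv hDv
      rcases S.eq_empty_or_nonempty with rfl | ⟨n, hn⟩
      · exact cycle_empty hD hv hDv
      · obtain ⟨δ, hδ⟩ := exists_isDel (K := K) n
        have ih' : ∀ T : Finset ℕ, T.card < S.card → ∀ v ∈ lin K T, D v = 0 →
            v ∈ GX K ⊔ LinearMap.range D := fun T hT => ih _ (hS ▸ hT) T rfl
        have h1 := cycle_step hD hδ hv hDv hn (N := GX K ⊔ LinearMap.range D) le_sup_right
          (fun i hi F ρ hF hρ => label_part hD hδ hv hDv hn hi hF hρ ih')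
        have h2 : δ v ∈ lin K (S.erase n) := by
          rw [lin, ind_erase hn]; exact del_lab hδ hv
        obtain ⟨g, hg, _, ⟨e, rfl⟩, hge⟩ := Submodule.mem_sup.1 (ih' (S.erase n)
          (Finset.card_erase_lt_of_mem hn) _ h2 (by rw [diff_del hD hδ, hDv, map_zero]))
        have h3 : mul K (vx K n) (δ v) ∈ GX K ⊔ LinearMap.range D := by
          rw [← hge, map_add]
          refine Submodule.add_mem_sup ?_ ⟨mul K (vx K n) e, by rw [hD.mul_x]; simp⟩
          have := mul_mem_wt (vx_gx (K := K) n) hg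
          rwa [add_zero] at this
        have := add_mem h1 h3
        rwa [sub_add_cancel] at this
  exact key _ S rfl v hv hDv

end Alpha

end FreeG

end OperadTw

namespace OperadTw

/-! ### Relabelling and substitution -/

/-- Renaming of labels. -/
def Letter.map (f : ℕ → ℕ) : Letter → Letter
  | .x i => .x (f i)
  | .y i => .y (f i)
  | .al => .al
  | .be => .be

theorem Letter.map_deg (f : ℕ → ℕ) (l : Letter) : (l.map f).deg = l.deg := by cases l <;> rfl

namespace FreeG

variable {K : Type u} [Field K]

theorem rl_aux (f : ℕ → ℕ) (l : Letter) : ltr K (l.map f) ∈ (freeGAlg K).gr l.deg :=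
  mem_gr (ltr_mem (l.map f)) (l.map_deg f)

variable (K) in
/-- The endomorphism of the free algebra which renames the labels. -/
def rl (f : ℕ → ℕ) : FreeG K →ₗ[K] FreeG K := (freeGAlg K).ev _ (rl_aux f)

variable (f g : ℕ → ℕ)

theorem rl_hom : (freeGAlg K).IsHom (rl K f) := GAlg.ev_isHom _

theorem rl_ltr (l : Letter) : rl K f (ltr K l) = ltr K (l.map f) := GAlg.ev_lt _ _

theorem rl_unit : rl K f (unit K) = unit K := (rl_hom f).one

theorem rl_mul (a b : FreeG K) : rl K f (mul K a b) = mul K (rl K f a) (rl K f b) :=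
  (rl_hom f).mul a b

theorem rl_brk (a b : FreeG K) : rl K f (brk K a b) = brk K (rl K f a) (rl K f b) :=
  (rl_hom f).brk a b

/-- Linear maps that agree on the monomials in given generators agree on `lin S`. -/
theorem eq_on_lin {M : Type*} [AddCommGroup M] [Module K M] {F G : FreeG K →ₗ[K] M}
    {S : Finset ℕ} (h : ∀ t : GTerm, t.All (labIn S) → F (cls K t) = G (cls K t)) {v : FreeG K}
    (hv : v ∈ lin K S) : F v = G v :=
  eq_on_wt (fun t ht => h t (all_of_lin ht)) hv

variable {f g}

theorem rl_congr {S : Finset ℕ} (h : ∀ i ∈ S, f i = g i) {v : FreeG K} (hv : v ∈ lin K S) :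
    rl K f v = rl K g v := by
  refine eq_on_lin (fun t ht => ?_) hv
  induction t with
  | one => exact (rl_unit f).trans (rl_unit g).symm
  | lt l =>
    refine (rl_ltr f l).trans (Eq.trans ?_ (rl_ltr g l).symm)
    cases l with
    | x i => simp only [Letter.map, h i (labIn_x ht)]
    | y i => simp only [Letter.map, h i (labIn_y ht)]
    | al => rfl
    | be => rfl
  | mul s t hs ht' => rw [← mul_cls, rl_mul, rl_mul, hs ht.1, ht' ht.2]
  | brk s t hs ht' => rw [← brk_cls, rl_brk, rl_brk, hs ht.1, ht' ht.2]

theorem rl_rl (v : FreeG K) : rl K f (rl K g v) = rl K (fun i => f (g i)) v := by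
  have : rl K f ∘ₗ rl K g = rl K (fun i => f (g i)) := hom_ext fun t => by
    rw [LinearMap.comp_apply]
    induction t with
    | one => rw [rl_unit, rl_unit, rl_unit]
    | lt l =>
      rw [rl_ltr, rl_ltr, rl_ltr]
      cases l <;> rfl
    | mul s t hs ht => rw [← mul_cls, rl_mul, rl_mul, rl_mul, hs, ht]
    | brk s t hs ht => rw [← brk_cls, rl_brk, rl_brk, rl_brk, hs, ht]
  exact LinearMap.congr_fun this v

theorem rl_id (v : FreeG K) : rl K (fun i => i) v = v := by
  have : rl K (fun i => i) = LinearMap.id := hom_ext fun t => by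
    rw [LinearMap.id_apply]
    induction t with
    | one => rw [rl_unit]
    | lt l =>
      rw [rl_ltr]
      cases l <;> rfl
    | mul s t hs ht => rw [← mul_cls, rl_mul, hs, ht]
    | brk s t hs ht => rw [← brk_cls, rl_brk, hs, ht]
  exact LinearMap.congr_fun this v

theorem rl_eq_self {S : Finset ℕ} (h : ∀ i ∈ S, f i = i) {v : FreeG K} (hv : v ∈ lin K S) :
    rl K f v = v := (rl_congr h hv).trans (rl_id v)

theorem hom_mem_wt {Γ Γ' : Type} [AddCommMonoid Γ] [AddCommMonoid Γ'] {g : Letter → Γ}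
    {g' : Letter → Γ'} {b : Γ} {b' : Γ'} (φ : Γ →+ Γ') (hb : φ b = b')
    {F : FreeG K →ₗ[K] FreeG K} (hF : (freeGAlg K).IsHom F) {p : Letter → Prop}
    (hl : ∀ l, p l → F (ltr K l) ∈ wtSub g' b' (φ (g l))) {c : Γ}
    (hp : ∀ t : GTerm, t.wt g b = c → t.All p) {v : FreeG K}
    (hv : v ∈ wtSub g b c) : F v ∈ wtSub g' b' (φ c) := by
  have key : ∀ t : GTerm, t.All p → F (cls K t) ∈ wtSub g' b' (φ (t.wt g b)) := by
    intro t ht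
    induction t with
    | one =>
      rw [show F (cls K .one) = unit K from hF.one, GTerm.wt, map_zero]
      exact cls_mem_wtSub g' b' .one
    | lt l => exact hl l ht
    | mul s t hs ht' =>
      rw [← mul_cls, show F (mul K _ _) = mul K _ _ from hF.mul _ _, GTerm.wt, map_add]
      exact mul_mem_wt (hs ht.1) (ht' ht.2)
    | brk s t hs ht' =>
      rw [← brk_cls, show F (brk K _ _) = brk K _ _ from hF.brk _ _, GTerm.wt, map_add, map_add, hb]
      exact brk_mem_wt (hs ht.1) (ht' ht.2)
  have h1 : wtSub g b c ≤ (wtSub g' b' (φ c)).comap F := wtSub_le fun t ht => by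
    have := key t (hp t ht)
    rwa [ht] at this
  exact h1 hv

theorem all_true (t : GTerm) : t.All (fun _ => True) := by
  induction t with
  | one => trivial
  | lt l => trivial
  | mul s t hs ht => exact ⟨hs, ht⟩
  | brk s t hs ht => exact ⟨hs, ht⟩

theorem rl_gr {d : ℤ} {v : FreeG K} (hv : v ∈ gr K d) : rl K f v ∈ gr K d :=
  hom_mem_wt (AddMonoidHom.id ℤ) rfl (rl_hom f) (p := fun _ => True)
    (fun l _ => mem_gr (by rw [rl_ltr]; exact ltr_mem _) (l.map_deg f))
    (fun t _ => all_true t) hv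

/-- The push-forward of multiplicities of labels. -/
def pushLab (f : ℕ → ℕ) (S : Finset ℕ) : (ℕ → ℤ) →+ (ℕ → ℤ) where
  toFun c := ∑ i ∈ S, Pi.single (f i) (c i)
  map_zero' := by simp
  map_add' c d := by simp [Pi.single_add, Finset.sum_add_distrib]

theorem pushLab_single {S : Finset ℕ} {i : ℕ} (hi : i ∈ S) :
    pushLab f S (Pi.single i 1) = Pi.single (f i) 1 := by
  change ∑ j ∈ S, (Pi.single (f j) ((Pi.single i (1 : ℤ) : ℕ → ℤ) j) : ℕ → ℤ) = _
  rw [Finset.sum_eq_single i]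
  · simp
  · intro j _ hj
    simp [Pi.single_apply, hj]
  · exact fun h => absurd hi h

theorem pushLab_ind {S : Finset ℕ} (h : Set.InjOn f S) : pushLab f S (ind S) = ind (S.image f) := by
  change ∑ j ∈ S, (Pi.single (f j) (ind S j) : ℕ → ℤ) = _
  funext k
  rw [Finset.sum_apply, ind]
  by_cases hk : k ∈ S.image f
  · obtain ⟨i, hi, rfl⟩ := Finset.mem_image.1 hk
    rw [if_pos hk, Finset.sum_eq_single i]
    · simp [ind, hi]
    · intro j hj hji
      have : f i ≠ f j := fun hh => hji (h hj hi hh.symm)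
      simp [Pi.single_apply, this]
    · exact fun h => absurd hi h
  · rw [if_neg hk]
    refine Finset.sum_eq_zero fun j hj => ?_
    have : k ≠ f j := fun hh => hk (Finset.mem_image.2 ⟨j, hj, hh.symm⟩)
    simp [Pi.single_apply, this]

theorem rl_lin {S T : Finset ℕ} (h : Set.InjOn f S) (hT : S.image f = T) {v : FreeG K}
    (hv : v ∈ lin K S) : rl K f v ∈ lin K T := by
  have h1 := hom_mem_wt (pushLab f S) (map_zero _) (rl_hom (K := K) f) (p := labIn S) (g := lab)
    (g' := lab) (b := 0) (b' := 0) (by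
      rintro (i | i | _ | _) hl
      · rw [rl_ltr]
        exact ltr_wt _ (pushLab_single (labIn_x hl)).symm
      · rw [rl_ltr]
        exact ltr_wt _ (pushLab_single (labIn_y hl)).symm
      · rw [rl_ltr]
        exact ltr_wt _ (map_zero _).symm
      · rw [rl_ltr]
        exact ltr_wt _ (map_zero _).symm) (c := ind S) (fun t ht => all_of_lin ht) hv
  rwa [pushLab_ind h, hT] at h1

/-! ### The operator `Δ` -/

/-- The operator of Batalin-Vilkovisky algebras on the free algebra. -/
structure IsBV (L : FreeG K →ₗ[K] FreeG K) : Prop where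
  op : IsOp 1 (fun _ => brk K) (fun _ => 0) L
  x : ∀ i, L (vx K i) = vy K i
  y : ∀ i, L (vy K i) = 0
  a : L (va K) = vb K
  b : L (vb K) = 0

theorem exists_isBV : ∃ L : FreeG K →ₗ[K] FreeG K, IsBV L := by
  obtain ⟨L, h, hl⟩ := exists_isOp_brk (K := K) (fun l => match l with
    | .x i => vy K i
    | .y i => 0
    | .al => vb K
    | .be => 0) (by
      rintro (i | i | _ | _)
      · exact mem_gr (vy_mem i) (by rfl)
      · exact zero_mem _
      · exact mem_gr vb_mem (by rfl)
      · exact zero_mem _)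
  exact ⟨L, h, fun i => hl (.x i), fun i => hl (.y i), hl .al, hl .be⟩

variable (K) in
/-- The operator `Δ`. -/
def dl : FreeG K →ₗ[K] FreeG K := exists_isBV.choose

theorem dl_isBV : IsBV (dl K) := exists_isBV.choose_spec

theorem dl_mul {i : ℤ} {a : FreeG K} (ha : a ∈ gr K i) (b : FreeG K) : dl K (mul K a b) =
    mul K (dl K a) b + sg K i • mul K a (dl K b) + brk K a b := by
  have := dl_isBV.op.mul b ha
  rwa [_root_.one_mul] at this

theorem dl_brk {i : ℤ} {a : FreeG K} (ha : a ∈ gr K i) (b : FreeG K) : dl K (brk K a b) =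
    - brk K (dl K a) b - sg K i • brk K a (dl K b) := by
  have := dl_isBV.op.brk b ha
  rw [_root_.one_mul] at this
  rw [this, sg_one, LinearMap.zero_apply, LinearMap.zero_apply]
  module

theorem dl_unit : dl K (unit K) = 0 := dl_isBV.op.one

theorem dl_wt {Γ : Type} [AddCommMonoid Γ] {g : Letter → Γ} {b e : Γ}
    (hx : ∀ i, g (.y i) = g (.x i) + e) (ha : g .be = g .al + e) (he : b = e)
    {c : Γ} {v : FreeG K} (hv : v ∈ wtSub g b c) : dl K v ∈ wtSub g b (c + e) := by
  refine dl_isBV.op.mem_wt ?_ ?_ ?_ hv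
  · rintro (i | i | _ | _)
    · rw [show dl K (ltr K (.x i)) = _ from dl_isBV.x i]
      exact ltr_wt _ (hx i)
    · rw [show dl K (ltr K (.y i)) = _ from dl_isBV.y i]
      exact zero_mem _
    · rw [show dl K (ltr K .al) = _ from dl_isBV.a]
      exact ltr_wt _ ha
    · rw [show dl K (ltr K .be) = _ from dl_isBV.b]
      exact zero_mem _
  · intro i c d u v hu hv
    rw [← he]
    exact brk_mem_wt hu hv
  · intro i c d u v hu hv
    exact zero_mem _

theorem dl_gr {d : ℤ} {v : FreeG K} (hv : v ∈ gr K d) : dl K v ∈ gr K (d + 1) :=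
  dl_wt (fun _ => rfl) rfl rfl hv

theorem dl_lin {S : Finset ℕ} {v : FreeG K} (hv : v ∈ lin K S) : dl K v ∈ lin K S := by
  have := dl_wt (e := 0) (fun i => (add_zero _).symm) (add_zero _).symm rfl hv
  rwa [add_zero] at this

theorem dl_dl (v : FreeG K) : dl K (dl K v) = 0 := by
  have : dl K ∘ₗ dl K = 0 := hom_ext fun t => by
    rw [LinearMap.comp_apply, LinearMap.zero_apply]
    induction t with
    | one => rw [dl_unit, map_zero]
    | lt l =>
      cases l with
      | x i => exact (congrArg (dl K) (dl_isBV.x i)).trans (dl_isBV.y i)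
      | y i => exact (congrArg (dl K) (dl_isBV.y i)).trans (map_zero _)
      | al => exact (congrArg (dl K) dl_isBV.a).trans dl_isBV.b
      | be => exact (congrArg (dl K) dl_isBV.b).trans (map_zero _)
    | mul s t hs ht =>
      have h := cls_mem_wtSub (K := K) Letter.deg 1 s
      rw [← mul_cls, dl_mul h, map_add, map_add, map_smul, dl_mul h, dl_mul (dl_gr h), dl_brk h,
        hs, ht]
      rcases sg_parity K (s.wt Letter.deg 1) with ⟨h1, -⟩ | ⟨h1, -⟩ <;>
        simp only [sg_add, h1, sg_one, map_zero, LinearMap.zero_apply] <;> module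
    | brk s t hs ht =>
      have h := cls_mem_wtSub (K := K) Letter.deg 1 s
      rw [← brk_cls, dl_brk h, map_sub, map_neg, map_smul, dl_brk h, dl_brk (dl_gr h), hs, ht]
      rcases sg_parity K (s.wt Letter.deg 1) with ⟨h1, -⟩ | ⟨h1, -⟩ <;>
        simp only [sg_add, h1, sg_one, map_zero, LinearMap.zero_apply] <;> module
  exact LinearMap.congr_fun this v

theorem rl_dl (v : FreeG K) : rl K f (dl K v) = dl K (rl K f v) := by
  have : rl K f ∘ₗ dl K = dl K ∘ₗ rl K f := hom_ext fun t => by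
    rw [LinearMap.comp_apply, LinearMap.comp_apply]
    induction t with
    | one => rw [dl_unit, rl_unit, dl_unit, map_zero]
    | lt l =>
      rw [rl_ltr]
      cases l with
      | x i => rw [dl_isBV.x, rl_ltr]; exact (dl_isBV.x _).symm
      | y i => rw [dl_isBV.y, map_zero]; exact (dl_isBV.y _).symm
      | al => rw [dl_isBV.a, rl_ltr]; exact dl_isBV.a.symm
      | be => rw [dl_isBV.b, map_zero]; exact dl_isBV.b.symm
    | mul s t hs ht =>
      have h := cls_mem_wtSub (K := K) Letter.deg 1 s
      rw [← mul_cls, dl_mul h, rl_mul, dl_mul (rl_gr h), map_add, map_add, map_smul, rl_mul, rl_mul,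
        rl_brk, hs, ht]
    | brk s t hs ht =>
      have h := cls_mem_wtSub (K := K) Letter.deg 1 s
      rw [← brk_cls, dl_brk h, rl_brk, dl_brk (rl_gr h), map_sub, map_neg, map_smul, rl_brk, rl_brk,
        hs, ht]
  exact LinearMap.congr_fun this v

/-! ### Substitution for one label -/

/-- The derivation of degree `b` which replaces the label `i` by `w`. -/
abbrev IsSb (i : ℕ) (b : ℤ) (w : FreeG K) (δ : FreeG K →ₗ[K] FreeG K) : Prop :=
  DerV b (pt i w) (pt i (sg K b • dl K w)) 0 0 δ

theorem exists_isSb (i : ℕ) {b : ℤ} {w : FreeG K} (hw : w ∈ gr K b) :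
    ∃ δ : FreeG K →ₗ[K] FreeG K, IsSb i b w δ :=
  exists_derV (fun j => pt_mem hw)
    (fun j => pt_mem (Submodule.smul_mem _ _ (mem_gr (dl_gr hw) (add_comm _ _))))
    (zero_mem _) (zero_mem _)

/-- Substitution of `w` for the label `i`. -/
def sb (i : ℕ) (b : ℤ) : gr K b →ₗ[K] FreeG K →ₗ[K] FreeG K where
  toFun w := (exists_isSb i w.2).choose
  map_add' v w := (exists_isSb i (v + w).2).choose_spec.ext
    ((exists_isSb i v.2).choose_spec.add (exists_isSb i w.2).choose_spec)
    (fun j => by simp only [pt]; split_ifs <;> simp)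
    (fun j => by simp only [pt]; split_ifs <;> simp) (by simp) (by simp)
  map_smul' r w := (exists_isSb i (r • w).2).choose_spec.ext
    ((exists_isSb i w.2).choose_spec.smul r)
    (fun j => by simp only [pt]; split_ifs <;> simp)
    (fun j => by simp only [pt]; split_ifs <;> simp [smul_comm r]) (by simp) (by simp)

theorem sb_isSb (i : ℕ) {b : ℤ} (w : gr K b) : IsSb i b w (sb i b w) :=
  (exists_isSb i w.2).choose_spec

section IsSb

variable {i k : ℕ} {b c : ℤ} {w z : FreeG K} {δ δ' : FreeG K →ₗ[K] FreeG K}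

theorem IsSb.dl (h : IsSb i b w δ) (v : FreeG K) : δ (dl K v) = sg K b • FreeG.dl K (δ v) := by
  have h1 := IsOp.comm_brk h.der h.shift dl_isBV.op (fun ha => dl_gr ha)
  rw [_root_.one_mul] at h1
  have h2 : δ ∘ₗ FreeG.dl K - sg K b • FreeG.dl K ∘ₗ δ = 0 := h1.ext DerV.zero.der (by
    rintro (j | j | _ | _)
    · simp only [LinearMap.sub_apply, LinearMap.comp_apply, LinearMap.smul_apply, dl_isBV.x, h.x, h.y]
      simp only [pt]
      split_ifs <;> simp
    · simp only [LinearMap.sub_apply, LinearMap.comp_apply, LinearMap.smul_apply, dl_isBV.y, h.x, h.y]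
      simp only [pt]
      split_ifs <;> simp [dl_dl]
    · simp only [LinearMap.sub_apply, LinearMap.comp_apply, LinearMap.smul_apply, dl_isBV.a, h.a, h.b]
      simp
    · simp only [LinearMap.sub_apply, LinearMap.comp_apply, LinearMap.smul_apply, dl_isBV.b, h.a, h.b]
      simp)
  have h3 := LinearMap.congr_fun h2 v
  exact sub_eq_zero.1 h3

/-- Substitution commutes with renaming. -/
theorem IsSb.rl (h : IsSb i b w δ) (h' : IsSb (f i) b (rl K f w) δ') {S : Finset ℕ}
    (hS : ∀ j ∈ S, j ≠ i → f j ≠ f i) {v : FreeG K} (hv : v ∈ lin K S) :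
    FreeG.rl K f (δ v) = δ' (FreeG.rl K f v) := by
  refine eq_on_lin (F := FreeG.rl K f ∘ₗ δ) (G := δ' ∘ₗ FreeG.rl K f) (fun t ht => ?_) hv
  rw [LinearMap.comp_apply, LinearMap.comp_apply]
  induction t with
  | one => rw [h.one, rl_unit, h'.one, map_zero]
  | lt l =>
    cases l with
    | x j =>
      rw [h.x, rl_ltr]
      refine Eq.trans ?_ (h'.x _).symm
      by_cases hj : j = i
      · subst hj; rw [pt_self, pt_self]
      · rw [pt_ne hj, pt_ne (hS j (labIn_x ht) hj), map_zero]
    | y j =>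
      rw [h.y, rl_ltr]
      refine Eq.trans ?_ (h'.y _).symm
      by_cases hj : j = i
      · subst hj; rw [pt_self, pt_self, map_smul, rl_dl]
      · rw [pt_ne hj, pt_ne (hS j (labIn_y ht) hj), map_zero]
    | al => rw [h.a, rl_ltr, map_zero]; exact h'.a.symm
    | be => rw [h.b, rl_ltr, map_zero]; exact h'.b.symm
  | mul s t hs ht' =>
    have hd := cls_mem_wtSub (K := K) Letter.deg 1 s
    rw [← mul_cls, h.der.mul _ hd, rl_mul, h'.der.mul _ (rl_gr hd), ← hs ht.1, ← ht' ht.2]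
    simp [rl_mul]
  | brk s t hs ht' =>
    have hd := cls_mem_wtSub (K := K) Letter.deg 1 s
    rw [← brk_cls, h.der.brk _ hd, rl_brk, h'.der.brk _ (rl_gr hd), ← hs ht.1, ← ht' ht.2]
    simp [rl_brk]

/-- Substitution of a generator is renaming. -/
theorem IsSb.var (h : IsSb i 0 (vx K k) δ) {S : Finset ℕ} (hi : i ∈ S) {v : FreeG K}
    (hv : v ∈ lin K S) : δ v = FreeG.rl K (fun j => if j = i then k else j) v := by
  have key : ∀ t : GTerm, (t.wt lab 0 i = 0 → δ (cls K t) = 0 ∧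
      FreeG.rl K (fun j => if j = i then k else j) (cls K t) = cls K t) ∧
      (t.wt lab 0 i = 1 → δ (cls K t) =
        FreeG.rl K (fun j => if j = i then k else j) (cls K t)) := by
    intro t
    induction t with
    | one => exact ⟨fun _ => ⟨h.one, rl_unit _⟩, fun h => absurd h (by simp [GTerm.wt])⟩
    | lt l =>
      cases l with
      | x j =>
        rw [rl_ltr, h.x, GTerm.wt, lab]
        by_cases hj : j = i
        · subst hj; simp [pt_self, Letter.map]
        · have hj' : ¬ i = j := fun h => hj h.symm
          simp [pt_ne hj, Letter.map, hj, hj', Pi.single_apply]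
      | y j =>
        rw [rl_ltr, h.y, GTerm.wt, lab]
        by_cases hj : j = i
        · subst hj; simp [pt_self, Letter.map, dl_isBV.x]
        · have hj' : ¬ i = j := fun h => hj h.symm
          simp [pt_ne hj, Letter.map, hj, hj', Pi.single_apply]
      | al => rw [rl_ltr, h.a, GTerm.wt, lab]; simp [Letter.map]
      | be => rw [rl_ltr, h.b, GTerm.wt, lab]; simp [Letter.map]
    | mul s t hs ht =>
      have hd := cls_mem_wtSub (K := K) Letter.deg 1 s
      have e1 : (GTerm.mul s t).wt lab 0 i = s.wt lab 0 i + t.wt lab 0 i := rfl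
      have h1 := wt_nonneg s i
      have h2 := wt_nonneg t i
      rw [e1, ← mul_cls, h.der.mul _ hd, rl_mul]
      constructor
      · intro h0
        rw [(hs.1 (by omega)).1, (hs.1 (by omega)).2, (ht.1 (by omega)).1, (ht.1 (by omega)).2]
        simp
      · intro h0
        rcases (show s.wt lab 0 i = 0 ∧ t.wt lab 0 i = 1 ∨ s.wt lab 0 i = 1 ∧ t.wt lab 0 i = 0 by
          omega) with ⟨a, b⟩ | ⟨a, b⟩
        · rw [(hs.1 a).1, (hs.1 a).2, ht.2 b]
          simp
        · rw [hs.2 a, (ht.1 b).2, (ht.1 b).1]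
          simp
    | brk s t hs ht =>
      have hd := cls_mem_wtSub (K := K) Letter.deg 1 s
      have e1 : (GTerm.brk s t).wt lab 0 i = s.wt lab 0 i + t.wt lab 0 i :=
        add_zero (s.wt lab 0 i + t.wt lab 0 i)
      have h1 := wt_nonneg s i
      have h2 := wt_nonneg t i
      rw [e1, ← brk_cls, h.der.brk _ hd, rl_brk]
      constructor
      · intro h0
        rw [(hs.1 (by omega)).1, (hs.1 (by omega)).2, (ht.1 (by omega)).1, (ht.1 (by omega)).2]
        simp
      · intro h0
        rcases (show s.wt lab 0 i = 0 ∧ t.wt lab 0 i = 1 ∨ s.wt lab 0 i = 1 ∧ t.wt lab 0 i = 0 by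
          omega) with ⟨a, b⟩ | ⟨a, b⟩
        · rw [(hs.1 a).1, (hs.1 a).2, ht.2 b]
          simp
        · rw [hs.2 a, (ht.1 b).2, (ht.1 b).1]
          simp
  refine eq_on_wt (fun t ht => (key t).2 ?_) hv
  rw [ht, ind, if_pos hi]

theorem IsSb.lin (h : IsSb i b w δ) {S T R : Finset ℕ} (hi : i ∈ S) (hw : w ∈ lin K T)
    (hd : Disjoint (S.erase i) T) (hR : S.erase i ∪ T = R) {v : FreeG K} (hv : v ∈ lin K S) :
    δ v ∈ lin K R := by
  have e : ∀ j, j = i → (Pi.single j (1 : ℤ) + (ind T + -Pi.single i 1) : ℕ → ℤ) = ind T := by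
    rintro j rfl; abel
  have h1 := h.lin_mem (e := ind T + -Pi.single i 1) (fun j => by
      by_cases hj : j = i
      · rw [e j hj, hj, pt_self]; exact hw
      · rw [pt_ne hj]; exact zero_mem _)
    (fun j => by
      by_cases hj : j = i
      · rw [e j hj, hj, pt_self]; exact Submodule.smul_mem _ _ (dl_lin hw)
      · rw [pt_ne hj]; exact zero_mem _) (zero_mem _) (zero_mem _) hv
  have e2 : ind S + (ind T + -Pi.single i 1) = ind R := by
    rw [show ind S + (ind T + -Pi.single i 1) = (ind S + -Pi.single i 1) + ind T by abel,
      ← ind_erase hi, ← hR]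
    funext j
    simp only [ind, Pi.add_apply, Finset.mem_union]
    have h3 : j ∈ S.erase i → j ∉ T := fun h => Finset.disjoint_left.1 hd h
    by_cases h1 : j ∈ S.erase i <;> by_cases h2 : j ∈ T <;> simp_all
  rwa [e2] at h1

/-- Sequential substitution. -/
theorem IsSb.seq (hk : IsSb k c z δ') (hi : IsSb i b w δ) {S : Finset ℕ} (hS : k ∉ S)
    {δ'' : FreeG K →ₗ[K] FreeG K} (h : IsSb i (b + c) (δ' w) δ'') {v : FreeG K}
    (hv : v ∈ FreeG.lin K S) : δ' (δ v) = δ'' v := by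
  have h1 := DerV.comm hk hi
  have h0 : δ' v = 0 := lin_label hv hk hS
  have h2 := DerV.eq_on_lin h1 h (S := S) (fun j hj => by
      rw [pt_ne (show j ≠ k from fun h => hS (h ▸ hj)), map_zero, smul_zero, sub_zero]
      simp only [pt]
      split_ifs <;> simp)
    (fun j hj => by
      rw [pt_ne (show j ≠ k from fun h => hS (h ▸ hj)), map_zero, smul_zero, sub_zero]
      simp only [pt]
      split_ifs
      · rw [map_smul, hk.dl, smul_smul, sg_add]
      · simp) (by simp) (by simp) hv
  rw [LinearMap.sub_apply, LinearMap.comp_apply, LinearMap.smul_apply, LinearMap.comp_apply, h0,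
    map_zero, smul_zero, sub_zero] at h2
  exact h2

/-- Parallel substitution. -/
theorem IsSb.par (hk : IsSb k c z δ') (hi : IsSb i b w δ) (hw : δ' w = 0) (hz : δ z = 0)
    (v : FreeG K) : δ' (δ v) = sg K (b * c) • δ (δ' v) := by
  have e : ∀ (δ : FreeG K →ₗ[K] FreeG K) (j n : ℕ) (v : FreeG K), δ v = 0 → δ (pt n v j) = 0 := by
    intro δ j n v h
    simp only [pt]
    split_ifs
    · exact h
    · exact map_zero _
  refine DerV.comm_eq hk hi (fun j => ?_) (fun j => ?_) (by simp) (by simp) v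
  · rw [e _ _ _ _ hw, e _ _ _ _ hz, smul_zero]
  · rw [e _ _ _ _ (by rw [map_smul, hk.dl, hw, map_zero, smul_zero, smul_zero]),
      e _ _ _ _ (by rw [map_smul, hi.dl, hz, map_zero, smul_zero, smul_zero]), smul_zero]

end IsSb

end FreeG

end OperadTw

namespace OperadTw

open Graft

namespace FreeG

variable {K : Type u} [Field K]

/-- Extension of a labelling of inputs to all natural numbers. -/
def exF {m : ℕ} (f : Fin m → ℕ) : ℕ → ℕ := fun j => if h : j < m then f ⟨j, h⟩ else j

theorem exF_val {m : ℕ} (f : Fin m → ℕ) (a : Fin m) : exF f a = f a := by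
  rw [exF, dif_pos a.2]

/-- The labelling which sends `i` to `N` and is given by `φ` elsewhere. -/
def plF {m : ℕ} (i : Fin m) (φ : ∀ a : Fin m, a ≠ i → ℕ) (N : ℕ) : Fin m → ℕ :=
  fun a => if h : a = i then N else φ a h

theorem plF_self {m : ℕ} (i : Fin m) (φ : ∀ a : Fin m, a ≠ i → ℕ) (N : ℕ) : plF i φ N i = N :=
  dif_pos rfl

theorem plF_ne {m : ℕ} {i a : Fin m} (φ : ∀ a : Fin m, a ≠ i → ℕ) (N : ℕ) (h : a ≠ i) :
    plF i φ N a = φ a h :=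
  dif_neg h

theorem rl_exF_congr {m : ℕ} {f : Fin m → ℕ} {g : ℕ → ℕ} (h : ∀ a : Fin m, g a = f a) {v : FreeG K}
    (hv : v ∈ lin K (Finset.range m)) : rl K g v = rl K (exF f) v :=
  rl_congr (fun i hi => (h ⟨i, Finset.mem_range.1 hi⟩).trans (exF_val f ⟨i, _⟩).symm) hv

theorem rl_rl_exF {m : ℕ} (f : Fin m → ℕ) (g : ℕ → ℕ) {v : FreeG K}
    (hv : v ∈ lin K (Finset.range m)) :
    rl K g (rl K (exF f) v) = rl K (exF fun a => g (f a)) v := by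
  rw [rl_rl]
  exact rl_exF_congr (fun a => by rw [exF_val]) hv

theorem rl_exF_lin {m : ℕ} {f : Fin m → ℕ} (hf : Function.Injective f) {v : FreeG K}
    (hv : v ∈ lin K (Finset.range m)) : rl K (exF f) v ∈ lin K (Finset.univ.image f) := by
  refine rl_lin ?_ ?_ hv
  · intro a ha b hb hab
    have ha := Finset.mem_range.1 (Finset.mem_coe.1 ha)
    have hb := Finset.mem_range.1 (Finset.mem_coe.1 hb)
    rw [exF, dif_pos ha, exF, dif_pos hb] at hab
    simpa using hf hab
  · ext j
    simp only [Finset.mem_image, Finset.mem_range, Finset.mem_univ, true_and]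
    constructor
    · rintro ⟨a, ha, rfl⟩
      exact ⟨⟨a, ha⟩, (exF_val f ⟨a, ha⟩).symm⟩
    · rintro ⟨a, rfl⟩
      exact ⟨a, a.2, exF_val f a⟩

theorem IsSb.smul {i : ℕ} {b : ℤ} {w : FreeG K} {δ : FreeG K →ₗ[K] FreeG K} (h : IsSb i b w δ)
    (r : K) : IsSb i b (r • w) (r • δ) where
  der := (DerV.smul h r).der
  shift := (DerV.smul h r).shift
  x j := by
    rw [(DerV.smul h r).x]; simp only [pt]; split_ifs <;> simp
  y j := by
    rw [(DerV.smul h r).y]; simp only [pt]; split_ifs <;> simp [smul_comm r]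
  a := by rw [(DerV.smul h r).a, smul_zero]
  b := by rw [(DerV.smul h r).b, smul_zero]

section Graft

variable {m n p : ℕ} {i : Fin m} (e : Graft i n p)

theorem outer_inj {a b : Fin m} {ha : a ≠ i} {hb : b ≠ i} (h : outer e a ha = outer e b hb) :
    a = b := by
  have := e.injective h
  simpa using this

theorem inner_inj {a b : Fin n} (h : inner e a = inner e b) : a = b := by
  have := e.injective h
  simpa using this

theorem outer_ne_inner {a : Fin m} (ha : a ≠ i) (b : Fin n) : outer e a ha ≠ inner e b := fun h => by
  have := e.injective h
  simp at this

theorem graft_cases (t : Fin p) : (∃ a, ∃ ha : a ≠ i, outer e a ha = t) ∨ ∃ b, inner e b = t := by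
  obtain ⟨s, rfl⟩ := e.surjective t
  rcases s with ⟨a, ha⟩ | b
  · exact .inl ⟨a, ha, rfl⟩
  · exact .inr ⟨b, rfl⟩

/-- The labels of the outer inputs, where the input `i` is labelled by `N`. -/
abbrev outF (N : ℕ) : Fin m → ℕ := plF i (fun a ha => (outer e a ha : ℕ)) N

/-- The labels of the inner inputs. -/
abbrev inF : Fin n → ℕ := fun b => (inner e b : ℕ)

theorem outF_self (N : ℕ) : outF e N i = N := plF_self _ _ _

theorem outF_ne {a : Fin m} (N : ℕ) (h : a ≠ i) : outF e N a = outer e a h := plF_ne _ _ h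

theorem inF_inj : Function.Injective (inF e) := fun a b h => inner_inj e (Fin.ext h)

theorem plF_inj {φ : ∀ a : Fin m, a ≠ i → ℕ} {N : ℕ}
    (hφ : ∀ a b (ha : a ≠ i) (hb : b ≠ i), φ a ha = φ b hb → a = b) (hN : ∀ a ha, φ a ha ≠ N) :
    Function.Injective (plF i φ N) := by
  intro a b h
  by_cases ha : a = i <;> by_cases hb : b = i
  · rw [ha, hb]
  · rw [ha, plF_self, plF_ne _ _ hb] at h
    exact absurd h.symm (hN b hb)
  · rw [hb, plF_self, plF_ne _ _ ha] at h
    exact absurd h (hN a ha)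
  · rw [plF_ne _ _ ha, plF_ne _ _ hb] at h
    exact hφ a b ha hb h

theorem outF_inj : Function.Injective (outF e p) :=
  plF_inj (fun a b ha hb h => outer_inj e (Fin.ext h)) (fun a ha => (outer e a ha).2.ne)

end Graft

/-! ### The operad of multilinear elements -/

variable {m n p : ℕ} {i : Fin m} {a b c : ℤ} {x y : FreeG K}

/-- The partial composition of multilinear elements. -/
def plug (e : Graft i n p) (a b : ℤ) (x : FreeG K) (y : gr K b) : FreeG K :=
  sg K (a * b) • sb p b ⟨rl K (exF (inF e)) y, rl_gr y.2⟩ (rl K (exF (outF e p)) x)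

theorem plug_lin (e : Graft i n p) (hx : x ∈ lin K (Finset.range m)) (hy : y ∈ gr K b)
    (hy' : y ∈ lin K (Finset.range n)) : plug e a b x ⟨y, hy⟩ ∈ lin K (Finset.range p) := by
  refine Submodule.smul_mem _ _ ((sb_isSb p _).lin ?_ (rl_exF_lin (inF_inj e) hy') ?_ ?_
    (rl_exF_lin (outF_inj e) hx))
  · exact Finset.mem_image.2 ⟨i, Finset.mem_univ i, plF_self _ _ _⟩
  · rw [Finset.disjoint_left]
    intro j hj hj'
    obtain ⟨hj1, hj⟩ := Finset.mem_erase.1 hj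
    obtain ⟨s, -, rfl⟩ := Finset.mem_image.1 hj
    obtain ⟨t, -, ht⟩ := Finset.mem_image.1 hj'
    by_cases hs : s = i
    · rw [hs, outF_self] at hj1
      exact hj1 rfl
    · rw [outF_ne _ _ hs] at ht
      exact outer_ne_inner e hs t (Fin.ext ht.symm)
  · ext j
    simp only [Finset.mem_union, Finset.mem_erase, Finset.mem_image, Finset.mem_univ, true_and,
      Finset.mem_range]
    constructor
    · rintro (⟨hj, s, rfl⟩ | ⟨s, rfl⟩)
      · by_cases hs : s = i
        · rw [hs, outF_self] at hj
          exact absurd rfl hj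
        · rw [outF_ne _ _ hs]
          exact (outer e s hs).2
      · exact (inner e s).2
    · intro hj
      rcases graft_cases e ⟨j, hj⟩ with ⟨s, hs, h⟩ | ⟨s, h⟩
      · exact .inl ⟨hj.ne, s, by rw [outF_ne _ _ hs, h]⟩
      · exact .inr ⟨s, by rw [inF, h]⟩

theorem plug_gr (e : Graft i n p) (h : a + b = c) (hx : x ∈ gr K a) (y : gr K b) :
    plug e a b x y ∈ gr K c :=
  Submodule.smul_mem _ _ (mem_gr ((sb_isSb p _).shift (rl_gr hx)) h)

/-- Renaming of the labels of a composite. -/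
theorem rl_plug (e : Graft i n p) (g : ℕ → ℕ) {N : ℕ} (hN : ∀ s hs, g (outer e s hs) ≠ N)
    (hx : x ∈ lin K (Finset.range m)) (hy : y ∈ gr K b) (hy' : y ∈ lin K (Finset.range n))
    {δ : FreeG K →ₗ[K] FreeG K} (hδ : IsSb N b (rl K (exF fun s => g (inF e s)) y) δ) :
    rl K g (plug e a b x ⟨y, hy⟩) = sg K (a * b) •
      δ (rl K (exF (plF i (fun s hs => g (outer e s hs)) N)) x) := by
  let g' : ℕ → ℕ := fun j => if j = p then N else g j
  have hg : ∀ j : Fin p, g' j = g j := fun j => if_neg j.2.ne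
  have hgp : g' p = N := if_pos rfl
  rw [rl_congr (g := g') (fun j hj => (hg ⟨j, Finset.mem_range.1 hj⟩).symm) (plug_lin e hx hy hy'),
    plug, map_smul]
  have h1 : rl K g' (rl K (exF (inF e)) y) = rl K (exF fun s => g (inF e s)) y := by
    rw [rl_rl_exF _ _ hy']
    exact rl_exF_congr (fun s => by rw [exF_val]; exact hg _) hy'
  have h2 : rl K g' (rl K (exF (outF e p)) x) =
      rl K (exF (plF i (fun s hs => g (outer e s hs)) N)) x := by
    rw [rl_rl_exF _ _ hx]
    refine rl_exF_congr (fun s => ?_) hx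
    rw [exF_val]
    by_cases hs : s = i
    · rw [hs, outF_self, plF_self, hgp]
    · rw [outF_ne _ _ hs, plF_ne _ _ hs]
      exact hg _
  have hδ' : IsSb (g' p) b (rl K g' (rl K (exF (inF e)) y)) δ := by rw [h1, hgp]; exact hδ
  rw [(sb_isSb p ⟨rl K (exF (inF e)) y, rl_gr hy⟩).rl hδ' (S := Finset.univ.image (outF e p)) ?_
    (rl_exF_lin (outF_inj e) hx), h2]
  intro j hj hjp
  obtain ⟨s, -, rfl⟩ := Finset.mem_image.1 hj
  by_cases hs : s = i
  · rw [hs, outF_self] at hjp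
    exact absurd rfl hjp
  · rw [outF_ne _ _ hs, hgp, hg]
    exact hN s hs

theorem plug_eq (e : Graft i n p) {N : ℕ} (hN : p ≤ N)
    (hx : x ∈ lin K (Finset.range m)) (hy : y ∈ gr K b) (hy' : y ∈ lin K (Finset.range n))
    {δ : FreeG K →ₗ[K] FreeG K} (hδ : IsSb N b (rl K (exF (inF e)) y) δ) :
    plug e a b x ⟨y, hy⟩ = sg K (a * b) • δ (rl K (exF (outF e N)) x) := by
  have := rl_plug (a := a) e (fun j => j) (N := N)
    (fun s hs => ((outer e s hs).2.trans_le hN).ne) hx hy hy' hδ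
  rwa [rl_id] at this

theorem plug_seq {q s r : ℕ} {j : Fin n} {k : Fin p} (e₁ : Graft i n p) (e₂ : Graft k q r)
    (f₁ : Graft j q s) (f₂ : Graft i s r) (hc : SeqCompat e₁ e₂ f₁ f₂) {ab bc : ℤ}
    (h₁ : a + b = ab) (h₃ : b + c = bc) {z : FreeG K} (hx : x ∈ lin K (Finset.range m))
    (hy : y ∈ gr K b) (hy' : y ∈ lin K (Finset.range n)) (hz : z ∈ gr K c)
    (hz' : z ∈ lin K (Finset.range q)) :
    plug e₂ ab c (plug e₁ a b x ⟨y, hy⟩) ⟨z, hz⟩ =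
      plug f₂ a bc x ⟨plug f₁ b c y ⟨z, hz⟩, plug_gr f₁ h₃ hy _⟩ := by
  subst h₁
  subst h₃
  set g := exF (outF e₂ r) with hg
  have hgk : g k = r := by rw [hg, exF_val, outF_self]
  have hgo : ∀ t (ht : t ≠ k), g t = outer e₂ t ht := fun t ht => by rw [hg, exF_val, outF_ne _ _ ht]
  have hok : ∀ t (ht : t ≠ i), outer e₁ t ht ≠ k := fun t ht h =>
    outer_ne_inner e₁ ht j (h.trans hc.node)
  have hik : ∀ t (ht : t ≠ j), inner e₁ t ≠ k := fun t ht h =>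
    ht (inner_inj e₁ (h.trans hc.node))
  have hout : ∀ t ht, g (outer e₁ t ht) = outer f₂ t ht := fun t ht => by
    rw [hgo _ (hok t ht), hc.outer_eq t ht (hok t ht)]
  -- the three substitutions
  obtain ⟨δz, hδz⟩ := exists_isSb r (rl_gr (f := exF (inF e₂)) hz)
  obtain ⟨δy, hδy⟩ := exists_isSb (r + 1) (rl_gr (f := exF fun t => g (inF e₁ t)) hy)
  obtain ⟨δ, hδ⟩ := exists_isSb (r + 1) (hδz.shift (rl_gr (f := exF fun t => g (inF e₁ t)) hy))
  have hz2 : rl K (exF (inF e₂)) z = rl K (exF fun t => exF (inF f₂) (inF f₁ t)) z := by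
    refine rl_exF_congr (fun t => ?_) hz'
    rw [exF_val, exF_val, inF, hc.inner_eq]
  have hy2 : rl K (exF fun t => g (inF e₁ t)) y =
      rl K (exF (plF j (fun t ht => exF (inF f₂) (outer f₁ t ht)) r)) y := by
    refine rl_exF_congr (fun t => ?_) hy'
    rw [exF_val]
    by_cases ht : t = j
    · rw [ht, plF_self, inF, ← hc.node, hgk]
    · rw [plF_ne _ _ ht, exF_val, hgo _ (hik t ht), hc.middle_eq t ht (hik t ht)]
  have hx2 : rl K (exF (plF i (fun t ht => g (outer e₁ t ht)) (r + 1))) x =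
      rl K (exF (outF f₂ (r + 1))) x := by
    refine rl_exF_congr (fun t => ?_) hx
    rw [exF_val]
    by_cases ht : t = i
    · rw [ht, plF_self, outF_self]
    · rw [plF_ne _ _ ht, outF_ne _ _ ht, hout]
  have hL := rl_plug (a := a) e₁ g (N := r + 1) (fun t ht => by
    rw [hout]; exact ((outer f₂ t ht).2.trans (Nat.lt_succ_self r)).ne) hx hy hy' hδy
  rw [plug_eq e₂ le_rfl (plug_lin e₁ hx hy hy') hz hz' hδz, hL, hx2, map_smul]
  have hR := rl_plug (a := b) f₁ (exF (inF f₂)) (N := r) (fun t ht => by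
    rw [exF_val]; exact (inner f₂ _).2.ne) hy' hz hz' (δ := δz) (hz2 ▸ hδz)
  have hδ' : IsSb (r + 1) (b + c) (rl K (exF (inF f₂)) (plug f₁ b c y ⟨z, hz⟩))
      (sg K (b * c) • δ) := by
    rw [hR, ← hy2]
    exact IsSb.smul hδ _
  rw [plug_eq f₂ (Nat.le_succ r) hx _ (plug_lin f₁ hy' hz hz') hδ']
  have hfin := IsSb.seq hδz hδy (S := Finset.univ.image (outF f₂ (r + 1))) ?_ hδ
    (rl_exF_lin (plF_inj (fun t t' ht ht' h => outer_inj f₂ (Fin.ext h))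
      (fun t ht => ((outer f₂ t ht).2.trans (Nat.lt_succ_self r)).ne)) hx)
  · rw [hfin, LinearMap.smul_apply, smul_smul, smul_smul]
    congr 1
    rw [add_mul, mul_add, sg_add, sg_add]
    ring
  · intro h
    obtain ⟨t, -, ht⟩ := Finset.mem_image.1 h
    by_cases hti : t = i
    · rw [hti, outF_self] at ht
      omega
    · rw [outF_ne _ _ hti] at ht
      exact (outer f₂ t hti).2.ne ht

theorem plug_par {q s r : ℕ} {i' : Fin m} {k : Fin p} {k' : Fin s} (e₁ : Graft i n p)
    (e₂ : Graft k q r) (f₁ : Graft i' q s) (f₂ : Graft k' n r) (hc : ParCompat e₁ e₂ f₁ f₂)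
    {ab ac : ℤ} (h₁ : a + b = ab) (h₃ : a + c = ac) {z : FreeG K}
    (hx : x ∈ lin K (Finset.range m)) (hy : y ∈ gr K b) (hy' : y ∈ lin K (Finset.range n))
    (hz : z ∈ gr K c) (hz' : z ∈ lin K (Finset.range q)) :
    plug e₂ ab c (plug e₁ a b x ⟨y, hy⟩) ⟨z, hz⟩ =
      sg K (b * c) • plug f₂ ac b (plug f₁ a c x ⟨z, hz⟩) ⟨y, hy⟩ := by
  subst h₁
  subst h₃
  set g := exF (outF e₂ r) with hg
  set g' := exF (outF f₂ (r + 1)) with hg'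
  have hgk : g k = r := by rw [hg, exF_val, outF_self]
  have hgo : ∀ t (ht : t ≠ k), g t = outer e₂ t ht := fun t ht => by rw [hg, exF_val, outF_ne _ _ ht]
  have hgk' : g' k' = r + 1 := by rw [hg', exF_val, outF_self]
  have hgo' : ∀ t (ht : t ≠ k'), g' t = outer f₂ t ht := fun t ht => by
    rw [hg', exF_val, outF_ne _ _ ht]
  have hik : ∀ t, inner e₁ t ≠ k := fun t h =>
    outer_ne_inner e₁ hc.ne.symm t (hc.node.symm.trans h.symm)
  have hik' : ∀ t, inner f₁ t ≠ k' := fun t h =>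
    outer_ne_inner f₁ hc.ne t (hc.node'.symm.trans h.symm)
  have hok : ∀ t (ht : t ≠ i) (ht' : t ≠ i'), outer e₁ t ht ≠ k := fun t ht ht' h =>
    ht' (outer_inj e₁ (h.trans hc.node))
  have hok' : ∀ t (ht : t ≠ i) (ht' : t ≠ i'), outer f₁ t ht' ≠ k' := fun t ht ht' h =>
    ht (outer_inj f₁ (h.trans hc.node'))
  obtain ⟨δz, hδz⟩ := exists_isSb r (rl_gr (f := exF (inF e₂)) hz)
  obtain ⟨δy, hδy⟩ := exists_isSb (r + 1) (rl_gr (f := exF (inF f₂)) hy)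
  have hz2 : rl K (exF (inF e₂)) z = rl K (exF fun t => g' (inF f₁ t)) z := by
    refine rl_exF_congr (fun t => ?_) hz'
    rw [exF_val, hgo' _ (hik' t), inF, hc.right_eq t (hik' t)]
  have hy2 : rl K (exF (inF f₂)) y = rl K (exF fun t => g (inF e₁ t)) y := by
    refine rl_exF_congr (fun t => ?_) hy'
    rw [exF_val, hgo _ (hik t), hc.left_eq t (hik t)]
  have hx2 : rl K (exF (plF i (fun t ht => g (outer e₁ t ht)) (r + 1))) x =
      rl K (exF (plF i' (fun t ht => g' (outer f₁ t ht)) r)) x := by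
    refine rl_exF_congr (fun t => ?_) hx
    rw [exF_val]
    by_cases ht : t = i
    · subst ht
      rw [plF_self, plF_ne _ _ hc.ne, ← hc.node', hgk']
    · by_cases ht' : t = i'
      · subst ht'
        rw [plF_self, plF_ne _ _ ht, ← hc.node, hgk]
      · rw [plF_ne _ _ ht, plF_ne _ _ ht', hgo _ (hok t ht ht'), hgo' _ (hok' t ht ht'),
          hc.outer_eq t ht ht' (hok t ht ht') (hok' t ht ht')]
  have hL := rl_plug (a := a) e₁ g (N := r + 1) (fun t ht => by
    by_cases htk : outer e₁ t ht = k
    · rw [htk, hgk]; omega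
    · rw [hgo _ htk]; exact ((outer e₂ _ htk).2.trans (Nat.lt_succ_self r)).ne)
    hx hy hy' (δ := δy) (hy2 ▸ hδy)
  have hR := rl_plug (a := a) f₁ g' (N := r) (fun t ht => by
    by_cases htk : outer f₁ t ht = k'
    · rw [htk, hgk']; omega
    · rw [hgo' _ htk]; exact (outer f₂ _ htk).2.ne)
    hx hz hz' (δ := δz) (hz2 ▸ hδz)
  rw [plug_eq e₂ le_rfl (plug_lin e₁ hx hy hy') hz hz' hδz, hL,
    plug_eq f₂ (Nat.le_succ r) (plug_lin f₁ hx hz hz') hy hy' hδy, hR, hx2, map_smul, map_smul,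
    IsSb.par hδz hδy ?_ ?_, smul_smul, smul_smul, smul_smul, smul_smul]
  · congr 1
    rw [add_mul, add_mul, sg_add, sg_add, _root_.mul_comm c b]
    ring
  · refine lin_label (rl_exF_lin (inF_inj f₂) hy') hδz fun h => ?_
    obtain ⟨t, -, ht⟩ := Finset.mem_image.1 h
    exact (inner f₂ t).2.ne ht
  · refine lin_label (rl_exF_lin (inF_inj e₂) hz') hδy fun h => ?_
    obtain ⟨t, -, ht⟩ := Finset.mem_image.1 h
    have := (inner e₂ t).2
    simp only [inF] at ht
    omega

theorem vx_lin : vx K 0 ∈ lin K (Finset.range 1) := by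
  have h := vx_lab (K := K) 0
  rwa [show (Pi.single 0 1 : ℕ → ℤ) = ind (Finset.range 1) from by
    funext j; simp [ind, Pi.single_apply]] at h

/-- The multilinear elements of degree `d` in the labels less than `n`. -/
abbrev qObj (K : Type u) [Field K] (n : ℕ) (d : ℤ) : Submodule K (FreeG K) :=
  gr K d ⊓ lin K (Finset.range n)

variable (K) in
/-- The operad of multilinear elements of the free algebra. -/
def multilin : OpData K where
  obj n d := qObj K n d
  one := ⟨vx K 0, vx_mem 0, vx_lin⟩
  comp {m n p} i e {a b c} h := LinearMap.mk₂ K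
    (fun (x : qObj K m a) (y : qObj K n b) => (⟨plug e a b x.1 ⟨y.1, y.2.1⟩,
      plug_gr e h x.2.1 _, plug_lin e x.2.2 y.2.1 y.2.2⟩ : qObj K p c))
    (fun x x' y => Subtype.ext (by simp [plug]))
    (fun r x y => Subtype.ext (by simp [plug, smul_comm r]))
    (fun x y y' => Subtype.ext (by
      simp only [plug]
      rw [show (⟨rl K (exF (inF e)) (y + y').1, rl_gr (y + y').2.1⟩ : gr K b) =
        ⟨rl K (exF (inF e)) y.1, rl_gr y.2.1⟩ + ⟨rl K (exF (inF e)) y'.1, rl_gr y'.2.1⟩ from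
        Subtype.ext (map_add _ _ _), map_add, LinearMap.add_apply, smul_add]
      rfl))
    (fun r x y => Subtype.ext (by
      simp only [plug]
      rw [show (⟨rl K (exF (inF e)) (r • y).1, rl_gr (r • y).2.1⟩ : gr K b) =
        r • ⟨rl K (exF (inF e)) y.1, rl_gr y.2.1⟩ from
        Subtype.ext (map_smul _ _ _), map_smul, LinearMap.smul_apply, smul_comm]
      rfl))

theorem plug_one {m : ℕ} {d : ℤ} (i : Fin m) (hx : x ∈ lin K (Finset.range m)) :
    plug (std i 1 rfl) d 0 x ⟨vx K 0, vx_mem 0⟩ = x := by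
  have h1 : rl K (exF (inF (std i 1 rfl))) (vx K 0) = vx K i := by
    rw [rl_ltr, Letter.map]
    exact congrArg (vx K) ((exF_val _ (0 : Fin 1)).trans (congrArg Fin.val (std_one_inner i rfl 0)))
  obtain ⟨δ, hδ⟩ := exists_isSb m (rl_gr (f := exF (inF (std i 1 rfl))) (vx_mem (K := K) 0))
  rw [plug_eq (std i 1 rfl) le_rfl hx (vx_mem 0) vx_lin hδ, mul_zero, sg_zero, one_smul]
  rw [h1] at hδ
  rw [hδ.var (Finset.mem_image.2 ⟨i, Finset.mem_univ i, plF_self _ _ _⟩)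
    (rl_exF_lin (outF_inj (std i 1 rfl)) hx), rl_rl_exF _ _ hx]
  refine rl_eq_self (fun j hj => ?_) hx
  have := exF_val (fun s => if outF (std i 1 rfl) m s = m then (i : ℕ) else outF (std i 1 rfl) m s)
    ⟨j, Finset.mem_range.1 hj⟩
  refine this.trans ?_
  by_cases hji : (⟨j, Finset.mem_range.1 hj⟩ : Fin m) = i
  · rw [hji, outF_self, if_pos rfl, ← hji]
  · rw [outF_ne _ _ hji, if_neg (outer (std i 1 rfl) _ hji).2.ne, std_one_outer]

theorem one_plug {n : ℕ} {d : ℤ} (hx : x ∈ lin K (Finset.range n)) (hd : x ∈ gr K d) :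
    plug (std (0 : Fin 1) n (add_comm 1 n)) 0 d (vx K 0) ⟨x, hd⟩ = x := by
  obtain ⟨δ, hδ⟩ := exists_isSb n (rl_gr (f := exF (inF (std (0 : Fin 1) n (add_comm 1 n)))) hd)
  rw [plug_eq _ le_rfl vx_lin hd hx hδ, zero_mul, sg_zero, one_smul, rl_ltr, Letter.map]
  have h1 : exF (outF (std (0 : Fin 1) n (add_comm 1 n)) n) 0 = n :=
    (exF_val _ (0 : Fin 1)).trans (plF_self _ _ _)
  rw [h1]
  refine (hδ.x n).trans ((pt_self n _).trans (rl_eq_self (fun j hj => ?_) hx))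
  exact (exF_val _ ⟨j, Finset.mem_range.1 hj⟩).trans (congrArg Fin.val (std_unit_inner _ _))

theorem multilin_isOperad : (multilin K).IsOperad where
  one_comp x := Subtype.ext (one_plug (x : qObj K _ _).2.2 (x : qObj K _ _).2.1)
  comp_one i x := Subtype.ext (plug_one i (x : qObj K _ _).2.2)
  assoc_seq e₁ e₂ f₁ f₂ hc a b c ab bc abc h₁ h₂ h₃ h₄ x y z :=
    Subtype.ext (plug_seq e₁ e₂ f₁ f₂ hc h₁ h₃ (x : qObj K _ _).2.2 (y : qObj K _ _).2.1
      (y : qObj K _ _).2.2 (z : qObj K _ _).2.1 (z : qObj K _ _).2.2)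
  assoc_par e₁ e₂ f₁ f₂ hc a b c ab ac abc h₁ h₂ h₃ h₄ x y z :=
    Subtype.ext (plug_par e₁ e₂ f₁ f₂ hc h₁ h₃ (x : qObj K _ _).2.2 (y : qObj K _ _).2.1
      (y : qObj K _ _).2.2 (z : qObj K _ _).2.1 (z : qObj K _ _).2.2)

end FreeG

end OperadTw

namespace OperadTw

open Graft

variable {K : Type u} [Field K]

/-! ### Morphisms of operads -/

/-- Families of linear maps which preserve the unit and the partial compositions. -/
structure OpMap (P Q : OpData K) where
  map : ∀ {n : ℕ} {d : ℤ}, P.obj n d →ₗ[K] Q.obj n d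
  map_one : map P.one = Q.one
  map_comp : ∀ {m n p : ℕ} (i : Fin m) (e : Graft i n p) {a b c : ℤ} (h : a + b = c)
    (x : P.obj m a) (y : P.obj n b), map (P.comp i e h x y) = Q.comp i e h (map x) (map y)

namespace OpMap

variable {P Q : OpData K} (F : OpMap P Q)

theorem map_circ {m n p : ℕ} (i : Fin m) {a b c : ℤ} (x : P.obj m a) (y : P.obj n b)
    (hp : m + n = p + 1) (h : a + b = c) :
    F.map (P.circ i x y hp h) = Q.circ i (F.map x) (F.map y) hp h :=
  F.map_comp i _ h x y

theorem map_act {n : ℕ} {d : ℤ} (σ : Equiv.Perm (Fin n)) (x : P.obj n d) :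
    F.map (P.act σ x) = Q.act σ (F.map x) := by
  rw [OpData.act, F.map_comp, F.map_one]
  rfl

end OpMap

/-- A Gerstenhaber structure: the relations of `GerstRel` hold. -/
structure IsGerst (Q : OpData K) (μ : Q.obj 2 0) (lam : Q.obj 2 1) : Prop where
  mu_symm : Q.act (Equiv.swap 0 1) μ = μ
  lam_symm : Q.act (Equiv.swap 0 1) lam = lam
  mu_assoc : Q.circ (c := 0) (p := 3) 0 μ μ = Q.circ 1 μ μ
  jacobi : Q.circ (c := 2) (p := 3) 0 lam lam + Q.act (finRotate 3) (Q.circ 0 lam lam) +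
    Q.act (finRotate 3 ^ 2) (Q.circ 0 lam lam) = 0
  leibniz : Q.circ (c := 1) (p := 3) 0 lam μ =
    Q.circ 1 μ lam + Q.act (Equiv.swap 1 2) (Q.circ 0 μ lam)

/-- A Batalin-Vilkovisky structure: the relations of `BVRel` hold. -/
structure IsBVOp (Q : OpData K) (μ : Q.obj 2 0) (lam : Q.obj 2 1) (Δ : Q.obj 1 1) : Prop where
  gerst : IsGerst Q μ lam
  delta_sq : Q.circ (c := 2) (p := 1) 0 Δ Δ = 0
  delta_mu : Q.circ (c := 1) (p := 2) 0 Δ μ = Q.circ 0 μ Δ + Q.circ 1 μ Δ + lam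
  delta_lam : Q.circ (c := 2) (p := 2) 0 Δ lam + Q.circ 0 lam Δ + Q.circ 1 lam Δ = 0

section Rel

variable {P Q : OpData K} (F : OpMap P Q) {μ : P.obj 2 0} {lam : P.obj 2 1} {Δ : P.obj 1 1}

theorem IsGerst.map_rel (h : IsGerst Q (F.map μ) (F.map lam)) {n : ℕ} {d : ℤ} {x : P.obj n d}
    (hx : GerstRel P μ lam n d x) : F.map x = 0 := by
  cases hx with
  | mu_symm => rw [map_sub, F.map_act, h.mu_symm, sub_self]
  | lam_symm => rw [map_sub, F.map_act, h.lam_symm, sub_self]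
  | mu_assoc => rw [map_sub, F.map_circ, F.map_circ]; exact sub_eq_zero.2 h.mu_assoc
  | jacobi =>
    rw [map_add, map_add, F.map_act, F.map_act, F.map_circ]
    exact h.jacobi
  | leibniz =>
    rw [map_sub, map_add, F.map_act, F.map_circ, F.map_circ, F.map_circ]
    exact sub_eq_zero.2 h.leibniz

theorem IsBVOp.map_rel (h : IsBVOp Q (F.map μ) (F.map lam) (F.map Δ)) {n : ℕ} {d : ℤ}
    {x : P.obj n d} (hx : BVRel P μ lam Δ n d x) : F.map x = 0 := by
  cases hx with
  | gerst x hx => exact h.gerst.map_rel F hx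
  | delta_sq => rw [F.map_circ]; exact h.delta_sq
  | delta_mu =>
    rw [map_sub, map_add, map_add, F.map_circ, F.map_circ, F.map_circ]
    exact sub_eq_zero.2 h.delta_mu
  | delta_lam =>
    rw [map_add, map_add, F.map_circ, F.map_circ, F.map_circ]
    exact h.delta_lam

theorem IsGerst.congr {μ' : P.obj 2 0} {lam' : P.obj 2 1} (h : IsGerst P μ lam) (h1 : μ = μ')
    (h2 : lam = lam') : IsGerst P μ' lam' := by
  subst h1; subst h2; exact h

theorem IsBVOp.congr {μ' : P.obj 2 0} {lam' : P.obj 2 1} {Δ' : P.obj 1 1} (h : IsBVOp P μ lam Δ)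
    (h1 : μ = μ') (h2 : lam = lam') (h3 : Δ = Δ') : IsBVOp P μ' lam' Δ' := by
  subst h1; subst h2; subst h3; exact h

theorem isGerst_of_rel (h : ∀ {n : ℕ} {d : ℤ} {x : P.obj n d}, GerstRel P μ lam n d x →
    F.map x = 0) : IsGerst Q (F.map μ) (F.map lam) where
  mu_symm := by
    have := h .mu_symm
    rw [map_sub, F.map_act] at this
    exact sub_eq_zero.1 this
  lam_symm := by
    have := h .lam_symm
    rw [map_sub, F.map_act] at this
    exact sub_eq_zero.1 this
  mu_assoc := by
    have := h .mu_assoc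
    rw [map_sub, F.map_circ, F.map_circ] at this
    exact sub_eq_zero.1 this
  jacobi := by
    have := h .jacobi
    rw [map_add, map_add, F.map_act, F.map_act, F.map_circ] at this
    exact this
  leibniz := by
    have := h .leibniz
    rw [map_sub, map_add, F.map_act, F.map_circ, F.map_circ, F.map_circ] at this
    exact sub_eq_zero.1 this

theorem isBVOp_of_rel (h : ∀ {n : ℕ} {d : ℤ} {x : P.obj n d}, BVRel P μ lam Δ n d x →
    F.map x = 0) : IsBVOp Q (F.map μ) (F.map lam) (F.map Δ) where
  gerst := isGerst_of_rel F fun hx => h (.gerst _ hx)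
  delta_sq := by
    have := h .delta_sq
    rw [F.map_circ] at this
    exact this
  delta_mu := by
    have := h .delta_mu
    rw [map_sub, map_add, map_add, F.map_circ, F.map_circ, F.map_circ] at this
    exact sub_eq_zero.1 this
  delta_lam := by
    have := h .delta_lam
    rw [map_add, map_add, F.map_circ, F.map_circ, F.map_circ] at this
    exact this

theorem IsGerst.map (h : IsGerst P μ lam) : IsGerst Q (F.map μ) (F.map lam) where
  mu_symm := by rw [← F.map_act, h.mu_symm]
  lam_symm := by rw [← F.map_act, h.lam_symm]
  mu_assoc := by rw [← F.map_circ, h.mu_assoc, F.map_circ]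
  jacobi := by
    rw [← F.map_circ, ← F.map_act, ← F.map_act, ← map_add, ← map_add]
    exact (congrArg F.map h.jacobi).trans (map_zero _)
  leibniz := by rw [← F.map_circ, h.leibniz, map_add, F.map_act, F.map_circ, F.map_circ]

end Rel

/-! ### Evaluation of formal composites -/

namespace Presentation

variable (R : Presentation K) {Q : OpData K} (g : ∀ {n : ℕ} {d : ℤ}, R.Gen n d → Q.obj n d)

/-- The value of a formal composite. -/
def evalTree : ∀ {n : ℕ} {d : ℤ}, Tree R.Gen n d → Q.obj n d
  | _, _, .gen x => g x
  | _, _, .one => Q.one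
  | _, _, .comp i e h x y => Q.comp i e h (evalTree x) (evalTree y)

/-- The linear extension of `evalTree`. -/
def evalFree : OpMap R.free Q where
  map := Finsupp.linearCombination K fun t => R.evalTree g t
  map_one := (Finsupp.linearCombination_single K 1 _).trans (one_smul _ _)
  map_comp {m n p} i e {a b c} h x y := by
    let E : ∀ {n : ℕ} {d : ℤ}, R.free.obj n d →ₗ[K] Q.obj n d :=
      Finsupp.linearCombination K fun t => R.evalTree g t
    have hE : ∀ {n : ℕ} {d : ℤ} (t : Tree R.Gen n d), E (freeTree K t) = R.evalTree g t :=
      fun t => (Finsupp.linearCombination_single K 1 t).trans (one_smul _ _)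
    have key : (R.free.comp i e h).compr₂ E = (Q.comp i e h).compl₁₂ E E := by
      refine freeData_hom_ext K fun s => freeData_hom_ext K fun t => ?_
      change E (R.free.comp i e h (freeTree K s) (freeTree K t)) =
        Q.comp i e h (E (freeTree K s)) (E (freeTree K t))
      rw [freeData_comp_tree, hE, hE, hE, evalTree]
    exact LinearMap.congr_fun₂ key x y

theorem evalFree_tree {n : ℕ} {d : ℤ} (t : Tree R.Gen n d) :
    (R.evalFree g).map (freeTree K t) = R.evalTree g t :=
  (Finsupp.linearCombination_single K 1 t).trans (one_smul _ _)

variable (hQ : Q.IsOperad)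
  (hrel : ∀ {n : ℕ} {d : ℤ} (x : R.free.obj n d), x ∈ R.rel n d → (R.evalFree g).map x = 0)

include hQ hrel in
theorem evalFree_ker {n : ℕ} {d : ℤ} (x : R.free.obj n d) (hx : R.Ker x) :
    (R.evalFree g).map x = 0 := by
  induction hx with
  | rel x h => exact hrel x h
  | zero => exact map_zero _
  | add x y _ _ hx hy => rw [map_add, hx, hy, add_zero]
  | smul c x _ hx => rw [map_smul, hx, smul_zero]
  | comp_left i e h x y hx' hx =>
    rw [(R.evalFree g).map_comp, hx, map_zero, LinearMap.zero_apply]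
  | comp_right i e h x y hx' hx => rw [(R.evalFree g).map_comp, hx, map_zero]
  | one_comp x =>
    rw [map_sub, (R.evalFree g).map_comp, (R.evalFree g).map_one, hQ.one_comp, sub_self]
  | comp_one i x =>
    rw [map_sub, (R.evalFree g).map_comp, (R.evalFree g).map_one, hQ.comp_one, sub_self]
  | assoc_seq e₁ e₂ f₁ f₂ hc h₁ h₂ h₃ h₄ x y z =>
    rw [map_sub, (R.evalFree g).map_comp, (R.evalFree g).map_comp, (R.evalFree g).map_comp,
      (R.evalFree g).map_comp, hQ.assoc_seq e₁ e₂ f₁ f₂ hc h₁ h₂ h₃ h₄, sub_self]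
  | assoc_par e₁ e₂ f₁ f₂ hc h₁ h₂ h₃ h₄ x y z =>
    rw [map_sub, map_smul, (R.evalFree g).map_comp, (R.evalFree g).map_comp,
      (R.evalFree g).map_comp, (R.evalFree g).map_comp,
      hQ.assoc_par e₁ e₂ f₁ f₂ hc h₁ h₂ h₃ h₄, sub_self]

/-- The morphism out of a presented operad with the given values on the generators. -/
def lift : OpMap R.data Q where
  map {n d} := (R.ker.carrier n d).liftQ (R.evalFree g).map fun x hx => R.evalFree_ker g hQ hrel x hx
  map_one := (R.evalFree g).map_one
  map_comp i e _ _ _ h x y := by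
    obtain ⟨x, rfl⟩ := R.cls_surj x
    obtain ⟨y, rfl⟩ := R.cls_surj y
    exact (R.evalFree g).map_comp i e h x y

theorem lift_gen {n : ℕ} {d : ℤ} (x : R.Gen n d) :
    (R.lift g hQ hrel).map (R.dataGen x) = g x := R.evalFree_tree g (.gen x)

/-- The morphism from formal composites of old generators. -/
def adjoinOp (s : ℤ) : OpMap R.free (R.adjoin s).data where
  map {n d} := R.adjoinMap s n d
  map_one := R.adjoinMap_one s
  map_comp i e _ _ _ h x y := R.adjoinMap_comp s i e h x y

theorem evalFree_adjoin (s : ℤ) (g : ∀ {n : ℕ} {d : ℤ}, (R.adjoin s).Gen n d → Q.obj n d)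
    (hrel : ∀ {n : ℕ} {d : ℤ} (x : R.free.obj n d), x ∈ R.rel n d →
      (R.evalFree (Q := Q) fun x => g (.old x)).map x = 0) {n : ℕ} {d : ℤ}
    (x : (R.adjoin s).free.obj n d) (hx : x ∈ (R.adjoin s).rel n d) :
    ((R.adjoin s).evalFree g).map x = 0 := by
  obtain ⟨r, hr, rfl⟩ := hx
  rw [← hrel r hr]
  have key : ∀ {n : ℕ} {d : ℤ} (t : Tree R.Gen n d), (R.adjoin s).evalTree g (t.map AdjoinGen.old) =
      R.evalTree (fun x => g (.old x)) t := by
    intro n d t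
    induction t with
    | gen x => rfl
    | one => rfl
    | comp i e h x y hx hy => exact congrArg₂ (fun x y => Q.comp i e h x y) hx hy
  have key2 : ∀ t : Tree R.Gen n d, ((R.adjoin s).evalFree g).map
      (freeMap AdjoinGen.old (freeTree K t)) =
      (R.evalFree (Q := Q) fun x => g (.old x)).map (freeTree K t) := by
    intro t
    rw [freeMap_tree]
    exact ((R.adjoin s).evalFree_tree g _).trans ((key t).trans (R.evalFree_tree _ t).symm)
  let f : (freeData K R.Gen).obj n d →ₗ[K] Q.obj n d :=
    LinearMap.comp ((R.adjoin s).evalFree g).map (freeMap AdjoinGen.old)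
  have : f = (R.evalFree (Q := Q) fun x => g (.old x)).map := freeData_hom_ext K key2
  exact LinearMap.congr_fun this r

end Presentation

theorem gerst_adjoin_isGerst (s : ℤ) : IsGerst ((gerst K).adjoin s).data
    (((gerst K).adjoin s).dataGen (.old .mu)) (((gerst K).adjoin s).dataGen (.old .lam)) :=
  (isGerst_of_rel ((gerst K).adjoinOp s) (fun hx => (gerst K).adjoinMap_rel s _ hx)).congr
    ((gerst K).adjoinMap_gen s GerstGen.mu) ((gerst K).adjoinMap_gen s GerstGen.lam)

theorem bvAlpha_isBVOp :
    IsBVOp (bvAlpha K).data (bvAlpha.mu K) (bvAlpha.lam K) (bvAlpha.delta K) :=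
  (isBVOp_of_rel ((bv K).adjoinOp 0) (fun hx => (bv K).adjoinMap_rel 0 _ hx)).congr
    ((bv K).adjoinMap_gen 0 BVGen.mu) ((bv K).adjoinMap_gen 0 BVGen.lam)
    ((bv K).adjoinMap_gen 0 BVGen.delta)

/-- Morphisms out of `Gerst ∨ η`. -/
theorem exists_gerst_lift {Q : OpData K} (hQ : Q.IsOperad) {s : ℤ} {μ : Q.obj 2 0} {lam : Q.obj 2 1}
    (h : IsGerst Q μ lam) (η : Q.obj 0 s) : ∃ F : OpMap ((gerst K).adjoin s).data Q,
      F.map (((gerst K).adjoin s).dataGen (.old .mu)) = μ ∧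
      F.map (((gerst K).adjoin s).dataGen (.old .lam)) = lam ∧
      F.map (((gerst K).adjoin s).dataGen .new) = η := by
  let g : ∀ {n : ℕ} {d : ℤ}, ((gerst K).adjoin s).Gen n d → Q.obj n d := fun x => match x with
    | .old .mu => μ
    | .old .lam => lam
    | .new => η
  refine ⟨((gerst K).adjoin s).lift g hQ ((gerst K).evalFree_adjoin s g fun x hx => ?_),
    Presentation.lift_gen _ _ _ _ _, Presentation.lift_gen _ _ _ _ _,
    Presentation.lift_gen _ _ _ _ _⟩
  refine IsGerst.map_rel _ ?_ hx
  exact h.congr (Presentation.evalFree_tree (gerst K) (fun x => g (.old x)) (.gen .mu)).symm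
    (Presentation.evalFree_tree (gerst K) (fun x => g (.old x)) (.gen .lam)).symm

/-- Morphisms out of `BV ∨ α`. -/
theorem exists_bv_lift {Q : OpData K} (hQ : Q.IsOperad) {μ : Q.obj 2 0} {lam : Q.obj 2 1}
    {Δ : Q.obj 1 1} (h : IsBVOp Q μ lam Δ) (α : Q.obj 0 0) : ∃ F : OpMap (bvAlpha K).data Q,
      F.map (bvAlpha.mu K) = μ ∧ F.map (bvAlpha.lam K) = lam ∧
      F.map (bvAlpha.delta K) = Δ ∧ F.map (bvAlpha.alpha K) = α := by
  let g : ∀ {n : ℕ} {d : ℤ}, (bvAlpha K).Gen n d → Q.obj n d := fun x => match x with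
    | .old .mu => μ
    | .old .lam => lam
    | .old .delta => Δ
    | .new => α
  refine ⟨(bvAlpha K).lift g hQ ((bv K).evalFree_adjoin 0 g fun x hx => ?_),
    Presentation.lift_gen _ _ _ _ _, Presentation.lift_gen _ _ _ _ _,
    Presentation.lift_gen _ _ _ _ _, Presentation.lift_gen _ _ _ _ _⟩
  refine IsBVOp.map_rel _ ?_ hx
  exact h.congr (Presentation.evalFree_tree (bv K) (fun x => g (.old x)) (.gen .mu)).symm
    (Presentation.evalFree_tree (bv K) (fun x => g (.old x)) (.gen .lam)).symm
    (Presentation.evalFree_tree (bv K) (fun x => g (.old x)) (.gen .delta)).symm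

/-! ### The Batalin-Vilkovisky structure on multilinear elements -/

namespace FreeG

theorem lin_of_term (t : GTerm) {S : Finset ℕ} (h : ∀ j, t.wt lab 0 j = ind S j) :
    cls K t ∈ lin K S := by
  have := cls_mem_wtSub (K := K) lab 0 t
  rwa [show t.wt lab 0 = ind S from funext h] at this

theorem mem_qObj_of_term (t : GTerm) {n : ℕ} {d : ℤ} (hd : t.deg = d)
    (h : ∀ j, t.wt lab 0 j = ind (Finset.range n) j) : cls K t ∈ qObj K n d :=
  ⟨hd ▸ cls_mem_wtSub _ _ t, lin_of_term t h⟩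

theorem two_labels (j : ℕ) : ((Pi.single 0 1 : ℕ → ℤ) j + (Pi.single 1 1 : ℕ → ℤ) j) =
    ind (Finset.range 2) j := by
  rcases j with _ | _ | j <;> simp [ind, Pi.single_apply]

variable (K) in
/-- The product of two labels. -/
def qmu : (multilin K).obj 2 0 := (⟨mul K (vx K 0) (vx K 1), by
  rw [mul_cls]; exact mem_qObj_of_term _ rfl two_labels⟩ : qObj K 2 0)

variable (K) in
/-- The bracket of two labels. -/
def qlam : (multilin K).obj 2 1 := (⟨brk K (vx K 0) (vx K 1), by
  rw [brk_cls]
  exact mem_qObj_of_term _ rfl fun j => (add_zero (_ + _)).trans (two_labels j)⟩ : qObj K 2 1)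

variable (K) in
/-- The operator `Δ`, applied to a label. -/
def qdelta : (multilin K).obj 1 1 := (⟨vy K 0, mem_qObj_of_term _ rfl fun j => by
  change (Pi.single 0 1 : ℕ → ℤ) j = _
  rcases j with _ | j <;> simp [ind, Pi.single_apply]⟩ : qObj K 1 1)

variable (K) in
/-- The element `α`. -/
def qalpha : (multilin K).obj 0 0 := (⟨va K, mem_qObj_of_term _ rfl fun j => by
  change (0 : ℕ → ℤ) j = _
  simp [ind]⟩ : qObj K 0 0)

/-- The underlying element of the free algebra. -/
def qval {n : ℕ} {d : ℤ} : (multilin K).obj n d →ₗ[K] FreeG K := (qObj K n d).subtype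

theorem qval_mem {n : ℕ} {d : ℤ} (x : (multilin K).obj n d) : qval x ∈ gr K d :=
  (x : qObj K n d).2.1

theorem qval_lin {n : ℕ} {d : ℤ} (x : (multilin K).obj n d) : qval x ∈ lin K (Finset.range n) :=
  (x : qObj K n d).2.2

theorem qval_inj {n : ℕ} {d : ℤ} {x y : (multilin K).obj n d} (h : qval x = qval y) : x = y :=
  Subtype.ext h

theorem qval_comp {m n p : ℕ} (i : Fin m) (e : Graft i n p) {a b c : ℤ} (h : a + b = c)
    (x : (multilin K).obj m a) (y : (multilin K).obj n b) :
    qval ((multilin K).comp i e h x y) = plug e a b (qval x) ⟨qval y, qval_mem y⟩ := rfl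

theorem qval_one : qval (multilin K).one = vx K 0 := rfl

theorem rl_exF_vx {m : ℕ} (f : Fin m → ℕ) (i : Fin m) : rl K (exF f) (vx K i) = vx K (f i) := by
  rw [rl_ltr, Letter.map, exF_val]

theorem qval_act {n : ℕ} {d : ℤ} (σ : Equiv.Perm (Fin n)) (x : (multilin K).obj n d) :
    qval ((multilin K).act σ x) = rl K (exF fun j => (σ j : ℕ)) (qval x) := by
  rw [OpData.act, qval_comp, qval_one]
  set e : Graft (0 : Fin 1) n n := (std (0 : Fin 1) n (add_comm 1 n)).trans σ with he
  obtain ⟨δ, hδ⟩ := exists_isSb n (rl_gr (f := exF (inF e)) (qval_mem x))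
  rw [plug_eq e le_rfl vx_lin (qval_mem x) (qval_lin x) hδ, zero_mul, sg_zero, one_smul]
  have h1 : rl K (exF (outF e n)) (vx K 0) = vx K n :=
    (rl_exF_vx _ (0 : Fin 1)).trans (congrArg (vx K) (outF_self e n))
  rw [h1, hδ.x, pt_self]
  refine rl_exF_congr (fun t => ?_) (qval_lin x)
  rw [exF_val]
  exact congrArg (fun z => (σ z : ℕ)) (std_unit_inner _ t)

section Bin

variable {m n p : ℕ} {b c : ℤ}

theorem rl_exF_two (f : Fin 2 → ℕ) (i j : ℕ) (h0 : f 0 = i) (h1 : f 1 = j) :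
    rl K (exF f) (vx K 0) = vx K i ∧ rl K (exF f) (vx K 1) = vx K j :=
  ⟨h0 ▸ rl_exF_vx f 0, h1 ▸ rl_exF_vx f 1⟩

theorem mu_left (e : Graft (0 : Fin 2) n p) (h : 0 + b = c) (y : (multilin K).obj n b) :
    qval ((multilin K).comp 0 e h (qmu K) y) =
      mul K (rl K (exF (inF e)) (qval y)) (vx K (outer e 1 (by decide))) := by
  obtain ⟨δ, hδ⟩ := exists_isSb p (rl_gr (f := exF (inF e)) (qval_mem y))
  obtain ⟨h0, h1⟩ := rl_exF_two (K := K) (outF e p) p (outer e 1 (by decide)) (outF_self e p)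
    (outF_ne e p (by decide))
  rw [qval_comp, plug_eq e le_rfl (qval_lin (qmu K)) (qval_mem y) (qval_lin y) hδ,
    show qval (qmu K) = mul K (vx K 0) (vx K 1) from rfl, rl_mul, h0, h1, hδ.mul_x, pt_self, hδ.x,
    pt_ne (outer e 1 (by decide)).2.ne, map_zero, add_zero, zero_mul, sg_zero, one_smul]

theorem mu_right (e : Graft (1 : Fin 2) n p) (h : 0 + b = c) (y : (multilin K).obj n b) :
    qval ((multilin K).comp 1 e h (qmu K) y) =
      mul K (vx K (outer e 0 (by decide))) (rl K (exF (inF e)) (qval y)) := by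
  obtain ⟨δ, hδ⟩ := exists_isSb p (rl_gr (f := exF (inF e)) (qval_mem y))
  obtain ⟨h0, h1⟩ := rl_exF_two (K := K) (outF e p) (outer e 0 (by decide)) p
    (outF_ne e p (by decide)) (outF_self e p)
  rw [qval_comp, plug_eq e le_rfl (qval_lin (qmu K)) (qval_mem y) (qval_lin y) hδ,
    show qval (qmu K) = mul K (vx K 0) (vx K 1) from rfl, rl_mul, h0, h1, hδ.mul_x, hδ.x, pt_self,
    pt_ne (outer e 0 (by decide)).2.ne, map_zero, LinearMap.zero_apply, zero_add, zero_mul, sg_zero,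
    one_smul]

theorem lam_left (e : Graft (0 : Fin 2) n p) (h : 1 + b = c) (y : (multilin K).obj n b) :
    qval ((multilin K).comp 0 e h (qlam K) y) =
      brk K (rl K (exF (inF e)) (qval y)) (vx K (outer e 1 (by decide))) := by
  obtain ⟨δ, hδ⟩ := exists_isSb p (rl_gr (f := exF (inF e)) (qval_mem y))
  obtain ⟨h0, h1⟩ := rl_exF_two (K := K) (outF e p) p (outer e 1 (by decide)) (outF_self e p)
    (outF_ne e p (by decide))
  rw [qval_comp, plug_eq e le_rfl (qval_lin (qlam K)) (qval_mem y) (qval_lin y) hδ,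
    show qval (qlam K) = brk K (vx K 0) (vx K 1) from rfl, rl_brk, h0, h1, hδ.brk_x, pt_self, hδ.x,
    pt_ne (outer e 1 (by decide)).2.ne, map_zero, add_zero, _root_.one_mul, smul_smul, sg_sq,
    one_smul]

theorem lam_right (e : Graft (1 : Fin 2) n p) (h : 1 + b = c) (y : (multilin K).obj n b) :
    qval ((multilin K).comp 1 e h (qlam K) y) =
      brk K (vx K (outer e 0 (by decide))) (rl K (exF (inF e)) (qval y)) := by
  obtain ⟨δ, hδ⟩ := exists_isSb p (rl_gr (f := exF (inF e)) (qval_mem y))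
  obtain ⟨h0, h1⟩ := rl_exF_two (K := K) (outF e p) (outer e 0 (by decide)) p
    (outF_ne e p (by decide)) (outF_self e p)
  rw [qval_comp, plug_eq e le_rfl (qval_lin (qlam K)) (qval_mem y) (qval_lin y) hδ,
    show qval (qlam K) = brk K (vx K 0) (vx K 1) from rfl, rl_brk, h0, h1, hδ.brk_x, hδ.x, pt_self,
    pt_ne (outer e 0 (by decide)).2.ne, map_zero, LinearMap.zero_apply, zero_add, _root_.one_mul,
    smul_smul, sg_sq, one_smul]

theorem delta_comp (e : Graft (0 : Fin 1) n p) (h : 1 + b = c) (y : (multilin K).obj n b) :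
    qval ((multilin K).comp 0 e h (qdelta K) y) = dl K (rl K (exF (inF e)) (qval y)) := by
  obtain ⟨δ, hδ⟩ := exists_isSb p (rl_gr (f := exF (inF e)) (qval_mem y))
  have h0 : rl K (exF (outF e p)) (vy K 0) = vy K p := by
    rw [rl_ltr, Letter.map]
    exact congrArg (vy K) ((exF_val _ (0 : Fin 1)).trans (outF_self e p))
  rw [qval_comp, plug_eq e le_rfl (qval_lin (qdelta K)) (qval_mem y) (qval_lin y) hδ,
    show qval (qdelta K) = vy K 0 from rfl, h0, hδ.y, pt_self, _root_.one_mul, smul_smul, sg_sq,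
    one_smul]

/-- The second composition with a binary operation. -/
theorem lam_bin {q r : ℕ} {k : Fin p} {a ab abc : ℤ} (e₁ : Graft (0 : Fin 2) n p) (e₂ : Graft k q r)
    (hk : k = outer e₁ 1 (by decide)) (h₁ : 1 + a = ab) (h₂ : ab + b = abc)
    (x : (multilin K).obj n a) (y : (multilin K).obj q b) :
    qval ((multilin K).comp k e₂ h₂ ((multilin K).comp 0 e₁ h₁ (qlam K) x) y) =
      brk K (rl K (exF fun t => exF (outF e₂ r) (inF e₁ t)) (qval x))
        (rl K (exF (inF e₂)) (qval y)) := by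
  subst hk
  subst h₁
  obtain ⟨δ, hδ⟩ := exists_isSb r (rl_gr (f := exF (inF e₂)) (qval_mem y))
  have hx := rl_gr (f := exF fun t => exF (outF e₂ r) (inF e₁ t)) (qval_mem x)
  have h0 : δ (rl K (exF fun t => exF (outF e₂ r) (inF e₁ t)) (qval x)) = 0 := by
    refine lin_label (rl_exF_lin (fun s t hst => ?_) (qval_lin x)) hδ fun h => ?_
    · rw [exF_val, exF_val] at hst
      exact inner_inj e₁ (outF_inj e₂ hst)
    · obtain ⟨t, -, ht⟩ := Finset.mem_image.1 h
      rw [inF, exF_val, outF_ne _ _ fun h => outer_ne_inner e₁ _ t h.symm] at ht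
      exact (outer e₂ _ _).2.ne ht
  rw [qval_comp, plug_eq e₂ le_rfl (qval_lin _) (qval_mem y) (qval_lin y) hδ, lam_left, rl_brk,
    rl_rl_exF _ _ (qval_lin x), rl_exF_vx, outF_self, hδ.der.brk _ hx, h0, hδ.x, pt_self, map_zero,
    LinearMap.zero_apply, LinearMap.zero_apply, LinearMap.zero_apply, zero_add, add_zero, smul_smul,
    smul_smul]
  rw [show sg K ((1 + a) * b) * sg K b * sg K (b * a) = 1 by
    rw [_root_.mul_assoc, ← sg_add, ← sg_add, show (1 + a) * b + (b + b * a) = (b + b * a) + (b + b * a) by ring,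
      sg_add, sg_sq], one_smul]

theorem mu_bin {q r : ℕ} {k : Fin p} {a ab abc : ℤ} (e₁ : Graft (0 : Fin 2) n p) (e₂ : Graft k q r)
    (hk : k = outer e₁ 1 (by decide)) (h₁ : 0 + a = ab) (h₂ : ab + b = abc)
    (x : (multilin K).obj n a) (y : (multilin K).obj q b) :
    qval ((multilin K).comp k e₂ h₂ ((multilin K).comp 0 e₁ h₁ (qmu K) x) y) =
      mul K (rl K (exF fun t => exF (outF e₂ r) (inF e₁ t)) (qval x))
        (rl K (exF (inF e₂)) (qval y)) := by
  subst hk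
  subst h₁
  obtain ⟨δ, hδ⟩ := exists_isSb r (rl_gr (f := exF (inF e₂)) (qval_mem y))
  have hx := rl_gr (f := exF fun t => exF (outF e₂ r) (inF e₁ t)) (qval_mem x)
  have h0 : δ (rl K (exF fun t => exF (outF e₂ r) (inF e₁ t)) (qval x)) = 0 := by
    refine lin_label (rl_exF_lin (fun s t hst => ?_) (qval_lin x)) hδ fun h => ?_
    · rw [exF_val, exF_val] at hst
      exact inner_inj e₁ (outF_inj e₂ hst)
    · obtain ⟨t, -, ht⟩ := Finset.mem_image.1 h
      rw [inF, exF_val, outF_ne _ _ fun h => outer_ne_inner e₁ _ t h.symm] at ht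
      exact (outer e₂ _ _).2.ne ht
  rw [qval_comp, plug_eq e₂ le_rfl (qval_lin _) (qval_mem y) (qval_lin y) hδ, mu_left, rl_mul,
    rl_rl_exF _ _ (qval_lin x), rl_exF_vx, outF_self, hδ.der.mul _ hx, h0, hδ.x, pt_self, map_zero,
    LinearMap.zero_apply, LinearMap.zero_apply, LinearMap.zero_apply, add_zero, zero_add, zero_add, smul_smul]
  rw [show sg K (a * b) * (sg K (b * a)) = 1 by
    rw [_root_.mul_comm a b, sg_sq], one_smul]

end Bin

theorem multilin_isBVOp : IsBVOp (multilin K) (qmu K) (qlam K) (qdelta K) := by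
  have hmu : qval (qmu K) = mul K (vx K 0) (vx K 1) := rfl
  have hlam : qval (qlam K) = brk K (vx K 0) (vx K 1) := rfl
  have hdelta : qval (qdelta K) = vy K 0 := rfl
  have hx : ∀ {m : ℕ} (f : Fin m → ℕ) (i : Fin m) (j k : ℕ), (i : ℕ) = j → f i = k →
      rl K (exF f) (vx K j) = vx K k := by
    rintro m f i j k rfl rfl
    exact rl_exF_vx f i
  have hy : ∀ {m : ℕ} (f : Fin m → ℕ) (i : Fin m) (j k : ℕ), (i : ℕ) = j → f i = k →
      rl K (exF f) (vy K j) = vy K k := by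
    rintro m f i j k rfl rfl
    rw [rl_ltr, Letter.map, exF_val]
  refine ⟨⟨qval_inj ?_, qval_inj ?_, qval_inj ?_, qval_inj ?_, qval_inj ?_⟩, qval_inj ?_,
    qval_inj ?_, qval_inj ?_⟩
  · rw [qval_act, hmu, rl_mul, hx _ 0 0 1 rfl rfl, hx _ 1 1 0 rfl rfl,
      mul_comm (vx_mem 1) (vx_mem 0), mul_zero, sg_zero, one_smul]
  · rw [qval_act, hlam, rl_brk, hx _ 0 0 1 rfl rfl, hx _ 1 1 0 rfl rfl,
      brk_comm (vx_mem 1) (vx_mem 0), mul_zero, sg_zero, one_smul]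
  · rw [OpData.circ, OpData.circ, mu_left, mu_right, hmu, rl_mul, rl_mul, hx _ 0 0 0 rfl rfl,
      hx _ 1 1 1 rfl rfl, hx _ 0 0 1 rfl rfl, hx _ 1 1 2 rfl rfl]
    exact assoc (vx_mem 0) (vx_mem 1) (vx_mem 2)
  · have h0 : qval ((multilin K).circ (c := 2) (p := 3) 0 (qlam K) (qlam K)) =
        brk K (brk K (vx K 0) (vx K 1)) (vx K 2) := by
      rw [OpData.circ, lam_left, hlam, rl_brk, hx _ 0 0 0 rfl rfl, hx _ 1 1 1 rfl rfl]
      rfl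
    rw [map_add, map_add, qval_act, qval_act, h0]
    simp only [rl_brk]
    rw [hx _ 0 0 1 rfl rfl, hx _ 1 1 2 rfl rfl, hx _ 2 2 0 rfl rfl,
      hx _ 0 0 2 rfl rfl, hx _ 1 1 0 rfl rfl, hx _ 2 2 1 rfl rfl, map_zero]
    simpa using jacobi (vx_mem (K := K) 0) (vx_mem 1) (vx_mem 2)
  · rw [map_add, qval_act, OpData.circ, OpData.circ, OpData.circ, lam_left, mu_right, mu_left, hmu,
      hlam, rl_mul, rl_mul, rl_brk, rl_brk, hx _ 0 0 0 rfl rfl, hx _ 1 1 1 rfl rfl,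
      hx _ 0 0 1 rfl rfl, hx _ 1 1 2 rfl rfl, rl_brk]
    have h2 : rl K (exF fun j : Fin 3 => ((Equiv.swap 1 2 : Equiv.Perm (Fin 3)) j : ℕ)) (vx K
        (outer (std (0 : Fin 2) 2 (p := 3) rfl) 1 (by decide) : ℕ)) = vx K 1 :=
      hx _ 2 2 1 rfl rfl
    rw [h2, hx _ 0 0 0 rfl rfl, hx _ 1 1 2 rfl rfl]
    have := leibniz (vx_mem (K := K) 0) (vx_mem 1) (vx_mem 2)
    rw [mul_zero, sg_zero, one_smul, one_smul] at this
    exact this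
  · rw [OpData.circ, delta_comp, hdelta, hy _ 0 0 0 rfl rfl, dl_isBV.y, map_zero]
  · rw [OpData.circ, OpData.circ, OpData.circ, map_add, map_add, delta_comp, mu_left, mu_right, hmu,
      hlam, hdelta, rl_mul, hx _ 0 0 0 rfl rfl, hx _ 1 1 1 rfl rfl, hy _ 0 0 0 rfl rfl,
      hy _ 0 0 1 rfl rfl, dl_mul (vx_mem 0), dl_isBV.x, dl_isBV.x, sg_zero, one_smul]
    rfl
  · rw [OpData.circ, OpData.circ, OpData.circ, map_add, map_add, delta_comp, lam_left, lam_right,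
      hlam, hdelta, rl_brk, hx _ 0 0 0 rfl rfl, hx _ 1 1 1 rfl rfl, hy _ 0 0 0 rfl rfl,
      hy _ 0 0 1 rfl rfl, dl_brk (vx_mem 0), dl_isBV.x, dl_isBV.x, sg_zero, one_smul, map_zero]
    exact (fun u v : FreeG K => show -u - v + u + v = 0 by abel) _ _

end FreeG

end OperadTw

namespace OperadTw

open Graft FreeG

variable {K : Type u} [Field K]

/-! ### Rebracketing of composites -/

theorem graft_card {m n p : ℕ} {i : Fin m} (e : Graft i n p) : m + n = p + 1 := by
  have h := Fintype.card_congr e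
  have hm := i.2
  rw [Fintype.card_sum, Fintype.card_fin, Fintype.card_fin, Fintype.card_subtype_compl,
    Fintype.card_fin, Fintype.card_subtype_eq] at h
  omega

theorem exists_graft {m : ℕ} (i : Fin m) {n p : ℕ} (h : m + n = p + 1) : Nonempty (Graft i n p) :=
  ⟨std i n h⟩

/-- A labelling, given by its values on outer and Graft.inner inputs. -/
theorem exists_graft_of {m : ℕ} (i : Fin m) {n p : ℕ} (h : m + n = p + 1)
    (fo : ∀ a : Fin m, a ≠ i → Fin p) (fi : Fin n → Fin p)
    (hs : ∀ t, (∃ a ha, fo a ha = t) ∨ ∃ b, fi b = t) :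
    ∃ e : Graft i n p, (∀ a ha, outer e a ha = fo a ha) ∧ ∀ b, Graft.inner e b = fi b := by
  have hm := i.2
  have hb : Function.Bijective (Sum.elim (fun a : {x : Fin m // x ≠ i} => fo a.1 a.2) fi) := by
    rw [Fintype.bijective_iff_surjective_and_card]
    constructor
    · intro t
      rcases hs t with ⟨a, ha, h⟩ | ⟨b, h⟩
      · exact ⟨.inl ⟨a, ha⟩, h⟩
      · exact ⟨.inr b, h⟩
    · rw [Fintype.card_sum, Fintype.card_fin, Fintype.card_fin, Fintype.card_subtype_compl,
        Fintype.card_fin, Fintype.card_subtype_eq]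
      omega
  exact ⟨Equiv.ofBijective _ hb, fun _ _ => rfl, fun _ => rfl⟩

theorem exists_seq {m n q p r : ℕ} {i : Fin m} {k : Fin p} (e₁ : Graft i n p) (e₂ : Graft k q r)
    (j : Fin n) (hk : k = Graft.inner e₁ j) :
    ∃ (s : ℕ) (f₁ : Graft j q s) (f₂ : Graft i s r), SeqCompat e₁ e₂ f₁ f₂ := by
  have c₁ := graft_card e₁
  have c₂ := graft_card e₂
  have hn := j.2
  have hm := i.2
  obtain ⟨f₁⟩ := exists_graft j (n := q) (p := n + q - 1) (by omega)
  have hik : ∀ t, t ≠ j → Graft.inner e₁ t ≠ k := fun t ht h => ht (inner_inj e₁ (h.trans hk))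
  have hok : ∀ t ht, outer e₁ t ht ≠ k := fun t ht h => outer_ne_inner e₁ ht j (h.trans hk)
  let fi : Fin (n + q - 1) → Fin r := fun t => Sum.elim
    (fun b : {x : Fin n // x ≠ j} => outer e₂ (Graft.inner e₁ b.1) (hik b.1 b.2)) (Graft.inner e₂) (f₁.symm t)
  have hfo : ∀ b hb, fi (outer f₁ b hb) = outer e₂ (Graft.inner e₁ b) (hik b hb) := fun b hb => by
    simp only [fi, outer, Equiv.symm_apply_apply, Sum.elim_inl]
  have hfi : ∀ c, fi (Graft.inner f₁ c) = Graft.inner e₂ c := fun c => by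
    simp only [fi, Graft.inner, Equiv.symm_apply_apply, Sum.elim_inr]
  obtain ⟨f₂, ho, hi⟩ := exists_graft_of i (n := n + q - 1) (p := r) (by omega)
    (fun a ha => outer e₂ (outer e₁ a ha) (hok a ha)) fi (fun t => by
      rcases graft_cases e₂ t with ⟨u, hu, rfl⟩ | ⟨c, rfl⟩
      · rcases graft_cases e₁ u with ⟨a, ha, rfl⟩ | ⟨b, rfl⟩
        · exact .inl ⟨a, ha, rfl⟩
        · exact .inr ⟨outer f₁ b (by rintro rfl; exact hu hk.symm), hfo _ _⟩
      · exact .inr ⟨Graft.inner f₁ c, hfi c⟩)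
  exact ⟨_, f₁, f₂, hk, fun a ha h => (ho a ha).symm, fun b hb h => by rw [hi, hfo],
    fun c => by rw [hi, hfi]⟩

theorem exists_par {m n q p r : ℕ} {i i' : Fin m} {k : Fin p} (e₁ : Graft i n p) (e₂ : Graft k q r)
    (hne : i ≠ i') (hk : k = outer e₁ i' hne.symm) :
    ∃ (s : ℕ) (f₁ : Graft i' q s) (f₂ : Graft (outer f₁ i hne) n r), ParCompat e₁ e₂ f₁ f₂ := by
  have c₁ := graft_card e₁
  have c₂ := graft_card e₂
  have hm := i.2
  obtain ⟨f₁⟩ := exists_graft i' (n := q) (p := m + q - 1) (by omega)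
  have hik : ∀ t, Graft.inner e₁ t ≠ k := fun t h => outer_ne_inner e₁ hne.symm t (hk.symm.trans h.symm)
  have hok : ∀ t ht, t ≠ i' → outer e₁ t ht ≠ k := fun t ht ht' h =>
    ht' (outer_inj e₁ (h.trans hk))
  let G : ∀ w : {x : Fin m // x ≠ i'} ⊕ Fin q, f₁ w ≠ outer f₁ i hne → Fin r := fun w hw =>
    match w, hw with
    | .inl a, hw => outer e₂ (outer e₁ a.1 (fun h => hw (outer_congr f₁ h a.2 hne)))
        (hok _ _ a.2)
    | .inr c, _ => Graft.inner e₂ c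
  have hG : ∀ w w' hw hw', w = w' → G w hw = G w' hw' := by rintro w w' hw hw' rfl; rfl
  let fo : ∀ t : Fin (m + q - 1), t ≠ outer f₁ i hne → Fin r := fun t ht =>
    G (f₁.symm t) (by rwa [Equiv.apply_symm_apply])
  have hfo : ∀ a ha (ha' : a ≠ i) h, fo (outer f₁ a ha) h = outer e₂ (outer e₁ a ha') (hok _ _ ha) :=
    fun a ha ha' h => hG _ (.inl ⟨a, ha⟩) _ h (Equiv.symm_apply_apply _ _)
  have hfi : ∀ c h, fo (Graft.inner f₁ c) h = Graft.inner e₂ c :=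
    fun c h => hG _ (.inr c) _ h (Equiv.symm_apply_apply _ _)
  have hni : ∀ c, Graft.inner f₁ c ≠ outer f₁ i hne := fun c h => outer_ne_inner f₁ hne c h.symm
  obtain ⟨f₂, ho, hi⟩ := exists_graft_of (outer f₁ i hne) (n := n) (p := r) (by omega) fo
    (fun b => outer e₂ (Graft.inner e₁ b) (hik b)) (fun t => by
      rcases graft_cases e₂ t with ⟨u, hu, rfl⟩ | ⟨c, rfl⟩
      · rcases graft_cases e₁ u with ⟨a, ha, rfl⟩ | ⟨b, rfl⟩
        · have ha' : a ≠ i' := by rintro rfl; exact hu hk.symm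
          have h0 : outer f₁ a ha' ≠ outer f₁ i hne := fun h => ha (outer_inj f₁ h)
          exact .inl ⟨outer f₁ a ha', h0, hfo _ _ ha h0⟩
        · exact .inr ⟨b, rfl⟩
      · exact .inl ⟨_, hni c, hfi c (hni c)⟩)
  exact ⟨_, f₁, f₂, hne, hk, rfl, fun a ha ha' h h' => by rw [ho _ h', hfo a ha' ha h'], fun b h => (hi b).symm,
    fun c h => by rw [ho _ h, hfi c h]⟩

/-! ### Operads generated by constants, unary and binary operations -/

/-- Iterated composites of the given constants, unary operations and binary operations. -/
inductive Gend (P : OpData K) (Co : ∀ d, Set (P.obj 0 d)) (Un : ∀ d, Set (P.obj 1 d))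
    (Bi : ∀ d, Set (P.obj 2 d)) : ∀ {n : ℕ} {d : ℤ}, P.obj n d → Prop
  | one : Gend P Co Un Bi P.one
  | smul {n : ℕ} {d : ℤ} (r : K) {x : P.obj n d} : Gend P Co Un Bi x → Gend P Co Un Bi (r • x)
  | const {d : ℤ} {κ : P.obj 0 d} : κ ∈ Co d → Gend P Co Un Bi κ
  | un {n p : ℕ} {s d c : ℤ} {ν : P.obj 1 s} (hν : ν ∈ Un s) (e : Graft (0 : Fin 1) n p)
      (h : s + d = c) {x : P.obj n d} : Gend P Co Un Bi x → Gend P Co Un Bi (P.comp 0 e h ν x)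
  | bin {n p q r : ℕ} {s a ab b c : ℤ} {ν : P.obj 2 s} (hν : ν ∈ Bi s) {k : Fin p}
      (e₁ : Graft (0 : Fin 2) n p) (e₂ : Graft k q r) (hk : k = outer e₁ 1 (by decide))
      (h₁ : s + a = ab) (h₂ : ab + b = c) {x : P.obj n a} {y : P.obj q b} :
      Gend P Co Un Bi x → Gend P Co Un Bi y →
        Gend P Co Un Bi (P.comp k e₂ h₂ (P.comp 0 e₁ h₁ ν x) y)

section Gend

variable {P : OpData K} (hP : P.IsOperad) {Co : ∀ d, Set (P.obj 0 d)} {Un : ∀ d, Set (P.obj 1 d)}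
  {Bi : ∀ d, Set (P.obj 2 d)}

/-- Relabelling, as a composition with the unit. -/
theorem one_comp_eq {n p : ℕ} (e : Graft (0 : Fin 1) n p) {d c : ℤ} (h : 0 + d = c)
    (x : P.obj n d) : ∃ (hn : n = p) (hd : d = c) (σ : Equiv.Perm (Fin p)),
      P.comp 0 e h P.one x = P.act σ (hd ▸ hn ▸ x) ∧ ∀ b, Graft.inner e b = σ (Fin.cast hn b) := by
  have hn : n = p := by have := graft_card e; omega
  subst hn
  have hd : d = c := by omega
  subst hd
  refine ⟨rfl, rfl, (std (0 : Fin 1) n (add_comm 1 n)).symm.trans e, ?_, fun b => ?_⟩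
  · simp [OpData.act, ← Equiv.trans_assoc]
  · change Graft.inner e b = e ((std (0 : Fin 1) n (add_comm 1 n)).symm b)
    have : (std (0 : Fin 1) n (add_comm 1 n)).symm b = Sum.inr b :=
      (Equiv.symm_apply_eq _).2 (std_unit_inner _ b).symm
    rw [this]
    rfl

include hP

theorem OpData.IsOperad.act_comp {m n p : ℕ} (σ : Equiv.Perm (Fin p)) (i : Fin m)
    (e : Graft i n p) {a b c : ℤ} (h : a + b = c) (x : P.obj m a) (y : P.obj n b) :
    P.act σ (P.comp i e h x y) = P.comp i (e.trans σ) h x y := by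
  have := hP.assoc_seq (std 0 m (add_comm 1 m)) (e.trans σ) e
    ((std (0 : Fin 1) p (add_comm 1 p)).trans σ) ⟨?_, ?_, ?_, ?_⟩ (zero_add a) h h (zero_add c)
    P.one x y
  · rw [hP.one_comp] at this
    exact this.symm
  · exact (std_unit_inner _ _).symm
  · intro u hu; exact absurd (Subsingleton.elim _ _) hu
  · intro u hu hu'
    exact (congrArg σ (outer_congr e (std_unit_inner (add_comm 1 m) u) hu' hu)).trans
      (congrArg σ (std_unit_inner (add_comm 1 p) (outer e u hu))).symm
  · intro u
    exact (congrArg σ (std_unit_inner (add_comm 1 p) (Graft.inner e u))).symm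

theorem act_of_subsingleton {n : ℕ} {d : ℤ} (hn : n ≤ 1) (σ : Equiv.Perm (Fin n)) (x : P.obj n d) :
    P.act σ x = x := by
  have : σ = Equiv.refl _ := Equiv.ext fun t => by
    have := t.2
    have := (σ t).2
    exact Fin.ext (by change (σ t).1 = t.1; omega)
  subst this
  exact hP.one_comp x

theorem Gend.act {n : ℕ} {d : ℤ} {x : P.obj n d} (hx : Gend P Co Un Bi x)
    (σ : Equiv.Perm (Fin n)) : Gend P Co Un Bi (P.act σ x) := by
  induction hx with
  | one => rw [act_of_subsingleton hP le_rfl]; exact .one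
  | smul r _ ih => rw [OpData.act, map_smul]; exact .smul r (ih σ)
  | const h => rw [act_of_subsingleton hP (Nat.zero_le _)]; exact .const h
  | un hν e h hx _ => rw [hP.act_comp]; exact .un hν _ h hx
  | bin hν e₁ e₂ hk h₁ h₂ hx hy _ _ => rw [hP.act_comp]; exact .bin hν e₁ _ hk h₁ h₂ hx hy

theorem Gend.comp {m : ℕ} {a : ℤ} {x : P.obj m a} (hx : Gend P Co Un Bi x) :
    ∀ {n p : ℕ} (i : Fin m) (e : Graft i n p) {b c : ℤ} (h : a + b = c) {y : P.obj n b},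
      Gend P Co Un Bi y → Gend P Co Un Bi (P.comp i e h x y) := by
  induction hx with
  | one =>
    intro n p i e b c h y hy
    obtain rfl : i = 0 := Subsingleton.elim _ _
    obtain ⟨hn, hd, σ, hσ, -⟩ := one_comp_eq e h y
    subst hn; subst hd
    rw [hσ]
    exact hy.act hP σ
  | smul r _ ih =>
    intro n p i e b c h y hy
    rw [map_smul, LinearMap.smul_apply]
    exact .smul r (ih i e h hy)
  | const => intro n p i; exact i.elim0
  | @un n p s d c ν hν e' h' x hx ih =>
    intro n' p' i e b c' h y hy
    have hi : ∃ j, Graft.inner e' j = i := by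
      rcases graft_cases e' i with ⟨a, ha, -⟩ | h
      · exact absurd (Subsingleton.elim _ _) ha
      · exact h
    obtain ⟨j, hj⟩ := hi
    obtain ⟨s', f₁, f₂, hc⟩ := exists_seq e' e j hj.symm
    rw [hP.assoc_seq e' e f₁ f₂ hc h' h (bc := d + b) rfl (by omega)]
    exact .un hν f₂ _ (ih j f₁ rfl hy)
  | @bin n p q r s a ab b c ν hν k e₁ e₂ hk h₁ h₂ x z hx hz ihx ihz =>
    intro n' p' i e b' c' h y hy
    rcases graft_cases e₂ i with ⟨u, hu, hi⟩ | ⟨j, hj⟩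
    · have hu' : ∃ j, Graft.inner e₁ j = u := by
        rcases graft_cases e₁ u with ⟨t, ht, htu⟩ | h
        · have : t = 1 := by omega
          subst this
          exact absurd (htu.symm.trans hk.symm) hu
        · exact h
      obtain ⟨j, rfl⟩ := hu'
      obtain ⟨s', f₁, f₂, hc⟩ := exists_par e₂ e hu.symm hi.symm
      rw [hP.assoc_par e₂ e f₁ f₂ hc h₂ h (ac := ab + b') rfl (by omega)]
      obtain ⟨s'', g₁, g₂, hc'⟩ := exists_seq e₁ f₁ j rfl
      rw [hP.assoc_seq e₁ f₁ g₁ g₂ hc' h₁ rfl (bc := a + b') rfl (by omega)]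
      refine .smul _ (.bin hν g₂ f₂ ?_ _ _ (ihx j g₁ rfl hy) hz)
      subst hk
      exact hc'.outer_eq 1 (by decide) _
    · obtain ⟨s', f₁, f₂, hc⟩ := exists_seq e₂ e j hj.symm
      rw [hP.assoc_seq e₂ e f₁ f₂ hc h₂ h (bc := b + b') rfl (by omega)]
      exact .bin hν e₁ f₂ hk _ _ hx (ihz j f₁ rfl hy)

theorem Gend.of_un {s : ℤ} {ν : P.obj 1 s} (hν : ν ∈ Un s) : Gend P Co Un Bi ν := by
  rw [← hP.comp_one 0 ν]
  exact .un hν _ _ .one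

theorem Gend.of_bin {s : ℤ} {ν : P.obj 2 s} (hν : ν ∈ Bi s) : Gend P Co Un Bi ν := by
  have h : P.comp 1 (std 1 1 rfl) (add_zero s) (P.comp 0 (std 0 1 rfl) (add_zero s) ν P.one) P.one
      = ν := by rw [hP.comp_one, hP.comp_one]
  rw [← h]
  exact .bin hν _ _ (std_one_outer _ _ _ _).symm _ _ .one .one

end Gend

namespace Presentation

variable (R : Presentation K) {Co : ∀ d, Set (R.data.obj 0 d)} {Un : ∀ d, Set (R.data.obj 1 d)}
  {Bi : ∀ d, Set (R.data.obj 2 d)}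

theorem gend_tree (hg : ∀ {n : ℕ} {d : ℤ} (g : R.Gen n d), Gend R.data Co Un Bi (R.dataGen g))
    {n : ℕ} {d : ℤ} (t : Tree R.Gen n d) : Gend R.data Co Un Bi (R.cls (freeTree K t)) := by
  induction t with
  | gen g => exact hg g
  | one => exact .one
  | comp i e h x y hx hy =>
    rw [← freeData_comp_tree]
    exact hx.comp R.data_isOperad i e h hy

theorem data_hom_ext {n : ℕ} {d : ℤ} {M : Type u} [AddCommGroup M] [Module K M]
    {f f' : R.data.obj n d →ₗ[K] M}
    (h : ∀ t : Tree R.Gen n d, f (R.cls (freeTree K t)) = f' (R.cls (freeTree K t))) : f = f' := by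
  have h1 : f ∘ₗ R.clsMap n d = f' ∘ₗ R.clsMap n d := freeData_hom_ext K h
  refine LinearMap.ext fun x => ?_
  obtain ⟨x, rfl⟩ := R.cls_surj x
  exact LinearMap.congr_fun h1 x

theorem hom_ext_gend
    (hg : ∀ {n : ℕ} {d : ℤ} (g : R.Gen n d), Gend R.data Co Un Bi (R.dataGen g)) {n : ℕ} {d : ℤ}
    {M : Type u} [AddCommGroup M] [Module K M] {f f' : R.data.obj n d →ₗ[K] M}
    (h : ∀ x, Gend R.data Co Un Bi x → f x = f' x) (x : R.data.obj n d) : f x = f' x :=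
  LinearMap.congr_fun (R.data_hom_ext fun t => h _ (R.gend_tree hg t)) x

end Presentation

end OperadTw

namespace OperadTw

open Graft FreeG

variable {K : Type u} [Field K]

/-! ### Equivariance of partial compositions -/

namespace OpData.IsOperad

variable {P : OpData K} (hP : P.IsOperad)

include hP

theorem act_one {n : ℕ} {d : ℤ} (x : P.obj n d) : P.act (Equiv.refl _) x = x := hP.one_comp x

theorem act_act {n : ℕ} {d : ℤ} (π σ : Equiv.Perm (Fin n)) (x : P.obj n d) :
    P.act π (P.act σ x) = P.act (σ.trans π) x :=
  (hP.act_comp π 0 _ (zero_add d) P.one x).trans rfl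

theorem comp_eq_act {m n p : ℕ} {i : Fin m} (e e' : Graft i n p) {a b c : ℤ} (h : a + b = c)
    (x : P.obj m a) (y : P.obj n b) :
    P.comp i e h x y = P.act (e'.symm.trans e) (P.comp i e' h x y) := by
  rw [hP.act_comp, ← Equiv.trans_assoc, Equiv.self_trans_symm, Equiv.refl_trans]

/-- The labelling for a composite with a relabelled outer operation. -/
theorem comp_act_left {m n p : ℕ} {k : Fin m} (π : Equiv.Perm (Fin m)) (e : Graft k n p) {a b c : ℤ}
    (h : a + b = c) (x : P.obj m a) (y : P.obj n b) {j : Fin m} (hj : k = π j) {f : Graft j n p}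
    (ho : ∀ t (ht : t ≠ j) ht', outer f t ht = outer e (π t) ht')
    (hi : ∀ t, Graft.inner f t = Graft.inner e t) :
    P.comp k e h (P.act π x) y = P.comp j f h x y := by
  have := hP.assoc_seq ((std (0 : Fin 1) m (add_comm 1 m)).trans π) e f
    (std (0 : Fin 1) p (add_comm 1 p)) ⟨?_, ?_, ?_, ?_⟩ (zero_add a) h h (zero_add c) P.one x y
  · rw [hP.one_comp] at this
    exact this
  · rw [hj]
    exact (congrArg π (std_unit_inner (add_comm 1 m) j)).symm
  · intro u hu; exact absurd (Subsingleton.elim _ _) hu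
  · intro u hu hu'
    have h1 : π (Graft.inner (std (0 : Fin 1) m (add_comm 1 m)) u) = π u :=
      congrArg π (std_unit_inner _ u)
    have h2 : π u ≠ k := by rw [hj]; exact fun h => hu (π.injective h)
    exact ((outer_congr e h1 hu' h2).trans (ho u hu h2).symm).trans (std_unit_inner _ _).symm
  · intro u
    exact (hi u).symm.trans (std_unit_inner _ _).symm

theorem comp_act_right {m n p : ℕ} {i : Fin m} (π : Equiv.Perm (Fin n)) (e : Graft i n p) {a b c : ℤ}
    (h : a + b = c) (x : P.obj m a) (y : P.obj n b) {f : Graft i n p}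
    (ho : ∀ t (ht : t ≠ i), outer f t ht = outer e t ht)
    (hi : ∀ t, Graft.inner f t = Graft.inner e (π t)) :
    P.comp i e h x (P.act π y) = P.comp i f h x y := by
  have := hP.assoc_seq (std i 1 rfl) f ((std (0 : Fin 1) n (add_comm 1 n)).trans π) e
    ⟨?_, ?_, ?_, ?_⟩ (add_zero a) h (zero_add b) h x P.one y
  · rw [hP.comp_one] at this
    exact this.symm
  · exact (std_one_inner _ _ _).symm
  · intro u hu hu'
    exact (outer_congr f (std_one_outer i rfl u hu) hu' hu).trans (ho u hu)
  · intro u hu; exact absurd (Subsingleton.elim _ _) hu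
  · intro u
    exact (hi u).trans (congrArg (fun z => Graft.inner e (π z)) (std_unit_inner _ u).symm)

end OpData.IsOperad

/-! ### The free algebra over an operad -/

/-- An operation together with labels for its inputs. -/
abbrev TagIdx : Type := Σ m : ℕ, (Fin m → ℕ) × ℤ

section Tags

variable (P : OpData K)

/-- Formal sums of operations with labelled inputs. -/
abbrev PreTag : Type u := DirectSum TagIdx fun t => P.obj t.1 t.2.2

variable {P} in
/-- An operation with labelled inputs. -/
def preTag {m : ℕ} (σ : Fin m → ℕ) {d : ℤ} : P.obj m d →ₗ[K] PreTag P :=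
  DirectSum.lof K TagIdx (fun t => P.obj t.1 t.2.2) ⟨m, σ, d⟩

/-- The relations which identify a relabelled operation with a relabelling of the labels. -/
def tagRel : Submodule K (PreTag P) :=
  Submodule.span K {r | ∃ (m : ℕ) (σ : Fin m → ℕ) (d : ℤ) (π : Equiv.Perm (Fin m)) (x : P.obj m d),
    r = preTag σ (P.act π x) - preTag (σ ∘ π) x}

/-- The free algebra over an operad, on the set of labels. -/
def TagAlg : Type u := PreTag P ⧸ tagRel P

instance : AddCommGroup (TagAlg P) := inferInstanceAs (AddCommGroup (PreTag P ⧸ tagRel P))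

instance : Module K (TagAlg P) := inferInstanceAs (Module K (PreTag P ⧸ tagRel P))

end Tags

namespace TagAlg

variable {P : OpData K}

/-- The class of an operation with labelled inputs. -/
def tag {m : ℕ} (σ : Fin m → ℕ) {d : ℤ} : P.obj m d →ₗ[K] TagAlg P :=
  (tagRel P).mkQ ∘ₗ preTag σ

theorem tag_act {m : ℕ} (σ : Fin m → ℕ) {d : ℤ} (π : Equiv.Perm (Fin m)) (x : P.obj m d) :
    tag σ (P.act π x) = tag (σ ∘ π) x :=
  (Submodule.Quotient.eq (tagRel P)).2 (Submodule.subset_span ⟨m, σ, d, π, x, rfl⟩)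

section Lift

variable {M : Type*} [AddCommGroup M] [Module K M]

theorem hom_ext {f g : TagAlg P →ₗ[K] M}
    (h : ∀ {m : ℕ} (σ : Fin m → ℕ) {d : ℤ} (x : P.obj m d), f (tag σ x) = g (tag σ x)) : f = g := by
  have h1 : f ∘ₗ (tagRel P).mkQ = g ∘ₗ (tagRel P).mkQ :=
    DirectSum.linearMap_ext K fun t => LinearMap.ext fun x => h t.2.1 x
  refine LinearMap.ext fun x => ?_
  obtain ⟨x, rfl⟩ := Submodule.mkQ_surjective (tagRel P) x
  exact LinearMap.congr_fun h1 x

/-- Linear maps out of the free algebra. -/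
def lift (f : ∀ {m : ℕ} (_ : Fin m → ℕ) {d : ℤ}, P.obj m d →ₗ[K] M)
    (hf : ∀ {m : ℕ} (σ : Fin m → ℕ) {d : ℤ} (π : Equiv.Perm (Fin m)) (x : P.obj m d),
      f σ (P.act π x) = f (σ ∘ π) x) : TagAlg P →ₗ[K] M :=
  (tagRel P).liftQ (DirectSum.toModule K TagIdx M fun t => f t.2.1) (by
    rw [tagRel, Submodule.span_le]
    rintro _ ⟨m, σ, d, π, x, rfl⟩
    rw [SetLike.mem_coe, LinearMap.mem_ker, map_sub, preTag, preTag, DirectSum.toModule_lof,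
      DirectSum.toModule_lof, sub_eq_zero]
    exact hf σ π x)

theorem lift_tag (f : ∀ {m : ℕ} (_ : Fin m → ℕ) {d : ℤ}, P.obj m d →ₗ[K] M)
    (hf : ∀ {m : ℕ} (σ : Fin m → ℕ) {d : ℤ} (π : Equiv.Perm (Fin m)) (x : P.obj m d),
      f σ (P.act π x) = f (σ ∘ π) x) {m : ℕ} (σ : Fin m → ℕ) {d : ℤ} (x : P.obj m d) :
    lift f hf (tag σ x) = f σ x := by
  change DirectSum.toModule K TagIdx M (fun t => f t.2.1) (DirectSum.lof K TagIdx
    (fun t => P.obj t.1 t.2.2) ⟨m, σ, d⟩ x) = _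
  rw [DirectSum.toModule_lof]

end Lift

/-- Homogeneous elements. -/
def gr (P : OpData K) (d : ℤ) : Submodule K (TagAlg P) :=
  Submodule.span K {v | ∃ (m : ℕ) (σ : Fin m → ℕ) (x : P.obj m d), v = tag σ x}

theorem tag_mem {m : ℕ} (σ : Fin m → ℕ) {d d' : ℤ} (x : P.obj m d) (h : d = d') :
    tag σ x ∈ gr P d' := by
  subst h
  exact Submodule.subset_span ⟨m, σ, x, rfl⟩

/-- The composite of a binary operation with two operations. -/
def binOp {s : ℤ} (ν : P.obj 2 s) (m n : ℕ) (a b : ℤ) :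
    P.obj m a →ₗ[K] P.obj n b →ₗ[K] P.obj (m + n) (s + a + b) :=
  P.comp (⟨m, Nat.lt_succ_self m⟩ : Fin (m + 1)) (std _ n (by omega)) rfl ∘ₗ
    P.comp 0 (std (0 : Fin 2) m (by omega)) rfl ν

theorem append_eq {m n : ℕ} {f : Fin (m + n) → ℕ} {σ : Fin m → ℕ} {τ : Fin n → ℕ}
    (h1 : ∀ t, f (Fin.castAdd n t) = σ t) (h2 : ∀ t, f (Fin.natAdd m t) = τ t) :
    f = Fin.append σ τ := by
  funext t
  refine Fin.addCases (fun t => ?_) (fun t => ?_) t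
  · rw [h1, Fin.append_left]
  · rw [h2, Fin.append_right]

section Bin

variable (hP : P.IsOperad)

include hP

/-- An arbitrary composite with a binary operation, as an element of the free algebra. -/
theorem tag_bin {s a ab b c : ℤ} (ν : P.obj 2 s) {m n p r : ℕ} {k : Fin p}
    (e₁ : Graft (0 : Fin 2) m p) (e₂ : Graft k n r) (hk : k = outer e₁ 1 (by decide))
    (h₁ : s + a = ab) (h₂ : ab + b = c) (x : P.obj m a) (y : P.obj n b) (ρ : Fin r → ℕ)
    {σ : Fin m → ℕ} {τ : Fin n → ℕ}
    (hσ : ∀ t h, ρ (outer e₂ (Graft.inner e₁ t) h) = σ t) (hτ : ∀ t, ρ (Graft.inner e₂ t) = τ t) :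
    tag ρ (P.comp k e₂ h₂ (P.comp 0 e₁ h₁ ν x) y) = tag (Fin.append σ τ) (binOp ν m n a b x y) := by
  obtain rfl : p = m + 1 := by have := graft_card e₁; omega
  obtain rfl : r = m + n := by have := graft_card e₂; omega
  subst h₁ h₂
  set π : Equiv.Perm (Fin (m + 1)) := (std (0 : Fin 2) m (by omega)).symm.trans e₁ with hπ
  have hπo : π ⟨m, Nat.lt_succ_self m⟩ = k := by
    rw [hk, hπ, Equiv.trans_apply]
    refine congrArg e₁ ((Equiv.symm_apply_eq _).2 ?_)
    exact Fin.ext (by simp [std])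
  have hπi : ∀ t : Fin m, π ⟨t, by omega⟩ = Graft.inner e₁ t := fun t => by
    rw [hπ, Equiv.trans_apply]
    refine congrArg e₁ ((Equiv.symm_apply_eq _).2 ?_)
    exact Fin.ext (by simp [std])
  have hne : ∀ t (ht : t ≠ (⟨m, Nat.lt_succ_self m⟩ : Fin (m + 1))), π t ≠ k := fun t ht h =>
    ht (π.injective (h.trans hπo.symm))
  obtain ⟨f, hfo, hfi⟩ := exists_graft_of (⟨m, Nat.lt_succ_self m⟩ : Fin (m + 1)) (n := n)
    (p := m + n) (by omega) (fun t ht => outer e₂ (π t) (hne t ht)) (Graft.inner e₂) (fun t => by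
      rcases graft_cases e₂ t with ⟨u, hu, rfl⟩ | h
      · refine .inl ⟨π.symm u, fun h => hu ?_, ?_⟩
        · rw [← hπo, ← h, Equiv.apply_symm_apply]
        · exact outer_congr e₂ (Equiv.apply_symm_apply _ _) _ _
      · exact .inr h)
  rw [hP.comp_eq_act e₁ (std (0 : Fin 2) m (by omega)), ← hπ,
    hP.comp_act_left π e₂ rfl _ y hπo.symm (f := f) (fun t ht ht' => hfo t ht) hfi,
    hP.comp_eq_act f (std _ n (by omega)), tag_act]
  have : ρ ∘ ((std (⟨m, Nat.lt_succ_self m⟩ : Fin (m + 1)) n (by omega)).symm.trans f :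
      Equiv.Perm (Fin (m + n))) = Fin.append σ τ := by
    refine append_eq (fun t => ?_) (fun t => ?_)
    · have h1 : (std (⟨m, Nat.lt_succ_self m⟩ : Fin (m + 1)) n (by omega)).symm (Fin.castAdd n t) =
          Sum.inl ⟨⟨t, by omega⟩, fun h => by have := congrArg Fin.val h; simp at this; omega⟩ :=
        (Equiv.symm_apply_eq _).2 (Fin.ext (by simp [std]))
      have hd : π ⟨t, by omega⟩ ≠ k := hne _ fun h => by
        have := congrArg Fin.val h; simp at this; omega
      rw [Function.comp_apply, Equiv.trans_apply, h1]
      refine Eq.trans (congrArg ρ (hfo ⟨t, by omega⟩ _)) ?_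
      refine Eq.trans (congrArg ρ (outer_congr e₂ (hπi t) _ (by rw [← hπi]; exact hd))) (hσ t _)
    · have h1 : (std (⟨m, Nat.lt_succ_self m⟩ : Fin (m + 1)) n (by omega)).symm (Fin.natAdd m t) =
          Sum.inr t := (Equiv.symm_apply_eq _).2 (Fin.ext (by simp [std]))
      rw [Function.comp_apply, Equiv.trans_apply, h1]
      exact (congrArg ρ (hfi t)).trans (hτ t)
  rw [this]
  rfl

end Bin

end TagAlg

end OperadTw

namespace OperadTw

open Graft FreeG

variable {K : Type u} [Field K]

/-! ### Products and unary operations on the free algebra -/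

namespace OpData.IsOperad

variable {P : OpData K} (hP : P.IsOperad)

include hP

theorem par_sg {m n q p s r : ℕ} {i i' : Fin m} {k : Fin p} {k' : Fin s}
    {e₁ : Graft i n p} {e₂ : Graft k q r} {f₁ : Graft i' q s} {f₂ : Graft k' n r}
    (hc : ParCompat e₁ e₂ f₁ f₂) {a b c ab ac abc : ℤ} (h₁ : a + b = ab) (h₂ : ab + c = abc)
    (h₃ : a + c = ac) (h₄ : ac + b = abc) (x : P.obj m a) (y : P.obj n b) (z : P.obj q c) :
    P.comp k e₂ h₂ (P.comp i e₁ h₁ x y) z =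
      sg K (b * c) • P.comp k' f₂ h₄ (P.comp i' f₁ h₃ x z) y :=
  hP.assoc_par e₁ e₂ f₁ f₂ hc h₁ h₂ h₃ h₄ x y z

/-- Composites of relabelled outer operations agree up to a relabelling. -/
theorem exists_comp_act {m n p : ℕ} (π : Equiv.Perm (Fin m)) {k j : Fin m} (hj : k = π j)
    (e : Graft k n p) (e' : Graft j n p) {a b c : ℤ} (h : a + b = c) (x : P.obj m a)
    (y : P.obj n b) : ∃ π' : Equiv.Perm (Fin p), (∀ t ht ht', π' (outer e' t ht) = outer e (π t) ht') ∧
      (∀ t, π' (Graft.inner e' t) = Graft.inner e t) ∧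
      P.comp k e h (P.act π x) y = P.act π' (P.comp j e' h x y) := by
  have hne : ∀ t (ht : t ≠ j), π t ≠ k := fun t ht h => ht (π.injective (h.trans hj))
  obtain ⟨f, hfo, hfi⟩ := exists_graft_of j (n := n) (p := p) (graft_card e)
    (fun t ht => outer e (π t) (hne t ht)) (Graft.inner e) (fun t => by
      rcases graft_cases e t with ⟨u, hu, rfl⟩ | h
      · refine .inl ⟨π.symm u, fun h => hu ?_, ?_⟩
        · rw [hj, ← h, Equiv.apply_symm_apply]
        · exact outer_congr e (Equiv.apply_symm_apply _ _) _ _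
      · exact .inr h)
  refine ⟨e'.symm.trans f, fun t ht ht' => ?_, fun t => ?_, ?_⟩
  · rw [← hfo t ht]
    exact congrArg f (Equiv.symm_apply_apply e' _)
  · rw [← hfi t]
    exact congrArg f (Equiv.symm_apply_apply e' _)
  · rw [hP.comp_act_left π e h x y hj (f := f) (fun t ht ht' => hfo t ht) hfi, hP.comp_eq_act f e']

end OpData.IsOperad

namespace TagAlg

variable {P : OpData K}

/-- The labelling of the first composite of a binary operation. -/
abbrev binL (m : ℕ) : Graft (0 : Fin 2) m (m + 1) := std 0 m (by omega)

/-- The labelling of the second composite of a binary operation. -/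
abbrev binR (m n : ℕ) : Graft (⟨m, Nat.lt_succ_self m⟩ : Fin (m + 1)) n (m + n) :=
  std _ n (by omega)

theorem append_outer {m n : ℕ} (σ : Fin m → ℕ) (τ : Fin n → ℕ) (t : Fin m)
    (ht : Graft.inner (binL m) t ≠ ⟨m, Nat.lt_succ_self m⟩) :
    Fin.append σ τ (outer (binR m n) (Graft.inner (binL m) t) ht) = σ t := by
  rw [show outer (binR m n) (Graft.inner (binL m) t) ht = Fin.castAdd n t from
    Fin.ext (by simp [outer, Graft.inner, std]), Fin.append_left]

theorem append_inner {m n : ℕ} (σ : Fin m → ℕ) (τ : Fin n → ℕ) (t : Fin n) :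
    Fin.append σ τ (Graft.inner (binR m n) t) = τ t := by
  rw [show Graft.inner (binR m n) t = Fin.natAdd m t from
    Fin.ext (by simp [Graft.inner, std]), Fin.append_right]

theorem std_outer_one (m : ℕ) :
    (⟨m, Nat.lt_succ_self m⟩ : Fin (m + 1)) = outer (binL m) 1 (by decide) :=
  Fin.ext (by simp [outer, std])

variable (hP : P.IsOperad)

include hP

/-- The product of an element with a labelled operation on the left. -/
theorem exists_bprod {s : ℤ} (ν : P.obj 2 s) : ∃ F : TagAlg P →ₗ[K] TagAlg P →ₗ[K] TagAlg P,
    ∀ {m n : ℕ} (σ : Fin m → ℕ) (τ : Fin n → ℕ) {a b : ℤ} (x : P.obj m a) (y : P.obj n b),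
      F (tag σ x) (tag τ y) = tag (Fin.append σ τ) (binOp ν m n a b x y) := by
  have h1 : ∀ {m : ℕ} (σ : Fin m → ℕ) {a : ℤ} (x : P.obj m a) {n : ℕ} (τ : Fin n → ℕ) {b : ℤ}
      (π : Equiv.Perm (Fin n)) (y : P.obj n b),
      tag (Fin.append σ τ) (binOp ν m n a b x (P.act π y)) =
        tag (Fin.append σ (τ ∘ π)) (binOp ν m n a b x y) := by
    intro m σ a x n τ b π y
    change tag (Fin.append σ τ) (P.comp _ _ _ _ (P.act π y)) = _
    rw [hP.comp_act_right π (binR m n) rfl _ y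
      (f := ((Equiv.sumCongr (Equiv.refl _) π).trans
        (binR m n))) (fun t ht => rfl)
      (fun t => rfl)]
    exact tag_bin hP ν _ _ (std_outer_one m) rfl rfl x y _ (fun t h => append_outer σ τ t h)
      (fun t => append_inner σ τ (π t))
  have h2 : ∀ {m : ℕ} (σ : Fin m → ℕ) {a : ℤ} (π : Equiv.Perm (Fin m)) (x : P.obj m a) {n : ℕ}
      (τ : Fin n → ℕ) {b : ℤ} (y : P.obj n b),
      tag (Fin.append σ τ) (binOp ν m n a b (P.act π x) y) =
        tag (Fin.append (σ ∘ π) τ) (binOp ν m n a b x y) := by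
    intro m σ a π x n τ b y
    change tag (Fin.append σ τ) (P.comp _ _ _ (P.comp 0 _ _ ν (P.act π x)) y) = _
    rw [hP.comp_act_right π (binL m) rfl ν x
      (f := ((Equiv.sumCongr (Equiv.refl _) π).trans
        (binL m))) (fun t ht => rfl)
      (fun t => rfl)]
    exact tag_bin hP ν ((Equiv.sumCongr (Equiv.refl _) π).trans (binL m)) (binR m n)
      (std_outer_one m) rfl rfl x y _ (fun t h => append_outer σ τ (π t) h)
      (fun t => append_inner σ τ t)
  have h3 : ∀ {m : ℕ} (σ : Fin m → ℕ) {a : ℤ} (x : P.obj m a), ∃ F : TagAlg P →ₗ[K] TagAlg P,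
      ∀ {n : ℕ} (τ : Fin n → ℕ) {b : ℤ} (y : P.obj n b),
        F (tag τ y) = tag (Fin.append σ τ) (binOp ν m n a b x y) := fun {m} σ a x =>
    ⟨lift (fun {n} τ {b} => tag (Fin.append σ τ) ∘ₗ binOp ν m n a b x)
      (fun τ _ π y => h1 σ x τ π y), fun τ _ y => lift_tag _ _ _ _⟩
  choose F hF using @h3
  let L : ∀ {m : ℕ} (σ : Fin m → ℕ) {a : ℤ}, P.obj m a →ₗ[K] TagAlg P →ₗ[K] TagAlg P :=
    fun {m} σ {a} =>
    { toFun := fun x => F σ x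
      map_add' := fun x x' => hom_ext fun τ _ y => by
        rw [LinearMap.add_apply, hF, hF, hF, map_add, LinearMap.add_apply, map_add]
      map_smul' := fun r x => hom_ext fun τ _ y => by
        rw [RingHom.id_apply, LinearMap.smul_apply, hF, hF, map_smul, LinearMap.smul_apply,
          map_smul] }
  refine ⟨lift (fun {m} σ {a} => L σ) (fun σ _ π x => hom_ext fun τ _ y => ?_), fun σ τ _ _ x y => ?_⟩
  · change F σ (P.act π x) (tag τ y) = F (σ ∘ π) x (tag τ y)
    rw [hF, hF]
    exact h2 σ π x τ y
  · rw [lift_tag]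
    exact hF σ x τ y

/-- The product defined by a binary operation. -/
def bprod {s : ℤ} (ν : P.obj 2 s) : TagAlg P →ₗ[K] TagAlg P →ₗ[K] TagAlg P :=
  (exists_bprod hP ν).choose

theorem bprod_tag {s : ℤ} (ν : P.obj 2 s) {m n : ℕ} (σ : Fin m → ℕ) (τ : Fin n → ℕ) {a b : ℤ}
    (x : P.obj m a) (y : P.obj n b) :
    bprod hP ν (tag σ x) (tag τ y) = tag (Fin.append σ τ) (binOp ν m n a b x y) :=
  (exists_bprod hP ν).choose_spec σ τ x y

/-- An arbitrary composite with a binary operation is a product. -/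
theorem tag_bprod {s a ab b c : ℤ} (ν : P.obj 2 s) {m n p r : ℕ} {k : Fin p}
    (e₁ : Graft (0 : Fin 2) m p) (e₂ : Graft k n r) (hk : k = outer e₁ 1 (by decide))
    (h₁ : s + a = ab) (h₂ : ab + b = c) (x : P.obj m a) (y : P.obj n b) (ρ : Fin r → ℕ)
    {σ : Fin m → ℕ} {τ : Fin n → ℕ}
    (hσ : ∀ t h, ρ (outer e₂ (Graft.inner e₁ t) h) = σ t) (hτ : ∀ t, ρ (Graft.inner e₂ t) = τ t) :
    tag ρ (P.comp k e₂ h₂ (P.comp 0 e₁ h₁ ν x) y) = bprod hP ν (tag σ x) (tag τ y) := by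
  rw [bprod_tag]
  exact tag_bin hP ν e₁ e₂ hk h₁ h₂ x y ρ hσ hτ

theorem bprod_eq {s : ℤ} (ν : P.obj 2 s) {m n : ℕ} (σ : Fin m → ℕ) (τ : Fin n → ℕ) {a b : ℤ}
    (x : P.obj m a) (y : P.obj n b) {c : ℤ} (h : s + a + b = c) :
    bprod hP ν (tag σ x) (tag τ y) = tag (Fin.append σ τ)
      (P.comp (⟨m, Nat.lt_succ_self m⟩ : Fin (m + 1)) (binR m n) h
        (P.comp 0 (binL m) rfl ν x) y) := by
  subst h
  exact bprod_tag hP ν σ τ x y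

theorem bprod_add {s : ℤ} (ν ν' : P.obj 2 s) : bprod hP (ν + ν') = bprod hP ν + bprod hP ν' :=
  hom_ext fun σ _ x => hom_ext fun τ _ y => by
    rw [LinearMap.add_apply, LinearMap.add_apply, bprod_tag, bprod_tag, bprod_tag, ← map_add]
    simp [binOp]

theorem bprod_smul {s : ℤ} (r : K) (ν : P.obj 2 s) : bprod hP (r • ν) = r • bprod hP ν :=
  hom_ext fun σ _ x => hom_ext fun τ _ y => by
    rw [LinearMap.smul_apply, LinearMap.smul_apply, bprod_tag, bprod_tag, ← map_smul]
    simp [binOp]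

theorem bprod_mem {s : ℤ} (ν : P.obj 2 s) {i j k : ℤ} {u v : TagAlg P} (hu : u ∈ gr P i)
    (hv : v ∈ gr P j) (h : s + i + j = k) : bprod hP ν u v ∈ gr P k := by
  have h1 : gr P i ≤ (gr P k).comap ((bprod hP ν).flip v) := by
    refine Submodule.span_le.2 ?_
    rintro _ ⟨m, σ, x, rfl⟩
    change bprod hP ν (tag σ x) v ∈ gr P k
    have h2 : gr P j ≤ (gr P k).comap (bprod hP ν (tag σ x)) := by
      refine Submodule.span_le.2 ?_
      rintro _ ⟨n, τ, y, rfl⟩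
      change bprod hP ν (tag σ x) (tag τ y) ∈ gr P k
      rw [bprod_tag]
      exact tag_mem _ _ h
    exact h2 hv
  exact h1 hu

omit hP in
theorem eq_on_gr {M : Type*} [AddCommGroup M] [Module K M] {f g : TagAlg P →ₗ[K] M} {i : ℤ}
    (h : ∀ {m : ℕ} (σ : Fin m → ℕ) (x : P.obj m i), f (tag σ x) = g (tag σ x)) {u : TagAlg P}
    (hu : u ∈ gr P i) : f u = g u := by
  have : gr P i ≤ LinearMap.eqLocus f g := by
    refine Submodule.span_le.2 ?_
    rintro _ ⟨m, σ, x, rfl⟩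
    exact h σ x
  exact this hu

theorem bprod_comm {s : ℤ} {ν : P.obj 2 s} (hν : P.act (Equiv.swap 0 1) ν = ν) {i j : ℤ}
    {u v : TagAlg P} (hu : u ∈ gr P i) (hv : v ∈ gr P j) :
    bprod hP ν u v = sg K (i * j) • bprod hP ν v u := by
  refine eq_on_gr (f := (bprod hP ν).flip v) (g := sg K (i * j) • bprod hP ν v) (fun σ x => ?_) hu
  refine eq_on_gr (f := bprod hP ν (tag σ x)) (g := sg K (i * j) • (bprod hP ν).flip (tag σ x))
    (fun τ y => ?_) hv
  rename_i m n
  change bprod hP ν (tag σ x) (tag τ y) = sg K (i * j) • bprod hP ν (tag τ y) (tag σ x)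
  have h0 := std_outer_one m
  set e₁ := binL m with he₁
  set e₂ := binR m n with he₂
  have ht : ∀ (t : Fin 2) (ht : t ≠ 1) (ht' : Equiv.swap 0 1 t ≠ 0),
      (Equiv.swap 0 1 : Equiv.Perm (Fin 2)) t ≠ 0 := fun _ _ h => h
  rw [bprod_eq hP ν σ τ x y rfl, ← hν]
  obtain ⟨π, ho, hi, hc⟩ := hP.exists_comp_act (Equiv.swap 0 1) (k := (0 : Fin 2)) (j := 1) rfl e₁
    (std (1 : Fin 2) m (by omega)) rfl ν x
  have hk : (⟨m, Nat.lt_succ_self m⟩ : Fin (m + 1)) = π (outer (std (1 : Fin 2) m (by omega)) 0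
      (by decide)) := by
    rw [ho 0 (by decide) (by decide)]
    exact h0
  obtain ⟨π', ho', hi', hc'⟩ := hP.exists_comp_act π hk e₂ (std _ n (by omega)) rfl
    (P.comp 1 (std (1 : Fin 2) m (by omega)) rfl ν x) y
  obtain ⟨q, f₁, f₂, hpar⟩ := exists_par (std (1 : Fin 2) m (by omega))
    (std (outer (std (1 : Fin 2) m (p := m + 1) (by omega)) 0 (by decide)) n (p := m + n) (by omega))
    (i' := 0) (by decide) rfl
  rw [hc, hc', tag_act, hP.par_sg hpar rfl rfl rfl (by omega), map_smul, hν]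
  congr 1
  refine tag_bprod hP ν f₁ f₂ rfl rfl _ y x _ (fun t h => ?_) (fun t => ?_)
  · rw [Function.comp_apply, ← hpar.right_eq t h, hi']
    exact append_inner σ τ t
  · have hne : Graft.inner (std (1 : Fin 2) m (p := m + 1) (by omega)) t ≠
        outer (std (1 : Fin 2) m (p := m + 1) (by omega)) 0 (by decide) := fun h =>
      outer_ne_inner _ _ _ h.symm
    rw [Function.comp_apply, ← hpar.left_eq t hne, ho' _ _ (by
      rw [hi, h0]; exact fun h => outer_ne_inner _ _ _ h.symm)]
    refine Eq.trans (congrArg (Fin.append σ τ) (outer_congr e₂ (hi t) _ ?_)) (append_outer σ τ t ?_)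
    all_goals rw [h0]; exact fun h => outer_ne_inner _ _ _ h.symm

end TagAlg

end OperadTw

namespace OperadTw

open Graft FreeG

variable {K : Type u} [Field K]

namespace TagAlg

variable {P : OpData K}

/-! ### Composites with ternary operations -/

/-- `v` is a composite of the ternary operation `T` with three labelled operations, plugged into the
inputs `i₁`, `i₂`, `i₃` in this order. -/
inductive IsTern {s : ℤ} (T : P.obj 3 s) (i₁ i₂ i₃ : Fin 3) {m n r : ℕ} {a b c : ℤ}
    (σ : Fin m → ℕ) (x : P.obj m a) (τ : Fin n → ℕ) (y : P.obj n b) (υ : Fin r → ℕ)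
    (z : P.obj r c) : TagAlg P → Prop
  | mk {p q t : ℕ} {k : Fin p} {l : Fin q} (e₁ : Graft i₁ m p) (e₂ : Graft k n q) (e₃ : Graft l r t)
      {d₁ d₂ d₃ : ℤ} (g₁ : s + a = d₁) (g₂ : d₁ + b = d₂) (g₃ : d₂ + c = d₃) (ρ : Fin t → ℕ)
      (h₂ : i₂ ≠ i₁) (h₃ : i₃ ≠ i₁) (h₂₃ : i₃ ≠ i₂) (hk : k = outer e₁ i₂ h₂)
      (hl : ∀ h, l = outer e₂ (outer e₁ i₃ h₃) h)
      (hσ : ∀ j h h', ρ (outer e₃ (outer e₂ (Graft.inner e₁ j) h) h') = σ j)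
      (hτ : ∀ j h, ρ (outer e₃ (Graft.inner e₂ j) h) = τ j)
      (hυ : ∀ j, ρ (Graft.inner e₃ j) = υ j) :
      IsTern T i₁ i₂ i₃ σ x τ y υ z (tag ρ (P.comp l e₃ g₃ (P.comp k e₂ g₂ (P.comp i₁ e₁ g₁ T x) y) z))

section Tern

variable {s : ℤ} {T T' : P.obj 3 s} {i₁ i₂ i₃ : Fin 3} {m n r : ℕ} {a b c : ℤ}
    {σ : Fin m → ℕ} {x : P.obj m a} {τ : Fin n → ℕ} {y : P.obj n b} {υ : Fin r → ℕ}
    {z : P.obj r c} {v v' : TagAlg P}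

theorem IsTern.congr (h : IsTern T i₁ i₂ i₃ σ x τ y υ z v) (h' : v = v') :
    IsTern T i₁ i₂ i₃ σ x τ y υ z v' := h' ▸ h

theorem eq_of_labels {t : ℕ} {q : ℕ} {l : Fin q} {f : Graft l r t} {ρ ρ' : Fin t → ℕ}
    (h1 : ∀ j h, ρ (outer f j h) = ρ' (outer f j h))
    (h2 : ∀ j, ρ (Graft.inner f j) = ρ' (Graft.inner f j)) : ρ = ρ' := by
  funext j
  rcases graft_cases f j with ⟨u, hu, rfl⟩ | ⟨u, rfl⟩
  · exact h1 u hu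
  · exact h2 u

/-- A chain of labels, for three given arities. -/
theorem exists_append3 {p q t : ℕ} {k : Fin p} {l : Fin q} (e₁ : Graft i₁ m p) (e₂ : Graft k n q)
    (e₃ : Graft l r t) (h₂ : i₂ ≠ i₁) (h₃ : i₃ ≠ i₁) (h₂₃ : i₃ ≠ i₂) (hk : k = outer e₁ i₂ h₂)
    (hl : ∀ h, l = outer e₂ (outer e₁ i₃ h₃) h) (σ : Fin m → ℕ) (τ : Fin n → ℕ) (υ : Fin r → ℕ) :
    ∃ ρ : Fin t → ℕ, (∀ j h h', ρ (outer e₃ (outer e₂ (Graft.inner e₁ j) h) h') = σ j) ∧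
      (∀ j h, ρ (outer e₃ (Graft.inner e₂ j) h) = τ j) ∧ ∀ j, ρ (Graft.inner e₃ j) = υ j := by
  refine ⟨fun w => Sum.elim (fun a => Sum.elim (fun a' => Sum.elim (fun _ => 0) σ (e₁.symm a'.1)) τ
    (e₂.symm a.1)) υ (e₃.symm w), fun j h h' => ?_, fun j h => ?_, fun j => ?_⟩
  · simp [outer, Graft.inner]
  · simp [outer, Graft.inner]
  · simp [Graft.inner]

variable (hP : P.IsOperad)

include hP

theorem IsTern.act_eq {π : Equiv.Perm (Fin 3)} {j₁ j₂ j₃ : Fin 3}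
    (H : IsTern (P.act π T) i₁ i₂ i₃ σ x τ y υ z v) (H' : IsTern T j₁ j₂ j₃ σ x τ y υ z v')
    (hj₁ : i₁ = π j₁) (hj₂ : i₂ = π j₂) (hj₃ : i₃ = π j₃) : v = v' := by
  subst hj₁ hj₂ hj₃
  obtain @⟨p, q, t, k, l, e₁, e₂, e₃, d₁, d₂, d₃, g₁, g₂, g₃, ρ, h₂, h₃, h₂₃, hk, hl, hσ, hτ, hυ⟩ := H
  obtain @⟨p', q', t', k', l', e₁', e₂', e₃', d₁', d₂', d₃', g₁', g₂', g₃', ρ', h₂', h₃', h₂₃', hk',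
    hl', hσ', hτ', hυ'⟩ := H'
  have c₁ := graft_card e₁
  have c₂ := graft_card e₂
  have c₃ := graft_card e₃
  have c₁' := graft_card e₁'
  have c₂' := graft_card e₂'
  have c₃' := graft_card e₃'
  obtain rfl : p = p' := by omega
  obtain rfl : q = q' := by omega
  obtain rfl : t = t' := by omega
  subst g₁ g₂ g₃ g₁' g₂' g₃'
  have hl0 : outer e₁' j₃ h₃' ≠ k' := by rw [hk']; exact fun h => h₂₃' (outer_inj e₁' h)
  obtain ⟨π₁, ho₁, hi₁, hc₁⟩ := hP.exists_comp_act π rfl e₁ e₁' rfl T x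
  have hk₁ : k = π₁ k' := by rw [hk, hk', ho₁ j₂ h₂' h₂]
  obtain ⟨π₂, ho₂, hi₂, hc₂⟩ := hP.exists_comp_act π₁ hk₁ e₂ e₂' rfl (P.comp j₁ e₁' rfl T x) y
  have hl1 : π₁ (outer e₁' j₃ h₃') ≠ k := by
    rw [hk₁]; exact fun h => hl0 (π₁.injective h)
  have hl1' : outer e₁ (π j₃) h₃ ≠ k := by rwa [ho₁ j₃ h₃' h₃] at hl1
  have hl₂ : l = π₂ l' := by
    rw [hl' hl0, ho₂ _ hl0 hl1, hl hl1']
    exact outer_congr e₂ (ho₁ j₃ h₃' h₃).symm _ _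
  obtain ⟨π₃, ho₃, hi₃, hc₃⟩ := hP.exists_comp_act π₂ hl₂ e₃ e₃' rfl
    (P.comp k' e₂' rfl (P.comp j₁ e₁' rfl T x) y) z
  rw [hc₁, hc₂, hc₃, tag_act]
  have hρ : ρ ∘ π₃ = ρ' := ?_
  · rw [hρ]
  refine eq_of_labels (f := e₃') (fun j h => ?_) fun j => ?_
  · have hj : π₂ j ≠ l := by rw [hl₂]; exact fun h' => h (π₂.injective h')
    rw [Function.comp_apply, ho₃ j h hj]
    rcases graft_cases e₂' j with ⟨j, hj', rfl⟩ | ⟨j, rfl⟩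
    · have hj1 : π₁ j ≠ k := by rw [hk₁]; exact fun h => hj' (π₁.injective h)
      rcases graft_cases e₁' j with ⟨j, hj'', rfl⟩ | ⟨j, rfl⟩
      · exfalso
        have h1 : j ≠ j₂ := by rintro rfl; exact hj' hk'.symm
        have h2 : j ≠ j₃ := by rintro rfl; exact h (hl' hj').symm
        have h3 : j₂ ≠ j₁ := h₂'
        have h4 : j₃ ≠ j₁ := h₃'
        have h5 : j₃ ≠ j₂ := h₂₃'
        omega
      · rw [hσ']
        have hj2 : Graft.inner e₁ j ≠ k := by rwa [hi₁] at hj1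
        have h0 : π₂ (outer e₂' (Graft.inner e₁' j) hj') = outer e₂ (Graft.inner e₁ j) hj2 :=
          (ho₂ _ hj' hj1).trans (outer_congr e₂ (hi₁ j) _ _)
        have hj3 : outer e₂ (Graft.inner e₁ j) hj2 ≠ l := by rwa [h0] at hj
        exact (congrArg ρ (outer_congr e₃ h0 hj hj3)).trans (hσ j _ _)
    · rw [hτ']
      have hj3 : Graft.inner e₂ j ≠ l := by rwa [hi₂] at hj
      exact (congrArg ρ (outer_congr e₃ (hi₂ j) hj hj3)).trans (hτ j _)
  · rw [Function.comp_apply, hi₃, hυ, hυ']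

theorem IsTern.unique (H : IsTern T i₁ i₂ i₃ σ x τ y υ z v) (H' : IsTern T i₁ i₂ i₃ σ x τ y υ z v') :
    v = v' := by
  have h := hP.act_one T
  refine IsTern.act_eq hP (π := Equiv.refl _) (T := T) ?_ H' rfl rfl rfl
  rwa [h]

omit hP in
variable (T σ x τ y υ z) in
theorem IsTern.exists (h₂ : i₂ ≠ i₁) (h₃ : i₃ ≠ i₁) (h₂₃ : i₃ ≠ i₂) :
    ∃ v, IsTern T i₁ i₂ i₃ σ x τ y υ z v := by
  obtain ⟨e₁⟩ := exists_graft i₁ (n := m) (p := m + 2) (by omega)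
  obtain ⟨e₂⟩ := exists_graft (outer e₁ i₂ h₂) (n := n) (p := m + n + 1) (by omega)
  have h : outer e₁ i₃ h₃ ≠ outer e₁ i₂ h₂ := fun h => h₂₃ (outer_inj e₁ h)
  obtain ⟨e₃⟩ := exists_graft (outer e₂ (outer e₁ i₃ h₃) h) (n := r) (p := m + n + r) (by omega)
  obtain ⟨ρ, hσ, hτ, hυ⟩ := exists_append3 e₁ e₂ e₃ h₂ h₃ h₂₃ rfl (fun _ => rfl) σ τ υ
  exact ⟨_, .mk e₁ e₂ e₃ rfl rfl rfl ρ h₂ h₃ h₂₃ rfl (fun _ => rfl) hσ hτ hυ⟩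

theorem IsTern.add (H : IsTern T i₁ i₂ i₃ σ x τ y υ z v) (H' : IsTern T' i₁ i₂ i₃ σ x τ y υ z v') :
    IsTern (T + T') i₁ i₂ i₃ σ x τ y υ z (v + v') := by
  obtain ⟨e₁, e₂, e₃, g₁, g₂, g₃, ρ, h₂, h₃, h₂₃, hk, hl, hσ, hτ, hυ⟩ := H
  have h := IsTern.mk (T := T') (x := x) (y := y) (z := z) e₁ e₂ e₃ g₁ g₂ g₃ ρ h₂ h₃ h₂₃ hk hl hσ hτ hυ
  rw [H'.unique hP h]
  refine (IsTern.mk e₁ e₂ e₃ g₁ g₂ g₃ ρ h₂ h₃ h₂₃ hk hl hσ hτ hυ).congr ?_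
  simp only [map_add, LinearMap.add_apply]

theorem IsTern.eq_zero (H : IsTern (0 : P.obj 3 s) i₁ i₂ i₃ σ x τ y υ z v) : v = 0 := by
  have h0 : (0 : P.obj 3 s) + 0 = 0 := add_zero 0
  have h := H.add hP H
  rw [h0] at h
  simpa using h.unique hP H

theorem IsTern.swap₁₂ (H : IsTern T i₁ i₂ i₃ σ x τ y υ z v) :
    IsTern T i₂ i₁ i₃ τ y σ x υ z (sg K (a * b) • v) := by
  obtain ⟨e₁, e₂, e₃, g₁, g₂, g₃, ρ, h₂, h₃, h₂₃, hk, hl, hσ, hτ, hυ⟩ := H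
  obtain ⟨q', f₁, f₂, hpar⟩ := exists_par e₁ e₂ h₂.symm hk
  have hl0 : outer e₁ i₃ h₃ ≠ _ := fun h => h₂₃ (outer_inj e₁ (h.trans hk))
  refine (IsTern.mk f₁ f₂ e₃ (d₁ := s + b) rfl (by omega) g₃ ρ h₂.symm h₂₃ h₃ rfl (fun h => ?_)
    (fun j h h' => ?_) (fun j h => ?_) hυ).congr ?_
  · rw [hl hl0]
    exact hpar.outer_eq i₃ h₃ h₂₃ hl0 h
  · have := hpar.right_eq j h
    rw [← hτ j (by rw [this]; exact h')]
    exact congrArg ρ (outer_congr e₃ this.symm _ _)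
  · have hj : Graft.inner e₁ j ≠ _ := fun h' => outer_ne_inner e₁ h₂ j (h'.trans hk).symm
    have := hpar.left_eq j hj
    rw [← hσ j hj (by rw [this]; exact h)]
    exact congrArg ρ (outer_congr e₃ this.symm _ _)
  · rw [hP.par_sg hpar g₁ g₂ rfl (by omega), map_smul, LinearMap.smul_apply, map_smul, smul_smul, sg_sq,
      one_smul]

theorem IsTern.swap₂₃ (H : IsTern T i₁ i₂ i₃ σ x τ y υ z v) :
    IsTern T i₁ i₃ i₂ σ x υ z τ y (sg K (b * c) • v) := by
  obtain @⟨p, q, w, k, l, e₁, e₂, e₃, d₁, d₂, d₃, g₁, g₂, g₃, ρ, h₂, h₃, h₂₃, hk, hl, hσ, hτ, hυ⟩ := H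
  have hl0 : outer e₁ i₃ h₃ ≠ _ := fun h => h₂₃ (outer_inj e₁ (h.trans hk))
  obtain ⟨q', f₁, f₂, hpar⟩ := exists_par e₂ e₃ hl0.symm (hl hl0)
  refine (IsTern.mk e₁ f₁ f₂ (d₃ := d₃) g₁ rfl (by omega) ρ h₃ h₂ h₂₃.symm rfl (fun h => ?_)
    (fun j h h' => ?_) (fun j h => ?_) (fun j => ?_)).congr ?_
  · exact outer_congr f₁ hk _ _
  · have hj : Graft.inner e₁ j ≠ _ := fun h' => outer_ne_inner e₁ h₂ j (h'.trans hk).symm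
    have hj' : outer e₂ (Graft.inner e₁ j) hj ≠ _ := fun h' =>
      outer_ne_inner e₁ h₃ j (outer_inj e₂ (h'.trans (hl hl0))).symm
    rw [← hσ j hj hj', ← hpar.outer_eq _ hj h hj' h']
  · have := hpar.right_eq j h
    rw [← hυ j, this]
  · have hj : Graft.inner e₂ j ≠ _ := fun h' => outer_ne_inner e₂ hl0 j (h'.trans (hl hl0)).symm
    rw [← hτ j hj, ← hpar.left_eq j hj]
  · rw [hP.par_sg hpar g₂ g₃ rfl (by omega), map_smul, smul_smul, sg_sq, one_smul]

theorem isTern_left {s s' t : ℤ} (ν : P.obj 2 s) (ν' : P.obj 2 s') (h : s + s' = t) :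
    IsTern (P.circ 0 ν ν' rfl h) 0 1 2 σ x τ y υ z
      (bprod hP ν (bprod hP ν' (tag σ x) (tag τ y)) (tag υ z)) := by
  obtain ⟨v, hv⟩ := IsTern.exists (P.circ 0 ν ν' rfl h) σ x τ y υ z (i₁ := 0) (i₂ := 1) (i₃ := 2)
    (by decide) (by decide) (by decide)
  refine hv.congr ?_
  obtain @⟨p, q, w, k, l, e₁, e₂, e₃, d₁, d₂, d₃, g₁, g₂, g₃, ρ, h₂, h₃, h₂₃, hk, hl, hσ, hτ, hυ⟩ := hv
  have hl0 : outer e₁ 2 h₃ ≠ k := fun h => h₂₃ (outer_inj e₁ (h.trans hk))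
  obtain ⟨m₁, f₁, f₂, hf⟩ := exists_seq (std (0 : Fin 2) 2 (p := 3) rfl) e₁ (0 : Fin 2) (by decide)
  have hk' : k = Graft.inner f₂ (outer f₁ 1 (by decide)) :=
    hk.trans (hf.middle_eq 1 (by decide) (by decide))
  obtain ⟨m₂, j₁, j₂, hj⟩ := exists_seq f₂ e₂ (outer f₁ 1 (by decide)) hk'
  have hl' : l = outer j₂ 1 (by decide) := by
    have h1 : outer f₂ 1 (by decide) ≠ k := fun h' => outer_ne_inner f₂ _ _ (h'.trans hk')
    rw [← hj.outer_eq 1 (by decide) h1, hl hl0]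
    exact outer_congr e₂ (hf.outer_eq 1 (by decide) (by decide)) _ _
  rw [OpData.circ, hP.assoc_seq _ _ _ _ hf h g₁ rfl (by omega),
    hP.assoc_seq _ _ _ _ hj _ g₂ rfl (by omega)]
  have hW : ∀ t, Graft.inner j₂ t ≠ l := fun t h => outer_ne_inner j₂ _ _ (h.trans hl').symm
  rw [tag_bprod hP ν j₂ e₃ hl' _ g₃ _ z ρ (σ := fun t => ρ (outer e₃ (Graft.inner j₂ t) (hW t)))
    (fun t h => rfl) hυ]
  congr 2
  refine tag_bprod hP ν' f₁ j₁ rfl rfl rfl x y _ (fun t ht => ?_) (fun t => ?_)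
  · have h0 : Graft.inner e₁ t ≠ k := fun h' => outer_ne_inner e₁ h₂ t (h'.trans hk).symm
    have h1 := hj.middle_eq (Graft.inner f₁ t) ht (by rw [← hf.inner_eq]; exact h0)
    have h2 : outer e₂ (Graft.inner e₁ t) h0 = Graft.inner j₂ (outer j₁ (Graft.inner f₁ t) ht) := by
      rw [← h1]; exact outer_congr e₂ (hf.inner_eq t) _ _
    rw [← hσ t h0 (by rw [h2]; exact hW _)]
    exact congrArg ρ (outer_congr e₃ h2.symm _ _)
  · rw [← hτ t (by rw [hj.inner_eq]; exact hW _)]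
    exact congrArg ρ (outer_congr e₃ (hj.inner_eq t).symm _ _)

theorem isTern_right {s s' t : ℤ} (ν : P.obj 2 s) (ν' : P.obj 2 s') (h : s + s' = t) :
    IsTern (P.circ 1 ν ν' rfl h) 0 1 2 σ x τ y υ z
      (sg K (s' * a) • bprod hP ν (tag σ x) (bprod hP ν' (tag τ y) (tag υ z))) := by
  obtain ⟨v, hv⟩ := IsTern.exists (P.circ 1 ν ν' rfl h) σ x τ y υ z (i₁ := 0) (i₂ := 1) (i₃ := 2)
    (by decide) (by decide) (by decide)
  refine hv.congr ?_
  obtain @⟨p, q, w, k, l, e₁, e₂, e₃, d₁, d₂, d₃, g₁, g₂, g₃, ρ, h₂, h₃, h₂₃, hk, hl, hσ, hτ, hυ⟩ := hv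
  have hl0 : outer e₁ 2 h₃ ≠ k := fun h => h₂₃ (outer_inj e₁ (h.trans hk))
  obtain ⟨m₁, f₁, f₂, hf⟩ := exists_par (std (1 : Fin 2) 2 (p := 3) rfl) e₁ (i' := 0) (by decide)
    (by decide)
  have hk' : k = Graft.inner f₂ 0 := hk.trans (hf.left_eq 0 (by decide))
  obtain ⟨m₂, j₁, j₂, hj⟩ := exists_seq f₂ e₂ (0 : Fin 2) hk'
  have h1k : Graft.inner f₂ 1 ≠ k := fun h' => by
    have := inner_inj f₂ (h'.trans hk')
    exact absurd this (by decide)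
  have hl' : l = Graft.inner j₂ (outer j₁ 1 (by decide)) := by
    rw [← hj.middle_eq 1 (by decide) h1k, hl hl0]
    exact outer_congr e₂ (hf.left_eq 1 (by decide)) _ _
  obtain ⟨m₃, l₁, l₂, hl₃⟩ := exists_seq j₂ e₃ (outer j₁ 1 (by decide)) hl'
  rw [OpData.circ, hP.par_sg hf h g₁ rfl (by omega), map_smul, LinearMap.smul_apply,
    hP.assoc_seq _ _ _ _ hj _ (by omega) rfl (by omega), map_smul, LinearMap.smul_apply,
    hP.assoc_seq _ _ _ _ hl₃ _ g₃ rfl (by omega), map_smul]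
  congr 1
  have hne : ∀ t, Graft.inner f₁ t ≠ outer f₁ 1 (by decide) := fun t h => outer_ne_inner f₁ _ _ h.symm
  rw [tag_bprod hP ν f₁ l₂ rfl rfl _ x _ ρ (σ := σ) (τ := fun t => ρ (Graft.inner l₂ t))
    (fun t ht => ?_) fun t => rfl]
  · congr 1
    refine tag_bprod hP ν' j₁ l₁ rfl rfl rfl y z _ (fun t ht => ?_) (fun t => ?_)
    · have h0 : Graft.inner e₂ t ≠ l := by
        rw [hl', hj.inner_eq]
        exact fun h => ht (inner_inj j₂ h)
      have h1 := hl₃.middle_eq (Graft.inner j₁ t) ht (by rw [← hj.inner_eq]; exact h0)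
      rw [← hτ t h0, ← h1]
      exact congrArg ρ (outer_congr e₃ (hj.inner_eq t).symm _ _)
    · rw [← hυ t, hl₃.inner_eq]
  · have h0 : Graft.inner e₁ t ≠ k := fun h' => outer_ne_inner e₁ h₂ t (h'.trans hk).symm
    have e1 : Graft.inner e₁ t = outer f₂ (Graft.inner f₁ t) (hne t) := hf.right_eq t (hne t)
    have e2 := hj.outer_eq (Graft.inner f₁ t) (hne t) (by rw [← e1]; exact h0)
    have e3 : outer e₂ (Graft.inner e₁ t) h0 = outer j₂ (Graft.inner f₁ t) (hne t) := by
      rw [← e2]; exact outer_congr e₂ e1 _ _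
    have hne' : outer j₂ (Graft.inner f₁ t) (hne t) ≠ l := fun h =>
      outer_ne_inner j₂ _ _ (h.trans hl')
    rw [← hσ t h0 (by rw [e3]; exact hne'), ← hl₃.outer_eq (Graft.inner f₁ t) (hne t) hne']
    exact congrArg ρ (outer_congr e₃ e3.symm _ _)

end Tern

end TagAlg

end OperadTw

namespace OperadTw

open Graft FreeG

variable {K : Type u} [Field K]

namespace TagAlg

/-! ### Functoriality, relabelling and extraction -/

section Maps

variable {P Q : OpData K}

theorem bmap_aux {g : ℤ → ℤ} (f : ∀ {n : ℕ} {d : ℤ}, P.obj n d →ₗ[K] Q.obj n (g d))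
    (hf : ∀ {n : ℕ} {d : ℤ} (π : Equiv.Perm (Fin n)) (x : P.obj n d),
      f (P.act π x) = Q.act π (f x)) {m : ℕ} (σ : Fin m → ℕ) {d : ℤ} (π : Equiv.Perm (Fin m))
    (x : P.obj m d) : (tag σ ∘ₗ f) (P.act π x) = (tag (σ ∘ π) ∘ₗ f) x := by
  rw [LinearMap.comp_apply, hf, tag_act]
  rfl

/-- The map induced by an equivariant family of maps. -/
def bmap {g : ℤ → ℤ} (f : ∀ {n : ℕ} {d : ℤ}, P.obj n d →ₗ[K] Q.obj n (g d))
    (hf : ∀ {n : ℕ} {d : ℤ} (π : Equiv.Perm (Fin n)) (x : P.obj n d),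
      f (P.act π x) = Q.act π (f x)) : TagAlg P →ₗ[K] TagAlg Q :=
  lift (fun {m} σ {d} => tag σ ∘ₗ f) (bmap_aux f hf)

theorem bmap_tag {g : ℤ → ℤ} (f : ∀ {n : ℕ} {d : ℤ}, P.obj n d →ₗ[K] Q.obj n (g d))
    (hf : ∀ {n : ℕ} {d : ℤ} (π : Equiv.Perm (Fin n)) (x : P.obj n d),
      f (P.act π x) = Q.act π (f x)) {m : ℕ} (σ : Fin m → ℕ) {d : ℤ} (x : P.obj m d) :
    bmap f hf (tag σ x) = tag σ (f x) :=
  lift_tag (fun {m} σ {d} => tag σ ∘ₗ f) (bmap_aux f hf) σ x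

/-- Renaming of labels. -/
def brl (f : ℕ → ℕ) : TagAlg P →ₗ[K] TagAlg P :=
  lift (fun {m} σ {d} => tag (f ∘ σ)) fun σ _ π x => tag_act (f ∘ σ) π x

theorem brl_tag (f : ℕ → ℕ) {m : ℕ} (σ : Fin m → ℕ) {d : ℤ} (x : P.obj m d) :
    brl f (tag σ x) = tag (f ∘ σ) x :=
  lift_tag (fun {m} σ {d} => tag (f ∘ σ)) (fun σ _ π x => tag_act (f ∘ σ) π x) σ x

open Classical in
/-- The part labelled by the first `n` numbers, in a given degree. -/
theorem exists_extract (hP : P.IsOperad) (n : ℕ) (d : ℤ) : ∃ F : TagAlg P →ₗ[K] P.obj n d,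
    (∀ x : P.obj n d, F (tag (fun i => (i : ℕ)) x) = x) ∧
    ∀ {m : ℕ} (σ : Fin m → ℕ) {e : ℤ} (x : P.obj m e), (¬ ∃ hm : m = n, d = e ∧ ∃ π : Equiv.Perm (Fin n),
      ∀ i : Fin m, σ i = π (Fin.cast hm i)) → F (tag σ x) = 0 := by
  let C : ∀ {m : ℕ} (σ : Fin m → ℕ) (e : ℤ), Prop := fun {m} σ e => (m = n ∧ e = d) ∧
    ∃ (hm : m = n) (π : Equiv.Perm (Fin n)), ∀ i : Fin m, σ i = π (Fin.cast hm i)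
  let ex : ∀ {m : ℕ} (σ : Fin m → ℕ) {e : ℤ}, P.obj m e →ₗ[K] P.obj n d := fun {m} σ {e} =>
    if h : C σ e
    then (P.comp 0 ((std (0 : Fin 1) n (add_comm 1 n)).trans h.2.choose_spec.choose)
      (zero_add d) P.one) ∘ₗ (by
        have hm := h.1.1
        have hd := h.1.2
        subst hm; subst hd
        exact LinearMap.id)
    else 0
  have h1 : ∀ (σ : Fin n → ℕ) (π : Equiv.Perm (Fin n)) (hπ : ∀ i, σ i = π i) (x : P.obj n d),
      ex σ x = P.act π x := by
    intro σ π hπ x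
    have h : C σ d := ⟨⟨rfl, rfl⟩, rfl, π, hπ⟩
    have h' : h.2.choose_spec.choose = π := by
      ext i
      exact (h.2.choose_spec.choose_spec i).symm.trans (hπ i)
    simp only [ex, dif_pos h, h']
    rfl
  have h0 : ∀ {m : ℕ} (σ : Fin m → ℕ) {e : ℤ} (x : P.obj m e), ¬ C σ e → ex σ x = 0 := by
    intro m σ e x h
    simp only [ex, dif_neg h]
    rfl
  refine ⟨lift (fun {m} σ {e} => ex σ) (fun {m} σ {e} π x => ?_), fun x => ?_, fun {m} σ {e} x h => ?_⟩
  · by_cases h : C σ e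
    · obtain ⟨⟨rfl, rfl⟩, h', ρ, hρ⟩ := h
      rw [h1 σ ρ hρ, h1 (σ ∘ π) (π.trans ρ) (fun i => hρ _), hP.act_act]
    · rw [h0 σ _ h, h0 (σ ∘ π) x]
      rintro ⟨⟨rfl, rfl⟩, h', ρ, hρ⟩
      refine h ⟨⟨rfl, rfl⟩, rfl, π.symm.trans ρ, fun i => ?_⟩
      have := hρ (π.symm i)
      rw [Function.comp_apply, Equiv.apply_symm_apply] at this
      exact this
  · rw [lift_tag]
    exact (h1 (fun i => (i : ℕ)) (Equiv.refl _) (fun i => rfl) x).trans (hP.act_one x)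
  · rw [lift_tag]
    exact h0 σ x fun h' => h ⟨h'.1.1, h'.1.2.symm, h'.2.choose_spec⟩

theorem val_inj (hP : P.IsOperad) {n : ℕ} {d : ℤ} {x y : P.obj n d}
    (h : tag (fun i : Fin n => (i : ℕ)) x = tag (fun i : Fin n => (i : ℕ)) y) : x = y := by
  obtain ⟨F, hF, -⟩ := exists_extract hP n d
  rw [← hF x, h, hF]

end Maps

section Unary

variable {P : OpData K} (hP : P.IsOperad)

/-- An operad with the coarsest filtration. -/
def coarse : FilteredOperad K where
  toOpData := P
  isOperad := hP
  fil _ _ _ := ⊤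
  fil_zero _ _ := rfl
  fil_anti _ _ _ _ _ := le_rfl
  comp_fil _ _ _ _ _ _ _ _ _ _ _ _ := trivial

include hP in
theorem lft_act {s : ℤ} (ν : P.obj 1 s) {n : ℕ} {d c : ℤ} (h : s + d = c) (π : Equiv.Perm (Fin n))
    (x : P.obj n d) : P.comp 0 (std 0 n (add_comm 1 n)) h ν (P.act π x) =
      P.act π (P.comp 0 (std 0 n (add_comm 1 n)) h ν x) := by
  rw [hP.act_comp]
  refine hP.comp_act_right π _ h ν x (fun t ht => absurd (Subsingleton.elim _ _) ht) fun t => ?_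
  exact (congrArg π (std_unit_inner _ t)).trans (std_unit_inner _ _).symm

/-- The operator defined by a unary operation. -/
def unB {s : ℤ} (ν : P.obj 1 s) : TagAlg P →ₗ[K] TagAlg P :=
  bmap (g := fun d => s + d) (fun {n} {d} => P.comp 0 (std 0 n (add_comm 1 n)) rfl ν)
    fun π x => lft_act hP ν rfl π x

theorem unB_tag {s : ℤ} (ν : P.obj 1 s) {m : ℕ} (σ : Fin m → ℕ) {d c : ℤ} (h : s + d = c)
    (x : P.obj m d) : unB hP ν (tag σ x) = tag σ (P.comp 0 (std 0 m (add_comm 1 m)) h ν x) := by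
  subst h
  exact bmap_tag (g := fun d => s + d) (fun {n} {d} => P.comp 0 (std 0 n (add_comm 1 n)) rfl ν)
    (fun π x => lft_act hP ν rfl π x) σ x

/-- An arbitrary composite with a unary operation. -/
theorem tag_un {s : ℤ} (ν : P.obj 1 s) {n p : ℕ} (e : Graft (0 : Fin 1) n p) {d c : ℤ}
    (h : s + d = c) (x : P.obj n d) (ρ : Fin p → ℕ) :
    tag ρ (P.comp 0 e h ν x) = unB hP ν (tag (fun t => ρ (Graft.inner e t)) x) := by
  obtain rfl : n = p := by have := graft_card e; omega
  rw [unB_tag hP ν _ h, hP.comp_eq_act e (std 0 n (add_comm 1 n)), tag_act]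
  congr 2
  funext t
  refine congrArg ρ (congrArg e ((Equiv.symm_apply_eq _).2 ?_))
  exact (std_unit_inner _ t).symm

theorem bprod_comp {s : ℤ} (ν : P.obj 2 s) {m n : ℕ} (σ : Fin m → ℕ) (τ : Fin n → ℕ) {a b : ℤ}
    (x : P.obj m a) (y : P.obj n b) {ab c : ℤ} (h₁ : s + a = ab) (h₂ : ab + b = c) :
    bprod hP ν (tag σ x) (tag τ y) =
      tag (Fin.append σ τ) (P.comp _ (binR m n) h₂ (P.comp 0 (binL m) h₁ ν x) y) := by
  subst h₁ h₂
  exact bprod_tag hP ν σ τ x y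

theorem unB_bprod {s s' t : ℤ} (ν' : P.obj 1 s') (ν : P.obj 2 s) (h : s' + s = t) (u v : TagAlg P) :
    unB hP ν' (bprod hP ν u v) = bprod hP (P.circ 0 ν' ν rfl h) u v := by
  have : (bprod hP ν).compr₂ (unB hP ν') = bprod hP (P.circ 0 ν' ν rfl h) :=
    hom_ext fun σ a x => hom_ext fun τ b y => by
      rw [LinearMap.compr₂_apply, bprod_comp hP ν σ τ x y rfl rfl, bprod_comp hP _ σ τ x y rfl rfl,
        unB_tag hP ν' _ (c := t + a + b) (by omega)]
      congr 1
      refine ((coarse hP).lft_comp _ _ ν' _ y rfl (by omega) (ca := t + a) (by omega) rfl).trans ?_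
      exact congrArg (fun z => P.comp _ (binR _ _) rfl z y)
        ((coarse hP).lft_comp _ (binL _) ν' ν x rfl (by omega) h rfl)
  exact LinearMap.congr_fun₂ this u v

theorem bprod_unB_left {s s' t : ℤ} (ν : P.obj 2 s) (ν' : P.obj 1 s') (h : s + s' = t)
    (u v : TagAlg P) : bprod hP (P.circ 0 ν ν' rfl h) u v = bprod hP ν (unB hP ν' u) v := by
  have : bprod hP (P.circ 0 ν ν' rfl h) = bprod hP ν ∘ₗ unB hP ν' :=
    hom_ext fun σ a x => hom_ext fun τ b y => by
      have hd : s + (s' + a) = t + a := by omega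
      rw [LinearMap.comp_apply, unB_tag hP ν' σ rfl, bprod_comp hP _ σ τ x y rfl rfl,
        bprod_comp hP ν σ τ _ y hd rfl]
      congr 1
      exact congrArg (fun z => P.comp _ (binR _ _) rfl z y)
        ((coarse hP).comp_lft (0 : Fin 2) (binL _) ν' ν x h rfl rfl hd)
  exact LinearMap.congr_fun₂ this u v

theorem bprod_unB_right {s s' t : ℤ} (ν : P.obj 2 s) (ν' : P.obj 1 s') (h : s + s' = t) {i : ℤ}
    {u : TagAlg P} (hu : u ∈ gr P i) (v : TagAlg P) :
    bprod hP (P.circ 1 ν ν' rfl h) u v = sg K (s' * i) • bprod hP ν u (unB hP ν' v) := by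
  have : (bprod hP (P.circ 1 ν ν' rfl h)) u = sg K (s' * i) • bprod hP ν u ∘ₗ unB hP ν' :=
    hom_ext fun {n} τ b y => by
      refine eq_on_gr (f := (bprod hP (P.circ 1 ν ν' rfl h)).flip (tag τ y))
        (g := sg K (s' * i) • (bprod hP ν).flip (unB hP ν' (tag τ y))) (fun {m} σ x => ?_) hu
      have hd : s + i + (s' + b) = t + i + b := by omega
      change bprod hP (P.circ 1 ν ν' rfl h) (tag σ x) (tag τ y) =
        sg K (s' * i) • bprod hP ν (tag σ x) (unB hP ν' (tag τ y))
      rw [unB_tag hP ν' τ rfl, bprod_comp hP _ σ τ x y rfl rfl, bprod_comp hP ν σ τ x _ rfl hd,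
        ← map_smul]
      congr 1
      have h1 := (coarse hP).comp_outer (0 : Fin 2) (binL m) ν' ν x 1 (by decide) rfl
        (show s + i + s' = t + i by omega) h rfl
      have h2 : P.comp (0 : Fin 2) (binL m) (rfl : t + i = t + i) (P.circ 1 ν ν' rfl h) x =
          sg K (s' * i) • P.comp (outer (binL m) 1 (by decide)) (std _ 1 rfl)
            (show s + i + s' = t + i by omega) (P.comp 0 (binL m) rfl ν x) ν' := by
        rw [_root_.mul_comm]
        refine Eq.symm ((congrArg (sg K (i * s') • ·) h1).trans ?_)
        have key : ∀ z : P.obj (m + 1) (t + i), sg K (i * s') • sg K (i * s') • z = z := fun z => by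
          rw [smul_smul, sg_sq, one_smul]
        exact key _
      rw [h2, map_smul, LinearMap.smul_apply]
      congr 1
      have h3 : ∀ (k : Fin (m + 1)) (hk : k = ⟨m, Nat.lt_succ_self m⟩),
          P.comp (⟨m, Nat.lt_succ_self m⟩ : Fin (m + 1)) (binR m n) (rfl : t + i + b = t + i + b)
            (P.comp k (std k 1 rfl) (show s + i + s' = t + i by omega) (P.comp 0 (binL m) rfl ν x) ν')
            y = P.comp _ (binR m n) hd (P.comp 0 (binL m) rfl ν x)
              (P.comp 0 (std 0 n (add_comm 1 n)) rfl ν' y) := by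
        rintro _ rfl
        exact (coarse hP).comp_lft _ (binR m n) ν' _ y _ rfl rfl hd
      exact h3 _ (std_outer_one m).symm
  exact LinearMap.congr_fun this v

end Unary

end TagAlg

end OperadTw

namespace OperadTw

open Graft FreeG

variable {K : Type u} [Field K]

namespace TagAlg

variable {P : OpData K}

/-! ### The Gerstenhaber algebra structure -/

@[elab_as_elim]
theorem gr_ind {i : ℤ} {p : TagAlg P → Prop} {u : TagAlg P} (hu : u ∈ gr P i)
    (ht : ∀ {m : ℕ} (σ : Fin m → ℕ) (x : P.obj m i), p (tag σ x)) (h0 : p 0)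
    (ha : ∀ u v, p u → p v → p (u + v)) (hs : ∀ (r : K) u, p u → p (r • u)) : p u := by
  refine Submodule.span_induction ?_ h0 (fun u v _ _ hu hv => ha u v hu hv) (fun r u _ hu => hs r u hu) hu
  rintro _ ⟨m, σ, x, rfl⟩
  exact ht σ x

section Gerst

variable (hP : P.IsOperad) {μ : P.obj 2 0} {lam : P.obj 2 1} (hG : IsGerst P μ lam) {i j k : ℤ}
  {u v w : TagAlg P}

include hG

theorem bprod_assoc (hu : u ∈ gr P i) (hv : v ∈ gr P j) (hw : w ∈ gr P k) :
    bprod hP μ (bprod hP μ u v) w = bprod hP μ u (bprod hP μ v w) := by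
  refine gr_ind hu (fun σ x => ?_) (by simp) (fun a b h1 h2 => by simp [h1, h2])
    (fun r a h => by simp [h])
  refine gr_ind hv (fun τ y => ?_) (by simp) (fun a b h1 h2 => by simp [h1, h2])
    (fun r a h => by simp [h])
  refine gr_ind hw (fun υ z => ?_) (by simp) (fun a b h1 h2 => by simp [h1, h2])
    (fun r a h => by simp [h])
  have h1 := isTern_left (σ := σ) (x := x) (τ := τ) (y := y) (υ := υ) (z := z) hP μ μ (t := 0) rfl
  have h2 := isTern_right (σ := σ) (x := x) (τ := τ) (y := y) (υ := υ) (z := z) hP μ μ (t := 0) rfl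
  rw [hG.mu_assoc] at h1
  rw [zero_mul, sg_zero, one_smul] at h2
  exact h1.unique hP h2

theorem bprod_leibniz (hu : u ∈ gr P i) (hv : v ∈ gr P j) (hw : w ∈ gr P k) :
    bprod hP lam (bprod hP μ u v) w = sg K i • bprod hP μ u (bprod hP lam v w) +
      sg K (j * k) • bprod hP μ (bprod hP lam u w) v := by
  refine gr_ind hu (fun σ x => ?_) (by simp)
    (fun a b h1 h2 => by simp only [map_add, LinearMap.add_apply, h1, h2, smul_add]; abel)
    (fun r a h => by simp only [map_smul, LinearMap.smul_apply, h, smul_add, smul_comm r])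
  refine gr_ind hv (fun τ y => ?_) (by simp)
    (fun a b h1 h2 => by simp only [map_add, LinearMap.add_apply, h1, h2, smul_add]; abel)
    (fun r a h => by simp only [map_smul, LinearMap.smul_apply, h, smul_add, smul_comm r])
  refine gr_ind hw (fun υ z => ?_) (by simp)
    (fun a b h1 h2 => by simp only [map_add, LinearMap.add_apply, h1, h2, smul_add]; abel)
    (fun r a h => by simp only [map_smul, LinearMap.smul_apply, h, smul_add, smul_comm r])
  have h1 := isTern_left (σ := σ) (x := x) (τ := τ) (y := y) (υ := υ) (z := z) hP lam μ (t := 1) rfl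
  have h2 := isTern_right (σ := σ) (x := x) (τ := τ) (y := y) (υ := υ) (z := z) hP μ lam (t := 1) rfl
  have h3 := isTern_left (σ := σ) (x := x) (τ := υ) (y := z) (υ := τ) (z := y) hP μ lam (t := 1) rfl
  obtain ⟨v', h4⟩ := IsTern.exists (P.act (Equiv.swap 1 2) (P.circ 0 μ lam rfl (rfl : (0 : ℤ) + 1 = 1)))
    σ x τ y υ z (i₁ := 0) (i₂ := 1) (i₃ := 2) (by decide) (by decide) (by decide)
  have h5 := h4.act_eq hP (h3.swap₂₃ hP) (by decide) (by decide) (by decide)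
  rw [hG.leibniz] at h1
  rw [_root_.one_mul] at h2
  rw [h1.unique hP (h2.add hP h4), h5, _root_.mul_comm k j]

theorem bprod_jacobi (hu : u ∈ gr P i) (hv : v ∈ gr P j) (hw : w ∈ gr P k) :
    bprod hP lam (bprod hP lam u v) w + sg K (i * (j + k)) • bprod hP lam (bprod hP lam v w) u +
      sg K (k * (i + j)) • bprod hP lam (bprod hP lam w u) v = 0 := by
  refine gr_ind hu (fun σ x => ?_) (by simp) (fun a b h1 h2 => by
      simp only [map_add, LinearMap.add_apply, smul_add]
      linear_combination (norm := module) h1 + h2)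
    (fun r a h => by
      simp only [map_smul, LinearMap.smul_apply]
      linear_combination (norm := module) r • h)
  refine gr_ind hv (fun τ y => ?_) (by simp) (fun a b h1 h2 => by
      simp only [map_add, LinearMap.add_apply, smul_add]
      linear_combination (norm := module) h1 + h2)
    (fun r a h => by
      simp only [map_smul, LinearMap.smul_apply]
      linear_combination (norm := module) r • h)
  refine gr_ind hw (fun υ z => ?_) (by simp) (fun a b h1 h2 => by
      simp only [map_add, LinearMap.add_apply, smul_add]
      linear_combination (norm := module) h1 + h2)
    (fun r a h => by
      simp only [map_smul, LinearMap.smul_apply]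
      linear_combination (norm := module) r • h)
  have h1 := isTern_left (σ := σ) (x := x) (τ := τ) (y := y) (υ := υ) (z := z) hP lam lam (t := 2) rfl
  have h2 := isTern_left (σ := τ) (x := y) (τ := υ) (y := z) (υ := σ) (z := x) hP lam lam (t := 2) rfl
  have h3 := isTern_left (σ := υ) (x := z) (τ := σ) (y := x) (υ := τ) (z := y) hP lam lam (t := 2) rfl
  obtain ⟨v', h4⟩ := IsTern.exists (P.act (finRotate 3) (P.circ 0 lam lam rfl (rfl : (1 : ℤ) + 1 = 2)))
    σ x τ y υ z (i₁ := 0) (i₂ := 1) (i₃ := 2) (by decide) (by decide) (by decide)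
  obtain ⟨w', h5⟩ := IsTern.exists (P.act (finRotate 3 ^ 2) (P.circ 0 lam lam rfl (rfl : (1 : ℤ) + 1 = 2)))
    σ x τ y υ z (i₁ := 0) (i₂ := 1) (i₃ := 2) (by decide) (by decide) (by decide)
  have h6 := h4.act_eq hP ((h2.swap₂₃ hP).swap₁₂ hP) (by decide) (by decide) (by decide)
  have h7 := h5.act_eq hP ((h3.swap₁₂ hP).swap₂₃ hP) (by decide) (by decide) (by decide)
  have h8 := (h1.add hP h4).add hP h5
  rw [hG.jacobi] at h8
  rw [← h8.eq_zero hP, h6, h7, smul_smul, smul_smul, ← sg_add, ← sg_add,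
    show j * i + k * i = i * (j + k) by ring, show k * j + k * i = k * (i + j) by ring]

/-- The algebra with a unit adjoined. -/
def galg : GAlg K (K × TagAlg P) where
  gr d :=
    { carrier := {p | p.2 ∈ gr P d ∧ (d ≠ 0 → p.1 = 0)}
      add_mem' := fun h h' => ⟨add_mem h.1 h'.1, fun hd => by
        rw [Prod.fst_add, h.2 hd, h'.2 hd, add_zero]⟩
      zero_mem' := ⟨zero_mem _, fun _ => rfl⟩
      smul_mem' := fun r p h => ⟨Submodule.smul_mem _ r h.1, fun hd => by
        rw [Prod.smul_fst, h.2 hd, smul_zero]⟩ }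
  one := (1, 0)
  mul := LinearMap.mk₂ K (fun p q => (p.1 * q.1, p.1 • q.2 + q.1 • p.2 + bprod hP μ p.2 q.2))
    (fun p p' q => Prod.ext (add_mul _ _ _) (by
      simp only [Prod.fst_add, Prod.snd_add, map_add, LinearMap.add_apply]; module))
    (fun r p q => Prod.ext (smul_mul_assoc _ _ _) (by
      simp only [Prod.smul_fst, Prod.smul_snd, map_smul, LinearMap.smul_apply, smul_eq_mul]; module))
    (fun p q q' => Prod.ext (mul_add _ _ _) (by
      simp only [Prod.fst_add, Prod.snd_add, map_add, LinearMap.add_apply]; module))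
    (fun r p q => Prod.ext (mul_smul_comm _ _ _) (by
      simp only [Prod.smul_fst, Prod.smul_snd, map_smul, LinearMap.smul_apply, smul_eq_mul]; module))
  brk := LinearMap.mk₂ K (fun p q => (0, bprod hP lam p.2 q.2))
    (fun p p' q => by simp) (fun r p q => by simp) (fun p q q' => by simp) (fun r p q => by simp)
  one_mem := ⟨zero_mem _, fun h => absurd rfl h⟩
  mul_mem {i j p q} hp hq := by
    refine ⟨add_mem (add_mem ?_ ?_) (bprod_mem hP μ hp.1 hq.1 (by ring)), fun hd => ?_⟩
    · rcases eq_or_ne i 0 with rfl | hi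
      · rw [zero_add]; exact Submodule.smul_mem _ _ hq.1
      · rw [hp.2 hi, zero_smul]; exact zero_mem _
    · rcases eq_or_ne j 0 with rfl | hj
      · rw [add_zero]; exact Submodule.smul_mem _ _ hp.1
      · rw [hq.2 hj, zero_smul]; exact zero_mem _
    · rcases eq_or_ne i 0 with rfl | hi
      · exact mul_eq_zero_of_right _ (hq.2 (by rwa [zero_add] at hd))
      · exact mul_eq_zero_of_left (hp.2 hi) _
  brk_mem hp hq := ⟨bprod_mem hP lam hp.1 hq.1 (by ring), fun _ => rfl⟩
  one_mul p := Prod.ext (_root_.one_mul _) (by simp)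
  one_brk p := Prod.ext rfl (by simp)
  mul_comm {i j p q} hp hq := by
    refine Prod.ext ?_ ?_
    · change p.1 * q.1 = sg K (i * j) * (q.1 * p.1)
      rcases eq_or_ne i 0 with rfl | hi
      · rw [zero_mul, sg_zero]; ring
      · rw [hp.2 hi]; ring
    · change p.1 • q.2 + q.1 • p.2 + bprod hP μ p.2 q.2 =
        sg K (i * j) • (q.1 • p.2 + p.1 • q.2 + bprod hP μ q.2 p.2)
      rw [bprod_comm hP hG.mu_symm hp.1 hq.1]
      rcases eq_or_ne i 0 with rfl | hi
      · rw [zero_mul, sg_zero]; module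
      · rcases eq_or_ne j 0 with rfl | hj
        · rw [mul_zero, sg_zero]; module
        · rw [hp.2 hi, hq.2 hj]; module
  brk_comm {i j p q} hp hq := Prod.ext (by simp) (bprod_comm hP hG.lam_symm hp.1 hq.1)
  assoc {i j k p q r} hp hq hr := by
    refine Prod.ext (_root_.mul_assoc _ _ _) ?_
    change (p.1 * q.1) • r.2 + r.1 • (p.1 • q.2 + q.1 • p.2 + bprod hP μ p.2 q.2) +
      bprod hP μ (p.1 • q.2 + q.1 • p.2 + bprod hP μ p.2 q.2) r.2 =
      p.1 • (q.1 • r.2 + r.1 • q.2 + bprod hP μ q.2 r.2) + (q.1 * r.1) • p.2 +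
        bprod hP μ p.2 (q.1 • r.2 + r.1 • q.2 + bprod hP μ q.2 r.2)
    simp only [map_add, map_smul, LinearMap.add_apply, LinearMap.smul_apply,
      bprod_assoc hP hG hp.1 hq.1 hr.1]
    module
  leibniz {i j k p q r} hp hq hr := by
    refine Prod.ext (by simp) ?_
    change bprod hP lam (p.1 • q.2 + q.1 • p.2 + bprod hP μ p.2 q.2) r.2 =
      sg K i • (p.1 • bprod hP lam q.2 r.2 + (0 : K) • p.2 + bprod hP μ p.2 (bprod hP lam q.2 r.2)) +
      sg K (j * k) • ((0 : K) • q.2 + q.1 • bprod hP lam p.2 r.2 +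
        bprod hP μ (bprod hP lam p.2 r.2) q.2)
    simp only [map_add, map_smul, LinearMap.add_apply, LinearMap.smul_apply,
      bprod_leibniz hP hG hp.1 hq.1 hr.1]
    have h1 : sg K i • p.1 = p.1 := by
      rcases eq_or_ne i 0 with rfl | hi
      · rw [sg_zero, one_smul]
      · rw [hp.2 hi, smul_zero]
    have h2 : sg K (j * k) • q.1 = q.1 := by
      rcases eq_or_ne j 0 with rfl | hi
      · rw [zero_mul, sg_zero, one_smul]
      · rw [hq.2 hi, smul_zero]
    rw [zero_smul, zero_smul, smul_add, smul_add, smul_add, smul_add, smul_smul, smul_smul,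
      show sg K i * p.1 = p.1 from h1, show sg K (j * k) * q.1 = q.1 from h2]
    module
  jacobi {i j k p q r} hp hq hr := Prod.ext (by simp) (bprod_jacobi hP hG hp.1 hq.1 hr.1)

end Gerst

end TagAlg

end OperadTw

namespace OperadTw

open Graft FreeG

variable {K : Type u} [Field K]

/-- The family of sets which consists of a single operation. -/
inductive IsPt {R : OpData K} {n : ℕ} {s : ℤ} (κ : R.obj n s) : ∀ d, R.obj n d → Prop
  | mk : IsPt κ s κ

/-- The family of sets which consists of a product and a bracket. -/
inductive IsBin {R : OpData K} (M : R.obj 2 0) (L : R.obj 2 1) : ∀ d, R.obj 2 d → Prop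
  | mu : IsBin M L 0 M
  | lam : IsBin M L 1 L

namespace TagAlg

variable {P : OpData K}

/-! ### The evaluation of the free algebra -/

/-- Labels of an operation of arity one. -/
abbrev lbl (i : ℕ) : Fin 1 → ℕ := fun _ => i

theorem brl_bprod (hP : P.IsOperad) {s : ℤ} (ν : P.obj 2 s) (f : ℕ → ℕ) (u v : TagAlg P) :
    brl f (bprod hP ν u v) = bprod hP ν (brl f u) (brl f v) := by
  have : (bprod hP ν).compr₂ (brl f) = (bprod hP ν).compl₁₂ (brl f) (brl f) :=
    hom_ext fun σ a x => hom_ext fun τ b y => by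
      rw [LinearMap.compr₂_apply, LinearMap.compl₁₂_apply, bprod_tag, brl_tag, brl_tag, brl_tag,
        bprod_tag]
      exact congrArg (fun ρ => tag ρ _) (append_eq
        (fun t => congrArg f (Fin.append_left _ _ t)) fun t => congrArg f (Fin.append_right _ _ t))
  exact LinearMap.congr_fun₂ this u v

variable (hP : P.IsOperad) {μ : P.obj 2 0} {lam : P.obj 2 1} (hG : IsGerst P μ lam)
  (Y : P.obj 1 1) (A : P.obj 0 0) (B : P.obj 0 1)

/-- The values on the generators. -/
def psiGen : Letter → K × TagAlg P
  | .x i => (0, tag (lbl i) P.one)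
  | .y i => (0, tag (lbl i) Y)
  | .al => (0, tag Fin.elim0 A)
  | .be => (0, tag Fin.elim0 B)

theorem psiGen_mem (l : Letter) : psiGen Y A B l ∈ (galg hP hG).gr l.deg := by
  cases l <;> exact ⟨tag_mem _ _ rfl, fun _ => rfl⟩

/-- The homomorphism from the free algebra with the given values of `y`, `α` and `β`. -/
def psi : FreeG K →ₗ[K] K × TagAlg P := (galg hP hG).ev (psiGen Y A B) (psiGen_mem hP hG Y A B)

theorem psi_ltr (l : Letter) : psi hP hG Y A B (ltr K l) = psiGen Y A B l := GAlg.ev_lt _ _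

theorem psi_mem (t : GTerm) : psi hP hG Y A B (cls K t) ∈ (galg hP hG).gr t.deg := by
  rw [psi, GAlg.ev_cls]
  exact (galg hP hG).evT_mem (psiGen_mem hP hG Y A B) t

theorem psi_unit : psi hP hG Y A B (unit K) = (1, 0) := (GAlg.ev_isHom _).one

theorem psi_mul (a b : FreeG K) : psi hP hG Y A B (FreeG.mul K a b) =
    ((psi hP hG Y A B a).1 * (psi hP hG Y A B b).1, (psi hP hG Y A B a).1 • (psi hP hG Y A B b).2 +
      (psi hP hG Y A B b).1 • (psi hP hG Y A B a).2 +
        bprod hP μ (psi hP hG Y A B a).2 (psi hP hG Y A B b).2) :=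
  (GAlg.ev_isHom (psiGen_mem hP hG Y A B)).mul a b

theorem psi_brk (a b : FreeG K) : psi hP hG Y A B (FreeG.brk K a b) =
    (0, bprod hP lam (psi hP hG Y A B a).2 (psi hP hG Y A B b).2) :=
  (GAlg.ev_isHom (psiGen_mem hP hG Y A B)).brk a b

theorem psi_rl (f : ℕ → ℕ) (v : FreeG K) : psi hP hG Y A B (rl K f v) =
    ((psi hP hG Y A B v).1, brl f (psi hP hG Y A B v).2) := by
  have : psi hP hG Y A B ∘ₗ rl K f =
      (LinearMap.id.prodMap (brl f)) ∘ₗ psi hP hG Y A B := FreeG.hom_ext fun t => by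
    rw [LinearMap.comp_apply, LinearMap.comp_apply, LinearMap.prodMap_apply, LinearMap.id_apply]
    induction t with
    | one => rw [rl_unit, psi_unit, map_zero]
    | lt l =>
      rw [rl_ltr, psi_ltr, psi_ltr]
      have h0 : f ∘ (Fin.elim0 : Fin 0 → ℕ) = Fin.elim0 := funext fun t => t.elim0
      cases l with
      | x i => exact congrArg (Prod.mk 0) (brl_tag f (lbl i) P.one).symm
      | y i => exact congrArg (Prod.mk 0) (brl_tag f (lbl i) Y).symm
      | al => exact congrArg (Prod.mk 0) ((brl_tag f Fin.elim0 A).trans (by rw [h0])).symm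
      | be => exact congrArg (Prod.mk 0) ((brl_tag f Fin.elim0 B).trans (by rw [h0])).symm
    | mul s t hs ht =>
      rw [← mul_cls, rl_mul, psi_mul, psi_mul, hs, ht]
      simp only [map_add, map_smul, brl_bprod]
    | brk s t hs ht =>
      rw [← brk_cls, rl_brk, psi_brk, psi_brk, hs, ht, brl_bprod]
  exact LinearMap.congr_fun this v

/-- Operators on the free algebra and on the target which satisfy the same rules correspond. -/
theorem psi_op {E : FreeG K →ₗ[K] FreeG K} {F : TagAlg P →ₗ[K] TagAlg P} {ε : K}
    {cm cl : ℤ → FreeG K →ₗ[K] FreeG K →ₗ[K] FreeG K} (hE : IsOp 1 cm cl E)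
    (hcm : ∀ i a b, cm i a b = ε • FreeG.brk K a b) (hcl : ∀ i a b, cl i a b = 0)
    (hm : ∀ {i : ℤ} {u : TagAlg P} (v : TagAlg P), u ∈ gr P i → F (bprod hP μ u v) =
      bprod hP μ (F u) v + sg K i • bprod hP μ u (F v) + ε • bprod hP lam u v)
    (hb : ∀ {i : ℤ} {u : TagAlg P} (v : TagAlg P), u ∈ gr P i → F (bprod hP lam u v) =
      -bprod hP lam (F u) v - sg K i • bprod hP lam u (F v))
    (hl : ∀ l, psi hP hG Y A B (E (ltr K l)) = (0, F (psiGen Y A B l).2)) (v : FreeG K) :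
    psi hP hG Y A B (E v) = (0, F (psi hP hG Y A B v).2) := by
  have : psi hP hG Y A B ∘ₗ E =
      LinearMap.inr K K (TagAlg P) ∘ₗ F ∘ₗ LinearMap.snd K K (TagAlg P) ∘ₗ psi hP hG Y A B :=
    FreeG.hom_ext fun t => by
      change psi hP hG Y A B (E _) = (0, F (psi hP hG Y A B _).2)
      induction t with
      | one => rw [hE.one, psi_unit, map_zero, map_zero]; rfl
      | lt l => rw [hl, psi_ltr]
      | mul s t hs ht =>
        have h1 := psi_mem hP hG Y A B s
        have h2 : sg K s.deg • (psi hP hG Y A B (cls K s)).1 = (psi hP hG Y A B (cls K s)).1 := by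
          rcases eq_or_ne s.deg 0 with h | h
          · rw [h, sg_zero, one_smul]
          · rw [h1.2 h, smul_zero]
        rw [← mul_cls, hE.mul _ (show cls K s ∈ FreeG.gr K s.deg from cls_mem_wtSub _ _ s), hcm, map_add, map_add, map_smul, map_smul,
          psi_mul, psi_mul, psi_mul, psi_brk, hs, ht]
        refine Prod.ext (by simp) ?_
        simp only [Prod.snd_add, Prod.smul_snd, map_add, map_smul, hm _ h1.1, zero_smul, zero_add,
          add_zero, _root_.one_mul, smul_add, smul_smul]
        rw [show sg K s.deg * (psi hP hG Y A B (cls K s)).1 = (psi hP hG Y A B (cls K s)).1 from h2]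
        module
      | brk s t hs ht =>
        have h1 := psi_mem hP hG Y A B s
        rw [← brk_cls, hE.brk _ (show cls K s ∈ FreeG.gr K s.deg from cls_mem_wtSub _ _ s), hcl, add_zero, map_smul, map_add, map_smul,
          psi_brk, psi_brk, psi_brk, hs, ht]
        refine Prod.ext (by simp) ?_
        simp only [Prod.snd_add, Prod.smul_snd, hb _ h1.1, sg_one, _root_.one_mul]
        module
  exact LinearMap.congr_fun this v

/-- Morphisms from a generated operad to the multilinear elements, evaluated. -/
theorem psi_gend {R : OpData K} (T : OpMap R (multilin K)) (U : OpMap R P)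
    {Co : ∀ d, Set (R.obj 0 d)} {Un : ∀ d, Set (R.obj 1 d)} {M : R.obj 2 0} {L : R.obj 2 1}
    (hTM : T.map M = qmu K) (hTL : T.map L = qlam K) (hUM : U.map M = μ) (hUL : U.map L = lam)
    (hC : ∀ {d : ℤ} {κ : R.obj 0 d}, κ ∈ Co d →
      psi hP hG Y A B (qval (T.map κ)) = (0, tag Fin.elim0 (U.map κ)))
    (hUn : ∀ {s : ℤ} {ν : R.obj 1 s}, ν ∈ Un s → ∀ {n p : ℕ} (e : Graft (0 : Fin 1) n p) {d c : ℤ}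
      (h : s + d = c) (x : R.obj n d),
      psi hP hG Y A B (qval (T.map x)) = (0, tag (fun i => (i : ℕ)) (U.map x)) →
      psi hP hG Y A B (qval (T.map (R.comp 0 e h ν x))) =
        (0, tag (fun i => (i : ℕ)) (U.map (R.comp 0 e h ν x))))
    {n : ℕ} {d : ℤ} {x : R.obj n d} (hx : Gend R Co Un (fun d => {ν | IsBin M L d ν}) x) :
    psi hP hG Y A B (qval (T.map x)) = (0, tag (fun i => (i : ℕ)) (U.map x)) := by
  induction hx with
  | one =>
    rw [T.map_one, U.map_one, qval_one, psi_ltr]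
    exact congrArg (fun f => ((0 : K), tag f P.one)) (funext fun i => (by omega : (i : ℕ) = 0).symm)
  | smul r _ ih => rw [map_smul, map_smul, map_smul, ih, map_smul, map_smul]; simp
  | const h =>
    rw [hC h]
    exact congrArg (fun f => ((0 : K), tag f _)) (funext fun i => i.elim0)
  | un hν e h hx ih => exact hUn hν e h _ ih
  | @bin n p q r s a ab b c ν hν k e₁ e₂ hk h₁ h₂ x y hx hy ihx ihy =>
    have key : ∀ ν' : P.obj 2 s, tag (fun i : Fin r => (i : ℕ)) (P.comp k e₂ h₂ (P.comp 0 e₁ h₁ ν'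
        (U.map x)) (U.map y)) = bprod hP ν' (tag (fun t => exF (outF e₂ r) (inF e₁ t)) (U.map x))
          (tag (inF e₂) (U.map y)) := fun ν' => by
      refine tag_bprod hP ν' e₁ e₂ hk h₁ h₂ _ _ _ (fun t h => ?_) fun t => rfl
      rw [inF, exF_val, outF_ne _ _ h]
    have hx' := psi_rl hP hG Y A B (exF fun t => exF (outF e₂ r) (inF e₁ t)) (qval (T.map x))
    have hy' := psi_rl hP hG Y A B (exF (inF e₂)) (qval (T.map y))
    rw [ihx, brl_tag] at hx'
    rw [ihy, brl_tag] at hy'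
    have hx'' : ((exF fun t => exF (outF e₂ r) (inF e₁ t)) ∘ fun i : Fin n => (i : ℕ)) =
      fun t => exF (outF e₂ r) (inF e₁ t) := funext fun t => exF_val _ t
    have hy'' : (exF (inF e₂) ∘ fun i : Fin q => (i : ℕ)) = inF e₂ := funext fun t => exF_val _ t
    rw [hx''] at hx'
    rw [hy''] at hy'
    rw [T.map_comp, T.map_comp, U.map_comp, U.map_comp, key]
    cases hν with
    | mu =>
      rw [hTM, mu_bin e₁ e₂ hk h₁ h₂, psi_mul, hx', hy', hUM]
      simp
    | lam => rw [hTL, lam_bin e₁ e₂ hk h₁ h₂, psi_brk, hx', hy', hUL]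

end TagAlg

end OperadTw

namespace OperadTw

open Graft FreeG

variable {K : Type u} [Field K]

/-! ### Multilinear elements and the twisted differential -/

variable (K) in
/-- The differential of the free algebra. -/
def dd : FreeG K →ₗ[K] FreeG K := exists_isDiff.choose

theorem dd_isDiff : IsDiff (dd K) := exists_isDiff.choose_spec

variable (K) in
/-- The morphism from `BV ∨ α` to the multilinear elements. -/
def theta : OpMap (bvAlpha K).data (multilin K) :=
  (exists_bv_lift multilin_isOperad multilin_isBVOp (qalpha K)).choose

theorem theta_mu : (theta K).map (bvAlpha.mu K) = qmu K :=
  (exists_bv_lift multilin_isOperad multilin_isBVOp (qalpha K)).choose_spec.1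

theorem theta_lam : (theta K).map (bvAlpha.lam K) = qlam K :=
  (exists_bv_lift multilin_isOperad multilin_isBVOp (qalpha K)).choose_spec.2.1

theorem theta_delta : (theta K).map (bvAlpha.delta K) = qdelta K :=
  (exists_bv_lift multilin_isOperad multilin_isBVOp (qalpha K)).choose_spec.2.2.1

theorem theta_alpha : (theta K).map (bvAlpha.alpha K) = qalpha K :=
  (exists_bv_lift multilin_isOperad multilin_isBVOp (qalpha K)).choose_spec.2.2.2

theorem FreeG.rl_dd (f : ℕ → ℕ) (v : FreeG K) : rl K f (dd K v) = dd K (rl K f v) := by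
  have : rl K f ∘ₗ dd K = dd K ∘ₗ rl K f := FreeG.hom_ext fun t => by
    rw [LinearMap.comp_apply, LinearMap.comp_apply]
    induction t with
    | one => rw [dd_isDiff.der.one, rl_unit, dd_isDiff.der.one, map_zero]
    | lt l =>
      rw [rl_ltr]
      cases l with
      | x i => rw [dd_isDiff.x]; exact (map_zero _).trans (dd_isDiff.x (f i)).symm
      | y i =>
        rw [dd_isDiff.y, map_neg, rl_brk, rl_ltr, rl_ltr]
        exact (dd_isDiff.y (f i)).symm
      | al => 
        rw [dd_isDiff.a, map_smul, rl_brk, rl_ltr]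
        exact dd_isDiff.a.symm
      | be => rw [dd_isDiff.b]; exact (map_zero _).trans dd_isDiff.b.symm
    | mul s t hs ht =>
      have h1 : cls K s ∈ FreeG.gr K s.deg := cls_mem_wtSub _ _ s
      rw [← mul_cls, rl_mul, dd_isDiff.der.mul _ h1, dd_isDiff.der.mul _ (rl_gr h1), map_add, map_add,
        map_smul, rl_mul, rl_mul, hs, ht]
      simp
    | brk s t hs ht =>
      have h1 : cls K s ∈ FreeG.gr K s.deg := cls_mem_wtSub _ _ s
      rw [← brk_cls, rl_brk, dd_isDiff.der.brk _ h1, dd_isDiff.der.brk _ (rl_gr h1), map_add, map_smul,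
        map_add, map_smul, rl_brk, rl_brk, hs, ht]
      simp
  exact LinearMap.congr_fun this v

/-- Composition with the bracket with a constant. -/
theorem brk_const_comp {n p : ℕ} {k b c : ℤ} {κ : FreeG K} (hκ : κ = va K ∨ κ = vb K)
    (hk : κ ∈ FreeG.gr K k) {ℓ : (multilin K).obj 1 (k + 1)} (hℓ : qval ℓ = brk K κ (vx K 0))
    (e : Graft (0 : Fin 1) n p) (h : k + 1 + b = c) (y : (multilin K).obj n b) :
    qval ((multilin K).comp 0 e h ℓ y) = brk K κ (rl K (exF (inF e)) (qval y)) := by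
  obtain ⟨δ, hδ⟩ := exists_isSb p (rl_gr (f := exF (inF e)) (qval_mem y))
  have h0 : rl K (exF (outF e p)) κ = κ := by rcases hκ with rfl | rfl <;> exact rl_ltr _ _
  have h1 : δ κ = 0 := by rcases hκ with rfl | rfl; exacts [hδ.a, hδ.b]
  have h2 : rl K (exF (outF e p)) (vx K 0) = vx K p :=
    (rl_exF_vx _ (0 : Fin 1)).trans (congrArg (vx K) (outF_self e p))
  rw [qval_comp, plug_eq e le_rfl (qval_lin ℓ) (qval_mem y) (qval_lin y) hδ, hℓ, rl_brk, h0, h2,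
    hδ.der.brk _ hk, h1, hδ.x, pt_self, map_zero, LinearMap.zero_apply, LinearMap.zero_apply,
    LinearMap.zero_apply, zero_add, add_zero, smul_smul, smul_smul, ← sg_add, ← sg_add,
    show (k + 1) * b + b + b * k = (b * k + b) + (b * k + b) by ring, sg_add, sg_sq, one_smul]

theorem qval_theta_lamAlpha : qval ((theta K).map (bvAlpha.lamAlpha K)) = brk K (va K) (vx K 0) := by
  rw [bvAlpha.lamAlpha, OpMap.map_circ, theta_lam, theta_alpha, OpData.circ, lam_left]
  exact congrArg₂ (fun u v => brk K u v) (rl_ltr _ _) rfl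

variable (K) in
/-- The family of binary generators of `BV ∨ α`. -/
theorem bvAlpha_gend {n : ℕ} {d : ℤ} (g : (bvAlpha K).Gen n d) : Gend (bvAlpha K).data
    (fun d => {κ | IsPt (bvAlpha.alpha K) d κ}) (fun d => {ν | IsPt (bvAlpha.delta K) d ν})
    (fun d => {ν | IsBin (bvAlpha.mu K) (bvAlpha.lam K) d ν}) ((bvAlpha K).dataGen g) := by
  have hP := (bvAlpha K).data_isOperad
  match g with
  | .old .mu => exact Gend.of_bin hP IsBin.mu
  | .old .lam => exact Gend.of_bin hP IsBin.lam
  | .old .delta => exact Gend.of_un hP IsPt.mk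
  | .new => exact .const IsPt.mk

variable [CharZero K]

theorem FreeG.dd_dl (v : FreeG K) : dd K (dl K v) = -dl K (dd K v) - brk K (vb K) v := by
  have h1 := IsOp.comm_brk (K := K) dd_isDiff.der dd_isDiff.shift dl_isBV.op (fun ha => dl_gr ha)
  have h2 : dd K ∘ₗ dl K - sg K (1 * 1) • dl K ∘ₗ dd K = (-1 : K) • brk K (vb K) :=
    h1.ext (by simpa using (brk_isDer (vb_mem (K := K))).smul (-1)) (by
      have h3 := dl_brk (va_mem (K := K)) (va K)
      rw [sg_zero, one_smul, dl_isBV.a, brk_comm va_mem vb_mem, zero_mul, sg_zero, one_smul] at h3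
      have h4 : brk K (vb K) (vb K) = 0 := by
        have h5 := brk_comm (vb_mem (K := K)) vb_mem
        rw [mul_one, sg_one] at h5
        have h6 : (2 : K) • brk K (vb K) (vb K) = 0 := by linear_combination (norm := module) h5
        exact (smul_eq_zero.1 h6).resolve_left two_ne_zero
      rintro (j | j | _ | _) <;>
        simp only [LinearMap.sub_apply, LinearMap.comp_apply, LinearMap.smul_apply, dl_isBV.x,
          dl_isBV.y, dl_isBV.a, dl_isBV.b, dd_isDiff.x, dd_isDiff.y, dd_isDiff.a, dd_isDiff.b,
          map_neg, map_smul, map_zero, mul_one, sg_one]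
      · simp
      · rw [dl_brk vb_mem, dl_isBV.b, dl_isBV.x, sg_one, map_zero, LinearMap.zero_apply]; module
      · rw [h3, show -brk K (vb K) (va K) - brk K (vb K) (va K) = (-2 : K) • brk K (vb K) (va K) by module,
          smul_smul, smul_smul, show (-1 : K) * 2⁻¹ * -2 = 1 by norm_num, one_smul, neg_smul,
          one_smul, zero_sub]
      · rw [h4]; simp)
  have h3 := LinearMap.congr_fun h2 v
  simp only [LinearMap.sub_apply, LinearMap.comp_apply, LinearMap.smul_apply, mul_one, sg_one] at h3
  linear_combination (norm := module) h3

theorem bvAlpha.lamAlpha_isMC : (bvAlpha.differential K).IsMC (bvAlpha.lamAlpha K) where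
  eq := add_eq_zero_iff_eq_neg.2 (bvAlpha.der_lamAlpha K)

variable (K) in
/-- The twisted differential before completion. -/
def bvAlpha.tw : (bvAlpha K).operad.Differential :=
  (bvAlpha.differential K).twist (bvAlpha.lamAlpha K) bvAlpha.lamAlpha_isMC

variable (K) in
/-- The twisted differential of the uncompleted operad, as a family of linear maps. -/
def bvAlpha.twl (n : ℕ) (d : ℤ) : (bvAlpha K).data.obj n d →ₗ[K] (bvAlpha K).data.obj n (d + 1) :=
  (bvAlpha.tw K).d rfl

theorem bvAlpha.twl_one : bvAlpha.twl K 1 0 (bvAlpha K).data.one = 0 := (bvAlpha.tw K).d_one rfl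

theorem bvAlpha.twl_comp {m n p : ℕ} (i : Fin m) (e : Graft i n p) {a b c : ℤ} (h : a + b = c)
    (h₁ : a + 1 + b = c + 1) (h₂ : a + (b + 1) = c + 1) (x : (bvAlpha K).data.obj m a)
    (y : (bvAlpha K).data.obj n b) : bvAlpha.twl K p c ((bvAlpha K).data.comp i e h x y) =
      (bvAlpha K).data.comp i e h₁ (bvAlpha.twl K m a x) y +
        sg K a • (bvAlpha K).data.comp i e h₂ x (bvAlpha.twl K n b y) :=
  (bvAlpha.tw K).leibniz i e h rfl rfl rfl h₁ h₂ x y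

theorem bvAlpha.tw_apply {n : ℕ} {d : ℤ} (x : (bvAlpha K).data.obj n d) :
    bvAlpha.twl K n d x = bvAlpha.der K n d x +
      ((bvAlpha K).data.comp 0 (std 0 n (add_comm 1 n)) (add_comm 1 d) (bvAlpha.lamAlpha K) x -
        (-1 : K) ^ d • ∑ j : Fin n, (bvAlpha K).data.comp j (std j 1 rfl) rfl x
          (bvAlpha.lamAlpha K)) :=
  congrArg (fun z => bvAlpha.der K n d x + (_ - (-1 : K) ^ d • z))
    (FilteredOperad.ins_apply (bvAlpha K).operad (bvAlpha.lamAlpha K) (rfl : d + 1 = d + 1) x)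

theorem qval_theta_lamAlpha_comp {n p : ℕ} {b c : ℤ} (e : Graft (0 : Fin 1) n p) (h : 1 + b = c)
    (y : (multilin K).obj n b) : qval ((multilin K).comp 0 e h
      ((theta K).map (bvAlpha.lamAlpha K)) y) = brk K (va K) (rl K (exF (inF e)) (qval y)) :=
  brk_const_comp (k := 0) (.inl rfl) va_mem qval_theta_lamAlpha e h y

theorem qval_tw_apply {n : ℕ} {d : ℤ} (x : (bvAlpha K).data.obj n d) :
    qval ((theta K).map (bvAlpha.twl K n d x)) = qval ((theta K).map (bvAlpha.der K n d x)) +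
      (brk K (va K) (qval ((theta K).map x)) - sg K d • ∑ j : Fin n,
        qval ((multilin K).comp j (std j 1 rfl) rfl ((theta K).map x)
          ((theta K).map (bvAlpha.lamAlpha K)))) := by
  have h1 : rl K (exF (inF (std (0 : Fin 1) n (add_comm 1 n)))) (qval ((theta K).map x)) =
      qval ((theta K).map x) := rl_eq_self (fun i hi => by
    have hi := Finset.mem_range.1 hi
    exact (exF_val _ (⟨i, hi⟩ : Fin n)).trans (congrArg Fin.val (std_unit_inner _ (⟨i, hi⟩ : Fin n))))
      (qval_lin _)
  have h2 := qval_theta_lamAlpha_comp (std (0 : Fin 1) n (add_comm 1 n)) (add_comm 1 d)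
    ((theta K).map x)
  rw [h1] at h2
  rw [bvAlpha.tw_apply, map_add, map_add, map_sub, map_sub, map_smul, map_smul, map_sum, map_sum,
    OpMap.map_comp, h2]
  simp only [OpMap.map_comp]
  rfl

/-- The twisted differential of the generators. -/
theorem qval_tw : qval ((theta K).map (bvAlpha.twl K 2 0 (bvAlpha.mu K))) = 0 ∧
    qval ((theta K).map (bvAlpha.twl K 2 1 (bvAlpha.lam K))) = 0 ∧
    qval ((theta K).map (bvAlpha.twl K 1 1 (bvAlpha.delta K))) = -brk K (vb K) (vx K 0) ∧
    qval ((theta K).map (bvAlpha.twl K 0 0 (bvAlpha.alpha K))) =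
      (2⁻¹ : K) • brk K (va K) (va K) := by
  have hl := qval_theta_lamAlpha (K := K)
  have hx : ∀ {m : ℕ} (f : Fin m → ℕ) (i : Fin m) (j k : ℕ), (i : ℕ) = j → f i = k →
      rl K (exF f) (vx K j) = vx K k := by
    rintro m f i j k rfl rfl
    exact rl_exF_vx f i
  have ha : ∀ f : ℕ → ℕ, rl K f (va K) = va K := fun f => rl_ltr _ _
  have h1 : bvAlpha.der K 2 0 (bvAlpha.mu K) = 0 := bvAlpha.der_gen K _
  have h2 : bvAlpha.der K 2 1 (bvAlpha.lam K) = 0 := bvAlpha.der_gen K _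
  have h3 : bvAlpha.der K 1 1 (bvAlpha.delta K) = 0 := bvAlpha.der_gen K _
  have h4 : bvAlpha.der K 0 0 (bvAlpha.alpha K) = bvAlpha.dAlpha K := bvAlpha.der_gen K _
  refine ⟨?_, ?_, ?_, ?_⟩
  · rw [qval_tw_apply, h1, map_zero, map_zero, Fin.sum_univ_two, theta_mu,
      mu_left, mu_right, hl, rl_brk, rl_brk, ha, ha,
      show qval (qmu K) = mul K (vx K 0) (vx K 1) from rfl, 
      hx _ 0 0 0 rfl rfl, hx _ 0 0 1 rfl rfl, (brk_isDer va_mem).mul _ (vx_mem 0)]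
    simp only [zero_add, mul_zero, sg_zero, one_smul, LinearMap.zero_apply, add_zero]
    exact sub_self _
  · rw [qval_tw_apply, h2, map_zero, map_zero, Fin.sum_univ_two, theta_lam,
      lam_left, lam_right, hl, rl_brk, rl_brk, ha, ha,
      show qval (qlam K) = brk K (vx K 0) (vx K 1) from rfl,
      hx _ 0 0 0 rfl rfl, hx _ 0 0 1 rfl rfl, (brk_isDer va_mem).brk _ (vx_mem 0)]
    simp only [zero_add, mul_zero, sg_zero, sg_one, one_smul, neg_smul, LinearMap.zero_apply, add_zero,
      sub_neg_eq_add, smul_add]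
    exact sub_self _
  · rw [qval_tw_apply, h3, map_zero, map_zero, Fin.sum_univ_one,
      theta_delta, delta_comp, hl, rl_brk, ha, hx _ 0 0 0 rfl rfl, dl_brk va_mem, dl_isBV.a, dl_isBV.x,
      show qval (qdelta K) = vy K 0 from rfl, sg_zero, sg_one]
    module
  · have h5 : qval (qalpha K) = va K := rfl
    rw [qval_tw_apply, h4, Fin.sum_univ_zero, bvAlpha.dAlpha, map_neg, map_neg, map_smul, map_smul,
      bvAlpha.lamAlphaAlpha, OpMap.map_circ, theta_alpha, OpData.circ, qval_theta_lamAlpha_comp, h5,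
      ha, smul_zero, sub_zero]
    rw [show brk K (va K) (va K) = ((2 : K)⁻¹ * 2) • brk K (va K) (va K) by
      rw [inv_mul_cancel₀ two_ne_zero, one_smul]]
    module

/-- The differentials correspond. -/
theorem qval_theta_tw {n : ℕ} {d : ℤ} (x : (bvAlpha K).data.obj n d) :
    qval ((theta K).map (bvAlpha.twl K n d x)) = dd K (qval ((theta K).map x)) := by
  refine (bvAlpha K).hom_ext_gend (bvAlpha_gend K)
    (f := qval ∘ₗ (theta K).map ∘ₗ bvAlpha.twl K n d) (f' := dd K ∘ₗ qval ∘ₗ (theta K).map)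
    (fun z hz => ?_) x
  clear x
  change qval ((theta K).map (bvAlpha.twl K _ _ z)) = dd K (qval ((theta K).map z))
  obtain ⟨tm, tl, tD, ta⟩ := qval_tw (K := K)
  induction hz with
  | one => rw [bvAlpha.twl_one, map_zero, map_zero, OpMap.map_one, qval_one, dd_isDiff.x]
  | smul r _ ih => rw [map_smul, map_smul, map_smul, map_smul, map_smul, map_smul, ih]
  | const h =>
    cases h with
    | mk => rw [ta, theta_alpha]; exact dd_isDiff.a.symm
  | @un n p s d c ν hν e h x hx ih =>
    cases hν with
    | mk =>
      have h1 : qval (-(theta K).map (bvAlpha.twl K 1 1 (bvAlpha.delta K))) =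
        brk K (vb K) (vx K 0) := by rw [map_neg, tD, neg_neg]
      have h2 := brk_const_comp (k := 1) (.inr rfl) vb_mem h1 e (show 1 + 1 + d = c + 1 by omega)
        ((theta K).map x)
      rw [map_neg, LinearMap.neg_apply, map_neg, neg_eq_iff_eq_neg] at h2
      rw [bvAlpha.twl_comp 0 e h (show 1 + 1 + d = c + 1 by omega)
        (show 1 + (d + 1) = c + 1 by omega), map_add, map_add, map_smul, map_smul, OpMap.map_comp,
        OpMap.map_comp, OpMap.map_comp, h2, theta_delta, delta_comp, delta_comp, ih, rl_dd, dd_dl,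
        sg_one]
      module
  | @bin n p q r s a ab b c ν hν k e₁ e₂ hk h₁ h₂ x y hx hy ihx ihy =>
    have h0 : (theta K).map (bvAlpha.twl K 2 s ν) = 0 := by
      cases hν with
      | mu => exact qval_inj tm
      | lam => exact qval_inj tl
    rw [bvAlpha.twl_comp k e₂ h₂ (show ab + 1 + b = c + 1 by omega)
      (show ab + (b + 1) = c + 1 by omega), bvAlpha.twl_comp 0 e₁ h₁ (show s + 1 + a = ab + 1 by omega)
      (show s + (a + 1) = ab + 1 by omega)]
    simp only [map_add, map_smul, LinearMap.add_apply, LinearMap.smul_apply, OpMap.map_comp, h0,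
      map_zero, LinearMap.zero_apply, zero_add]
    have hg := rl_gr (f := exF fun t => exF (outF e₂ r) (inF e₁ t)) (qval_mem ((theta K).map x))
    cases hν with
    | mu =>
      rw [theta_mu, mu_bin e₁ e₂ hk _ _, mu_bin e₁ e₂ hk _ _, mu_bin e₁ e₂ hk _ _, ihx, ihy, rl_dd, rl_dd,
        dd_isDiff.der.mul _ hg, sg_zero, one_smul, _root_.one_mul, ← h₁, zero_add]
      simp
    | lam =>
      rw [theta_lam, lam_bin e₁ e₂ hk _ _, lam_bin e₁ e₂ hk _ _, lam_bin e₁ e₂ hk _ _, ihx, ihy, rl_dd, rl_dd,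
        dd_isDiff.der.brk _ hg, sg_one, _root_.one_mul, ← h₁, sg_add, sg_one]
      simp only [LinearMap.zero_apply, add_zero]
      module

end OperadTw

namespace OperadTw

open Graft FreeG

variable {K : Type u} [Field K]

/-- Composition of morphisms. -/
def OpMap.trans {P Q R : OpData K} (F : OpMap P Q) (G : OpMap Q R) : OpMap P R where
  map := G.map ∘ₗ F.map
  map_one := (congrArg G.map F.map_one).trans G.map_one
  map_comp i e _ _ _ h x y := (congrArg G.map (F.map_comp i e h x y)).trans (G.map_comp i e h _ _)

theorem OpMap.trans_map {P Q R : OpData K} (F : OpMap P Q) (G : OpMap Q R) {n : ℕ} {d : ℤ}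
    (x : P.obj n d) : (F.trans G).map x = G.map (F.map x) := rfl

namespace TagAlg

/-- An extraction of the part labelled by the first `n` numbers. -/
structure IsExtract {P : OpData K} {n : ℕ} {d : ℤ} (F : TagAlg P →ₗ[K] P.obj n d) : Prop where
  val : ∀ x : P.obj n d, F (tag (fun i => (i : ℕ)) x) = x
  eq_zero : ∀ {m : ℕ} (σ : Fin m → ℕ) {e : ℤ} (x : P.obj m e), (¬ ∃ hm : m = n, d = e ∧
    ∃ π : Equiv.Perm (Fin n), ∀ i : Fin m, σ i = π (Fin.cast hm i)) → F (tag σ x) = 0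

/-- Extraction is natural. -/
theorem IsExtract.bmap {P Q : OpData K} (hP : P.IsOperad) {n : ℕ} {d : ℤ}
    {g : ℤ → ℤ} (hg : Function.Injective g)
    (f : ∀ {n : ℕ} {d : ℤ}, P.obj n d →ₗ[K] Q.obj n (g d))
    (hf : ∀ {n : ℕ} {d : ℤ} (π : Equiv.Perm (Fin n)) (x : P.obj n d),
      f (P.act π x) = Q.act π (f x)) {F : TagAlg Q →ₗ[K] Q.obj n (g d)} (hF : IsExtract F)
    (u : TagAlg P) : ∃ x : P.obj n d, F (TagAlg.bmap f hf u) = f x := by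
  obtain ⟨E, hE, hE'⟩ := exists_extract hP n d
  refine ⟨E u, ?_⟩
  have : F ∘ₗ TagAlg.bmap f hf = f ∘ₗ E := hom_ext fun {m} σ e x => by
    rw [LinearMap.comp_apply, LinearMap.comp_apply, bmap_tag]
    by_cases h : ∃ hm : m = n, d = e ∧ ∃ π : Equiv.Perm (Fin n), ∀ i : Fin m, σ i = π (Fin.cast hm i)
    · obtain ⟨rfl, rfl, π, hπ⟩ := h
      obtain rfl : σ = (fun i : Fin m => (i : ℕ)) ∘ π := funext hπ
      rw [← tag_act, ← tag_act, hE, hF.val, hf]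
    · rw [hE' σ x h, map_zero]
      exact hF.eq_zero σ _ fun ⟨hm, he, hπ⟩ => h ⟨hm, hg he, hπ⟩
  exact LinearMap.congr_fun this u

variable {P Q : OpData K} (hP : P.IsOperad)

theorem bmap_bprod (hQ : Q.IsOperad) (U : OpMap P Q) {s : ℤ} (ν : P.obj 2 s) (u v : TagAlg P) :
    bmap (g := fun d => d) (fun {n} {d} => U.map) (fun π x => U.map_act π x) (bprod hP ν u v) =
      bprod hQ (U.map ν) (bmap (g := fun d => d) (fun {n} {d} => U.map) (fun π x => U.map_act π x) u)
        (bmap (g := fun d => d) (fun {n} {d} => U.map) (fun π x => U.map_act π x) v) := by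
  set f := bmap (g := fun d => d) (fun {n} {d} => U.map) (fun π x => U.map_act π x) with hf
  have h0 : ∀ {m : ℕ} (σ : Fin m → ℕ) {d : ℤ} (x : P.obj m d), f (tag σ x) = tag σ (U.map x) :=
    fun σ _ x => bmap_tag (g := fun d => d) (fun {n} {d} => U.map) (fun π x => U.map_act π x) σ x
  have : (bprod hP ν).compr₂ f = (bprod hQ (U.map ν)).compl₁₂ f f :=
    hom_ext fun σ a x => hom_ext fun τ b y => by
      rw [LinearMap.compr₂_apply, LinearMap.compl₁₂_apply, bprod_eq hP ν σ τ x y rfl, h0, h0, h0,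
        bprod_eq hQ _ σ τ _ _ rfl, U.map_comp, U.map_comp]
  exact LinearMap.congr_fun₂ this u v

/-- The product of a constant and an operation. -/
theorem bprod_const {s a c : ℤ} (ν : P.obj 2 s) (κ : P.obj 0 a) (i : ℕ) (h : s + a = c) :
    bprod hP ν (tag Fin.elim0 κ) (tag (lbl i) P.one) = tag (lbl i) (P.circ 0 ν κ rfl h) := by
  have h1 := tag_bprod hP ν (std (0 : Fin 2) 0 (p := 1) rfl) (std (0 : Fin 1) 1 rfl) (by decide) h
    (add_zero c) κ P.one (lbl i) (σ := Fin.elim0) (τ := lbl i) (fun t => t.elim0) (fun t => rfl)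
  rw [← h1, hP.comp_one]
  rfl

end TagAlg

open TagAlg

/-! ### The free algebra and the operad -/

section Bv

variable (K) in
/-- The element `Δ(α)`. -/
def bvAlpha.deltaAlpha : (bvAlpha K).data.obj 0 1 :=
  (bvAlpha K).data.circ 0 (bvAlpha.delta K) (bvAlpha.alpha K)

variable (K) in
/-- The evaluation of the free algebra in the operad `BV ∨ α`. -/
abbrev psiBv : FreeG K →ₗ[K] K × TagAlg (bvAlpha K).data :=
  psi (bvAlpha K).data_isOperad bvAlpha_isBVOp.gerst (bvAlpha.delta K) (bvAlpha.alpha K)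
    (bvAlpha.deltaAlpha K)

theorem psiBv_dl (v : FreeG K) : psiBv K (dl K v) =
    (0, unB (bvAlpha K).data_isOperad (bvAlpha.delta K) (psiBv K v).2) := by
  have hP := (bvAlpha K).data_isOperad
  have hB := bvAlpha_isBVOp (K := K)
  have hdd : (bvAlpha K).data.comp 0 (std 0 1 (add_comm 1 1)) (show (1 : ℤ) + 1 = 2 from rfl)
    (bvAlpha.delta K) (bvAlpha.delta K) = 0 := hB.delta_sq
  refine psi_op hP hB.gerst _ _ _ dl_isBV.op (ε := 1) (fun i a b => (one_smul _ _).symm)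
    (fun i a b => rfl) (fun {i u} v hu => ?_) (fun {i u} v hu => ?_) (fun l => ?_) v
  · rw [unB_bprod hP _ _ (rfl : (1 : ℤ) + 0 = 1), hB.delta_mu, bprod_add, bprod_add,
      LinearMap.add_apply, LinearMap.add_apply, LinearMap.add_apply, LinearMap.add_apply,
      bprod_unB_left, bprod_unB_right hP _ _ _ hu, _root_.one_mul, one_smul]
  · rw [unB_bprod hP _ _ (rfl : (1 : ℤ) + 1 = 2), eq_neg_of_add_eq_zero_left
      ((add_assoc _ _ _).symm.trans hB.delta_lam), ← neg_one_smul K, bprod_smul, bprod_add,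
      LinearMap.smul_apply, LinearMap.smul_apply, LinearMap.add_apply, LinearMap.add_apply,
      bprod_unB_left, bprod_unB_right hP _ _ _ hu, _root_.one_mul]
    module
  · cases l with
    | x i =>
      rw [dl_isBV.x, psi_ltr]
      refine congrArg (Prod.mk 0) ((unB_tag hP _ (lbl i) (add_zero 1) _).trans ?_).symm
      rw [hP.comp_one]
    | y i =>
      rw [dl_isBV.y, map_zero]
      refine congrArg (Prod.mk 0) ((unB_tag hP _ (lbl i) rfl _).trans ?_).symm
      rw [hdd, map_zero]
    | al =>
      rw [dl_isBV.a, psi_ltr]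
      exact congrArg (Prod.mk 0) (unB_tag hP _ Fin.elim0 (add_zero 1) _).symm
    | be =>
      rw [dl_isBV.b, map_zero]
      refine congrArg (Prod.mk 0) ((unB_tag hP _ Fin.elim0 rfl _).trans ?_).symm
      have h := (coarse hP).lft_comp 0 (std (0 : Fin 1) 0 (p := 0) rfl) (bvAlpha.delta K) (bvAlpha.delta K)
        (bvAlpha.alpha K) (add_zero 1) rfl rfl (add_zero 2)
      have h' : (bvAlpha K).data.comp 0 (std 0 0 (add_comm 1 0)) (show (1 : ℤ) + 1 = 2 from rfl)
        (bvAlpha.delta K) (bvAlpha.deltaAlpha K) = 0 := h.trans ((congrArg (fun z => (bvAlpha K).data.comp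
          0 (std (0 : Fin 1) 0 (p := 0) rfl) (add_zero 2) z (bvAlpha.alpha K)) hdd).trans (by simp))
      exact (congrArg (tag Fin.elim0) h').trans (map_zero _)

theorem psiBv_theta {n : ℕ} {d : ℤ} (x : (bvAlpha K).data.obj n d) :
    psiBv K (qval ((theta K).map x)) = (0, tag (fun i => (i : ℕ)) x) := by
  have hP := (bvAlpha K).data_isOperad
  refine (bvAlpha K).hom_ext_gend (bvAlpha_gend K) (f := psiBv K ∘ₗ qval ∘ₗ (theta K).map)
    (f' := LinearMap.inr K K _ ∘ₗ tag (fun i => (i : ℕ))) (fun y hy => ?_) x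
  refine psi_gend hP bvAlpha_isBVOp.gerst _ _ _ (theta K)
    (⟨LinearMap.id, rfl, fun _ _ _ _ _ _ _ _ => rfl⟩ : OpMap (bvAlpha K).data (bvAlpha K).data)
    theta_mu theta_lam rfl rfl (fun hκ => ?_) (fun hν n p e d c h x ih => ?_) hy
  · cases hκ with
    | mk => rw [theta_alpha]; exact psi_ltr _ _ _ _ _ .al
  · cases hν with
    | mk =>
      rw [OpMap.map_comp, theta_delta, delta_comp, psiBv_dl, psi_rl, ih]
      refine congrArg (Prod.mk 0) ?_
      rw [brl_tag, show (exF (inF e)) ∘ (fun i : Fin n => (i : ℕ)) = inF e from funext fun t => exF_val _ t]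
      exact (tag_un hP (bvAlpha.delta K) e h x _).symm

theorem theta_inj {n : ℕ} {d : ℤ} {x y : (bvAlpha K).data.obj n d}
    (h : qval ((theta K).map x) = qval ((theta K).map y)) : x = y := by
  have h1 := psiBv_theta x
  rw [h, psiBv_theta] at h1
  exact (val_inj (bvAlpha K).data_isOperad (congrArg Prod.snd h1)).symm

end Bv

/-! ### Cocycles -/

section Cycles

variable (K) in
/-- The operad `Gerst ∨ η`. -/
abbrev gerstAdj : Presentation K := (gerst K).adjoin 1

variable (K) in
/-- The product of `Gerst ∨ η`. -/
abbrev gerstAdj.mu : (gerstAdj K).data.obj 2 0 := (gerstAdj K).dataGen (.old .mu)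

variable (K) in
/-- The bracket of `Gerst ∨ η`. -/
abbrev gerstAdj.lam : (gerstAdj K).data.obj 2 1 := (gerstAdj K).dataGen (.old .lam)

variable (K) in
/-- The constant of `Gerst ∨ η`. -/
abbrev gerstAdj.eta : (gerstAdj K).data.obj 0 1 := (gerstAdj K).dataGen .new

variable (K) in
theorem gerstAdj_gend {n : ℕ} {d : ℤ} (g : (gerstAdj K).Gen n d) : Gend (gerstAdj K).data
    (fun d => {κ | IsPt (gerstAdj.eta K) d κ}) (fun _ => ∅)
    (fun d => {ν | IsBin (gerstAdj.mu K) (gerstAdj.lam K) d ν}) ((gerstAdj K).dataGen g) := by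
  have hP := (gerstAdj K).data_isOperad
  match g with
  | .old .mu => exact Gend.of_bin hP IsBin.mu
  | .old .lam => exact Gend.of_bin hP IsBin.lam
  | .new => exact .const IsPt.mk

variable (K) in
/-- The morphism from `Gerst ∨ η` to `BV ∨ α`. -/
def phi : OpMap (gerstAdj K).data (bvAlpha K).data :=
  (exists_gerst_lift (bvAlpha K).data_isOperad bvAlpha_isBVOp.gerst (bvAlpha.deltaAlpha K)).choose

theorem phi_mu : (phi K).map (gerstAdj.mu K) = bvAlpha.mu K :=
  (exists_gerst_lift (bvAlpha K).data_isOperad bvAlpha_isBVOp.gerst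
    (bvAlpha.deltaAlpha K)).choose_spec.1

theorem phi_lam : (phi K).map (gerstAdj.lam K) = bvAlpha.lam K :=
  (exists_gerst_lift (bvAlpha K).data_isOperad bvAlpha_isBVOp.gerst
    (bvAlpha.deltaAlpha K)).choose_spec.2.1

theorem phi_eta : (phi K).map (gerstAdj.eta K) = bvAlpha.deltaAlpha K :=
  (exists_gerst_lift (bvAlpha K).data_isOperad bvAlpha_isBVOp.gerst
    (bvAlpha.deltaAlpha K)).choose_spec.2.2

theorem qval_theta_deltaAlpha : qval ((theta K).map (bvAlpha.deltaAlpha K)) = vb K := by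
  rw [bvAlpha.deltaAlpha, OpMap.map_circ, theta_delta, theta_alpha, OpData.circ, delta_comp,
    show qval (qalpha K) = va K from rfl, rl_ltr]
  exact dl_isBV.a

/-- On the subalgebra generated by the `x i` and `β`, the evaluation factors through `Gerst ∨ η`. -/
theorem psiBv_gx {v : FreeG K} (hv : v ∈ GX K) : ∃ u : TagAlg (gerstAdj K).data, (psiBv K v).2 =
    bmap (g := fun d => d) (fun {n} {d} => (phi K).map) (fun π x => (phi K).map_act π x) u := by
  have hQ := (gerstAdj K).data_isOperad
  set f := bmap (g := fun d => d) (fun {n} {d} => (phi K).map)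
    (fun π x => (phi K).map_act π x) with hf
  let p := psi hQ (gerst_adjoin_isGerst 1) 0 0 (gerstAdj.eta K)
  refine ⟨(p v).2, ?_⟩
  have h0 : ∀ {m : ℕ} (σ : Fin m → ℕ) {d : ℤ} (x : (gerstAdj K).data.obj m d),
      f (tag σ x) = tag σ ((phi K).map x) := fun σ _ x => bmap_tag (g := fun d => d)
    (fun {n} {d} => (phi K).map) (fun π x => (phi K).map_act π x) σ x
  have h1 : ∀ {s : ℤ} (ν : (gerstAdj K).data.obj 2 s) (u v : TagAlg (gerstAdj K).data),
    f (bprod hQ ν u v) = bprod (bvAlpha K).data_isOperad ((phi K).map ν) (f u) (f v) :=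
      fun ν u v => bmap_bprod hQ (bvAlpha K).data_isOperad (phi K) ν u v
  have key : ∀ t : GTerm, t.wt gxw 0 = 0 → psiBv K (cls K t) = ((p (cls K t)).1, f (p (cls K t)).2) := by
    intro t ht
    induction t with
    | one =>
      exact (psi_unit _ _ _ _ _).trans (by rw [show p (cls K .one) = (1, 0) from psi_unit _ _ _ _ _, map_zero])
    | lt l =>
      refine (psi_ltr _ _ _ _ _ l).trans ?_
      rw [show p (cls K (.lt l)) = _ from psi_ltr _ _ _ _ _ l]
      cases l with
      | x i => exact congrArg (Prod.mk 0) ((h0 _ _).trans (by rw [OpMap.map_one])).symm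
      | y i => exact absurd ht one_ne_zero
      | al => exact absurd ht one_ne_zero
      | be => exact congrArg (Prod.mk 0) ((h0 _ _).trans (by rw [phi_eta])).symm
    | mul s t hs ht' =>
      have hst : s.wt gxw 0 + t.wt gxw 0 = 0 := ht
      have h2 := psi_mul hQ (gerst_adjoin_isGerst 1) 0 0 (gerstAdj.eta K) (cls K s) (cls K t)
      rw [← mul_cls, psi_mul, hs (by omega), ht' (by omega), show p (FreeG.mul K _ _) = _ from h2,
        map_add, map_add, map_smul, map_smul, h1, phi_mu]
    | brk s t hs ht' =>
      have hst : s.wt gxw 0 + t.wt gxw 0 + 0 = 0 := ht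
      have h2 := psi_brk hQ (gerst_adjoin_isGerst 1) 0 0 (gerstAdj.eta K) (cls K s) (cls K t)
      rw [← brk_cls, psi_brk, hs (by omega), ht' (by omega), show p (FreeG.brk K _ _) = _ from h2,
        h1, phi_lam]
  exact eq_on_wt (f := LinearMap.snd K K _ ∘ₗ psiBv K) (f' := f ∘ₗ LinearMap.snd K K _ ∘ₗ p)
    (fun t ht => congrArg Prod.snd (key t ht)) hv

variable [CharZero K]

theorem twl_mu : bvAlpha.twl K 2 0 (bvAlpha.mu K) = 0 :=
  theta_inj (qval_tw.1.trans (by rw [map_zero, map_zero]))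

theorem twl_lam : bvAlpha.twl K 2 1 (bvAlpha.lam K) = 0 :=
  theta_inj (qval_tw.2.1.trans (by rw [map_zero, map_zero]))

theorem twl_deltaAlpha : bvAlpha.twl K 0 1 (bvAlpha.deltaAlpha K) = 0 :=
  theta_inj (by rw [qval_theta_tw, qval_theta_deltaAlpha, map_zero, map_zero]; exact dd_isDiff.b)

theorem twl_delta : bvAlpha.twl K 1 1 (bvAlpha.delta K) =
    -(bvAlpha K).data.circ 0 (bvAlpha.lam K) (bvAlpha.deltaAlpha K) :=
  theta_inj (qval_tw.2.2.1.trans (by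
    rw [map_neg, map_neg, OpMap.map_circ, theta_lam, OpData.circ, lam_left, qval_theta_deltaAlpha,
      rl_ltr]
    rfl))

theorem twl_phi {n : ℕ} {d : ℤ} (x : (gerstAdj K).data.obj n d) :
    bvAlpha.twl K n d ((phi K).map x) = 0 := by
  refine LinearMap.congr_fun ((gerstAdj K).data_hom_ext (f := bvAlpha.twl K n d ∘ₗ (phi K).map)
    (f' := 0) (fun t => ?_)) x
  clear x
  change bvAlpha.twl K n d ((phi K).map _) = 0
  induction t with
  | gen g =>
    match g with
    | .old .mu => exact (congrArg _ phi_mu).trans twl_mu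
    | .old .lam => exact (congrArg _ phi_lam).trans twl_lam
    | .new => exact (congrArg _ phi_eta).trans twl_deltaAlpha
  | one => exact (congrArg _ (phi K).map_one).trans bvAlpha.twl_one
  | comp i e h p q hx hy =>
    rw [← freeData_comp_tree]
    refine (congrArg (bvAlpha.twl K _ _) ((phi K).map_comp i e h ((gerstAdj K).cls (freeTree K p))
      ((gerstAdj K).cls (freeTree K q)))).trans ?_
    rw [bvAlpha.twl_comp i e h (by omega) (by omega), hx, hy]
    simp

theorem twl_act {n : ℕ} {d : ℤ} (π : Equiv.Perm (Fin n)) (x : (bvAlpha K).data.obj n d) :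
    bvAlpha.twl K n d ((bvAlpha K).data.act π x) =
      (bvAlpha K).data.act π (bvAlpha.twl K n d x) := by
  rw [OpData.act, bvAlpha.twl_comp _ _ _ (by omega) (zero_add _), bvAlpha.twl_one, map_zero,
    LinearMap.zero_apply, zero_add, sg_zero, one_smul]
  rfl

variable (K) in
/-- The differential on the labelled operations. -/
def dB : TagAlg (bvAlpha K).data →ₗ[K] TagAlg (bvAlpha K).data :=
  bmap (g := fun d => d + 1) (fun {n} {d} => bvAlpha.twl K n d) fun π x => twl_act π x

theorem dB_tag {m : ℕ} (σ : Fin m → ℕ) {d : ℤ} (x : (bvAlpha K).data.obj m d) :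
    dB K (tag σ x) = tag σ (bvAlpha.twl K m d x) :=
  bmap_tag (g := fun d => d + 1) (fun {n} {d} => bvAlpha.twl K n d) (fun π x => twl_act π x) σ x

theorem dB_bprod {s : ℤ} {ν : (bvAlpha K).data.obj 2 s} (hν : bvAlpha.twl K 2 s ν = 0) {i : ℤ}
    {u : TagAlg (bvAlpha K).data} (hu : u ∈ TagAlg.gr _ i) (v : TagAlg (bvAlpha K).data) :
    dB K (bprod (bvAlpha K).data_isOperad ν u v) =
      sg K s • bprod (bvAlpha K).data_isOperad ν (dB K u) v +
        sg K (s + i) • bprod (bvAlpha K).data_isOperad ν u (dB K v) := by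
  have hP := (bvAlpha K).data_isOperad
  have : dB K ∘ₗ bprod hP ν u = sg K s • bprod hP ν (dB K u) + sg K (s + i) • bprod hP ν u ∘ₗ dB K :=
    hom_ext fun {n} τ b y => by
      refine eq_on_gr (f := dB K ∘ₗ (bprod hP ν).flip (tag τ y))
        (g := sg K s • (bprod hP ν).flip (tag τ y) ∘ₗ dB K +
          sg K (s + i) • (bprod hP ν).flip (dB K (tag τ y))) (fun {m} σ x => ?_) hu
      change dB K (bprod hP ν (tag σ x) (tag τ y)) = sg K s • bprod hP ν (dB K (tag σ x)) (tag τ y) +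
        sg K (s + i) • bprod hP ν (tag σ x) (dB K (tag τ y))
      rw [dB_tag, dB_tag, bprod_eq hP ν σ τ x y rfl, dB_tag,
        bprod_comp hP ν σ τ (bvAlpha.twl K m i x) y (show s + (i + 1) = s + i + 1 by omega)
          (show s + i + 1 + b = s + i + b + 1 by omega),
        bprod_comp hP ν σ τ x (bvAlpha.twl K n b y) rfl
          (show s + i + (b + 1) = s + i + b + 1 by omega),
        bvAlpha.twl_comp _ _ _ (show s + i + 1 + b = s + i + b + 1 by omega)
          (show s + i + (b + 1) = s + i + b + 1 by omega),
        bvAlpha.twl_comp _ _ _ (show s + 1 + i = s + i + 1 by omega)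
          (show s + (i + 1) = s + i + 1 by omega), hν]
      simp only [map_zero, LinearMap.zero_apply, zero_add, map_add, map_smul, LinearMap.smul_apply]
  exact LinearMap.congr_fun this v

theorem psiBv_dd (v : FreeG K) : psiBv K (dd K v) = (0, dB K (psiBv K v).2) := by
  have hP := (bvAlpha K).data_isOperad
  have hl : ∀ (f : ℕ → ℕ) {n : ℕ} {d : ℤ} (x : (bvAlpha K).data.obj n d),
      psiBv K (dd K (rl K f (qval ((theta K).map x)))) = (0, dB K (tag (fun i => f i) x)) := by
    intro f n d x
    rw [← rl_dd, ← qval_theta_tw, psi_rl, psiBv_theta, dB_tag, brl_tag]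
    rfl
  refine psi_op hP bvAlpha_isBVOp.gerst _ _ _ dd_isDiff.der (ε := 0) (fun i a b => (zero_smul K _).symm)
    (fun i a b => rfl) (fun {i u} v hu => ?_) (fun {i u} v hu => ?_) (fun l => ?_) v
  · rw [dB_bprod twl_mu hu, sg_zero, one_smul, zero_add, zero_smul, add_zero]
  · rw [dB_bprod twl_lam hu, sg_add, sg_one]
    module
  · cases l with
    | x i =>
      have h := hl (fun _ => i) (bvAlpha K).data.one
      rwa [OpMap.map_one, qval_one, rl_ltr] at h
    | y i =>
      have h := hl (fun _ => i) (bvAlpha.delta K)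
      rwa [theta_delta, show qval (qdelta K) = vy K 0 from rfl, rl_ltr] at h
    | al =>
      have h := hl id (bvAlpha.alpha K)
      rwa [theta_alpha, show qval (qalpha K) = va K from rfl, rl_ltr,
        show (fun i : Fin 0 => id (i : ℕ)) = Fin.elim0 from funext fun i => i.elim0] at h
    | be =>
      have h := hl id (bvAlpha.deltaAlpha K)
      rwa [qval_theta_deltaAlpha, rl_ltr,
        show (fun i : Fin 0 => id (i : ℕ)) = Fin.elim0 from funext fun i => i.elim0] at h

/-- A cocycle is the sum of an operation from `Gerst ∨ η` and a coboundary. -/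
theorem exists_cycle_eq {n : ℕ} {d : ℤ} (z : (bvAlpha K).data.obj n (d + 1))
    (hz : bvAlpha.twl K n (d + 1) z = 0) : ∃ (x : (gerstAdj K).data.obj n (d + 1))
      (w : (bvAlpha K).data.obj n d), z = (phi K).map x + bvAlpha.twl K n d w := by
  have hP := (bvAlpha K).data_isOperad
  have h1 : dd K (qval ((theta K).map z)) = 0 := by rw [← qval_theta_tw, hz, map_zero, map_zero]
  obtain ⟨g, hg, _, ⟨w, rfl⟩, hgw⟩ := Submodule.mem_sup.1
    (cycle_mem dd_isDiff (Finset.range n) (qval_lin _) h1)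
  obtain ⟨F, hF, hF'⟩ := exists_extract hP n (d + 1)
  obtain ⟨u, hu⟩ := psiBv_gx hg
  have h2 := congrArg (fun v => F (psiBv K v).2) hgw
  simp only [map_add, Prod.snd_add, psiBv_theta, psiBv_dd, hu, hF] at h2
  obtain ⟨x, hx⟩ := IsExtract.bmap (gerstAdj K).data_isOperad (g := fun d => d) (d := d + 1)
    Function.injective_id (fun {n} {d} => (phi K).map) (fun π x => (phi K).map_act π x) (F := F) ⟨hF, hF'⟩ u
  obtain ⟨y, hy⟩ := IsExtract.bmap hP (g := fun d => d + 1) (d := d) (add_left_injective 1)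
    (fun {n} {d} => bvAlpha.twl K n d) (fun π x => twl_act π x) (F := F) ⟨hF, hF'⟩ (psiBv K w).2
  exact ⟨x, y, by rw [← h2, hx, dB, hy]⟩

/-- Morphisms which kill `λ(η, -)` vanish on the operations which are mapped to coboundaries. -/
theorem map_eq_zero_of_coboundary {Q : OpData K} (hQ : Q.IsOperad) (U : OpMap (gerstAdj K).data Q)
    (hU : U.map ((gerstAdj K).data.circ (c := 2) (p := 1) 0 (gerstAdj.lam K) (gerstAdj.eta K)) = 0)
    {n : ℕ} {d : ℤ} (x : (gerstAdj K).data.obj n (d + 1)) (w : (bvAlpha K).data.obj n d)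
    (h : (phi K).map x = bvAlpha.twl K n d w) : U.map x = 0 := by
  have hG := (gerst_adjoin_isGerst (K := K) 1).map U
  have hU' : Q.circ (c := 2) (p := 1) 0 (U.map (gerstAdj.lam K)) (U.map (gerstAdj.eta K)) = 0 := by
    rw [← OpMap.map_circ, hU]
  have h0 : ∀ v, psi hQ hG 0 0 (U.map (gerstAdj.eta K)) (dd K v) = 0 := fun v => by
    refine psi_op hQ hG _ _ _ dd_isDiff.der (ε := 0) (F := 0) (fun i a b => (zero_smul K _).symm)
      (fun i a b => rfl) (fun {i u} v hu => by simp) (fun {i u} v hu => by simp) (fun l => ?_) v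
    cases l with
    | x i => rw [dd_isDiff.x, map_zero]; rfl
    | y i =>
      rw [dd_isDiff.y, map_neg, psi_brk, psi_ltr, psi_ltr]
      refine neg_eq_zero.2 (congrArg (Prod.mk 0) ((bprod_const hQ _ _ i rfl).trans ?_))
      exact (congrArg _ hU').trans (map_zero _)
    | al =>
      rw [dd_isDiff.a, map_smul, psi_brk, psi_ltr]
      simp [psiGen]
    | be => rw [dd_isDiff.b, map_zero]; rfl
  have h1 : psi hQ hG 0 0 (U.map (gerstAdj.eta K)) (qval ((theta K).map ((phi K).map x))) =
      (0, tag (fun i => (i : ℕ)) (U.map x)) := by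
    refine (gerstAdj K).hom_ext_gend (gerstAdj_gend K)
      (f := psi hQ hG 0 0 (U.map (gerstAdj.eta K)) ∘ₗ qval ∘ₗ (theta K).map ∘ₗ (phi K).map)
      (f' := LinearMap.inr K K _ ∘ₗ tag (fun i => (i : ℕ)) ∘ₗ U.map) (fun y hy => ?_) x
    refine psi_gend hQ hG _ _ _ ((phi K).trans (theta K)) U
      (by rw [OpMap.trans_map, phi_mu, theta_mu]) (by rw [OpMap.trans_map, phi_lam, theta_lam])
      rfl rfl (fun hκ => ?_) (fun hν => hν.elim) hy
    cases hκ with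
    | mk => rw [OpMap.trans_map, phi_eta, qval_theta_deltaAlpha, psi_ltr]; rfl
  rw [h, qval_theta_tw, h0] at h1
  exact val_inj hQ (((congrArg Prod.snd h1).symm.trans (map_zero _).symm))

end Cycles

end OperadTw

namespace OperadTw

open Graft FreeG

variable {K : Type u} [Field K]

/-! ### Weights -/

namespace Presentation

variable (R : Presentation K)

/-- The weight of a formal composite. -/
def twt : ∀ {n : ℕ} {d : ℤ}, Tree R.Gen n d → ℕ
  | _, _, .gen g => R.weight g
  | _, _, .one => 0
  | _, _, .comp _ _ _ x y => twt x + twt y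

/-- The operations of weight `k`. -/
def wPart (n : ℕ) (d : ℤ) (k : ℕ) : Submodule K (R.data.obj n d) :=
  Submodule.span K {x | ∃ t : Tree R.Gen n d, R.twt t = k ∧ R.cls (freeTree K t) = x}

theorem tree_mem_wPart {n : ℕ} {d : ℤ} (t : Tree R.Gen n d) {k : ℕ} (h : R.twt t = k) :
    R.cls (freeTree K t) ∈ R.wPart n d k := Submodule.subset_span ⟨t, h, rfl⟩

theorem gen_mem_wPart {n : ℕ} {d : ℤ} (g : R.Gen n d) : R.dataGen g ∈ R.wPart n d (R.weight g) :=
  R.tree_mem_wPart (.gen g) rfl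

theorem one_mem_wPart : R.data.one ∈ R.wPart 1 0 0 := R.tree_mem_wPart .one rfl

theorem wPart_le {n : ℕ} {d : ℤ} {k : ℕ} {V : Submodule K (R.data.obj n d)}
    (h : ∀ t : Tree R.Gen n d, R.twt t = k → R.cls (freeTree K t) ∈ V) : R.wPart n d k ≤ V :=
  Submodule.span_le.2 (by rintro _ ⟨t, ht, rfl⟩; exact h t ht)

theorem comp_mem_wPart {m n p : ℕ} (i : Fin m) (e : Graft i n p) {a b c : ℤ} (h : a + b = c)
    {j k l : ℕ} (hl : j + k = l) {x : R.data.obj m a} {y : R.data.obj n b} (hx : x ∈ R.wPart m a j)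
    (hy : y ∈ R.wPart n b k) : R.data.comp i e h x y ∈ R.wPart p c l := by
  have h1 : R.wPart m a j ≤ (R.wPart p c l).comap ((R.data.comp i e h).flip y) :=
    R.wPart_le fun s hs => by
      have h2 : R.wPart n b k ≤ (R.wPart p c l).comap (R.data.comp i e h (R.cls (freeTree K s))) :=
        R.wPart_le fun t ht => by
          change R.data.comp i e h (R.cls (freeTree K s)) (R.cls (freeTree K t)) ∈ R.wPart p c l
          rw [cls_comp]
          have h3 := R.tree_mem_wPart (.comp i e h s t) ((congrArg₂ (· + ·) hs ht).trans hl)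
          rwa [← freeData_comp_tree] at h3
      exact h2 hy
  exact h1 hx

theorem iSup_wPart (n : ℕ) (d : ℤ) : ⨆ k, R.wPart n d k = ⊤ := by
  have h : (⨆ k, R.wPart n d k).mkQ = 0 := R.data_hom_ext fun t =>
    (Submodule.Quotient.mk_eq_zero _).2
      (Submodule.mem_iSup_of_mem (R.twt t) (R.tree_mem_wPart t rfl))
  rw [← Submodule.ker_mkQ (⨆ k, R.wPart n d k), h, LinearMap.ker_zero]

theorem hom_ext_wPart {n : ℕ} {d : ℤ} {M : Type u} [AddCommGroup M] [Module K M]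
    {f f' : R.data.obj n d →ₗ[K] M} (h : ∀ k, ∀ x ∈ R.wPart n d k, f x = f' x)
    (x : R.data.obj n d) : f x = f' x :=
  LinearMap.congr_fun (R.data_hom_ext fun t => h _ _ (R.tree_mem_wPart t rfl)) x

theorem wPart_le_fil (n : ℕ) (d : ℤ) {j k : ℕ} (h : k ≤ j) : R.wPart n d j ≤ R.operad.fil n d k := by
  have key : ∀ {n : ℕ} {d : ℤ} (t : Tree R.Gen n d), R.FilMem (R.twt t) (R.cls (freeTree K t)) := by
    intro n d t
    induction t with
    | gen g => exact .gen g
    | one => exact .top _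
    | comp i e h s t hs ht =>
      have := FilMem.comp i e h _ _ _ _ hs ht
      rwa [cls_comp, freeData_comp_tree] at this
  refine R.wPart_le fun t ht => R.operad.fil_anti n d h ?_
  rw [← ht]
  exact key t

theorem fil_le_wPart {n : ℕ} {d : ℤ} {k : ℕ} {x : R.data.obj n d} (hx : R.FilMem k x) :
    x ∈ ⨆ j : ℕ, R.wPart n d (k + j) := by
  have key : ∀ {m n p : ℕ} (i : Fin m) (e : Graft i n p) {a b c : ℤ} (h : a + b = c) (s t : ℕ)
      (x : R.data.obj m a) (y : R.data.obj n b), x ∈ ⨆ j : ℕ, R.wPart m a (s + j) →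
      y ∈ ⨆ j : ℕ, R.wPart n b (t + j) → R.data.comp i e h x y ∈ ⨆ j : ℕ, R.wPart p c (s + t + j) := by
    intro m n p i e a b c h s t x y hx hy
    have h1 : (⨆ j : ℕ, R.wPart m a (s + j)) ≤
        (⨆ j : ℕ, R.wPart p c (s + t + j)).comap ((R.data.comp i e h).flip y) :=
      iSup_le fun j x hx => by
        have h2 : (⨆ j : ℕ, R.wPart n b (t + j)) ≤
            (⨆ j : ℕ, R.wPart p c (s + t + j)).comap (R.data.comp i e h x) :=
          iSup_le fun j' y hy => Submodule.mem_iSup_of_mem (j + j')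
            (R.comp_mem_wPart i e h (by omega) hx hy)
        exact h2 hy
    exact h1 hx
  induction hx with
  | top x => simp only [zero_add]; rw [iSup_wPart]; trivial
  | @anti n d k x _ ih =>
    have h : ⨆ j : ℕ, R.wPart n d (k + 1 + j) ≤ ⨆ j : ℕ, R.wPart n d (k + j) := iSup_le fun j => by
      rw [add_assoc]
      exact le_iSup (fun j => R.wPart n d (k + j)) (1 + j)
    exact h ih
  | zero => exact zero_mem _
  | add k x y _ _ hx hy => exact add_mem hx hy
  | smul k c x _ hx => exact Submodule.smul_mem _ c hx
  | gen g => exact Submodule.mem_iSup_of_mem 0 (R.gen_mem_wPart g)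
  | comp i e h s t x y _ _ hx hy => exact key i e h s t x y hx hy

/-- There is an endomorphism which multiplies the operations of weight `k` by `2 ^ k`. -/
def HasScaling : Prop := ∃ F : OpMap R.data R.data,
  ∀ {n : ℕ} {d : ℤ} (g : R.Gen n d), F.map (R.dataGen g) = (2 : K) ^ R.weight g • R.dataGen g

variable {R} [CharZero K] (hR : R.HasScaling)

include hR in
theorem HasScaling.exists_comp (n : ℕ) (d : ℤ) : ∃ c : ℕ → R.data.obj n d →ₗ[K] R.data.obj n d,
    (∀ k x, c k x ∈ R.wPart n d k) ∧
      ∀ j k, ∀ x ∈ R.wPart n d j, c k x = if j = k then x else 0 := by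
  classical
  obtain ⟨F, hF⟩ := hR
  have h1 : ∀ {n : ℕ} {d : ℤ} (t : Tree R.Gen n d), F.map (R.cls (freeTree K t)) =
      (2 : K) ^ R.twt t • R.cls (freeTree K t) := by
    intro n d t
    induction t with
    | gen g => exact hF g
    | one => exact F.map_one.trans (by rw [twt, pow_zero, one_smul]; rfl)
    | comp i e h s t hs ht =>
      rw [← freeData_comp_tree, ← cls_comp, F.map_comp, hs, ht, map_smul, map_smul,
        LinearMap.smul_apply, smul_smul, ← pow_add, add_comm]
      rfl
  have h2 : ∀ k, R.wPart n d k ≤ Module.End.eigenspace (F.map : Module.End K (R.data.obj n d)) (2 ^ k) :=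
    fun k => R.wPart_le fun t ht => Module.End.mem_eigenspace_iff.2 (by rw [h1, ht])
  have h0 : Function.Injective fun k : ℕ => (2 : K) ^ k := fun a b hab =>
    Nat.pow_right_injective le_rfl (by
      have : ((2 ^ a : ℕ) : K) = ((2 ^ b : ℕ) : K) := by push_cast; exact hab
      exact_mod_cast this)
  have h3 : iSupIndep (R.wPart n d) := ((Module.End.eigenspaces_iSupIndep _).comp h0).mono h2
  have h4 := DirectSum.isInternal_submodule_of_iSupIndep_of_iSup_eq_top h3 (R.iSup_wPart n d)
  let E := LinearEquiv.ofBijective (DirectSum.coeLinearMap (R.wPart n d)) h4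
  refine ⟨fun k => (R.wPart n d k).subtype ∘ₗ DirectSum.component K ℕ _ k ∘ₗ E.symm.toLinearMap,
    fun k x => (DirectSum.component K ℕ _ k (E.symm x)).2, fun j k x hx => ?_⟩
  have h5 : E.symm x = DirectSum.lof K ℕ (fun k => R.wPart n d k) j ⟨x, hx⟩ := by
    rw [LinearEquiv.symm_apply_eq]
    exact (DirectSum.coeLinearMap_lof (R.wPart n d) j ⟨x, hx⟩).symm
  change ((DirectSum.component K ℕ _ k (E.symm x) : R.wPart n d k) : R.data.obj n d) = _
  rw [h5]
  split_ifs with h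
  · subst h
    rw [DirectSum.component.lof_self]
  · rw [DirectSum.component.of, dif_neg h]
    rfl

namespace HasScaling

/-- The component of weight `k`. -/
def part (n : ℕ) (d : ℤ) (k : ℕ) : R.data.obj n d →ₗ[K] R.data.obj n d := (hR.exists_comp n d).choose k

theorem part_mem {n : ℕ} {d : ℤ} (k : ℕ) (x : R.data.obj n d) : hR.part n d k x ∈ R.wPart n d k :=
  (hR.exists_comp n d).choose_spec.1 k x

theorem part_self {n : ℕ} {d : ℤ} {k : ℕ} {x : R.data.obj n d} (hx : x ∈ R.wPart n d k) :
    hR.part n d k x = x := by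
  rw [part, (hR.exists_comp n d).choose_spec.2 k k x hx, if_pos rfl]

theorem part_ne {n : ℕ} {d : ℤ} {j k : ℕ} {x : R.data.obj n d} (hx : x ∈ R.wPart n d j)
    (h : j ≠ k) : hR.part n d k x = 0 := by
  rw [part, (hR.exists_comp n d).choose_spec.2 j k x hx, if_neg h]

theorem filMem_iff {n : ℕ} {d : ℤ} {k : ℕ} {x : R.data.obj n d} :
    R.FilMem k x ↔ ∀ j < k, hR.part n d j x = 0 := by
  constructor
  · intro hx j hj
    have h : (⨆ i : ℕ, R.wPart n d (k + i)) ≤ LinearMap.ker (hR.part n d j) :=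
      iSup_le fun i y hy => hR.part_ne hy (by omega)
    exact h (R.fil_le_wPart hx)
  · intro hx
    let f : R.data.obj n d →ₗ[K] R.data.obj n d := LinearMap.id - ∑ j ∈ Finset.range k, hR.part n d j
    have h : ∀ i, R.wPart n d i ≤ (R.operad.fil n d k).comap f := fun i y hy => by
      change R.FilMem k (y - (∑ j ∈ Finset.range k, hR.part n d j) y)
      rw [LinearMap.sum_apply]
      by_cases hi : i < k
      · rw [Finset.sum_eq_single_of_mem i (Finset.mem_range.2 hi) fun j _ hj => hR.part_ne hy hj.symm,
          hR.part_self hy, sub_self]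
        exact .zero k
      · rw [Finset.sum_eq_zero fun j hj => hR.part_ne hy (by have := Finset.mem_range.1 hj; omega),
          sub_zero]
        exact R.wPart_le_fil n d (not_lt.1 hi) hy
    have h1 : R.FilMem k (x - (∑ j ∈ Finset.range k, hR.part n d j) x) :=
      (iSup_le h) (R.iSup_wPart n d ▸ Submodule.mem_top : x ∈ ⨆ i, R.wPart n d i)
    rwa [LinearMap.sum_apply, Finset.sum_eq_zero fun j hj => hx j (Finset.mem_range.1 hj), sub_zero] at h1

end HasScaling

variable (R) in
/-- The canonical map to the completion. -/
def toC (n : ℕ) (d : ℤ) : R.data.obj n d →ₗ[K] R.complete.obj n d := R.operad.toLim n d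

omit [CharZero K] in
theorem toC_mem {n : ℕ} {d : ℤ} {k : ℕ} {w : R.data.obj n d} :
    R.toC n d w ∈ R.complete.fil n d k ↔ R.FilMem k w :=
  Submodule.Quotient.mk_eq_zero (R.operad.fil n d k)

omit [CharZero K] in
theorem toC_comp {m n p : ℕ} (i : Fin m) (e : Graft i n p) {a b c : ℤ} (h : a + b = c)
    (x : R.data.obj m a) (y : R.data.obj n b) : R.toC p c (R.data.comp i e h x y) =
      R.complete.comp i e h (R.toC m a x) (R.toC n b y) := rfl

omit [CharZero K] in
theorem exists_approx {n : ℕ} {d : ℤ} (x : R.complete.obj n d) (k : ℕ) :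
    ∃ w, x - R.toC n d w ∈ R.complete.fil n d k := by
  obtain ⟨w, hw⟩ := Submodule.Quotient.mk_surjective _ (R.operad.limEval n d k x)
  exact ⟨w, sub_eq_zero.2 hw.symm⟩

namespace HasScaling

theorem part_eq {n : ℕ} {d : ℤ} {k m : ℕ} (hk : k < m) {x : R.complete.obj n d} {v w : R.data.obj n d}
    (hv : x - R.toC n d v ∈ R.complete.fil n d m) (hw : x - R.toC n d w ∈ R.complete.fil n d (k + 1)) :
    hR.part n d k v = hR.part n d k w := by
  have h := Submodule.sub_mem _ hw (R.complete.fil_anti n d hk hv)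
  rw [sub_sub_sub_cancel_left, ← map_sub, toC_mem, hR.filMem_iff] at h
  exact sub_eq_zero.1 ((map_sub _ _ _).symm.trans (h k k.lt_succ_self))

/-- The component of weight `k` of an element of the completion. -/
def cpart (n : ℕ) (d : ℤ) (k : ℕ) : R.complete.obj n d →ₗ[K] R.data.obj n d where
  toFun x := hR.part n d k (exists_approx x (k + 1)).choose
  map_add' x y := by
    rw [← map_add]
    refine (hR.part_eq k.lt_succ_self ?_ (exists_approx (x + y) (k + 1)).choose_spec).symm
    rw [map_add, add_sub_add_comm]
    exact add_mem (exists_approx x _).choose_spec (exists_approx y _).choose_spec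
  map_smul' c x := by
    rw [RingHom.id_apply, ← map_smul]
    refine (hR.part_eq k.lt_succ_self ?_ (exists_approx (c • x) (k + 1)).choose_spec).symm
    rw [map_smul, ← smul_sub]
    exact Submodule.smul_mem _ c (exists_approx x _).choose_spec

theorem cpart_rep {n : ℕ} {d : ℤ} {k m : ℕ} (hk : k < m) {x : R.complete.obj n d} {w : R.data.obj n d}
    (h : x - R.toC n d w ∈ R.complete.fil n d m) : hR.cpart n d k x = hR.part n d k w :=
  (hR.part_eq hk h (exists_approx x (k + 1)).choose_spec).symm

theorem cpart_toC {n : ℕ} {d : ℤ} (k : ℕ) (w : R.data.obj n d) :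
    hR.cpart n d k (R.toC n d w) = hR.part n d k w :=
  hR.cpart_rep k.lt_succ_self (by rw [sub_self]; exact zero_mem _)

theorem cpart_mem {n : ℕ} {d : ℤ} (k : ℕ) (x : R.complete.obj n d) :
    hR.cpart n d k x ∈ R.wPart n d k := hR.part_mem k _

theorem mem_cfil {n : ℕ} {d : ℤ} {p : ℕ} {x : R.complete.obj n d} :
    x ∈ R.complete.fil n d p ↔ ∀ k < p, hR.cpart n d k x = 0 := by
  obtain ⟨w, hw⟩ := exists_approx x p
  rw [← sub_add_cancel x (R.toC n d w), Submodule.add_mem_iff_right _ hw, toC_mem, hR.filMem_iff,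
    sub_add_cancel]
  exact forall₂_congr fun k hk => by rw [hR.cpart_rep hk hw]

theorem cext {n : ℕ} {d : ℤ} {x y : R.complete.obj n d}
    (h : ∀ k, hR.cpart n d k x = hR.cpart n d k y) : x = y := by
  refine sub_eq_zero.1 (R.operad.completion_isComplete.sep _ fun p => hR.mem_cfil.2 fun k _ => ?_)
  exact (map_sub _ _ _).trans (sub_eq_zero.2 (h k))

theorem cpart_sum {n : ℕ} {d : ℤ} {s : ℕ → R.data.obj n d} (hs : ∀ k, s k ∈ R.wPart n d k)
    {k p : ℕ} (hk : k < p) : hR.cpart n d k (R.toC n d (∑ k ∈ Finset.range p, s k)) = s k := by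
  rw [cpart_toC, map_sum, Finset.sum_eq_single_of_mem k (Finset.mem_range.2 hk) fun j _ hj =>
    hR.part_ne (hs j) hj, hR.part_self (hs k)]

theorem exists_cpart {n : ℕ} {d : ℤ} (s : ℕ → R.data.obj n d) (hs : ∀ k, s k ∈ R.wPart n d k) :
    ∃ x : R.complete.obj n d, ∀ k, hR.cpart n d k x = s k := by
  obtain ⟨x, hx⟩ := R.operad.completion_isComplete.cauchy
    (fun p => R.toC n d (∑ k ∈ Finset.range p, s k)) (fun p => hR.mem_cfil.2 fun k hk => by
      refine (map_sub _ _ _).trans ?_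
      rw [hR.cpart_sum hs hk, hR.cpart_sum hs (hk.trans p.lt_succ_self), sub_self])
  refine ⟨x, fun k => ?_⟩
  have h := (map_sub _ _ _).symm.trans (hR.mem_cfil.1 (hx (k + 1)) k k.lt_succ_self)
  exact (sub_eq_zero.1 h).trans (hR.cpart_sum hs k.lt_succ_self)

theorem sub_sum_mem {n : ℕ} {d : ℤ} (x : R.complete.obj n d) (p : ℕ) :
    x - R.toC n d (∑ k ∈ Finset.range p, hR.cpart n d k x) ∈ R.complete.fil n d p :=
  hR.mem_cfil.2 fun k hk => by rw [map_sub, hR.cpart_sum (fun k => hR.cpart_mem k x) hk, sub_self]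

variable {S : Presentation K} (hS : S.HasScaling) {n : ℕ} {d e : ℤ}
  {f : R.data.obj n d →ₗ[K] S.data.obj n e} {s : ℕ}
  (hf : ∀ k, R.wPart n d k ≤ (S.wPart n e (k + s)).comap f)

include hf

theorem part_map (k : ℕ) (x : R.data.obj n d) :
    hS.part n e (k + s) (f x) = f (hR.part n d k x) := by
  refine R.hom_ext_wPart (f := hS.part n e (k + s) ∘ₗ f) (f' := f ∘ₗ hR.part n d k)
    (fun j x hx => ?_) x
  rw [LinearMap.comp_apply, LinearMap.comp_apply]
  obtain rfl | h := eq_or_ne j k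
  · rw [hS.part_self (hf j hx), hR.part_self hx]
  · rw [hS.part_ne (hf j hx) (by omega), hR.part_ne hx h, map_zero]

theorem part_map_of_lt {k : ℕ} (hk : k < s) (x : R.data.obj n d) : hS.part n e k (f x) = 0 :=
  R.hom_ext_wPart (f := hS.part n e k ∘ₗ f) (f' := 0)
    (fun j x hx => hS.part_ne (hf j hx) (by omega)) x

variable {g : R.complete.obj n d →ₗ[K] S.complete.obj n e}
  (hg : ∀ w, g (R.toC n d w) = S.toC n e (f w))
  (hg' : ∀ k x, x ∈ R.complete.fil n d k → g x ∈ S.complete.fil n e k)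

include hg hg'

theorem cpart_map (k : ℕ) (x : R.complete.obj n d) :
    hS.cpart n e (k + s) (g x) = f (hR.cpart n d k x) := by
  obtain ⟨w, hw⟩ := exists_approx x (k + s + 1)
  rw [hR.cpart_rep (by omega) hw, hS.cpart_rep (w := f w) (k + s).lt_succ_self, hR.part_map hS hf]
  rw [← hg, ← map_sub]
  exact hg' _ _ hw

theorem cpart_map_of_lt {k : ℕ} (hk : k < s) (x : R.complete.obj n d) : hS.cpart n e k (g x) = 0 := by
  obtain ⟨w, hw⟩ := exists_approx x (k + 1)
  rw [hS.cpart_rep (w := f w) k.lt_succ_self, part_map_of_lt hS hf hk]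
  rw [← hg, ← map_sub]
  exact hg' _ _ hw

end HasScaling

end Presentation

end OperadTw

namespace OperadTw

open Graft FreeG

variable {K : Type u} [Field K]

/-! ### Completions of morphisms, quotients by closed ideals -/

namespace FilteredOperad

theorem comp_sub_mem (P : FilteredOperad K) {m n p : ℕ} (i : Fin m) (e : Graft i n p) {a b c : ℤ}
    (h : a + b = c) {k : ℕ} {x x' : P.obj m a} {y y' : P.obj n b} (hx : x - x' ∈ P.fil m a k)
    (hy : y - y' ∈ P.fil n b k) : P.comp i e h x y - P.comp i e h x' y' ∈ P.fil p c k := by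
  have h1 := add_mem (P.comp_fil_left i e h _ y hx) (P.comp_fil_right i e h x' _ hy)
  rwa [map_sub, map_sub, LinearMap.sub_apply, sub_add_sub_cancel] at h1

theorem Iso.isComplete {P Q : FilteredOperad K} (F : P.Iso Q) (hP : P.IsComplete) : Q.IsComplete := by
  refine isComplete_of _ (fun {n} {d} y hy => ?_) fun {n} {d} s hs => ?_
  · rw [← F.hom_inv y, hP.sep _ fun p => F.inv.map_fil p y (hy p), map_zero]
  · obtain ⟨x, hx⟩ := hP.cauchy (fun p => F.inv.map (s p)) fun p => by
      rw [← map_sub]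
      exact F.inv.map_fil p _ (hs p)
    refine ⟨F.hom.map x, fun p => ?_⟩
    have h := F.hom.map_fil p _ (hx p)
    rwa [map_sub, F.hom_inv] at h

/-- A morphism whose kernel is a closed ideal and which is onto on all stages of the filtrations is a
quotient map. -/
theorem Hom.exists_iso {P Q : FilteredOperad K} (F : P.Hom Q) {n₀ : ℕ} {d₀ : ℤ} {r : P.obj n₀ d₀}
    (hker : ∀ {n : ℕ} {d : ℤ} (x : P.obj n d), F.map x = 0 ↔ P.ClosedIdealMem r x)
    (hsurj : ∀ {n : ℕ} {d : ℤ} (k : ℕ) (y : Q.obj n d), y ∈ Q.fil n d k → ∃ x ∈ P.fil n d k, F.map x = y) :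
    ∃ ψ : (P.quot (P.closedIdeal r)).Iso Q, ∀ {n : ℕ} {d : ℤ} (x : P.obj n d),
      ψ.hom.map (Submodule.Quotient.mk (p := (P.closedIdeal r).carrier n d) x) = F.map x := by
  let f : ∀ n d, (P.obj n d ⧸ (P.closedIdeal r).carrier n d) →ₗ[K] Q.obj n d := fun n d =>
    ((P.closedIdeal r).carrier n d).liftQ F.map fun x hx => (hker x).2 hx
  have hf : ∀ n d, Function.Bijective (f n d) := fun n d => by
    refine ⟨(injective_iff_map_eq_zero _).2 fun x hx => ?_, fun y => ?_⟩
    · obtain ⟨x, rfl⟩ := Submodule.Quotient.mk_surjective _ x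
      exact (Submodule.Quotient.mk_eq_zero _).2 ((hker x).1 hx)
    · obtain ⟨x, _, hx⟩ := hsurj 0 y (Q.mem_fil_zero y)
      exact ⟨Submodule.Quotient.mk x, hx⟩
  let E : ∀ n d, (P.obj n d ⧸ (P.closedIdeal r).carrier n d) ≃ₗ[K] Q.obj n d := fun n d =>
    LinearEquiv.ofBijective (f n d) (hf n d)
  let H : (P.quot (P.closedIdeal r)).Hom Q :=
    { map := fun {n} {d} => f n d
      map_one := F.map_one
      map_comp := fun {m} {n} {p} i e {a} {b} {c} h x y => by
        obtain ⟨x, rfl⟩ := Submodule.Quotient.mk_surjective _ x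
        obtain ⟨y, rfl⟩ := Submodule.Quotient.mk_surjective _ y
        exact F.map_comp i e h x y
      map_fil := fun {n} {d} k x hx => by
        obtain ⟨x, hx, rfl⟩ := hx
        exact F.map_fil k x hx }
  refine ⟨⟨H, ⟨fun {n} {d} => (E n d).symm.toLinearMap, ?_, ?_, ?_⟩, ?_, ?_⟩, fun x => rfl⟩
  · exact (LinearEquiv.symm_apply_eq (E 1 0)).2 H.map_one.symm
  · intro m n p i e a b c h x y
    refine (LinearEquiv.symm_apply_eq (E p c)).2 (Eq.trans ?_ (H.map_comp i e h _ _).symm)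
    exact congrArg₂ (fun u v => Q.comp i e h u v) ((E m a).apply_symm_apply x).symm
      ((E n b).apply_symm_apply y).symm
  · intro n d k y hy
    obtain ⟨x, hx, rfl⟩ := hsurj k y hy
    exact ⟨x, hx, ((LinearEquiv.symm_apply_eq (E n d)).2 rfl).symm⟩
  · exact fun {n} {d} x => (E n d).symm_apply_apply x
  · exact fun {n} {d} y => (E n d).apply_symm_apply y

end FilteredOperad

namespace Presentation

variable {R S : Presentation K}

theorem map_mem_wPart (F : OpMap R.data S.data)
    (hF : ∀ {n : ℕ} {d : ℤ} (g : R.Gen n d), F.map (R.dataGen g) ∈ S.wPart n d (R.weight g)) (n : ℕ)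
    (d : ℤ) (k : ℕ) : R.wPart n d k ≤ (S.wPart n d k).comap F.map := by
  refine R.wPart_le fun t ht => ?_
  rw [← ht, Submodule.mem_comap]
  clear ht
  induction t with
  | gen g => exact hF g
  | one => exact (congrArg (· ∈ S.wPart 1 0 0) F.map_one).mpr S.one_mem_wPart
  | comp i e h s t hs ht =>
    rw [← freeData_comp_tree, ← cls_comp, F.map_comp]
    exact S.comp_mem_wPart i e h rfl hs ht

theorem exists_extension (F : OpMap R.data S.data)
    (hF : ∀ n d k, R.wPart n d k ≤ (S.wPart n d k).comap F.map) {n : ℕ} {d : ℤ}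
    (x : R.complete.obj n d) : ∃ y : S.complete.obj n d, ∀ k w,
      x - R.toC n d w ∈ R.complete.fil n d k → y - S.toC n d (F.map w) ∈ S.complete.fil n d k := by
  have hS : S.complete.IsComplete := S.operad.completion_isComplete
  have hfil : ∀ {k : ℕ} {v w : R.data.obj n d}, x - R.toC n d v ∈ R.complete.fil n d k →
      x - R.toC n d w ∈ R.complete.fil n d k →
        S.toC n d (F.map w) - S.toC n d (F.map v) ∈ S.complete.fil n d k := fun {k} {v} {w} hv hw => by
    have h0 : (⨆ j : ℕ, R.wPart n d (k + j)) ≤ (S.operad.fil n d k).comap F.map :=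
      iSup_le fun j x hx => S.wPart_le_fil n d (Nat.le_add_right k j) (hF n d _ hx)
    have h := Submodule.sub_mem _ hv hw
    rw [sub_sub_sub_cancel_left, ← map_sub, toC_mem] at h
    rw [← map_sub, ← map_sub]
    exact toC_mem.2 (h0 (R.fil_le_wPart h))
  choose w hw using exists_approx x
  obtain ⟨y, hy⟩ := hS.cauchy (fun k => S.toC n d (F.map (w k))) fun k =>
    hfil (hw k) (R.complete.fil_anti n d k.le_succ (hw (k + 1)))
  refine ⟨y, fun k v hv => ?_⟩
  have := add_mem (hy k) (hfil hv (hw k))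
  rwa [sub_add_sub_cancel] at this

/-- The extension of a morphism to the completions. -/
theorem exists_hom (F : OpMap R.data S.data)
    (hF : ∀ n d k, R.wPart n d k ≤ (S.wPart n d k).comap F.map) :
    ∃ G : R.complete.Hom S.complete, ∀ {n : ℕ} {d : ℤ} (w : R.data.obj n d),
      G.map (R.toC n d w) = S.toC n d (F.map w) := by
  have hS : S.complete.IsComplete := S.operad.completion_isComplete
  choose g hg using fun n d (x : R.complete.obj n d) => exists_extension F hF x
  have uniq : ∀ {n : ℕ} {d : ℤ} {x : R.complete.obj n d} {y : S.complete.obj n d},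
      (∀ k, ∃ w, x - R.toC n d w ∈ R.complete.fil n d k ∧ y - S.toC n d (F.map w) ∈ S.complete.fil n d k) →
        g n d x = y := fun {n} {d} {x} {y} h => by
    refine sub_eq_zero.1 (hS.sep _ fun k => ?_)
    obtain ⟨w, hx, hy⟩ := h k
    have := Submodule.sub_mem _ (hg n d x k w hx) hy
    rwa [sub_sub_sub_cancel_right] at this
  have hgt : ∀ {n : ℕ} {d : ℤ} (w : R.data.obj n d), g n d (R.toC n d w) = S.toC n d (F.map w) :=
    fun w => uniq fun k => ⟨w, by rw [sub_self]; exact zero_mem _, by rw [sub_self]; exact zero_mem _⟩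
  have hadd : ∀ n d x y, g n d (x + y) = g n d x + g n d y := fun n d x y => uniq fun k => by
    obtain ⟨v, hv⟩ := exists_approx x k
    obtain ⟨w, hw⟩ := exists_approx y k
    refine ⟨v + w, ?_, ?_⟩
    · rw [map_add, add_sub_add_comm]
      exact add_mem hv hw
    · rw [map_add, map_add, add_sub_add_comm]
      exact add_mem (hg _ _ _ _ _ hv) (hg _ _ _ _ _ hw)
  have hsmul : ∀ n d (c : K) x, g n d (c • x) = c • g n d x := fun n d c x => uniq fun k => by
    obtain ⟨v, hv⟩ := exists_approx x k
    refine ⟨c • v, ?_, ?_⟩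
    · rw [map_smul, ← smul_sub]
      exact Submodule.smul_mem _ c hv
    · rw [map_smul, map_smul, ← smul_sub]
      exact Submodule.smul_mem _ c (hg _ _ _ _ _ hv)
  have hcomp : ∀ {m n p : ℕ} (i : Fin m) (e : Graft i n p) {a b c : ℤ} (h : a + b = c)
      (x : R.complete.obj m a) (y : R.complete.obj n b), g p c (R.complete.comp i e h x y) =
        S.complete.comp i e h (g m a x) (g n b y) := fun i e _ _ _ h x y => uniq fun k => by
    obtain ⟨v, hv⟩ := exists_approx x k
    obtain ⟨w, hw⟩ := exists_approx y k
    refine ⟨R.data.comp i e h v w, ?_, ?_⟩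
    · rw [toC_comp]
      exact R.complete.comp_sub_mem i e h hv hw
    rw [F.map_comp, toC_comp]
    exact S.complete.comp_sub_mem i e h (hg _ _ _ _ _ hv) (hg _ _ _ _ _ hw)
  let f : ∀ n d, R.complete.obj n d →ₗ[K] S.complete.obj n d := fun n d => ⟨⟨g n d, hadd n d⟩, hsmul n d⟩
  refine ⟨⟨fun {n} {d} => f n d, (hgt R.data.one).trans (congrArg (S.toC 1 0) F.map_one), hcomp,
    fun {n} {d} k x hx => ?_⟩, hgt⟩
  have := hg n d x k 0 (by rw [map_zero, sub_zero]; exact hx)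
  rwa [map_zero, map_zero, sub_zero] at this

/-- Morphisms out of the completion are determined by their values on the generators. -/
theorem complete_hom_ext {Q : FilteredOperad K} (hQ : Q.IsComplete) (G H : R.complete.Hom Q)
    (h : ∀ {n : ℕ} {d : ℤ} (g : R.Gen n d), G.map (R.cgen g) = H.map (R.cgen g)) {n : ℕ} {d : ℤ}
    (x : R.complete.obj n d) : G.map x = H.map x := by
  have h1 : ∀ w : R.data.obj n d, G.map (R.toC n d w) = H.map (R.toC n d w) := fun w => by
    refine LinearMap.congr_fun (R.data_hom_ext (f := G.map ∘ₗ R.toC n d) (f' := H.map ∘ₗ R.toC n d)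
      fun t => ?_) w
    clear w x
    change G.map (R.toC _ _ _) = H.map (R.toC _ _ _)
    induction t with
    | gen g => exact h g
    | one => exact G.map_one.trans H.map_one.symm
    | comp i e h s t hs ht =>
      rw [← freeData_comp_tree, ← cls_comp]
      exact (G.map_comp i e h _ _).trans ((congrArg₂ (fun u v => Q.comp i e h u v) hs ht).trans
        (H.map_comp i e h _ _).symm)
  refine sub_eq_zero.1 (hQ.sep _ fun k => ?_)
  obtain ⟨w, hw⟩ := exists_approx x k
  have := Submodule.sub_mem _ (G.map_fil k _ hw) (H.map_fil k _ hw)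
  rwa [map_sub, map_sub, h1, sub_sub_sub_cancel_right] at this

end Presentation

end OperadTw

namespace OperadTw

open Graft FreeG

variable {K : Type u} [Field K]

/-! ### The cohomology of the twisted operad -/

section Weights

theorem gerstAdj_hasScaling : (gerstAdj K).HasScaling := by
  obtain ⟨F, h1, h2, h3⟩ := exists_gerst_lift (gerstAdj K).data_isOperad (gerst_adjoin_isGerst (K := K) 1)
    ((2 : K) • gerstAdj.eta K)
  refine ⟨F, fun {n} {d} g => ?_⟩
  cases g with
  | old g =>
    rw [show (gerstAdj K).weight (.old g) = 0 from rfl, pow_zero, one_smul]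
    cases g with
    | mu => exact h1
    | lam => exact h2
  | new => exact h3.trans (by rw [show (gerstAdj K).weight .new = 1 from rfl, pow_one])

theorem bvAlpha_hasScaling : (bvAlpha K).HasScaling := by
  obtain ⟨F, h1, h2, h3, h4⟩ := exists_bv_lift (bvAlpha K).data_isOperad bvAlpha_isBVOp
    ((2 : K) • bvAlpha.alpha K)
  refine ⟨F, fun {n} {d} g => ?_⟩
  cases g with
  | old g =>
    rw [show (bvAlpha K).weight (.old g) = 0 from rfl, pow_zero, one_smul]
    cases g with
    | mu => exact h1
    | lam => exact h2
    | delta => exact h3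
  | new => exact h4.trans (by rw [show (bvAlpha K).weight .new = 1 from rfl, pow_one]; rfl)

theorem deltaAlpha_mem : bvAlpha.deltaAlpha K ∈ (bvAlpha K).wPart 0 1 1 :=
  (bvAlpha K).comp_mem_wPart _ _ _ (zero_add 1)
    ((bvAlpha K).gen_mem_wPart (.old .delta)) ((bvAlpha K).gen_mem_wPart .new)

theorem phi_wPart (n : ℕ) (d : ℤ) (k : ℕ) :
    (gerstAdj K).wPart n d k ≤ ((bvAlpha K).wPart n d k).comap (phi K).map := by
  refine Presentation.map_mem_wPart (phi K) (fun {n} {d} g => ?_) n d k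
  cases g with
  | old g =>
    cases g with
    | mu =>
      exact (congrArg (· ∈ (bvAlpha K).wPart 2 0 0) (phi_mu (K := K))).mpr
        ((bvAlpha K).gen_mem_wPart (.old .mu))
    | lam =>
      exact (congrArg (· ∈ (bvAlpha K).wPart 2 1 0) (phi_lam (K := K))).mpr
        ((bvAlpha K).gen_mem_wPart (.old .lam))
  | new => exact (congrArg (· ∈ (bvAlpha K).wPart 0 1 1) (phi_eta (K := K))).mpr deltaAlpha_mem

variable [CharZero K]

theorem twl_alpha : bvAlpha.twl K 0 0 (bvAlpha.alpha K) = (2⁻¹ : K) •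
    (bvAlpha K).data.circ (c := 1) (p := 0) 0 (bvAlpha.lamAlpha K) (bvAlpha.alpha K) := by
  refine theta_inj (qval_tw.2.2.2.trans ?_)
  rw [map_smul, map_smul, OpMap.map_circ, OpData.circ, qval_theta_lamAlpha_comp, theta_alpha,
    show qval (qalpha K) = va K from rfl, rl_ltr]
  rfl

theorem twl_gen_mem {n : ℕ} {d : ℤ} (g : (bvAlpha K).Gen n d) :
    bvAlpha.twl K n d ((bvAlpha K).dataGen g) ∈
      (bvAlpha K).wPart n (d + 1) ((bvAlpha K).weight g + 1) := by
  have h1 := (bvAlpha K).gen_mem_wPart (.old BVGen.lam)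
  have h2 := (bvAlpha K).gen_mem_wPart .new
  have h3 : (bvAlpha K).data.circ (c := 2) (p := 1) 0 (bvAlpha.lam K) (bvAlpha.deltaAlpha K) ∈
      (bvAlpha K).wPart 1 2 1 := (bvAlpha K).comp_mem_wPart _ _ _ (zero_add 1) h1 deltaAlpha_mem
  have h4 : bvAlpha.lamAlpha K ∈ (bvAlpha K).wPart 1 1 1 :=
    (bvAlpha K).comp_mem_wPart _ _ _ (zero_add 1) h1 h2
  have h5 : (bvAlpha K).data.circ (c := 1) (p := 0) 0 (bvAlpha.lamAlpha K) (bvAlpha.alpha K) ∈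
      (bvAlpha K).wPart 0 1 2 := (bvAlpha K).comp_mem_wPart _ _ _ (one_add_one_eq_two) h4 h2
  cases g with
  | old g =>
    cases g with
    | mu => exact (congrArg (· ∈ (bvAlpha K).wPart 2 (0 + 1) 1) (twl_mu (K := K))).mpr (zero_mem _)
    | lam => exact (congrArg (· ∈ (bvAlpha K).wPart 2 (1 + 1) 1) (twl_lam (K := K))).mpr (zero_mem _)
    | delta =>
      exact (congrArg (· ∈ (bvAlpha K).wPart 1 (1 + 1) 1) (twl_delta (K := K))).mpr (neg_mem h3)
  | new =>
    exact (congrArg (· ∈ (bvAlpha K).wPart 0 (0 + 1) 2) (twl_alpha (K := K))).mpr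
      (Submodule.smul_mem _ _ h5)

theorem twl_wPart (n : ℕ) (d : ℤ) (k : ℕ) :
    (bvAlpha K).wPart n d k ≤ ((bvAlpha K).wPart n (d + 1) (k + 1)).comap (bvAlpha.twl K n d) := by
  refine (bvAlpha K).wPart_le fun t ht => ?_
  rw [← ht, Submodule.mem_comap]
  clear ht
  induction t with
  | gen g => exact twl_gen_mem g
  | one => exact (congrArg (· ∈ (bvAlpha K).wPart 1 (0 + 1) 1) (bvAlpha.twl_one (K := K))).mpr (zero_mem _)
  | @comp m n p i e a b c h s t hs ht =>
    have h1 := bvAlpha.twl_comp i e h (by omega) (by omega) ((bvAlpha K).cls (freeTree K s))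
      ((bvAlpha K).cls (freeTree K t))
    rw [Presentation.cls_comp, freeData_comp_tree] at h1
    refine (congrArg (· ∈ (bvAlpha K).wPart p (c + 1) _) h1).mpr
      (add_mem ((bvAlpha K).comp_mem_wPart i e _ ?_ hs ((bvAlpha K).tree_mem_wPart t rfl))
        (Submodule.smul_mem _ _ ((bvAlpha K).comp_mem_wPart i e _ ?_
          ((bvAlpha K).tree_mem_wPart s rfl) ht)))
    · change _ = (bvAlpha K).twt s + (bvAlpha K).twt t + 1
      omega
    · change _ = (bvAlpha K).twt s + (bvAlpha K).twt t + 1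
      omega

end Weights

section Completed

variable (K)

/-- The morphism `phi`, extended to the completions. -/
def cphi : (gerstAdj K).complete.Hom (bvAlpha K).complete :=
  (Presentation.exists_hom (phi K) phi_wPart).choose

theorem cphi_toC {n : ℕ} {d : ℤ} (w : (gerstAdj K).data.obj n d) :
    (cphi K).map ((gerstAdj K).toC n d w) = (bvAlpha K).toC n d ((phi K).map w) :=
  (Presentation.exists_hom (phi K) phi_wPart).choose_spec w

variable [CharZero K]

/-- The twisted differential of the completion. -/
def ctw (n : ℕ) (d : ℤ) : (bvAlpha K).complete.obj n d →ₗ[K] (bvAlpha K).complete.obj n (d + 1) :=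
  (twBV K).diff.d rfl

theorem ctw_toC {n : ℕ} {d : ℤ} (w : (bvAlpha K).data.obj n d) :
    ctw K n d ((bvAlpha K).toC n d w) = (bvAlpha K).toC n (d + 1) (bvAlpha.twl K n d w) := by
  have h : (mcBV K).ins (mcBV.lamAlpha K) (rfl : d + 1 = d + 1) ((bvAlpha K).toC n d w) =
      (bvAlpha K).toC n (d + 1) ((bvAlpha K).operad.ins (bvAlpha.lamAlpha K) rfl w) := by
    refine (FilteredOperad.ins_apply (mcBV K).toFilteredOperad _ _ _).trans ?_
    refine Eq.trans ?_ (congrArg ((bvAlpha K).toC n (d + 1))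
      (FilteredOperad.ins_apply (bvAlpha K).operad _ _ w)).symm
    exact (map_sum ((bvAlpha K).toC n (d + 1)) _ _).symm
  change _ + (_ - (-1 : K) ^ d • (mcBV K).ins (mcBV.lamAlpha K) _ _) = _
  rw [h]
  rfl

variable {K}

theorem cpart_cphi {n : ℕ} {d : ℤ} (k : ℕ) (x : (gerstAdj K).complete.obj n d) :
    bvAlpha_hasScaling.cpart n d k ((cphi K).map x) =
      (phi K).map (gerstAdj_hasScaling.cpart n d k x) :=
  gerstAdj_hasScaling.cpart_map bvAlpha_hasScaling (s := 0) (phi_wPart n d) (cphi_toC K)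
    (cphi K).map_fil k x

theorem cpart_ctw {n : ℕ} {d : ℤ} (k : ℕ) (x : (bvAlpha K).complete.obj n d) :
    bvAlpha_hasScaling.cpart n (d + 1) (k + 1) (ctw K n d x) =
      bvAlpha.twl K n d (bvAlpha_hasScaling.cpart n d k x) :=
  bvAlpha_hasScaling.cpart_map bvAlpha_hasScaling (s := 1) (twl_wPart n d) (ctw_toC K)
    ((twBV K).diff.d_fil rfl) k x

theorem cpart_ctw_zero {n : ℕ} {d : ℤ} (x : (bvAlpha K).complete.obj n d) :
    bvAlpha_hasScaling.cpart n (d + 1) 0 (ctw K n d x) = 0 :=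
  Presentation.HasScaling.cpart_map_of_lt bvAlpha_hasScaling (s := 1)
    (twl_wPart n d) (ctw_toC K) ((twBV K).diff.d_fil rfl) one_pos x

theorem part_twl_mem {n : ℕ} {d : ℤ} (k : ℕ) (w : (bvAlpha K).data.obj n d) :
    bvAlpha_hasScaling.part n (d + 1) k (bvAlpha.twl K n d w) ∈
      LinearMap.range (bvAlpha.twl K n d) := by
  cases k with
  | zero =>
    rw [Presentation.HasScaling.part_map_of_lt bvAlpha_hasScaling (s := 1)
      (twl_wPart n d) one_pos]
    exact zero_mem _
  | succ k => exact ⟨_, (bvAlpha_hasScaling.part_map bvAlpha_hasScaling (twl_wPart n d) k w).symm⟩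

theorem mem_range_ctw {n : ℕ} {d : ℤ} (z : (bvAlpha K).complete.obj n (d + 1)) :
    z ∈ LinearMap.range (ctw K n d) ↔ ∀ k, bvAlpha_hasScaling.cpart n (d + 1) k z ∈
      LinearMap.range (bvAlpha.twl K n d) := by
  have hR := bvAlpha_hasScaling (K := K)
  constructor
  · rintro ⟨x, rfl⟩ k
    cases k with
    | zero => rw [cpart_ctw_zero]; exact zero_mem _
    | succ k => exact ⟨_, (cpart_ctw k x).symm⟩
  · intro h
    choose w hw using h
    obtain ⟨x, hx⟩ := hR.exists_cpart (fun k => hR.part n d k (w (k + 1))) fun k => hR.part_mem k _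
    refine ⟨x, hR.cext fun k => ?_⟩
    have h1 := hR.part_self (hR.cpart_mem k z)
    rw [← hw k] at h1 ⊢
    cases k with
    | zero =>
      rw [cpart_ctw_zero, ← h1, Presentation.HasScaling.part_map_of_lt hR (s := 1)
        (twl_wPart n d) one_pos]
    | succ k => rw [cpart_ctw, hx, ← hR.part_map hR (twl_wPart n d), h1]

theorem ctw_cphi {n : ℕ} {d : ℤ} (x : (gerstAdj K).complete.obj n d) :
    ctw K n d ((cphi K).map x) = 0 := by
  refine bvAlpha_hasScaling.cext fun k => ?_
  rw [map_zero]
  cases k with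
  | zero => exact cpart_ctw_zero _
  | succ k => rw [cpart_ctw, cpart_cphi, twl_phi]

theorem exists_cocycle_eq {n : ℕ} {d : ℤ} {z : (bvAlpha K).complete.obj n (d + 1)}
    (hz : ctw K n (d + 1) z = 0) {p : ℕ} (hp : z ∈ (bvAlpha K).complete.fil n (d + 1) p) :
    ∃ x ∈ (gerstAdj K).complete.fil n (d + 1) p,
      z - (cphi K).map x ∈ LinearMap.range (ctw K n d) := by
  have hR := bvAlpha_hasScaling (K := K)
  have hG := gerstAdj_hasScaling (K := K)
  have key : ∀ k, ∃ x ∈ (gerstAdj K).wPart n (d + 1) k, (k < p → x = 0) ∧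
      hR.cpart n (d + 1) k z - (phi K).map x ∈ LinearMap.range (bvAlpha.twl K n d) := fun k => by
    by_cases hk : k < p
    · refine ⟨0, zero_mem _, fun _ => rfl, ?_⟩
      rw [hR.mem_cfil.1 hp k hk, map_zero, sub_zero]
      exact zero_mem _
    · obtain ⟨x, w, h⟩ := exists_cycle_eq (hR.cpart n (d + 1) k z) (by
        rw [← cpart_ctw, hz, map_zero])
      refine ⟨hG.part n (d + 1) k x, hG.part_mem k x, fun h => absurd h hk, ?_⟩
      have h1 := hG.part_map hR (s := 0) (phi_wPart n (d + 1)) k x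
      have h2 := congrArg (hR.part n (d + 1) k) h
      rw [hR.part_self (hR.cpart_mem k z), map_add] at h2
      rw [h2, ← h1, Nat.add_zero, add_sub_cancel_left]
      exact part_twl_mem k w
  choose x hx hx0 hxz using key
  obtain ⟨y, hy⟩ := hG.exists_cpart x hx
  refine ⟨y, hG.mem_cfil.2 fun k hk => (hy k).trans (hx0 k hk), (mem_range_ctw _).2 fun k => ?_⟩
  rw [map_sub, cpart_cphi, hy]
  exact hxz k

theorem closedIdealMem_of_coboundary {n : ℕ} {d : ℤ} {x : (gerstAdj K).complete.obj n (d + 1)}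
    (h : (cphi K).map x ∈ LinearMap.range (ctw K n d)) :
    (gerstEta K).ClosedIdealMem (gerstEta.lamEta K) x := by
  have hG := gerstAdj_hasScaling (K := K)
  let U : OpMap (gerstAdj K).data (gerstPlus K).toOpData :=
    ⟨fun {n} {d} => (((gerstEta K).closedIdeal (gerstEta.lamEta K)).carrier n d).mkQ ∘ₗ
      (gerstAdj K).toC n d, rfl, fun {m n p} i e {a b c} h x y => rfl⟩
  have hU : U.map ((gerstAdj K).data.circ (c := 2) (p := 1) 0 (gerstAdj.lam K) (gerstAdj.eta K)) = 0 :=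
    (Submodule.Quotient.mk_eq_zero _).2 .base
  have h1 : ∀ k, (gerstEta K).ClosedIdealMem (gerstEta.lamEta K)
      ((gerstAdj K).toC n (d + 1) (hG.cpart n (d + 1) k x)) := fun k => by
    obtain ⟨w, hw⟩ := (mem_range_ctw _).1 h k
    rw [cpart_cphi] at hw
    exact (Submodule.Quotient.mk_eq_zero _).1
      (map_eq_zero_of_coboundary (gerstPlus K).isOperad U hU _ w hw.symm)
  refine .limit x (fun p => (gerstAdj K).toC n (d + 1) (∑ k ∈ Finset.range p, hG.cpart n (d + 1) k x))
    (fun p => ?_) fun p => hG.sub_sum_mem x p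
  rw [map_sum]
  exact Submodule.sum_mem (((gerstEta K).closedIdeal (gerstEta.lamEta K)).carrier n (d + 1))
    fun k _ => h1 k

end Completed

end OperadTw

namespace OperadTw

open Graft FreeG

variable {K : Type u} [Field K]

section Comparison

theorem homologyClass_eq_zero {P : FilteredOperad K} (D : P.Differential) {n : ℕ} {a b : ℤ}
    (h : a + 1 = b) (y : P.obj n b) (hy : y ∈ D.cycles.carrier n b) :
    D.homologyClass y hy = 0 ↔ y ∈ LinearMap.range (D.d (n := n) h) := by
  obtain rfl : a = b - 1 := by omega
  exact Submodule.Quotient.mk_eq_zero _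

variable (K) [CharZero K]

theorem diff_cphi {n : ℕ} {a b : ℤ} (h : a + 1 = b) (x : (gerstAdj K).complete.obj n a) :
    (twBV K).diff.d h ((cphi K).map x) = 0 := by
  subst h
  exact ctw_cphi x

/-- The morphism from `Gerst ∨̂ η` to the twisted operad. -/
def twHom : (gerstEta K).Hom (twBV K) where
  toHom := cphi K
  map_d h x := (map_zero (cphi K).map).trans (diff_cphi K h x).symm

theorem twHom_cgen {n : ℕ} {d : ℤ} (g : (gerstAdj K).Gen n d) :
    (twHom K).map ((gerstAdj K).cgen g) =
      (bvAlpha K).toC n d ((phi K).map ((gerstAdj K).dataGen g)) := cphi_toC K _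

theorem twHom_mu : (twHom K).map (gerstEta.mu K) = twBV.mu K :=
  (twHom_cgen K _).trans (congrArg ((bvAlpha K).toC 2 0) phi_mu)

theorem twHom_lam : (twHom K).map (gerstEta.lam K) = twBV.lam K :=
  (twHom_cgen K _).trans (congrArg ((bvAlpha K).toC 2 1) phi_lam)

theorem twHom_eta : (twHom K).map (gerstEta.eta K) = twBV.deltaAlpha K :=
  (twHom_cgen K _).trans (congrArg ((bvAlpha K).toC 0 1) phi_eta)

theorem twHom_mem {n : ℕ} {d : ℤ} (x : (gerstEta K).obj n d) :
    (twHom K).map x ∈ (twBV K).diff.cycles.carrier n d := diff_cphi K rfl x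

/-- The morphism from `Gerst ∨̂ η` to the cohomology of the twisted operad. -/
def cohHom : (gerstEta K).toFilteredOperad.Hom (twBV K).diff.homology where
  map {n d} := ((twBV K).diff.boundaries.carrier n d).mkQ ∘ₗ
    (twHom K).map.codRestrict ((twBV K).diff.cycles.carrier n d) (twHom_mem K)
  map_one := congrArg (Submodule.mkQ _) (Subtype.ext (twHom K).map_one)
  map_comp i e _ _ _ h x y := congrArg (Submodule.mkQ _) (Subtype.ext ((twHom K).map_comp i e h x y))
  map_fil k x hx := ⟨⟨(twHom K).map x, twHom_mem K x⟩, (twHom K).map_fil k x hx, rfl⟩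

variable {K}

theorem cohHom_eq_zero {n : ℕ} {d : ℤ} (x : (gerstEta K).obj n (d + 1)) :
    (cohHom K).map x = 0 ↔ (cphi K).map x ∈ LinearMap.range (ctw K n d) :=
  homologyClass_eq_zero (twBV K).diff rfl _ (twHom_mem K x)

theorem cohHom_lamEta : (cohHom K).map (gerstEta.lamEta K) = 0 := by
  refine (cohHom_eq_zero (d := 1) (gerstEta.lamEta K)).2
    ⟨-(bvAlpha K).toC 1 1 (bvAlpha.delta K), ?_⟩
  rw [map_neg, ctw_toC, twl_delta, map_neg, neg_neg]
  exact (congrArg₂ (fun u v => (twBV K).circ (c := 2) (p := 1) 0 u v) (twHom_lam K)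
    (twHom_eta K)).symm.trans ((twHom K).map_comp _ _ _ _ _).symm

theorem cohHom_of_closedIdealMem {n : ℕ} {d : ℤ} {x : (gerstEta K).obj n d}
    (h : (gerstEta K).ClosedIdealMem (gerstEta.lamEta K) x) : (cohHom K).map x = 0 := by
  induction h with
  | base => exact cohHom_lamEta
  | zero => exact map_zero _
  | add x y _ _ hx hy => rw [map_add, hx, hy, add_zero]
  | smul c x _ hx => rw [map_smul, hx, smul_zero]
  | comp_left i e h x y _ hx => rw [(cohHom K).map_comp, hx, map_zero, LinearMap.zero_apply]
  | comp_right i e h x y _ hy => rw [(cohHom K).map_comp, hy, map_zero]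
  | @limit n d x s _ hs ih =>
    have hR := bvAlpha_hasScaling (K := K)
    obtain ⟨a, rfl⟩ : ∃ a, d = a + 1 := ⟨d - 1, by omega⟩
    refine (cohHom_eq_zero x).2 ((mem_range_ctw _).2 fun k => ?_)
    have h1 := (mem_range_ctw _).1 ((cohHom_eq_zero _).1 (ih (k + 1))) k
    have h2 := hR.mem_cfil.1 ((cphi K).map_fil (k + 1) _ (hs (k + 1))) k k.lt_succ_self
    have h3 : hR.cpart n (a + 1) k ((cphi K).map x) =
        hR.cpart n (a + 1) k ((cphi K).map (s (k + 1))) := by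
      refine sub_eq_zero.1 (((map_sub _ _ _).symm.trans (congrArg _ ?_)).trans h2)
      exact (map_sub (cphi K).map _ _).symm
    rw [h3]
    exact h1

theorem cohHom_eq_zero_iff {n : ℕ} {d : ℤ} (x : (gerstEta K).obj n d) :
    (cohHom K).map x = 0 ↔ (gerstEta K).ClosedIdealMem (gerstEta.lamEta K) x := by
  obtain ⟨a, rfl⟩ : ∃ a, d = a + 1 := ⟨d - 1, by omega⟩
  exact ⟨fun h => closedIdealMem_of_coboundary ((cohHom_eq_zero x).1 h), cohHom_of_closedIdealMem⟩

theorem cohHom_surj {n : ℕ} {d : ℤ} (k : ℕ) (y : (twBV K).diff.homology.obj n d)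
    (hy : y ∈ (twBV K).diff.homology.fil n d k) :
    ∃ x ∈ (gerstEta K).fil n d k, (cohHom K).map x = y := by
  obtain ⟨a, rfl⟩ : ∃ a, d = a + 1 := ⟨d - 1, by omega⟩
  obtain ⟨⟨z, hz⟩, hzk, rfl⟩ := hy
  obtain ⟨x, hx, h⟩ := exists_cocycle_eq (z := z) (((twBV K).diff.mem_cycles rfl z).1 hz) hzk
  refine ⟨x, hx, Eq.symm (sub_eq_zero.1 ?_)⟩
  exact (homologyClass_eq_zero (twBV K).diff rfl _ (sub_mem hz (twHom_mem K x))).2 h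

end Comparison

end OperadTw

end

theorem mainTheorem12 (𝕜 : Type u) [Field 𝕜] [CharZero 𝕜] :
    ∃ φ : (gerstEta 𝕜).Hom (twBV 𝕜),
      (φ.map (gerstEta.mu 𝕜) = twBV.mu 𝕜 ∧
        φ.map (gerstEta.lam 𝕜) = twBV.lam 𝕜 ∧
        φ.map (gerstEta.eta 𝕜) = twBV.deltaAlpha 𝕜) ∧
      (∀ φ' : (gerstEta 𝕜).toFilteredOperad.Hom (twBV 𝕜).toFilteredOperad,
        φ'.map (gerstEta.mu 𝕜) = twBV.mu 𝕜 →
        φ'.map (gerstEta.lam 𝕜) = twBV.lam 𝕜 →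
        φ'.map (gerstEta.eta 𝕜) = twBV.deltaAlpha 𝕜 →
        ∀ (n : ℕ) (d : ℤ) (x : (gerstEta 𝕜).obj n d), φ'.map x = φ.map x) ∧
      (gerstPlus 𝕜).IsComplete ∧
      (twBV 𝕜).diff.homology.IsComplete ∧
      ∃ ψ : (gerstPlus 𝕜).Iso (twBV 𝕜).diff.homology,
        ∀ (n : ℕ) (d : ℤ) (x : (gerstEta 𝕜).obj n d),
          ∃ hx : φ.map x ∈ (twBV 𝕜).diff.cycles.carrier n d,
            ψ.hom.map (gerstPlus.proj 𝕜 x) =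
              (twBV 𝕜).diff.homologyClass (φ.map x) hx := by
  obtain ⟨ψ, hψ⟩ := (cohHom 𝕜).exists_iso cohHom_eq_zero_iff cohHom_surj
  refine ⟨twHom 𝕜, ⟨twHom_mu 𝕜, twHom_lam 𝕜, twHom_eta 𝕜⟩, fun φ' h1 h2 h3 n d x => ?_,
    gerstPlus_isComplete 𝕜, ψ.isComplete (gerstPlus_isComplete 𝕜), ψ,
    fun n d x => ⟨twHom_mem 𝕜 x, hψ x⟩⟩
  refine Presentation.complete_hom_ext (twBV 𝕜).complete φ' (twHom 𝕜).toHom (fun g => ?_) x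
  cases g with
  | old g =>
    cases g with
    | mu => exact h1.trans (twHom_mu 𝕜).symm
    | lam => exact h2.trans (twHom_lam 𝕜).symm
  | new => exact h3.trans (twHom_eta 𝕜).symm
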